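/- Fix $\kappa\in(4,8)$ and put $h=\frac{6-\kappa}{2\kappa}$ and $q=4\cos^2(4\pi/\kappa)$. For $N\ge 0$ let $\mathrm{LP}_N$ be the set of planar link patterns $\beta=\{\{a_1,b_1\},\dots,\{a_N,b_N\}\}$, i.e. partitions of $\{1,\dots,2N\}$ into pairs, ordered so that $a_1<\cdots<a_N$ and $a_r<b_r$, such that there are no $r,s$ with $a_r<a_s<b_r<b_s$. Let $\mathfrak X_{2N}=\{\boldsymbol x\in\mathbb R^{2N}\colon x_1<\cdots<x_{2N}\}$, and for $\beta\in\mathrm{LP}_N$ and $\boldsymbol x\in\mathfrak X_{2N}$ define the Coulomb gas integral $$\mathcal G_\beta(\boldsymbol x)=\Big(\frac{\sqrt q\,\Gamma(2-8/\kappa)}{\Gamma(1-4/\kappa)^2}\Big)^{N}\int_{\gamma_1}\cdots\int_{\gamma_N}f_\beta(\boldsymbol x;u_1,\dots,u_N)\,du_1\cdots du_N,$$ where $\gamma_1,\dots,\gamma_N$ are pairwise non-intersecting paths in the upper half-plane $\mathbb H$, $\gamma_r$ going from $x_{a_r}$ to $x_{b_r}$ (for definiteness, semicircles centred on the real line), and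 $f_\beta$ is the branch of $$\prod_{1\le i<j\le 2N}(x_j-x_i)^{2/\kappa}\prod_{1\le r<s\le N}(u_s-u_r)^{8/\kappa}\prod_{i=1}^{2N}\prod_{r=1}^{N}(u_r-x_i)^{-4/\kappa}$$ which is real and positive when $u_r\in(x_{a_r},x_{a_r+1})$ for all $r$, continued analytically along the paths from there into $\mathbb H$. Then these integrals converge absolutely and define real-valued functions $\mathcal G_\beta\colon\mathfrak X_{2N}\to\mathbb R$ with the following properties. (PDE) For every $N$ and $\beta\in\mathrm{LP}_N$, the function $\mathcal G_\beta$ is twice continuously differentiable on $\mathfrak X_{2N}$ and, for every $j\in\{1,\dots,2N\}$, $$\Big[\frac{\kappa}{2}\frac{\partial^2}{\partial x_j^2}+\sum_{i\ne j}\Big(\frac{2}{x_i-x_j}\frac{\partial}{\partial x_i}-\frac{2h}{(x_i-x_j)^2}\Big)\Big]\mathcal G_\beta(\boldsymbol x)=0 .$$ (COV) For every $N$, $\beta\in\mathrm{LP}_N$ and $\boldsymbol x\in\mathfrak X_{2N}$, and every Möbius map $\varphi$ of $\mathbb H$ that is finite at $x_1,\dots,x_{2N}$ with $\varphi(x_1)<\cdots<\varphi(x_{2N})$,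 $$\mathcal G_\beta(x_1,\dots,x_{2N})=\prod_{i=1}^{2N}\varphi'(x_i)^{h}\;\mathcal G_\beta(\varphi(x_1),\dots,\varphi(x_{2N})).$$ (ASY) $\mathcal G_\emptyset=1$ for the empty link pattern $\emptyset\in\mathrm{LP}_0$. For $N\ge1$, $\beta\in\mathrm{LP}_N$, $j\in\{1,\dots,2N-1\}$, $\boldsymbol x\in\mathfrak X_{2N}$ and $\xi\in(x_{j-1},x_{j+2})$ (with $x_0=-\infty$, $x_{2N+1}=+\infty$), writing $\ddot{\boldsymbol x}_j=(x_1,\dots,x_{j-1},x_{j+2},\dots,x_{2N})$, we have, as $x_j<x_{j+1}$ both tend to $\xi$ and the other coordinates stay fixed, $$\lim_{x_j,x_{j+1}\to\xi}\frac{\mathcal G_\beta(\boldsymbol x)}{(x_{j+1}-x_j)^{-2h}}=\begin{cases}\sqrt q\;\mathcal G_{\beta/\{j,j+1\}}(\ddot{\boldsymbol x}_j),&\{j,j+1\}\in\beta,\\ \mathcal G_{\wp_j(\beta)/\{j,j+1\}}(\ddot{\boldsymbol x}_j),&\{j,j+1\}\notin\beta.\end{cases}$$ Here, for a pattern containing the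 link $\{j,j+1\}$, the operation $/\{j,j+1\}$ removes this link and relabels the remaining indices increasingly by $1,\dots,2N-2$; and $\wp_j(\beta)$ is obtained from $\beta$ by replacing the links $\{j,k_1\},\{j+1,k_2\}$ by $\{j,j+1\},\{k_1,k_2\}$. -/

import Mathlib

noncomputable section

namespace CoulombGas

open MeasureTheory

/-- A planar link pattern with `N` links on the points `0, …, 2N - 1`, encoded by the map `pair`
sending every point to the other endpoint of its link: the links are `{i, pair i}`.
Planarity: there are no links `{a, b}`, `{a', b'}` with `a < a' < b < b'`. -/
@[ext]
structure LinkPattern (N : ℕ) where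
  pair : Fin (2 * N) → Fin (2 * N)
  pair_pair : ∀ i, pair (pair i) = i
  pair_ne : ∀ i, pair i ≠ i
  planar : ∀ i k, ¬ (i < k ∧ k < pair i ∧ pair i < pair k)

/-- For a position `j` (points `j` and `j + 1` out of `2N + 2`), the increasing relabeling of
`0, …, 2N - 1` by the points other than `j`, `j + 1`. -/
def skip {N : ℕ} (j : Fin (2 * N + 1)) (i : Fin (2 * N)) : Fin (2 * (N + 1)) :=
  ⟨if (i : ℕ) < j then i else i + 2, by split_ifs <;> omega⟩

/-- The inverse relabeling, from the points other than `j`, `j + 1`. -/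
def unskip {N : ℕ} (j : Fin (2 * N + 1)) (k : Fin (2 * (N + 1)))
    (h : (k : ℕ) ≠ j ∧ (k : ℕ) ≠ j + 1) : Fin (2 * N) :=
  ⟨if (k : ℕ) < j then k else k - 2, by split_ifs <;> omega⟩

namespace LinkPattern

/-- The point `j` among `2N + 2` points. -/
abbrev left {N : ℕ} (j : Fin (2 * N + 1)) : Fin (2 * (N + 1)) := ⟨j, by omega⟩

/-- The point `j + 1` among `2N + 2` points. -/
abbrev right {N : ℕ} (j : Fin (2 * N + 1)) : Fin (2 * (N + 1)) := ⟨j + 1, by omega⟩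

theorem pair_inj {N : ℕ} (β : LinkPattern N) {i k : Fin (2 * N)} (h : β.pair i = β.pair k) :
    i = k := by
  rw [← β.pair_pair i, h, β.pair_pair]

theorem pair_skip_ne {N : ℕ} (β : LinkPattern (N + 1)) (j : Fin (2 * N + 1))
    (h : β.pair (left j) = right j) (i : Fin (2 * N)) :
    (β.pair (skip j i) : ℕ) ≠ j ∧ (β.pair (skip j i) : ℕ) ≠ j + 1 := by
  have h' : β.pair (right j) = left j := by rw [← h, β.pair_pair]
  constructor
  · intro e
    have e1 : β.pair (skip j i) = β.pair (right j) := by rw [h']; exact Fin.ext e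
    have e2 := congrArg Fin.val (β.pair_inj e1)
    simp only [skip] at e2
    split_ifs at e2 <;> omega
  · intro e
    have e1 : β.pair (skip j i) = β.pair (left j) := by rw [h]; exact Fin.ext e
    have e2 := congrArg Fin.val (β.pair_inj e1)
    simp only [skip] at e2
    split_ifs at e2 <;> omega

theorem skip_unskip {N : ℕ} (j : Fin (2 * N + 1)) (k : Fin (2 * (N + 1)))
    (h : (k : ℕ) ≠ j ∧ (k : ℕ) ≠ j + 1) : skip j (unskip j k h) = k := by
  apply Fin.ext
  simp only [skip, unskip]
  split_ifs <;> omega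

theorem unskip_skip {N : ℕ} (j : Fin (2 * N + 1)) (i : Fin (2 * N))
    (h : (skip j i : ℕ) ≠ j ∧ (skip j i : ℕ) ≠ j + 1) : unskip j (skip j i) h = i := by
  apply Fin.ext
  simp only [skip, unskip]
  split_ifs <;> omega

theorem skip_lt_skip {N : ℕ} (j : Fin (2 * N + 1)) {i k : Fin (2 * N)} :
    skip j i < skip j k ↔ i < k := by
  simp only [skip, Fin.lt_def]
  split_ifs <;> omega

/-- `β / {j, j+1}`: remove the link `{j, j+1}` and relabel the remaining points increasingly. -/
def remove {N : ℕ} (β : LinkPattern (N + 1)) (j : Fin (2 * N + 1))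
    (h : β.pair (left j) = right j) : LinkPattern N where
  pair i := unskip j (β.pair (skip j i)) (β.pair_skip_ne j h i)
  pair_pair i := by
    have e : β.pair (skip j (unskip j (β.pair (skip j i)) (β.pair_skip_ne j h i))) = skip j i := by
      rw [skip_unskip, β.pair_pair]
    simp only [e, unskip_skip]
  pair_ne i e := by
    apply β.pair_ne (skip j i)
    conv_rhs => rw [← e]
    rw [skip_unskip]
  planar i k := by
    rintro ⟨h1, h2, h3⟩
    apply β.planar (skip j i) (skip j k)
    rw [← skip_lt_skip j] at h1 h2 h3
    simp only [skip_unskip] at h2 h3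
    exact ⟨h1, h2, h3⟩

/-- The map underlying the tying operation: `j` and `j + 1` become linked, and so do their
former partners; all other links are kept. -/
def tiePair {N : ℕ} (β : LinkPattern (N + 1)) (j : Fin (2 * N + 1)) (i : Fin (2 * (N + 1))) :
    Fin (2 * (N + 1)) :=
  if i = left j then right j
  else if i = right j then left j
  else if i = β.pair (left j) then β.pair (right j)
  else if i = β.pair (right j) then β.pair (left j)
  else β.pair i

/-- The tying operation `℘_j`. -/
def tie {N : ℕ} (β : LinkPattern (N + 1)) (j : Fin (2 * N + 1)) : LinkPattern (N + 1) where
  pair := β.tiePair j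
  pair_pair i := by
    have := β.pair_pair
    have := β.pair_ne
    have : left j ≠ right j := by simp [Fin.ext_iff]
    unfold tiePair
    grind
  pair_ne i := by
    have := β.pair_pair
    have := β.pair_ne
    have : left j ≠ right j := by simp [Fin.ext_iff]
    unfold tiePair
    grind
  planar i k := by
    rintro ⟨h1, h2, h3⟩
    have p0 := β.planar
    have e1 := β.pair_pair (left j)
    have e2 := β.pair_pair (right j)
    have key : ∀ m : Fin (2 * (N + 1)), m ≠ left j → m ≠ right j → m < left j ∨ right j < m := by
      intro m h1 h2
      simp only [Fin.lt_def, ne_eq, Fin.ext_iff] at *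
      omega
    have n3 : left j < right j := by simp [Fin.lt_def]
    have inj : ∀ a b, β.pair a = b → a = β.pair b := fun a b h => by rw [← h, β.pair_pair]
    unfold tiePair at h2 h3
    generalize left j = L at *
    generalize right j = R at *
    by_cases i1 : i = L
    · grind
    by_cases i2 : i = R
    · grind
    by_cases k1 : k = L
    · grind
    by_cases k2 : k = R
    · grind
    have ki := key i i1 i2
    have kk := key k k1 k2
    have q2 := p0 L R
    have q3 := p0 (β.pair L) (β.pair R)
    have q4 := p0 (β.pair R) (β.pair L)
    rw [if_neg i1, if_neg i2] at h2 h3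
    rw [if_neg k1, if_neg k2] at h3
    by_cases i3 : i = β.pair L
    · rw [if_pos i3] at h2 h3
      split_ifs at h3 with k3 k4
      · omega
      · omega
      · have r1 := p0 R k
        have r3 := p0 (β.pair L) k
        have r4 := p0 k (β.pair L)
        have r5 := p0 k (β.pair R)
        have n4 := key (β.pair k)
        have n5 := inj k L
        have n6 := inj k R
        simp only [e1, e2] at *
        clear key p0 inj
        omega
    rw [if_neg i3] at h2 h3
    by_cases i4 : i = β.pair R
    · rw [if_pos i4] at h2 h3
      split_ifs at h3 with k3 k4
      · omega
      · omega
      · have r1 := p0 L k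
        have r3 := p0 (β.pair R) k
        have r4 := p0 k (β.pair L)
        have r5 := p0 k (β.pair R)
        have n4 := key (β.pair k)
        have n5 := inj k L
        have n6 := inj k R
        simp only [e1, e2] at *
        clear key p0 inj
        omega
    rw [if_neg i4] at h2 h3
    split_ifs at h3 with k3 k4
    · have r1 := p0 i L
      have r2 := p0 i R
      have r3 := p0 i (β.pair L)
      have r4 := p0 i (β.pair R)
      have r5 := p0 L i
      have r6 := p0 R i
      have n4 := key (β.pair i)
      have n5 := inj i L
      have n6 := inj i R
      simp only [e1, e2] at *
      clear key p0 inj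
      omega
    · have r1 := p0 i L
      have r2 := p0 i R
      have r3 := p0 i (β.pair L)
      have r4 := p0 i (β.pair R)
      have r5 := p0 L i
      have r6 := p0 R i
      have n4 := key (β.pair i)
      have n5 := inj i L
      have n6 := inj i R
      simp only [e1, e2] at *
      clear key p0 inj
      omega
    · exact p0 i k ⟨h1, h2, h3⟩

theorem tie_pair {N : ℕ} (β : LinkPattern (N + 1)) (j : Fin (2 * N + 1)) :
    (β.tie j).pair (left j) = right j := by
  simp [tie, tiePair]

/-- The links `{a, b}`, `a < b`, of `β`, indexed by their left endpoints `a` and hence ordered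
by them; the right endpoint is `β.pair a`. -/
abbrev Link {N : ℕ} (β : LinkPattern N) : Type := {a : Fin (2 * N) // a < β.pair a}

/-- The integration contour of the link `{a, b}`: the semicircle in the upper half-plane from `x a`
(at `θ = 0`) to `x b` (at `θ = π`). By planarity, the contours of distinct links are disjoint. -/
def contour {N : ℕ} (β : LinkPattern N) (x : Fin (2 * N) → ℝ) (r : β.Link) (θ : ℝ) : ℂ :=
  ((x r.1 + x (β.pair r.1)) / 2 : ℝ)
    - ((x (β.pair r.1) - x r.1) / 2 : ℝ) * Complex.exp (-(θ * Complex.I))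

/-- The power `z ^ s` with branch cut along the positive imaginary axis (arguments in
`(-3π/2, π/2)`), positive for `z > 0`. -/
def powCutUp (z : ℂ) (s : ℝ) : ℂ :=
  Complex.exp (s * (Complex.log (Complex.I * z) - Complex.I * Real.pi / 2))

/-- The branch of the integrand
`∏ (x_j - x_i)^(2/κ) ∏ (u_s - u_r)^(8/κ) ∏ (u_r - x_i)^(-4/κ)` that is positive when
every `u_r` lies on the real interval `(x_{a_r}, x_{a_r + 1})`, continued analytically to variables
`u_r` on the contours of `β`.

Each `u_r` lies in the upper half-plane, where the principal powers of `u_r - x_i` and of `x_i - u_r`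
are analytic; the former are positive for real `u_r > x_i`, the latter for real `u_r < x_i`.
For `r < s`, the contour of `s` lies either to the right of the contour of `r` or below it, so that
`u_s - u_r` never lies on the positive imaginary axis. -/
def integrand {N : ℕ} (κ : ℝ) (β : LinkPattern N) (x : Fin (2 * N) → ℝ) (u : β.Link → ℂ) : ℂ :=
  ((∏ i, ∏ j with i < j, (x j - x i) ^ (2 / κ) : ℝ) : ℂ)
    * (∏ r, ∏ s with r < s, powCutUp (u s - u r) (8 / κ))
    * ∏ r, ∏ i, (if i ≤ r.1 then u r - x i else x i - u r) ^ (-(4 / κ) : ℂ)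

/-- The integrand pulled back to the parameters `θ` of the contours, including the factors `du_r`. -/
def pullback {N : ℕ} (κ : ℝ) (β : LinkPattern N) (x : Fin (2 * N) → ℝ) (θ : β.Link → ℝ) : ℂ :=
  β.integrand κ x (fun r => β.contour x r (θ r)) * ∏ r, deriv (β.contour x r) (θ r)

end LinkPattern

/-- The parameter domain of the product of all contours. -/
def box {N : ℕ} (β : LinkPattern N) : Set (β.Link → ℝ) :=
  Set.univ.pi fun _ => Set.Ioo 0 Real.pi

/-- The conformal weight `h(κ)`. -/
def weight (κ : ℝ) : ℝ := (6 - κ) / (2 * κ)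

/-- The cluster weight `q(κ)`. -/
def clusterWeight (κ : ℝ) : ℝ := 4 * Real.cos (4 * Real.pi / κ) ^ 2

/-- The Coulomb gas integral `𝒢_β`. -/
def G {N : ℕ} (κ : ℝ) (β : LinkPattern N) (x : Fin (2 * N) → ℝ) : ℂ :=
  ((Real.sqrt (clusterWeight κ) * Real.Gamma (2 - 8 / κ) / Real.Gamma (1 - 4 / κ) ^ 2 : ℝ) : ℂ) ^ N
    * ∫ θ in box β, β.pullback κ x θ

/-- The configuration space `x_1 < ⋯ < x_{2N}`. -/
def chamber (N : ℕ) : Set (Fin (2 * N) → ℝ) := {x | StrictMono x}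

/-- The partial derivative `∂F/∂x_i`. -/
def pderiv {n : ℕ} (i : Fin n) (F : (Fin n → ℝ) → ℂ) (x : Fin n → ℝ) : ℂ :=
  deriv (fun t : ℝ => F (Function.update x i t)) (x i)

/-- `F` is a (twice continuously differentiable) solution of the second-order BPZ equations. -/
def SatisfiesBPZ {N : ℕ} (κ : ℝ) (F : (Fin (2 * N) → ℝ) → ℂ) : Prop :=
  ContDiffOn ℝ 2 F (chamber N) ∧
  ∀ x ∈ chamber N, ∀ j,
    (κ / 2 : ℂ) * pderiv j (pderiv j F) x
      + ∑ i with i ≠ j, (2 / (x i - x j : ℂ) * pderiv i F x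
          - 2 * weight κ / (x i - x j : ℂ) ^ 2 * F x) = 0

/-- The Möbius map `z ↦ (a z + b) / (c z + d)` on the real line. -/
def mobius (a b c d t : ℝ) : ℝ := (a * t + b) / (c * t + d)

/-- Covariance with weight `h(κ)` under the Möbius maps of the upper half-plane that are finite at
the points `x_i` and preserve their order. -/
def MobiusCovariant {N : ℕ} (κ : ℝ) (F : (Fin (2 * N) → ℝ) → ℂ) : Prop :=
  ∀ x ∈ chamber N, ∀ a b c d : ℝ, 0 < a * d - b * c → (∀ i, c * x i + d ≠ 0) →
    (fun i => mobius a b c d (x i)) ∈ chamber N →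
    F x = ((∏ i, deriv (mobius a b c d) (x i) ^ weight κ : ℝ) : ℂ)
      * F (fun i => mobius a b c d (x i))

/-- The limit of `F(x) / (x_{j+1} - x_j)^(-2h)` as `x_j < x_{j+1}` tend to `ξ`, with the other
coordinates of `x` fixed, is `ℓ`. -/
def FusionLimit {N : ℕ} (κ : ℝ) (F : (Fin (2 * (N + 1)) → ℝ) → ℂ) (j : Fin (2 * N + 1))
    (x : Fin (2 * (N + 1)) → ℝ) (ξ : ℝ) (ℓ : ℂ) : Prop :=
  Filter.Tendsto
    (fun p : ℝ × ℝ =>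
      F (Function.update (Function.update x (LinkPattern.left j) p.1) (LinkPattern.right j) p.2)
        / (((p.2 - p.1) ^ (-2 * weight κ) : ℝ) : ℂ))
    (nhdsWithin (ξ, ξ) {p | p.1 < p.2}) (nhds ℓ)

end CoulombGas

end

/-! Put t = 1/κ and A = 4/κ, so that 1/2 < A < 1. The integrand f has exponent -A > -1 at the ends
of every contour, which gives absolute convergence. (PDE) and (COV) should hold because the relevant
operators turn f into sums of total derivatives in the variables u_r. For κ > 4 this cannot be used
directly, because f and f/(u_r - x_j) blow up at the ends of the contours.

The way out is analytic continuation in t. Up to constants the integral is the function `screened`,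
jointly holomorphic in the points and in t for Re t < 1/4 (`differentiableOn_screened`); this also
yields smoothness. For Re t ≤ -1 the integrand vanishes to high order at the ends, all boundary
terms are zero, and the identity theorem (`eq_zero_of_re_lt`) carries the resulting identities to t
= 1/κ. For (PDE) the total derivatives are those of f/(u_r - x_j) (`bpz_algebra`). For (COV),
translations and dilations are direct. For special conformal maps the total derivatives of u_r^2 f
leave the defect (1 - 4t)(2 ∑ u_r - ∑ x_i). This defect is itself the sum of the total derivatives
of f ∏_i (u_r - x_i) / ∏_{s ≠ r} (u_r - u_s)^2, by a residue computation (`sum_residues`). The Ward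
identity `ward` is then integrated along the flow x/(1 + scx) (`screened_inversion`).

Reality and (ASY) come from a second representation. The contours are replaced by semi-ellipses of
eccentricity η. The integral does not depend on η (`integral_density_eccentricity`), and η → 0 moves
all u_r to the real line (`integral_density_eq_flat`). There f is its absolute value times a phase
exp(iπA·`turn`). The absolute value is symmetric in the variables, so one may average over their
relabellings; the sum of the phases factorizes into quantum numbers [m] = sin(πAm)/sin(πA), one per
link (`sum_perm_wt`), where m is the number of variables under the link minus the number of links
strictly below it. Thus G is a real integral over N unlabelled variables
(`LinkPattern.G_eq_integral`).

When x_j and x_{j+1} merge at distance ε, a single variable close to them contributes the dominant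
power ε^(1-2A). A second close variable is suppressed by the repulsion, and for a distant variable z
the factors |z - ξ|^(-2A) and |z - ξ|^(2A) cancel (`tendsto_fuseGas`). Rescaling produces beta
integrals according to whether the close variable is left of, between or right of the two points.
Relative to the normalization they are 1, -2cos(πA) = √q and 1 (`outer_beta_eq`, `inner_beta_eq`).
It remains to see that the weights satisfy left + right - 2cos(πA)·between = weight of the fused
pattern. If j and j+1 are linked, this is [0] + [0] - 2cos(πA)[1] = √q; otherwise it is an addition
formula for sines (`qnum_fuse`, `LinkPattern.potWeight_tie`). -/

set_option linter.unusedSectionVars false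

noncomputable section

namespace CoulombGas

open MeasureTheory Metric Set Filter Topology
open Complex (I exp log slitPlane exp_sum exp_add)
open Finset (sum_congr prod_congr prod_mul_distrib sum_add_distrib sum_sub_distrib prod_nonneg mul_sum measurable_prod measurable_sum prod_le_prod sum_filter)
open Real (sin cos Gamma)
open Function (update Injective)
open scoped Real

/-! ### Holomorphic functions of several variables and differentiation under the integral -/

section Holomorphic

variable {Z : Type*} [NormedAddCommGroup Z] [NormedSpace ℂ Z] [FiniteDimensional ℂ Z]

/-- Measurability of a family of linear functionals can be tested pointwise. -/
theorem aestronglyMeasurable_clm {α : Type*} [MeasurableSpace α] {μ : Measure α}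
    {f : α → Z →L[ℂ] ℂ} (h : ∀ v, AEStronglyMeasurable (fun t => f t v) μ) :
    AEStronglyMeasurable f μ := by
  let b := Module.finBasis ℂ Z
  have e : f = fun t => ∑ k, (f t (b k)) • LinearMap.toContinuousLinearMap (b.coord k) := by
    funext t
    ext v
    conv_lhs => rw [← b.sum_repr v, map_sum]
    rw [sum_apply]
    refine sum_congr rfl fun k _ => ?_
    simp [mul_comm]
  rw [e]
  refine Finset.aestronglyMeasurable_fun_sum _ fun k _ => ?_
  exact (h (b k)).smul_const _

/-- A dominated integral of holomorphic functions can be differentiated under the integral. -/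
theorem hasFDerivAt_integral_of_holomorphic {α : Type*} [MeasurableSpace α] {μ : Measure α}
    {F : Z → α → ℂ} {g : α → ℝ} {z₀ : Z} {δ : ℝ} (hδ : 0 < δ)
    (hm : ∀ z ∈ ball z₀ δ, AEStronglyMeasurable (F z) μ)
    (hd : ∀ᵐ t ∂μ, DifferentiableOn ℂ (F · t) (ball z₀ δ))
    (hb : ∀ᵐ t ∂μ, ∀ z ∈ ball z₀ δ, ‖F z t‖ ≤ g t) (hg : Integrable g μ) :
    HasFDerivAt (fun z => ∫ t, F z t ∂μ) (∫ t, fderiv ℂ (F · t) z₀ ∂μ) z₀ ∧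
      Integrable (fun t => fderiv ℂ (F · t) z₀) μ := by
  have hz₀ : z₀ ∈ ball z₀ δ := mem_ball_self hδ
  have hsub : ∀ z ∈ ball z₀ (δ / 2), ball z (δ / 2) ⊆ ball z₀ δ := by
    intro z hz w hw
    rw [mem_ball] at *
    linarith [dist_triangle w z z₀]
  -- Each directional derivative is a pointwise limit of difference quotients with steps 1/(n+1),
  -- hence measurable.
  have hmeas : AEStronglyMeasurable (fun t => fderiv ℂ (F · t) z₀) μ := by
    refine aestronglyMeasurable_clm fun v => ?_
    have hlim : ∀ᵐ t ∂μ, Tendsto (fun n : ℕ => ((n : ℂ) + 1) *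
        (F (z₀ + ((n : ℂ) + 1)⁻¹ • v) t - F z₀ t)) atTop (𝓝 (fderiv ℂ (F · t) z₀ v)) := by
      filter_upwards [hd] with t ht
      have h1 : HasFDerivAt (F · t) (fderiv ℂ (F · t) z₀) z₀ :=
        ((ht z₀ hz₀).differentiableAt (isOpen_ball.mem_nhds hz₀)).hasFDerivAt
      have h2 := h1.lim v (c := fun n : ℕ => (n : ℂ) + 1) (l := atTop) ?_
      · simpa [smul_eq_mul] using h2
      · have : ∀ n : ℕ, ‖(n : ℂ) + 1‖ = n + 1 := fun n => by
          rw [← Nat.cast_succ, Complex.norm_natCast]; push_cast; ring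
        simp only [this]
        exact tendsto_atTop_add_const_right _ _ tendsto_natCast_atTop_atTop
    have hev : ∀ᶠ n : ℕ in atTop, z₀ + ((n : ℂ) + 1)⁻¹ • v ∈ ball z₀ δ := by
      have : Tendsto (fun n : ℕ => z₀ + ((n : ℂ) + 1)⁻¹ • v) atTop (𝓝 (z₀ + (0 : ℂ) • v)) := by
        refine tendsto_const_nhds.add (Tendsto.smul_const ?_ v)
        have := tendsto_one_div_add_atTop_nhds_zero_nat (𝕜 := ℂ)
        simpa using this
      rw [zero_smul, add_zero] at this
      exact this.eventually (isOpen_ball.mem_nhds hz₀)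
    obtain ⟨n₀, hn₀⟩ := eventually_atTop.1 hev
    -- The shift by `n₀` keeps every point `z₀ + v/(n+n₀+1)` in the ball where measurability is
    -- known.
    refine aestronglyMeasurable_of_tendsto_ae atTop
      (f := fun n t => ((n + n₀ : ℕ) + 1 : ℂ) * (F (z₀ + (((n + n₀ : ℕ) : ℂ) + 1)⁻¹ • v) t - F z₀ t))
      (fun n => ?_) ?_
    · exact ((hm _ (hn₀ _ (by omega))).sub (hm _ hz₀)).const_mul _
    · filter_upwards [hlim] with t ht
      exact ht.comp (tendsto_add_atTop_nat n₀)
  -- Cauchy's estimate on balls of radius δ/2: the oscillation of `F · t` there is at most `2 * g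
  -- t`, so the bound on the function already dominates the derivative.
  have hbound : ∀ᵐ t ∂μ, ∀ z ∈ ball z₀ (δ / 2), ‖fderiv ℂ (F · t) z‖ ≤ (2 * g t) / (δ / 2) := by
    filter_upwards [hd, hb] with t ht hbt z hz
    refine Complex.norm_fderiv_le_div_of_mapsTo_ball (ht.mono (hsub z hz)) ?_ (by positivity)
    intro w hw
    rw [mem_closedBall, dist_eq_norm]
    have h1 := hbt w (hsub z hz hw)
    have h2 := hbt z (hsub z hz (mem_ball_self (by positivity)))
    linarith [norm_sub_le (F w t) (F z t)]
  have hgint : Integrable (fun t => (2 * g t) / (δ / 2)) μ := (hg.const_mul 2).div_const _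
  refine ⟨hasFDerivAt_integral_of_dominated_of_fderiv_le (ball_mem_nhds z₀ (half_pos hδ))
    ?_ ?_ hmeas hbound hgint ?_, ?_⟩
  · filter_upwards [ball_mem_nhds z₀ hδ] with z hz using hm z hz
  · refine hg.mono' (hm _ hz₀) ?_
    filter_upwards [hb] with t ht using ht _ hz₀
  · filter_upwards [hd] with t ht z hz
    have hz' : z ∈ ball z₀ δ := ball_subset_ball (by linarith) hz
    exact ((ht z hz').differentiableAt (isOpen_ball.mem_nhds hz')).hasFDerivAt
  · refine hgint.mono' hmeas ?_
    filter_upwards [hbound] with t ht using ht _ (mem_ball_self (half_pos hδ))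

theorem hasDerivAt_integral_of_holomorphic {α : Type*} [MeasurableSpace α] {μ : Measure α}
    {F : ℂ → α → ℂ} {g : α → ℝ} {z₀ : ℂ} {δ : ℝ} (hδ : 0 < δ)
    (hm : ∀ z ∈ ball z₀ δ, AEStronglyMeasurable (F z) μ)
    (hd : ∀ᵐ t ∂μ, DifferentiableOn ℂ (F · t) (ball z₀ δ))
    (hb : ∀ᵐ t ∂μ, ∀ z ∈ ball z₀ δ, ‖F z t‖ ≤ g t) (hg : Integrable g μ) :
    HasDerivAt (fun z => ∫ t, F z t ∂μ) (∫ t, deriv (F · t) z₀ ∂μ) z₀ := by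
  obtain ⟨h1, h2⟩ := hasFDerivAt_integral_of_holomorphic hδ hm hd hb hg
  have h3 := h1.hasDerivAt
  rw [ContinuousLinearMap.integral_apply h2] at h3
  simpa using h3

/-- Directional derivatives of holomorphic functions of several variables are holomorphic. -/
theorem differentiableOn_fderiv_apply {f : Z → ℂ} {Ω : Set Z} (hΩ : IsOpen Ω)
    (hf : DifferentiableOn ℂ f Ω) (v : Z) :
    DifferentiableOn ℂ (fun z => fderiv ℂ f z v) Ω := by
  intro z₀ hz₀
  apply DifferentiableAt.differentiableWithinAt
  obtain ⟨ρ, hρ, hball⟩ : ∃ ρ > 0, ball z₀ ρ ⊆ Ω ∩ {z | ‖f z‖ ≤ ‖f z₀‖ + 1} := by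
    refine Metric.mem_nhds_iff.1 (inter_mem (hΩ.mem_nhds hz₀) ?_)
    have hc : ContinuousAt (fun z => ‖f z‖) z₀ :=
      ((hf z₀ hz₀).differentiableAt (hΩ.mem_nhds hz₀)).continuousAt.norm
    exact (hc.eventually (gt_mem_nhds (lt_add_one _))).mono fun z hz => le_of_lt hz
  -- The disc of radius `R` in direction `v` around any point of the half ball stays in the full
  -- ball; the `+ 1` allows `v = 0`.
  set R : ℝ := ρ / 2 / (‖v‖ + 1) with hR
  have hRpos : 0 < R := by positivity
  have hin : ∀ z ∈ ball z₀ (ρ / 2), ∀ s : ℂ, ‖s‖ ≤ R → z + s • v ∈ ball z₀ ρ := by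
    intro z hz s hs
    rw [mem_ball, dist_eq_norm] at *
    have h1 : ‖s • v‖ ≤ ρ / 2 := by
      rw [norm_smul]
      calc ‖s‖ * ‖v‖ ≤ R * (‖v‖ + 1) := by gcongr; linarith
        _ = ρ / 2 := by rw [hR]; field_simp
    have h2 : z + s • v - z₀ = (z - z₀) + s • v := by abel
    rw [h2]
    linarith [norm_add_le (z - z₀) (s • v)]
  -- Cauchy's formula on the complex line through `z` in direction `v`, with a radius independent of
  -- `z`, exhibits the directional derivative as an integral of functions holomorphic in `z`.
  have key : ∀ z ∈ ball z₀ (ρ / 2), fderiv ℂ f z v = (2 * π * I)⁻¹ *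
      ∫ t in (0 : ℝ)..2 * π, deriv (circleMap 0 R) t •
        ((1 / (circleMap 0 R t - 0) ^ 2) • f (z + circleMap 0 R t • v)) := by
    intro z hz
    have hd : ∀ s : ℂ, ‖s‖ ≤ R → DifferentiableAt ℂ (fun s : ℂ => f (z + s • v)) s := by
      intro s hs
      have h1 := (hball (hin z hz s hs)).1
      exact ((hf _ h1).differentiableAt (hΩ.mem_nhds h1)).comp s
        ((differentiableAt_const z).add (differentiableAt_id.smul_const v))
    have h1 := DifferentiableOn.deriv_eq_smul_circleIntegral (c := 0) hRpos
      (f := fun s : ℂ => f (z + s • v)) fun s hs =>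
        (hd s (by simpa using hs)).differentiableWithinAt
    have h2 : deriv (fun s : ℂ => f (z + s • v)) 0 = fderiv ℂ f z v := by
      have h3 := (hball (hin z hz 0 (by simpa using hRpos.le))).1
      have h4 : HasFDerivAt f (fderiv ℂ f z) (z + (0 : ℂ) • v) := by
        simp only [zero_smul, add_zero] at h3 ⊢
        exact ((hf _ h3).differentiableAt (hΩ.mem_nhds h3)).hasFDerivAt
      have h5 : HasDerivAt (fun s : ℂ => z + s • v) v 0 := by
        simpa using ((hasDerivAt_id (0 : ℂ)).smul_const v).const_add z
      exact (h4.comp_hasDerivAt 0 h5).deriv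
    rw [h2] at h1
    rw [circleIntegral] at h1
    rw [h1, smul_eq_mul, inv_mul_cancel_left₀ Complex.two_pi_I_ne_zero]
  have hev : (fun z => fderiv ℂ f z v) =ᶠ[𝓝 z₀] _ :=
    Filter.eventually_of_mem (ball_mem_nhds z₀ (half_pos hρ)) key
  refine DifferentiableAt.congr_of_eventuallyEq ?_ hev
  refine DifferentiableAt.const_mul ?_ _
  simp only [intervalIntegral.integral_of_le Real.two_pi_pos.le]
  have hnorm : ∀ t, ‖circleMap 0 R t‖ = R := fun t => by simp [abs_of_pos hRpos]
  have hmap : ∀ z ∈ ball z₀ (ρ / 2), ∀ t, z + circleMap 0 R t • v ∈ ball z₀ ρ :=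
    fun z hz t => hin z hz _ (hnorm t).le
  refine (hasFDerivAt_integral_of_holomorphic (g := fun _ => R⁻¹ * (‖f z₀‖ + 1)) (half_pos hρ)
    ?_ ?_ ?_ ?_).1.differentiableAt
  · intro z hz
    refine Continuous.aestronglyMeasurable ?_
    have h1 : Continuous fun t => f (z + circleMap 0 R t • v) := by
      refine ContinuousOn.comp_continuous (s := Ω) hf.continuousOn (by fun_prop) fun t =>
        (hball (hmap z hz t)).1
    have h2 : ∀ t, circleMap 0 R t ≠ 0 := fun t => by
      rw [← norm_pos_iff, hnorm]; exact hRpos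
    simp only [deriv_circleMap, sub_zero, smul_eq_mul]
    have h3 : Continuous (circleMap 0 R) := continuous_circleMap 0 R
    refine (h3.mul continuous_const).mul (Continuous.mul ?_ h1)
    exact continuous_const.div (h3.pow 2) fun t => pow_ne_zero 2 (h2 t)
  · refine .of_forall fun t z hz => ?_
    have h1 := (hball (hmap z hz t)).1
    refine DifferentiableAt.differentiableWithinAt ?_
    simp only [smul_eq_mul]
    refine DifferentiableAt.const_mul (DifferentiableAt.const_mul ?_ _) _
    exact ((hf _ h1).differentiableAt (hΩ.mem_nhds h1)).comp z
        (differentiableAt_id.add_const _)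
  · refine .of_forall fun t z hz => ?_
    have h1 := (hball (hmap z hz t)).2
    simp only [mem_ofPred_eq] at h1
    rw [norm_smul, norm_smul, deriv_circleMap, norm_mul, hnorm, sub_zero, norm_div, norm_pow, hnorm,
      Complex.norm_I, norm_one, ← mul_assoc]
    refine mul_le_mul (le_of_eq ?_) h1 (norm_nonneg _) (by positivity)
    field_simp
  · exact integrable_const _

/-- Holomorphic functions of several variables are smooth. -/
theorem contDiffOn_of_holomorphic {f : Z → ℂ} {Ω : Set Z} (hΩ : IsOpen Ω)
    (hf : DifferentiableOn ℂ f Ω) (n : ℕ) : ContDiffOn ℂ n f Ω := by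
  induction n generalizing f with
  | zero => simpa using hf.continuousOn
  | succ n ih =>
    push_cast
    rw [contDiffOn_succ_iff_fderiv_of_isOpen hΩ]
    refine ⟨hf, fun h => by simp at h, ?_⟩
    rw [contDiffOn_clm_apply]
    exact fun v => ih (differentiableOn_fderiv_apply hΩ hf v)

end Holomorphic

/-! ### Integrable endpoint singularities on the box of contour parameters -/

section Weights

variable {ι : Type*} [Fintype ι]

/-- The open box of contour parameters. -/
def openBox (ι : Type*) : Set (ι → ℝ) := univ.pi fun _ => Ioo 0 π

/-- The closed box of contour parameters. -/
def closedBox (ι : Type*) : Set (ι → ℝ) := univ.pi fun _ => Icc 0 π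

theorem openBox_subset_closedBox : openBox ι ⊆ closedBox ι :=
  fun _ h r hr => Ioo_subset_Icc_self (h r hr)

theorem isOpen_openBox : IsOpen (openBox ι) := isOpen_set_pi finite_univ fun _ _ => isOpen_Ioo

theorem measurableSet_openBox : MeasurableSet (openBox ι) := isOpen_openBox.measurableSet

theorem isCompact_closedBox : IsCompact (closedBox ι) := isCompact_univ_pi fun _ => isCompact_Icc

theorem sin_half_pos {t : ℝ} (h : t ∈ Ioo 0 π) : 0 < sin (t / 2) :=
  Real.sin_pos_of_pos_of_lt_pi (by linarith [h.1]) (by linarith [h.1, h.2])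

theorem cos_half_pos {t : ℝ} (h : t ∈ Ioo 0 π) : 0 < cos (t / 2) :=
  Real.cos_pos_of_mem_Ioo ⟨by linarith [h.1, Real.pi_pos], by linarith [h.2]⟩

theorem sin_half_nonneg {t : ℝ} (h : t ∈ Icc 0 π) : 0 ≤ sin (t / 2) :=
  Real.sin_nonneg_of_nonneg_of_le_pi (by linarith [h.1]) (by linarith [h.1, h.2])

theorem cos_half_nonneg {t : ℝ} (h : t ∈ Icc 0 π) : 0 ≤ cos (t / 2) :=
  Real.cos_nonneg_of_mem_Icc ⟨by linarith [h.1, Real.pi_pos], by linarith [h.2]⟩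

theorem le_sin_half {t : ℝ} (h : t ∈ Icc 0 π) : t / π ≤ sin (t / 2) := by
  have := Real.mul_le_sin (x := t / 2) (by linarith [h.1]) (by linarith [h.2])
  calc t / π = 2 / π * (t / 2) := by ring
    _ ≤ _ := this

/-- Jordan's inequality bounds a negative power of the sine by the same power of t/π; a nonnegative
power is at most 1. The sum of both bounds covers the two cases. -/
theorem integrableOn_sin_half_rpow {p : ℝ} (hp : -1 < p) :
    IntegrableOn (fun t : ℝ => sin (t / 2) ^ p) (Ioo 0 π) := by
  have hc : ContinuousOn (fun t : ℝ => sin (t / 2) ^ p) (Ioo 0 π) := by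
    refine ContinuousOn.rpow_const (by fun_prop) fun t ht => Or.inl (sin_half_pos ht).ne'
  have h1 : IntegrableOn (fun t : ℝ => 1 + (t / π) ^ p) (Ioo 0 π) := by
    rw [← integrableOn_Ioc_iff_integrableOn_Ioo, ← intervalIntegrable_iff_integrableOn_Ioc_of_le
      Real.pi_pos.le]
    refine intervalIntegrable_const.add ?_
    have := (intervalIntegral.intervalIntegrable_rpow' (a := 0) (b := 1) hp).comp_mul_right
      (c := π⁻¹)
    simpa [div_eq_mul_inv] using this
  refine h1.mono' (hc.aestronglyMeasurable measurableSet_Ioo) ?_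
  refine (ae_restrict_iff' measurableSet_Ioo).2 (.of_forall fun t ht => ?_)
  have hs := sin_half_pos ht
  have ht' : 0 < t / π := div_pos ht.1 Real.pi_pos
  rw [Real.norm_of_nonneg (Real.rpow_nonneg hs.le _)]
  rcases le_total p 0 with h | h
  · have := Real.rpow_le_rpow_of_nonpos ht' (le_sin_half (Ioo_subset_Icc_self ht)) h
    linarith
  · have := Real.rpow_le_one hs.le (Real.sin_le_one _) h
    linarith [Real.rpow_nonneg ht'.le p]

theorem integrableOn_cos_half_rpow {p : ℝ} (hp : -1 < p) :
    IntegrableOn (fun t : ℝ => cos (t / 2) ^ p) (Ioo 0 π) := by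
  have h := integrableOn_sin_half_rpow hp
  rw [← integrableOn_Ioc_iff_integrableOn_Ioo, ← intervalIntegrable_iff_integrableOn_Ioc_of_le
      Real.pi_pos.le] at h ⊢
  have h2 := (h.comp_sub_left π).symm
  simp only [sub_self, sub_zero] at h2
  refine h2.congr fun t _ => ?_
  rw [show (π - t) / 2 = π / 2 - t / 2 by ring, Real.sin_pi_div_two_sub]

/-- Sine and cosine are never both small: where one factor is singular the other is at least 1/2 and
its power is bounded by `K`. -/
theorem integrableOn_sin_cos_half_rpow {p q : ℝ} (hp : -1 < p) (hq : -1 < q) :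
    IntegrableOn (fun t : ℝ => sin (t / 2) ^ p * cos (t / 2) ^ q) (Ioo 0 π) := by
  have hc : ContinuousOn (fun t : ℝ => sin (t / 2) ^ p * cos (t / 2) ^ q)
      (Ioo 0 π) := by
    refine ContinuousOn.mul
      (ContinuousOn.rpow_const (by fun_prop) fun t ht => Or.inl (sin_half_pos ht).ne')
      (ContinuousOn.rpow_const (by fun_prop) fun t ht => Or.inl (cos_half_pos ht).ne')
  set K : ℝ := 1 + (1 / 2) ^ p + (1 / 2) ^ q with hK
  have hK1 : ∀ r : ℝ, r = p ∨ r = q → ∀ y : ℝ, 1 / 2 ≤ y → y ≤ 1 → y ^ r ≤ K := by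
    intro r hr y hy hy1
    have h1 : (0 : ℝ) ≤ (1 / 2) ^ p := by positivity
    have h2 : (0 : ℝ) ≤ (1 / 2) ^ q := by positivity
    rcases le_total r 0 with h | h
    · have := Real.rpow_le_rpow_of_nonpos (by norm_num) hy h
      rcases hr with rfl | rfl <;> linarith
    · have := Real.rpow_le_one (by linarith) hy1 h
      linarith
  have h1 := (((integrableOn_sin_half_rpow hp).add (integrableOn_cos_half_rpow hq)).const_mul K)
  refine h1.mono' (hc.aestronglyMeasurable measurableSet_Ioo) ?_
  refine (ae_restrict_iff' measurableSet_Ioo).2 (.of_forall fun t ht => ?_)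
  have hs := sin_half_pos ht
  have hc := cos_half_pos ht
  have e := Real.sin_sq_add_cos_sq (t / 2)
  have p1 := Real.rpow_nonneg hs.le p
  have p2 := Real.rpow_nonneg hc.le q
  have hK0 : 0 ≤ K := by positivity
  rw [Real.norm_of_nonneg (by positivity)]
  simp only [Pi.add_apply]
  rw [mul_add]
  rcases le_total (1 / 2) (cos (t / 2)) with h | h
  · have := mul_le_mul_of_nonneg_left (hK1 q (Or.inr rfl) _ h (Real.cos_le_one _)) p1
    nlinarith
  · have h' : 1 / 2 ≤ sin (t / 2) := by nlinarith
    have := mul_le_mul_of_nonneg_right (hK1 p (Or.inl rfl) _ h' (Real.sin_le_one _)) p2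
    nlinarith

theorem integrableOn_openBox_prod {f : ι → ℝ → ℝ} (hf : ∀ r, IntegrableOn (f r) (Ioo 0 π)) :
    IntegrableOn (fun θ : ι → ℝ => ∏ r, f r (θ r)) (openBox ι) := by
  rw [IntegrableOn, openBox, volume_pi, Measure.restrict_pi_pi]
  exact Integrable.fintype_prod (f := f) hf

/-- The singular factor of the integrands at the endpoints of the contours. -/
def endWeight (m n : ι → ℂ) (θ : ι → ℝ) : ℂ :=
  exp (∑ r, (m r * Real.log (sin (θ r / 2)) + n r * Real.log (cos (θ r / 2))))

theorem norm_endWeight (m n : ι → ℂ) {θ : ι → ℝ} (hθ : θ ∈ openBox ι) :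
    ‖endWeight m n θ‖ = ∏ r, (sin (θ r / 2) ^ (m r).re * cos (θ r / 2) ^ (n r).re) := by
  rw [endWeight, Complex.norm_exp, Complex.re_sum, Real.exp_sum]
  refine prod_congr rfl fun r _ => ?_
  rw [Real.rpow_def_of_pos (sin_half_pos (hθ r trivial)),
    Real.rpow_def_of_pos (cos_half_pos (hθ r trivial)), ← Real.exp_add]
  simp [mul_comm]

theorem norm_endWeight_le {m n : ι → ℂ} {p q : ι → ℝ} (hp : ∀ r, p r ≤ (m r).re)
    (hq : ∀ r, q r ≤ (n r).re) {θ : ι → ℝ} (hθ : θ ∈ openBox ι) :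
    ‖endWeight m n θ‖ ≤ ∏ r, (sin (θ r / 2) ^ p r * cos (θ r / 2) ^ q r) := by
  rw [norm_endWeight m n hθ]
  refine prod_le_prod (fun r _ => ?_) fun r _ => ?_
  · have := sin_half_pos (hθ r trivial)
    have := cos_half_pos (hθ r trivial)
    positivity
  · have h1 := sin_half_pos (hθ r trivial)
    have h2 := cos_half_pos (hθ r trivial)
    exact mul_le_mul (Real.rpow_le_rpow_of_exponent_ge h1 (Real.sin_le_one _) (hp r))
      (Real.rpow_le_rpow_of_exponent_ge h2 (Real.cos_le_one _) (hq r)) (by positivity)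
      (by positivity)

theorem continuousOn_endWeight (m n : ι → ℂ) : ContinuousOn (endWeight m n) (openBox ι) := by
  unfold endWeight
  refine Complex.continuous_exp.comp_continuousOn (continuousOn_finsetSum _ fun r _ => ?_)
  refine ContinuousOn.add (continuousOn_const.mul ?_) (continuousOn_const.mul ?_)
  · refine Complex.continuous_ofReal.comp_continuousOn (ContinuousOn.log (by fun_prop) ?_)
    exact fun θ hθ => (sin_half_pos (hθ r trivial)).ne'
  · refine Complex.continuous_ofReal.comp_continuousOn (ContinuousOn.log (by fun_prop) ?_)
    exact fun θ hθ => (cos_half_pos (hθ r trivial)).ne'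

theorem integrableOn_prod_rpow {p q : ι → ℝ} (hp : ∀ r, -1 < p r) (hq : ∀ r, -1 < q r) :
    IntegrableOn (fun θ : ι → ℝ => ∏ r, (sin (θ r / 2) ^ p r * cos (θ r / 2) ^ q r))
      (openBox ι) :=
  integrableOn_openBox_prod (f := fun r t => sin (t / 2) ^ p r * cos (t / 2) ^ q r)
    fun r => integrableOn_sin_cos_half_rpow (hp r) (hq r)

end Weights

/-! ### Holomorphic dependence of weighted integrals on parameters -/

section Parametric

variable {ι : Type*} [Fintype ι]

/-- A function that is continuous near `{z₀} × closedBox` is bounded there, uniformly in a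
neighbourhood of `z₀`. -/
theorem exists_uniform_bound {Z : Type*} [PseudoMetricSpace Z] {z₀ : Z} {U : Set (Z × (ι → ℝ))}
    (hU : IsOpen U) (hK : ∀ θ ∈ closedBox ι, (z₀, θ) ∈ U) {Ψ : Z → (ι → ℝ) → ℂ}
    (hΨ : ContinuousOn (fun p : Z × (ι → ℝ) => Ψ p.1 p.2) U) :
    ∃ δ > 0, ∃ M : ℝ, ∀ z ∈ ball z₀ δ, ∀ θ ∈ closedBox ι, (z, θ) ∈ U ∧ ‖Ψ z θ‖ ≤ M := by
  have hc : ContinuousOn (fun θ => Ψ z₀ θ) (closedBox ι) :=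
    hΨ.comp (f := fun θ => (z₀, θ)) (by fun_prop) hK
  obtain ⟨M, hM⟩ := isCompact_closedBox.exists_bound_of_continuousOn hc
  have hV : IsOpen (U ∩ (fun p : Z × (ι → ℝ) => ‖Ψ p.1 p.2‖) ⁻¹' Iio (M + 1)) :=
    hΨ.norm.isOpen_inter_preimage hU isOpen_Iio
  obtain ⟨u, v, hu, -, h1, h2, h3⟩ := generalized_tube_lemma (isCompact_singleton (x := z₀))
    isCompact_closedBox hV (by
      rintro ⟨z, θ⟩ ⟨hz, hθ⟩
      obtain rfl : z = z₀ := hz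
      exact ⟨hK θ hθ, lt_of_le_of_lt (hM θ hθ) (lt_add_one M)⟩)
  obtain ⟨δ, hδ, hball⟩ := Metric.isOpen_iff.1 hu z₀ (h1 rfl)
  refine ⟨δ, hδ, M + 1, fun z hz θ hθ => ?_⟩
  have := h3 (mk_mem_prod (hball hz) (h2 hθ))
  exact ⟨this.1, le_of_lt this.2⟩

variable {Z : Type*} [NormedAddCommGroup Z] [NormedSpace ℂ Z] [FiniteDimensional ℂ Z]
  {z₀ : Z} {U : Set (Z × (ι → ℝ))} {Ψ : Z → (ι → ℝ) → ℂ} {m n : Z → ι → ℂ}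

/-- The dominating function has the exponents (Re m - 1)/2, the midpoints between -1 and the
exponents at `z₀`. They are still integrable, and they lie below the exponents at all nearby `z`.
The regular factor is bounded by compactness of the closed box. -/
theorem weighted_integral_hypotheses (hU : IsOpen U) (hK : ∀ θ ∈ closedBox ι, (z₀, θ) ∈ U)
    (hΨ : ContinuousOn (fun p : Z × (ι → ℝ) => Ψ p.1 p.2) U)
    (hd : ∀ z θ, (z, θ) ∈ U → DifferentiableAt ℂ (Ψ · θ) z)
    (hm : Differentiable ℂ m) (hn : Differentiable ℂ n)
    (hm₀ : ∀ r, -1 < (m z₀ r).re) (hn₀ : ∀ r, -1 < (n z₀ r).re) :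
    ∃ δ > 0, ∃ g : (ι → ℝ) → ℝ, IntegrableOn g (openBox ι) ∧
      (∀ z ∈ ball z₀ δ, ContinuousOn (fun θ => endWeight (m z) (n z) θ * Ψ z θ) (openBox ι)) ∧
      (∀ θ ∈ openBox ι, DifferentiableOn ℂ (fun z => endWeight (m z) (n z) θ * Ψ z θ)
        (ball z₀ δ)) ∧
      ∀ θ ∈ openBox ι, ∀ z ∈ ball z₀ δ, ‖endWeight (m z) (n z) θ * Ψ z θ‖ ≤ g θ := by
  obtain ⟨δ₁, hδ₁, M, hM⟩ := exists_uniform_bound hU hK hΨ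
  have hev : ∀ᶠ z in 𝓝 z₀, ∀ r, ((m z₀ r).re - 1) / 2 ≤ (m z r).re ∧
      ((n z₀ r).re - 1) / 2 ≤ (n z r).re := by
    refine eventually_all.2 fun r => ?_
    have h1 : ContinuousAt (fun z => (m z r).re) z₀ :=
      Complex.continuous_re.continuousAt.comp ((continuous_apply r).comp hm.continuous).continuousAt
    have h2 : ContinuousAt (fun z => (n z r).re) z₀ :=
      Complex.continuous_re.continuousAt.comp ((continuous_apply r).comp hn.continuous).continuousAt
    exact ((h1.eventually (lt_mem_nhds (show ((m z₀ r).re - 1) / 2 < _ by linarith [hm₀ r]))).and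
      (h2.eventually (lt_mem_nhds (show ((n z₀ r).re - 1) / 2 < _ by linarith [hn₀ r])))).mono
      fun z hz => ⟨hz.1.le, hz.2.le⟩
  obtain ⟨δ₂, hδ₂, hball⟩ := Metric.mem_nhds_iff.1 hev
  refine ⟨min δ₁ δ₂, lt_min hδ₁ hδ₂, fun θ => (∏ r, (sin (θ r / 2) ^ (((m z₀ r).re - 1) / 2) *
    cos (θ r / 2) ^ (((n z₀ r).re - 1) / 2))) * M, ?_, ?_, ?_, ?_⟩
  · exact (integrableOn_prod_rpow (fun r => by linarith [hm₀ r])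
      (fun r => by linarith [hn₀ r])).mul_const M
  · intro z hz
    refine (continuousOn_endWeight _ _).mul ?_
    exact hΨ.comp (f := fun θ => (z, θ)) (by fun_prop) fun θ hθ =>
      (hM z (ball_subset_ball (min_le_left _ _) hz) θ (openBox_subset_closedBox hθ)).1
  · intro θ hθ z hz
    refine DifferentiableAt.differentiableWithinAt (DifferentiableAt.mul ?_ ?_)
    · unfold endWeight
      have h1 : ∀ r, Differentiable ℂ fun z => m z r := fun r => differentiable_pi.1 hm r
      have h2 : ∀ r, Differentiable ℂ fun z => n z r := fun r => differentiable_pi.1 hn r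
      refine DifferentiableAt.cexp (DifferentiableAt.fun_sum fun r _ => ?_)
      exact ((h1 r z).mul_const _).add ((h2 r z).mul_const _)
    · exact hd z θ (hM z (ball_subset_ball (min_le_left _ _) hz) θ (openBox_subset_closedBox hθ)).1
  · intro θ hθ z hz
    rw [norm_mul]
    have h1 := hball (ball_subset_ball (min_le_right _ _) hz)
    refine mul_le_mul (norm_endWeight_le (fun r => (h1 r).1) (fun r => (h1 r).2) hθ)
      (hM z (ball_subset_ball (min_le_left _ _) hz) θ (openBox_subset_closedBox hθ)).2
      (norm_nonneg _) ?_
    refine prod_nonneg fun r _ => ?_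
    have := sin_half_pos (hθ r trivial)
    have := cos_half_pos (hθ r trivial)
    positivity

theorem weighted_integral_differentiableAt (hU : IsOpen U)
    (hK : ∀ θ ∈ closedBox ι, (z₀, θ) ∈ U)
    (hΨ : ContinuousOn (fun p : Z × (ι → ℝ) => Ψ p.1 p.2) U)
    (hd : ∀ z θ, (z, θ) ∈ U → DifferentiableAt ℂ (Ψ · θ) z)
    (hm : Differentiable ℂ m) (hn : Differentiable ℂ n)
    (hm₀ : ∀ r, -1 < (m z₀ r).re) (hn₀ : ∀ r, -1 < (n z₀ r).re) :
    IntegrableOn (fun θ => endWeight (m z₀) (n z₀) θ * Ψ z₀ θ) (openBox ι) ∧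
    DifferentiableAt ℂ (fun z => ∫ θ in openBox ι, endWeight (m z) (n z) θ * Ψ z θ) z₀ := by
  obtain ⟨δ, hδ, g, hg, h1, h2, h3⟩ := weighted_integral_hypotheses hU hK hΨ hd hm hn hm₀ hn₀
  refine ⟨hg.mono' ((h1 z₀ (mem_ball_self hδ)).aestronglyMeasurable measurableSet_openBox) ?_,
    (hasFDerivAt_integral_of_holomorphic hδ
    (fun z hz => (h1 z hz).aestronglyMeasurable measurableSet_openBox) ?_ ?_ hg).1.differentiableAt⟩
  · exact (ae_restrict_iff' measurableSet_openBox).2 (.of_forall fun θ hθ =>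
      h3 θ hθ z₀ (mem_ball_self hδ))
  · exact (ae_restrict_iff' measurableSet_openBox).2 (.of_forall h2)
  · exact (ae_restrict_iff' measurableSet_openBox).2 (.of_forall h3)

theorem weighted_integral_hasDerivAt {z₀ : ℂ} {U : Set (ℂ × (ι → ℝ))} {Ψ : ℂ → (ι → ℝ) → ℂ}
    {m n : ℂ → ι → ℂ} (hU : IsOpen U) (hK : ∀ θ ∈ closedBox ι, (z₀, θ) ∈ U)
    (hΨ : ContinuousOn (fun p : ℂ × (ι → ℝ) => Ψ p.1 p.2) U)
    (hd : ∀ z θ, (z, θ) ∈ U → DifferentiableAt ℂ (Ψ · θ) z)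
    (hm : Differentiable ℂ m) (hn : Differentiable ℂ n)
    (hm₀ : ∀ r, -1 < (m z₀ r).re) (hn₀ : ∀ r, -1 < (n z₀ r).re) :
    HasDerivAt (fun z => ∫ θ in openBox ι, endWeight (m z) (n z) θ * Ψ z θ)
      (∫ θ in openBox ι, deriv (fun z => endWeight (m z) (n z) θ * Ψ z θ) z₀) z₀ := by
  obtain ⟨δ, hδ, g, hg, h1, h2, h3⟩ := weighted_integral_hypotheses hU hK hΨ hd hm hn hm₀ hn₀
  refine hasDerivAt_integral_of_holomorphic hδ
    (fun z hz => (h1 z hz).aestronglyMeasurable measurableSet_openBox) ?_ ?_ hg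
  · exact (ae_restrict_iff' measurableSet_openBox).2 (.of_forall h2)
  · exact (ae_restrict_iff' measurableSet_openBox).2 (.of_forall h3)

end Parametric

/-! ### Integrals of total derivatives over the box -/

section TotalDerivative

variable {ι : Type*} [Fintype ι] [DecidableEq ι]

/-- The integral over the box of a partial derivative vanishes if the function vanishes
to second order at the boundary. -/
theorem integral_openBox_partial_eq_zero {ψ ψ' : (ι → ℝ) → ℂ} {r : ι} {M : ℝ}
    (hi : IntegrableOn ψ (openBox ι)) (hi' : IntegrableOn ψ' (openBox ι))
    (hd : ∀ θ ∈ openBox ι, HasDerivAt (fun t : ℝ => ψ (update θ r t)) (ψ' θ) (θ r))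
    (hb : ∀ θ ∈ openBox ι, ‖ψ θ‖ ≤ M * (sin (θ r)) ^ 2) :
    ∫ θ in openBox ι, ψ' θ = 0 := by
  -- Extension by zero. Vanishing of second order at the faces makes the extension differentiable in
  -- direction `r` everywhere, so integration by parts on the whole space leaves no boundary term.
  set g := (openBox ι).indicator ψ
  set g' := (openBox ι).indicator ψ'
  have hg : Integrable g := (integrable_indicator_iff measurableSet_openBox).2 hi
  have hg' : Integrable g' := (integrable_indicator_iff measurableSet_openBox).2 hi'
  have hb' : ∀ θ, ‖g θ‖ ≤ |M| * (sin (θ r)) ^ 2 := by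
    intro θ
    by_cases h : θ ∈ openBox ι
    · simp only [g, indicator_of_mem h]
      exact (hb θ h).trans (by gcongr; exact le_abs_self M)
    · simp only [g, indicator_of_notMem h, norm_zero]
      positivity
  have hupd : ∀ θ : ι → ℝ, ∀ t : ℝ, θ + t • Pi.single r (1 : ℝ) = update θ r (θ r + t) := by
    intro θ t
    ext k
    by_cases hk : k = r
    · subst hk; simp
    · simp [hk]
  have hopen : ∀ θ ∈ openBox ι, ∀ᶠ t in 𝓝 (θ r), update θ r t ∈ openBox ι := by
    intro θ hθ
    have : Continuous fun t => update θ r t := continuous_const.update r continuous_id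
    refine this.continuousAt.eventually (isOpen_openBox.mem_nhds ?_)
    simpa using hθ
  have key : ∀ θ, HasLineDerivAt ℝ g (g' θ) θ (Pi.single r 1) := by
    intro θ
    rw [HasLineDerivAt]
    simp only [hupd]
    by_cases h : θ ∈ openBox ι
    · have h1 : HasDerivAt (fun t : ℝ => ψ (update θ r t)) (ψ' θ) (θ r + 0) := by
        simpa using hd θ h
      have h2 := h1.comp_const_add (θ r) 0
      simp only [g', indicator_of_mem h]
      refine h2.congr_of_eventuallyEq ?_
      have h3 : Tendsto (fun t : ℝ => θ r + t) (𝓝 0) (𝓝 (θ r)) := by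
        have : Continuous fun t : ℝ => θ r + t := by fun_prop
        simpa using this.tendsto 0
      filter_upwards [h3.eventually (hopen θ h)] with t ht
      simp only [g, indicator_of_mem ht]
    · simp only [g', indicator_of_notMem h]
      -- On a face of direction `r` the bound by sin² gives an increment of order `t ^ 2`, hence
      -- derivative zero.
      by_cases h2 : θ r = 0 ∨ θ r = π
      · have hs : sin (θ r) = 0 := by rcases h2 with h | h <;> simp [h]
        have h0 : g θ = 0 := by
          have := hb' θ
          rw [hs] at this
          simpa using this
        rw [hasDerivAt_iff_isLittleO]
        simp only [add_zero, Function.update_eq_self, h0, sub_zero, smul_zero]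
        refine Asymptotics.IsBigO.trans_isLittleO (g := fun t : ℝ => t ^ 2) ?_ ?_
        · refine Asymptotics.IsBigO.of_bound |M| (.of_forall fun t => ?_)
          refine (hb' _).trans ?_
          simp only [Function.update_self, Real.norm_eq_abs, abs_pow, sq_abs]
          have : (sin (θ r + t)) ^ 2 = (sin t) ^ 2 := by
            rcases h2 with h | h <;> rw [h] <;> simp [Real.sin_add]
          rw [this]
          refine mul_le_mul_of_nonneg_left ?_ (abs_nonneg M)
          rw [← sq_abs, ← sq_abs t]
          exact pow_le_pow_left₀ (abs_nonneg _) Real.abs_sin_le_abs 2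
        · exact Asymptotics.isLittleO_pow_id one_lt_two
      -- Either another coordinate is outside its interval, and the extension vanishes on the entire
      -- line, or `θ r` is outside the closed interval, and it vanishes near the point.
      · have hz : ∀ᶠ t : ℝ in 𝓝 0, g (update θ r (θ r + t)) = 0 := by
          by_cases h3 : θ r ∈ Ioo 0 π
          · refine .of_forall fun t => indicator_of_notMem (fun h4 => h ?_) _
            intro k hk
            by_cases hkr : k = r
            · rw [hkr]; exact h3
            · simpa [hkr] using h4 k hk
          · have h5 : θ r ∈ (Icc 0 π)ᶜ := by
              intro h6
              apply h3
              push Not at h2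
              exact ⟨lt_of_le_of_ne h6.1 (Ne.symm h2.1), lt_of_le_of_ne h6.2 h2.2⟩
            have h7 : Tendsto (fun t : ℝ => θ r + t) (𝓝 0) (𝓝 (θ r)) := by
              have : Continuous fun t : ℝ => θ r + t := by fun_prop
              simpa using this.tendsto 0
            filter_upwards [h7.eventually (isClosed_Icc.isOpen_compl.mem_nhds h5)] with t ht
            refine indicator_of_notMem (fun h4 => ht ?_) _
            have := h4 r trivial
            simp only [Function.update_self] at this
            exact Ioo_subset_Icc_self this
        refine (hasDerivAt_const (0 : ℝ) (0 : ℂ)).congr_of_eventuallyEq ?_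
        exact hz
  -- Integration by parts against the constant function 1.
  have := integral_bilinear_hasLineDerivAt_right_eq_neg_left_of_integrable
    (μ := (volume : Measure (ι → ℝ))) (f := fun _ => (1 : ℂ)) (f' := fun _ => (0 : ℂ)) (g := g)
    (g' := g') (v := Pi.single r (1 : ℝ)) (B := ContinuousLinearMap.mul ℝ ℂ) (by simp)
    (by simpa using hg') (by simpa using hg) (fun θ _ => by
      simpa [HasLineDerivAt] using hasDerivAt_const (0 : ℝ) (1 : ℂ)) (fun θ _ => key θ)
  simp only [ContinuousLinearMap.mul_apply', one_mul, zero_mul, integral_zero, neg_zero] at this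
  rwa [integral_indicator measurableSet_openBox] at this

end TotalDerivative

/-! ### Elliptic contours and the logarithmic derivative of the integrand -/

section System

variable {P ι : Type*} [Fintype P] [DecidableEq P] [Fintype ι] [LinearOrder ι] (a b : ι → P)

/-- A point of the contour from `x (a r)` to `x (b r)`; here `S`, `C` are the sine and cosine of
half the contour parameter, and `η` is the eccentricity of the contour, a semi-ellipse. -/
def pt (x : P → ℂ) (η : ℂ) (S C : ι → ℂ) (r : ι) : ℂ :=
  x (a r) + (x (b r) - x (a r)) * (S r * (S r + I * η * C r))

/-- The velocity of the contour. -/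
def vel (x : P → ℂ) (η : ℂ) (S C : ι → ℂ) (r : ι) : ℂ :=
  (x (b r) - x (a r)) * (S r * C r + I * η * (C r ^ 2 - S r ^ 2) / 2)

/-- The branch of `log (-i (u_r - x_i))`, without the contribution of the endpoint singularity. -/
def logReg (x : P → ℂ) (η : ℂ) (S C : ι → ℂ) (r : ι) (i : P) : ℂ :=
  if i = a r then log (x (b r) - x (a r)) + log (η * C r - I * S r)
  else if i = b r then
    log (x (b r) - x (a r)) + log (η * S r + I * C r)
  else log (-I * (pt a b x η S C r - x i))

/-- The branch of `log (-i (u_r - x_i))`. -/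
def logFull (x : P → ℂ) (η : ℂ) (S C : ι → ℂ) (r : ι) (i : P) : ℂ :=
  logReg a b x η S C r i + (if i = a r then log (S r) else 0)
    + (if i = b r then log (C r) else 0)

/-- The logarithm of the integrand, for arbitrary charges, without the endpoint singularities. -/
def expReg (μ : ι → P → ℂ) (ν : ι → ι → ℂ) (x : P → ℂ) (η : ℂ) (S C : ι → ℂ) : ℂ :=
  ∑ r, ∑ i, μ r i * logReg a b x η S C r i
    + ∑ r, ∑ s with r < s, ν r s * log (-I * (pt a b x η S C r - pt a b x η S C s))

/-- The logarithm of the integrand, for arbitrary charges. -/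
def expFull (μ : ι → P → ℂ) (ν : ι → ι → ℂ) (x : P → ℂ) (η : ℂ) (S C : ι → ℂ) : ℂ :=
  ∑ r, ∑ i, μ r i * logFull a b x η S C r i
    + ∑ r, ∑ s with r < s, ν r s * log (-I * (pt a b x η S C r - pt a b x η S C s))

/-- The arguments of all regular logarithms avoid the branch cut. -/
structure RegSlit (x : P → ℂ) (η : ℂ) (S C : ι → ℂ) : Prop where
  diff : ∀ r, x (b r) - x (a r) ∈ slitPlane
  left : ∀ r, η * C r - I * S r ∈ slitPlane
  right : ∀ r, η * S r + I * C r ∈ slitPlane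
  point : ∀ r i, i ≠ a r → i ≠ b r →
    -I * (pt a b x η S C r - x i) ∈ slitPlane
  pair : ∀ r s, r < s →
    -I * (pt a b x η S C r - pt a b x η S C s) ∈ slitPlane

/-- The logarithmic derivative of the integrand when the `u_r` move with speeds `ζ_r` and the points
`x_i` with speeds `ξ_i`. -/
def logDer (μ : ι → P → ℂ) (ν : ι → ι → ℂ) (x : P → ℂ) (u : ι → ℂ) (ξ : P → ℂ) (ζ : ι → ℂ) : ℂ :=
  ∑ r, ∑ i, μ r i * ((ζ r - ξ i) / (u r - x i))
    + ∑ r, ∑ s with r < s, ν r s * ((ζ r - ζ s) / (u r - u s))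

variable {a b}

/-- The factor `S` carries the whole endpoint singularity. On the contours the middle factor has
nonnegative real part and never vanishes, so that its principal logarithm is regular up to the
endpoints. -/
theorem pt_sub_left (x : P → ℂ) (η : ℂ) (S C : ι → ℂ) (r : ι) :
    -I * (pt a b x η S C r - x (a r)) =
      (x (b r) - x (a r)) * (η * C r - I * S r) * S r := by
  simp only [pt]
  linear_combination (-(x (b r) - x (a r)) * S r * η * C r) * Complex.I_mul_I

theorem pt_sub_right (x : P → ℂ) (η : ℂ) {S C : ι → ℂ} {r : ι} (h : S r ^ 2 + C r ^ 2 = 1) :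
    -I * (pt a b x η S C r - x (b r)) =
      (x (b r) - x (a r)) * (η * S r + I * C r) * C r := by
  simp only [pt]
  linear_combination (-(x (b r) - x (a r)) * S r * η * C r) * Complex.I_mul_I
    - (x (b r) - x (a r)) * I * h

section Derivative

variable {𝕜 : Type*} [NontriviallyNormedField 𝕜] [NormedAlgebra 𝕜 ℂ]

theorem hasDerivAt_clog_comp {f : 𝕜 → ℂ} {f' : ℂ} {y : 𝕜} (hf : HasDerivAt f f' y)
    (h : f y ∈ slitPlane) :
    HasDerivAt (fun t => log (f t)) (f' / f y) y := by
  have := (Complex.hasDerivAt_log h).scomp y hf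
  simpa [div_eq_mul_inv, Function.comp_def] using this

/-- Logarithmic derivatives are insensitive to the branch, so the logarithm of the product `k` never
has to be compared with the sum of the three logarithms. -/
theorem hasDerivAt_log_add_log_add_log {f g h k : 𝕜 → ℂ} {f' g' h' k' : ℂ} {y : 𝕜}
    (hf : HasDerivAt f f' y) (hg : HasDerivAt g g' y) (hh : HasDerivAt h h' y)
    (hk : HasDerivAt k k' y) (e : ∀ t, k t = f t * g t * h t)
    (sf : f y ∈ slitPlane) (sg : g y ∈ slitPlane)
    (sh : h y ∈ slitPlane) :
    HasDerivAt (fun t => log (f t) + log (g t) + log (h t))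
      (k' / k y) y := by
  have h1 := ((hasDerivAt_clog_comp hf sf).add (hasDerivAt_clog_comp hg sg)).add
    (hasDerivAt_clog_comp hh sh)
  have h2 : HasDerivAt k ((f' * g y + f y * g') * h y + f y * g y * h') y := by
    have := (hf.mul hg).mul hh
    have e' : k = f * g * h := funext fun t => by simp [e t]
    rw [e']
    exact this
  have n1 := Complex.slitPlane_ne_zero sf
  have n2 := Complex.slitPlane_ne_zero sg
  have n3 := Complex.slitPlane_ne_zero sh
  refine h1.congr_deriv ?_
  rw [hk.unique h2, e y]
  field_simp

variable {x : 𝕜 → P → ℂ} {η : 𝕜 → ℂ} {S C : 𝕜 → ι → ℂ} {y : 𝕜} {ξ : P → ℂ} {ζ : ι → ℂ}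
  {η' : ℂ} {S' C' : ι → ℂ}

/-- One chain rule serves all the motions needed: along a contour (𝕜 = ℝ), and of the points or the
eccentricity (𝕜 = ℂ). By the factorizations `pt_sub_left` and `pt_sub_right` only the speeds of the
`u_r` and the `x_i` enter the result. -/
theorem hasDerivAt_expFull (μ : ι → P → ℂ) (ν : ι → ι → ℂ)
    (hab : ∀ r, a r ≠ b r) (hx : ∀ i, HasDerivAt (fun t => x t i) (ξ i) y)
    (hη : HasDerivAt η η' y) (hS : ∀ r, HasDerivAt (fun t => S t r) (S' r) y)
    (hC : ∀ r, HasDerivAt (fun t => C t r) (C' r) y)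
    (hu : ∀ r, HasDerivAt (fun t => pt a b (x t) (η t) (S t) (C t) r) (ζ r) y)
    (hSC : ∀ t r, S t r ^ 2 + C t r ^ 2 = 1)
    (hslit : RegSlit a b (x y) (η y) (S y) (C y)) (sS : ∀ r, S y r ∈ slitPlane)
    (sC : ∀ r, C y r ∈ slitPlane) :
    HasDerivAt (fun t => expFull a b μ ν (x t) (η t) (S t) (C t))
      (logDer μ ν (x y) (pt a b (x y) (η y) (S y) (C y)) ξ ζ) y := by
  have hI : -I ≠ 0 := by simp
  unfold expFull logDer
  refine HasDerivAt.add (HasDerivAt.fun_sum fun r _ => HasDerivAt.fun_sum fun i _ => ?_)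
    (HasDerivAt.fun_sum fun r _ => HasDerivAt.fun_sum fun s hs => ?_)
  · refine HasDerivAt.const_mul _ ?_
    have hk : HasDerivAt (fun t => -I * (pt a b (x t) (η t) (S t) (C t) r - x t i))
        (-I * (ζ r - ξ i)) y := ((hu r).sub (hx i)).const_mul _
    rw [← mul_div_mul_left _ _ hI]
    have hD : HasDerivAt (fun t => x t (b r) - x t (a r)) (ξ (b r) - ξ (a r)) y :=
      (hx _).sub (hx _)
    have hL : HasDerivAt (fun t => η t * C t r - I * S t r)
        (η' * C y r + η y * C' r - I * S' r) y :=
      (hη.fun_mul (hC r)).fun_sub ((hS r).const_mul _)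
    have hR : HasDerivAt (fun t => η t * S t r + I * C t r)
        (η' * S y r + η y * S' r + I * C' r) y :=
      (hη.fun_mul (hS r)).fun_add ((hC r).const_mul _)
    unfold logFull logReg
    by_cases hia : i = a r
    · subst hia
      simp only [if_true, if_neg (hab r), add_zero]
      have := hasDerivAt_log_add_log_add_log hD hL (hS r) hk (fun t => pt_sub_left _ _ _ _ _)
        (hslit.diff r) (hslit.left r) (sS r)
      exact this
    · by_cases hib : i = b r
      · subst hib
        simp only [if_neg hia, if_true, add_zero]
        have := hasDerivAt_log_add_log_add_log hD hR (hC r) hk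
          (fun t => pt_sub_right _ _ (hSC t r)) (hslit.diff r) (hslit.right r) (sC r)
        exact this
      · simp only [if_neg hia, if_neg hib, add_zero]
        exact hasDerivAt_clog_comp hk (hslit.point r i hia hib)
  · refine HasDerivAt.const_mul _ ?_
    rw [← mul_div_mul_left _ _ hI]
    exact hasDerivAt_clog_comp (((hu r).sub (hu s)).const_mul _)
      (hslit.pair r s (by simpa using hs))

end Derivative

end System

/-! ### The integrand on the box -/

section System

variable {P ι : Type*} [Fintype P] [DecidableEq P] [Fintype ι] [LinearOrder ι] {a b : ι → P}

/-- The sines of the half parameters. -/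
def sn (θ : ι → ℝ) (r : ι) : ℂ := (sin (θ r / 2) : ℝ)

/-- The cosines of the half parameters. -/
def cs (θ : ι → ℝ) (r : ι) : ℂ := (cos (θ r / 2) : ℝ)

theorem sn_sq_add_cs_sq (θ : ι → ℝ) (r : ι) : sn θ r ^ 2 + cs θ r ^ 2 = 1 := by
  simp only [sn, cs]
  exact_mod_cast Real.sin_sq_add_cos_sq (θ r / 2)

theorem continuous_sn (r : ι) : Continuous fun θ : ι → ℝ => sn θ r := by
  unfold sn; fun_prop

theorem continuous_cs (r : ι) : Continuous fun θ : ι → ℝ => cs θ r := by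
  unfold cs; fun_prop

variable (a b) in
/-- The integrand for the charges `μ` (of `u_r` with `x_i`) and `ν` (of `u_r` with `u_s`), pulled
back to the parameters of the contours. -/
def density (μ : ι → P → ℂ) (ν : ι → ι → ℂ) (x : P → ℂ) (η : ℂ) (θ : ι → ℝ) : ℂ :=
  endWeight (fun r => μ r (a r)) (fun r => μ r (b r)) θ *
    (exp (expReg a b μ ν x η (sn θ) (cs θ)) * ∏ r, vel a b x η (sn θ) (cs θ) r)

/-- Inside the open box the endpoint weight restores the logarithms that `logReg` omits. The
right-hand side is convenient for differentiation, the definition for bounds up to the boundary. -/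
theorem density_eq (μ : ι → P → ℂ) (ν : ι → ι → ℂ) (x : P → ℂ) (η : ℂ)
    (θ : ι → ℝ) (hθ : θ ∈ openBox ι) : density a b μ ν x η θ =
      exp (expFull a b μ ν x η (sn θ) (cs θ)) * ∏ r, vel a b x η (sn θ) (cs θ) r := by
  rw [density, endWeight, ← mul_assoc, ← exp_add]
  congr 2
  unfold expReg expFull logFull
  rw [← add_assoc]
  congr 1
  rw [← sum_add_distrib]
  refine sum_congr rfl fun r _ => ?_
  have h1 : log (sn θ r) = Real.log (sin (θ r / 2)) :=
    (Complex.ofReal_log (sin_half_pos (hθ r trivial)).le).symm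
  have h2 : log (cs θ r) = Real.log (cos (θ r / 2)) :=
    (Complex.ofReal_log (cos_half_pos (hθ r trivial)).le).symm
  simp only [mul_add, sum_add_distrib, mul_ite, mul_zero, Finset.sum_ite_eq',
    Finset.mem_univ, if_true, h1, h2]
  ring

/-! ### Continuity and holomorphy of the integrand in all parameters -/

section Regularity

theorem isOpen_setOf_forall {X κ : Type*} [TopologicalSpace X] [Finite κ] {q : κ → X → Prop}
    (h : ∀ k, IsOpen {p | q k p}) : IsOpen {p | ∀ k, q k p} := by
  have : {p | ∀ k, q k p} = ⋂ k, {p | q k p} := by ext; simp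
  rw [this]
  exact isOpen_iInter_of_finite h

theorem isOpen_setOf_imp {X : Type*} [TopologicalSpace X] {c : Prop} {q : X → Prop}
    (h : IsOpen {p | q p}) : IsOpen {p | c → q p} := by
  by_cases hc : c <;> simp [hc, h]

theorem isOpen_setOf_regSlit {X : Type*} [TopologicalSpace X] {x : X → P → ℂ} {η : X → ℂ}
    {S C : X → ι → ℂ} (hx : ∀ i, Continuous fun p => x p i) (hη : Continuous η)
    (hS : ∀ r, Continuous fun p => S p r) (hC : ∀ r, Continuous fun p => C p r) :
    IsOpen {p | RegSlit a b (x p) (η p) (S p) (C p)} := by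
  have hpt : ∀ r, Continuous fun p => pt a b (x p) (η p) (S p) (C p) r := by
    intro r; unfold pt; fun_prop
  have e : {p | RegSlit a b (x p) (η p) (S p) (C p)} =
      {p | ∀ r, x p (b r) - x p (a r) ∈ slitPlane} ∩
      {p | ∀ r, η p * C p r - I * S p r ∈ slitPlane} ∩
      {p | ∀ r, η p * S p r + I * C p r ∈ slitPlane} ∩
      {p | ∀ r i, i ≠ a r → i ≠ b r →
        -I * (pt a b (x p) (η p) (S p) (C p) r - x p i) ∈ slitPlane} ∩
      {p | ∀ r s, r < s → -I * (pt a b (x p) (η p) (S p) (C p) r -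
        pt a b (x p) (η p) (S p) (C p) s) ∈ slitPlane} := by
    ext p
    exact ⟨fun h => ⟨⟨⟨⟨h.1, h.2⟩, h.3⟩, h.4⟩, h.5⟩,
      fun h => ⟨h.1.1.1.1, h.1.1.1.2, h.1.1.2, h.1.2, h.2⟩⟩
  have o := Complex.isOpen_slitPlane
  rw [e]
  refine ((((isOpen_setOf_forall fun r => ?_).inter (isOpen_setOf_forall fun r => ?_)).inter
    (isOpen_setOf_forall fun r => ?_)).inter (isOpen_setOf_forall fun r => isOpen_setOf_forall
    fun i => isOpen_setOf_imp (isOpen_setOf_imp ?_))).inter (isOpen_setOf_forall fun r =>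
    isOpen_setOf_forall fun s => isOpen_setOf_imp ?_)
  · exact o.preimage (f := fun p => x p (b r) - x p (a r)) (by fun_prop)
  · exact o.preimage (f := fun p => η p * C p r - I * S p r) (by fun_prop)
  · exact o.preimage (f := fun p => η p * S p r + I * C p r) (by fun_prop)
  · exact o.preimage (f := fun p => -I * (pt a b (x p) (η p) (S p) (C p) r - x p i))
      (by fun_prop)
  · exact o.preimage (f := fun p => -I * (pt a b (x p) (η p) (S p) (C p) r -
        pt a b (x p) (η p) (S p) (C p) s)) (by fun_prop)

theorem continuousOn_expReg_mul {X : Type*} [TopologicalSpace X] {x : X → P → ℂ} {η : X → ℂ}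
    {S C : X → ι → ℂ} {μ : X → ι → P → ℂ} {ν : X → ι → ι → ℂ} {U : Set X}
    (hx : ∀ i, Continuous fun p => x p i) (hη : Continuous η)
    (hS : ∀ r, Continuous fun p => S p r) (hC : ∀ r, Continuous fun p => C p r)
    (hμ : ∀ r i, Continuous fun p => μ p r i) (hν : ∀ r s, Continuous fun p => ν p r s)
    (hU : ∀ p ∈ U, RegSlit a b (x p) (η p) (S p) (C p)) :
    ContinuousOn (fun p => exp (expReg a b (μ p) (ν p) (x p) (η p) (S p) (C p)) *
      ∏ r, vel a b (x p) (η p) (S p) (C p) r) U := by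
  have hpt : ∀ r, Continuous fun p => pt a b (x p) (η p) (S p) (C p) r := by
    intro r; unfold pt; fun_prop
  refine ContinuousOn.mul (Complex.continuous_exp.comp_continuousOn ?_) (Continuous.continuousOn ?_)
  · unfold expReg
    refine (continuousOn_finsetSum _ fun r _ => continuousOn_finsetSum _ fun i _ => ?_).add
      (continuousOn_finsetSum _ fun r _ => continuousOn_finsetSum _ fun s hs => ?_)
    · refine (hμ r i).continuousOn.mul ?_
      unfold logReg
      split_ifs with h1 h2
      · refine (ContinuousOn.clog (by fun_prop) fun p hp => (hU p hp).diff r).add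
          (ContinuousOn.clog (by fun_prop) fun p hp => (hU p hp).left r)
      · refine (ContinuousOn.clog (by fun_prop) fun p hp => (hU p hp).diff r).add
          (ContinuousOn.clog (by fun_prop) fun p hp => (hU p hp).right r)
      · exact ContinuousOn.clog (by fun_prop) fun p hp => (hU p hp).point r i h1 h2
    · refine (hν r s).continuousOn.mul ?_
      exact ContinuousOn.clog (by fun_prop) fun p hp => (hU p hp).pair r s (by simpa using hs)
  · unfold vel
    fun_prop

variable {Z : Type*} [NormedAddCommGroup Z] [NormedSpace ℂ Z]

theorem differentiableAt_finset_prod {κ : Type*} {f : κ → Z → ℂ} {z : Z} (u : Finset κ)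
    (h : ∀ k, DifferentiableAt ℂ (f k) z) : DifferentiableAt ℂ (fun p => ∏ k ∈ u, f k p) z := by
  classical
  induction u using Finset.induction_on with
  | empty => simp
  | insert k u hk ih =>
    simp only [Finset.prod_insert hk]
    exact (h k).mul ih

theorem differentiableAt_expReg_mul {x : Z → P → ℂ} {η : Z → ℂ} {S C : ι → ℂ}
    {μ : Z → ι → P → ℂ} {ν : Z → ι → ι → ℂ} {z : Z}
    (hx : ∀ i, Differentiable ℂ fun p => x p i) (hη : Differentiable ℂ η)
    (hμ : ∀ r i, Differentiable ℂ fun p => μ p r i) (hν : ∀ r s, Differentiable ℂ fun p => ν p r s)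
    (hU : RegSlit a b (x z) (η z) S C) :
    DifferentiableAt ℂ (fun p => exp (expReg a b (μ p) (ν p) (x p) (η p) S C) *
      ∏ r, vel a b (x p) (η p) S C r) z := by
  have hx' : ∀ i, DifferentiableAt ℂ (fun p => x p i) z := fun i => hx i z
  have hη' := hη z
  have hpt : ∀ r, DifferentiableAt ℂ (fun p => pt a b (x p) (η p) S C r) z := by
    intro r; unfold pt; fun_prop
  refine DifferentiableAt.mul (DifferentiableAt.cexp ?_) ?_
  · unfold expReg
    refine (DifferentiableAt.fun_sum fun r _ => DifferentiableAt.fun_sum fun i _ => ?_).add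
      (DifferentiableAt.fun_sum fun r _ => DifferentiableAt.fun_sum fun s hs => ?_)
    · refine (hμ r i z).mul ?_
      unfold logReg
      split_ifs with h1 h2
      · refine (DifferentiableAt.clog ((hx' _).sub (hx' _)) (hU.diff r)).add
          (DifferentiableAt.clog (by fun_prop) (hU.left r))
      · refine (DifferentiableAt.clog ((hx' _).sub (hx' _)) (hU.diff r)).add
          (DifferentiableAt.clog (by fun_prop) (hU.right r))
      · exact DifferentiableAt.clog (by fun_prop) (hU.point r i h1 h2)
    · refine (hν r s z).mul ?_
      exact DifferentiableAt.clog (by fun_prop) (hU.pair r s (by simpa using hs))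
  · refine differentiableAt_finset_prod _ fun r => ?_
    unfold vel
    fun_prop

variable {x : Z → P → ℂ} {η : Z → ℂ} {μ : Z → ι → P → ℂ} {ν : Z → ι → ι → ℂ} {z : Z}

/-- The charges are allowed to vary with the parameter; this is what makes the integral holomorphic
in 1/κ and not only in the points. -/
theorem differentiableAt_integral_density [FiniteDimensional ℂ Z]
    (hx : ∀ i, Differentiable ℂ fun p => x p i) (hη : Differentiable ℂ η)
    (hμ : ∀ r i, Differentiable ℂ fun p => μ p r i) (hν : ∀ r s, Differentiable ℂ fun p => ν p r s)
    (hU : ∀ θ ∈ closedBox ι, RegSlit a b (x z) (η z) (sn θ) (cs θ))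
    (ha : ∀ r, -1 < (μ z r (a r)).re) (hb : ∀ r, -1 < (μ z r (b r)).re) :
    IntegrableOn (density a b (μ z) (ν z) (x z) (η z)) (openBox ι) ∧
    DifferentiableAt ℂ (fun p => ∫ θ in openBox ι, density a b (μ p) (ν p) (x p) (η p) θ) z := by
  refine weighted_integral_differentiableAt (U := {p : Z × (ι → ℝ) |
      RegSlit a b (x p.1) (η p.1) (sn p.2) (cs p.2)})
    (Ψ := fun z θ => exp (expReg a b (μ z) (ν z) (x z) (η z) (sn θ) (cs θ)) *
      ∏ r, vel a b (x z) (η z) (sn θ) (cs θ) r) (m := fun z r => μ z r (a r))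
    (n := fun z r => μ z r (b r)) ?_ hU ?_ ?_ ?_ ?_ ha hb
  · exact isOpen_setOf_regSlit (fun i => (hx i).continuous.comp continuous_fst)
      (hη.continuous.comp continuous_fst) (fun r => (continuous_sn r).comp continuous_snd)
      (fun r => (continuous_cs r).comp continuous_snd)
  · exact continuousOn_expReg_mul (X := Z × (ι → ℝ)) (μ := fun p => μ p.1) (ν := fun p => ν p.1)
      (fun i => (hx i).continuous.comp continuous_fst)
      (hη.continuous.comp continuous_fst) (fun r => (continuous_sn r).comp continuous_snd)
      (fun r => (continuous_cs r).comp continuous_snd)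
      (fun r i => (hμ r i).continuous.comp continuous_fst)
      (fun r s => (hν r s).continuous.comp continuous_fst) fun p hp => hp
  · exact fun z θ h => differentiableAt_expReg_mul hx hη hμ hν h
  · exact differentiable_pi.2 fun r => hμ r _
  · exact differentiable_pi.2 fun r => hμ r _

theorem hasDerivAt_integral_density {x : ℂ → P → ℂ} {η : ℂ → ℂ} {μ : ℂ → ι → P → ℂ}
    {ν : ℂ → ι → ι → ℂ} {z : ℂ}
    (hx : ∀ i, Differentiable ℂ fun p => x p i) (hη : Differentiable ℂ η)
    (hμ : ∀ r i, Differentiable ℂ fun p => μ p r i) (hν : ∀ r s, Differentiable ℂ fun p => ν p r s)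
    (hU : ∀ θ ∈ closedBox ι, RegSlit a b (x z) (η z) (sn θ) (cs θ))
    (ha : ∀ r, -1 < (μ z r (a r)).re) (hb : ∀ r, -1 < (μ z r (b r)).re) :
    HasDerivAt (fun p => ∫ θ in openBox ι, density a b (μ p) (ν p) (x p) (η p) θ)
      (∫ θ in openBox ι, deriv (fun p => density a b (μ p) (ν p) (x p) (η p) θ) z) z := by
  refine weighted_integral_hasDerivAt (U := {p : ℂ × (ι → ℝ) |
      RegSlit a b (x p.1) (η p.1) (sn p.2) (cs p.2)})
    (Ψ := fun z θ => exp (expReg a b (μ z) (ν z) (x z) (η z) (sn θ) (cs θ)) *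
      ∏ r, vel a b (x z) (η z) (sn θ) (cs θ) r) (m := fun z r => μ z r (a r))
    (n := fun z r => μ z r (b r)) ?_ hU ?_ ?_ ?_ ?_ ha hb
  · exact isOpen_setOf_regSlit (fun i => (hx i).continuous.comp continuous_fst)
      (hη.continuous.comp continuous_fst) (fun r => (continuous_sn r).comp continuous_snd)
      (fun r => (continuous_cs r).comp continuous_snd)
  · exact continuousOn_expReg_mul (X := ℂ × (ι → ℝ)) (μ := fun p => μ p.1) (ν := fun p => ν p.1)
      (fun i => (hx i).continuous.comp continuous_fst)
      (hη.continuous.comp continuous_fst) (fun r => (continuous_sn r).comp continuous_snd)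
      (fun r => (continuous_cs r).comp continuous_snd)
      (fun r i => (hμ r i).continuous.comp continuous_fst)
      (fun r s => (hν r s).continuous.comp continuous_fst) fun p hp => hp
  · exact fun z θ h => differentiableAt_expReg_mul hx hη hμ hν h
  · exact differentiable_pi.2 fun r => hμ r _
  · exact differentiable_pi.2 fun r => hμ r _

end Regularity

/-! ### Disjointness of the contours and avoidance of the branch cuts -/

section Geometry

/-- The function log(-iz) has its cut on the negative imaginary axis, which suits differences
between a point of the upper half-plane and a point on the line or below it. -/
theorem neg_I_mul_mem_slitPlane {z : ℂ} (h : 0 < z.im ∨ z.re ≠ 0) :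
    -I * z ∈ slitPlane := by
  rw [Complex.mem_slitPlane_iff]
  simpa using h

/-- Real positions of the points for which the contours are pairwise disjoint. -/
structure Config (a b : ι → P) (x : P → ℝ) : Prop where
  lt : ∀ r, x (a r) < x (b r)
  inj : Injective x
  pair : ∀ r s, r < s → x (b r) < x (a s) ∨ (x (a r) < x (a s) ∧ x (b s) < x (b r))

variable {x : P → ℝ} {η : ℝ} {θ : ι → ℝ} {r s : ι}

theorem pt_re : (pt a b (fun i => (x i : ℂ)) η (sn θ) (cs θ) r).re =
    x (a r) + (x (b r) - x (a r)) * sin (θ r / 2) ^ 2 := by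
  simp only [pt, sn, cs]
  rw [← Complex.ofReal_sub]
  generalize sin (θ r / 2) = S
  generalize cos (θ r / 2) = C
  simp only [Complex.add_re, Complex.ofReal_re, Complex.re_ofReal_mul]
  simp
  exact Or.inl (by ring)

theorem pt_im : (pt a b (fun i => (x i : ℂ)) η (sn θ) (cs θ) r).im =
    η * ((x (b r) - x (a r)) * (sin (θ r / 2) * cos (θ r / 2))) := by
  simp only [pt, sn, cs]
  rw [← Complex.ofReal_sub]
  generalize sin (θ r / 2) = S
  generalize cos (θ r / 2) = C
  simp only [Complex.add_im, Complex.ofReal_im, Complex.im_ofReal_mul]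
  simp
  ring

/-- Altitude relation: up to the factor η, the height of a point of the contour is the geometric
mean of the distances of its foot to the two endpoints. It allows comparison of the heights of
nested contours. -/
theorem sub_mul_sub_pt_re : ((pt a b (fun i => (x i : ℂ)) η (sn θ) (cs θ) r).re - x (a r)) *
    (x (b r) - (pt a b (fun i => (x i : ℂ)) η (sn θ) (cs θ) r).re) =
    ((x (b r) - x (a r)) * (sin (θ r / 2) * cos (θ r / 2))) ^ 2 := by
  rw [pt_re]
  have := Real.sin_sq_add_cos_sq (θ r / 2)
  linear_combination (x (b r) - x (a r)) ^ 2 * sin (θ r / 2) ^ 2 * (-1 : ℝ) * this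

theorem le_pt_re (h : x (a r) ≤ x (b r)) :
    x (a r) ≤ (pt a b (fun i => (x i : ℂ)) η (sn θ) (cs θ) r).re := by
  rw [pt_re]
  have := mul_nonneg (sub_nonneg.2 h) (sq_nonneg (sin (θ r / 2)))
  linarith

theorem pt_re_le (h : x (a r) ≤ x (b r)) :
    (pt a b (fun i => (x i : ℂ)) η (sn θ) (cs θ) r).re ≤ x (b r) := by
  rw [pt_re]
  have h1 := Real.sin_sq_le_one (θ r / 2)
  nlinarith [mul_nonneg (sub_nonneg.2 h) (sub_nonneg.2 h1)]

/-- Two points with the same real part X can only occur on nested contours. The product (X - a)(b -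
X) is larger for the outer endpoints, so the point on the outer contour is strictly higher. -/
theorem pt_pair_mem_slitPlane (hη : 0 < η) (hθ : θ ∈ closedBox ι) (hr : x (a r) ≤ x (b r))
    (hs : x (a s) ≤ x (b s))
    (h : x (b r) < x (a s) ∨ (x (a r) < x (a s) ∧ x (b s) < x (b r))) :
    -I * (pt a b (fun i => (x i : ℂ)) η (sn θ) (cs θ) r -
      pt a b (fun i => (x i : ℂ)) η (sn θ) (cs θ) s) ∈ slitPlane := by
  apply neg_I_mul_mem_slitPlane
  rw [Complex.sub_re, Complex.sub_im]
  set X := (pt a b (fun i => (x i : ℂ)) η (sn θ) (cs θ) r).re with hX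
  set Y := (pt a b (fun i => (x i : ℂ)) η (sn θ) (cs θ) s).re with hY
  have x2 : X ≤ x (b r) := pt_re_le hr
  have y1 : x (a s) ≤ Y := le_pt_re hs
  have y2 : Y ≤ x (b s) := pt_re_le hs
  by_cases hXY : X - Y = 0
  · left
    have e : X = Y := by linarith
    rcases h with h | ⟨h1, h2⟩
    · linarith
    · have hs1 := sub_mul_sub_pt_re (a := a) (b := b) (x := x) (η := η) (θ := θ) (r := s)
      have hr1 := sub_mul_sub_pt_re (a := a) (b := b) (x := x) (η := η) (θ := θ) (r := r)
      rw [← hY] at hs1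
      rw [← hX, e] at hr1
      rw [pt_im, pt_im]
      have p1 := mul_nonneg (sin_half_nonneg (hθ r trivial)) (cos_half_nonneg (hθ r trivial))
      have p2 := mul_nonneg (sub_nonneg.2 hr) p1
      have p3 := mul_nonneg (sin_half_nonneg (hθ s trivial)) (cos_half_nonneg (hθ s trivial))
      have p4 := mul_nonneg (sub_nonneg.2 hs) p3
      have : (x (b s) - x (a s)) * (sin (θ s / 2) * cos (θ s / 2)) <
          (x (b r) - x (a r)) * (sin (θ r / 2) * cos (θ r / 2)) := by
        refine lt_of_pow_lt_pow_left₀ 2 p2 ?_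
        rw [← hs1, ← hr1]
        nlinarith
      nlinarith
  · exact Or.inr hXY

theorem pt_sub_mem_slitPlane (hη : 0 < η) (hθ : θ ∈ closedBox ι) (hr : x (a r) < x (b r))
    {p : ℝ} (h1 : p ≠ x (a r)) (h2 : p ≠ x (b r)) :
    -I * (pt a b (fun i => (x i : ℂ)) η (sn θ) (cs θ) r - p) ∈ slitPlane := by
  apply neg_I_mul_mem_slitPlane
  rw [Complex.sub_re, Complex.sub_im, Complex.ofReal_re, Complex.ofReal_im, pt_re, pt_im, sub_zero]
  have s0 := sin_half_nonneg (hθ r trivial)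
  have c0 := cos_half_nonneg (hθ r trivial)
  have e := Real.sin_sq_add_cos_sq (θ r / 2)
  rcases s0.eq_or_lt with hs | hs
  · right
    rw [← hs]
    intro h
    apply h1
    linarith
  · rcases c0.eq_or_lt with hc | hc
    · right
      rw [← hc] at e
      have : sin (θ r / 2) ^ 2 = 1 := by linarith
      rw [this]
      intro h
      apply h2
      linarith
    · left
      have := sub_pos.2 hr
      positivity

theorem left_mem_slitPlane (hη : 0 < η) (hθ : θ ∈ closedBox ι) :
    (η : ℂ) * cs θ r - I * sn θ r ∈ slitPlane := by
  rw [Complex.mem_slitPlane_iff]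
  simp only [sn, cs]
  have s0 := sin_half_nonneg (hθ r trivial)
  have c0 := cos_half_nonneg (hθ r trivial)
  have e := Real.sin_sq_add_cos_sq (θ r / 2)
  generalize sin (θ r / 2) = S at *
  generalize cos (θ r / 2) = C at *
  rcases c0.eq_or_lt with hc | hc
  · right
    have : S ≠ 0 := by
      intro h; rw [← hc, h] at e; norm_num at e
    simpa using this
  · left
    simpa using mul_pos hη hc

theorem right_mem_slitPlane (hη : 0 < η) (hθ : θ ∈ closedBox ι) :
    (η : ℂ) * sn θ r + I * cs θ r ∈ slitPlane := by
  rw [Complex.mem_slitPlane_iff]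
  simp only [sn, cs]
  have s0 := sin_half_nonneg (hθ r trivial)
  have c0 := cos_half_nonneg (hθ r trivial)
  have e := Real.sin_sq_add_cos_sq (θ r / 2)
  generalize sin (θ r / 2) = S at *
  generalize cos (θ r / 2) = C at *
  rcases s0.eq_or_lt with hc | hc
  · right
    have : C ≠ 0 := by
      intro h; rw [← hc, h] at e; norm_num at e
    simpa using this
  · left
    simpa using mul_pos hη hc

theorem Config.ne (h : Config a b x) (r : ι) : a r ≠ b r := fun e => by
  have := h.lt r
  rw [e] at this
  exact lt_irrefl _ this

theorem Config.regSlit (h : Config a b x) (hη : 0 < η) (hθ : θ ∈ closedBox ι) :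
    RegSlit a b (fun i => (x i : ℂ)) η (sn θ) (cs θ) where
  diff r := by
    rw [← Complex.ofReal_sub, Complex.ofReal_mem_slitPlane]
    exact sub_pos.2 (h.lt r)
  left r := left_mem_slitPlane hη hθ
  right r := right_mem_slitPlane hη hθ
  point r i h1 h2 := pt_sub_mem_slitPlane hη hθ (h.lt r) (fun e => h1 (h.inj e))
    (fun e => h2 (h.inj e))
  pair r s hrs := pt_pair_mem_slitPlane hη hθ (h.lt r).le (h.lt s).le (h.pair r s hrs)

/-- The real part vanishes only where sine or cosine of the half parameter does, and there the
imaginary part does not vanish. -/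
theorem vel_ne_zero (h : x (a r) < x (b r)) (hη : 0 < η) :
    vel a b (fun i => (x i : ℂ)) η (sn θ) (cs θ) r ≠ 0 := by
  unfold vel
  refine mul_ne_zero (by rw [← Complex.ofReal_sub]; exact_mod_cast (sub_pos.2 h).ne') ?_
  intro h0
  have e := Real.sin_sq_add_cos_sq (θ r / 2)
  have e1 := congrArg Complex.re h0
  have e2 := congrArg Complex.im h0
  simp only [sn, cs, ← Complex.ofReal_mul, ← Complex.ofReal_pow, ← Complex.ofReal_sub] at e1 e2
  have e3 : I * η * ((cos (θ r / 2) ^ 2 - sin (θ r / 2) ^ 2 : ℝ) : ℂ) / 2 =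
      ((η * (cos (θ r / 2) ^ 2 - sin (θ r / 2) ^ 2) / 2 : ℝ) : ℂ) * I := by
    push_cast; ring
  rw [e3] at e1 e2
  simp only [Complex.add_re, Complex.add_im, Complex.ofReal_re, Complex.ofReal_im,
    Complex.re_ofReal_mul, Complex.im_ofReal_mul, Complex.I_re, Complex.I_im, Complex.zero_re,
    Complex.zero_im, mul_zero, mul_one, add_zero, zero_add] at e1 e2
  have e4 : cos (θ r / 2) ^ 2 - sin (θ r / 2) ^ 2 = 0 := by
    have : η * (cos (θ r / 2) ^ 2 - sin (θ r / 2) ^ 2) = 0 := by linarith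
    exact (mul_eq_zero.1 this).resolve_left hη.ne'
  rcases mul_eq_zero.1 e1 with h | h <;> rw [h] at e e4 <;> nlinarith

end Geometry

end System

/-! ### Functions with poles of bounded order at the boundary of the box -/

section Admissible

variable {ι : Type*} [Fintype ι]

/-- The product of all sines and cosines of the half parameters: it vanishes on the boundary of the
box. -/
def bdry (θ : ι → ℝ) : ℝ := ∏ r, (sin (θ r / 2) * cos (θ r / 2))

theorem bdry_pos {θ : ι → ℝ} (hθ : θ ∈ openBox ι) : 0 < bdry θ :=
  Finset.prod_pos fun r _ => mul_pos (sin_half_pos (hθ r trivial)) (cos_half_pos (hθ r trivial))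

theorem sin_mul_cos_half_le_one (t : ℝ) : sin (t / 2) * cos (t / 2) ≤ 1 := by
  have := Real.sin_sq_add_cos_sq (t / 2)
  nlinarith [sq_nonneg (sin (t / 2) - cos (t / 2))]

theorem bdry_le_single {θ : ι → ℝ} (hθ : θ ∈ openBox ι) (r : ι) :
    bdry θ ≤ sin (θ r / 2) * cos (θ r / 2) := by
  classical
  unfold bdry
  rw [← Finset.mul_prod_erase _ _ (Finset.mem_univ r)]
  have h1 := mul_pos (sin_half_pos (hθ r trivial)) (cos_half_pos (hθ r trivial))
  refine mul_le_of_le_one_right h1.le (Finset.prod_le_one (fun s _ => ?_) fun s _ => ?_)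
  · exact (mul_pos (sin_half_pos (hθ s trivial)) (cos_half_pos (hθ s trivial))).le
  · exact sin_mul_cos_half_le_one _

theorem bdry_le_one {θ : ι → ℝ} (hθ : θ ∈ openBox ι) : bdry θ ≤ 1 := by
  refine Finset.prod_le_one (fun s _ => ?_) fun s _ => ?_
  · exact (mul_pos (sin_half_pos (hθ s trivial)) (cos_half_pos (hθ s trivial))).le
  · exact sin_mul_cos_half_le_one _

/-- Continuous functions on the open box with at most poles of order `k` at the boundary. -/
def Adm (k : ℕ) (R : (ι → ℝ) → ℂ) : Prop :=
  ContinuousOn R (openBox ι) ∧ ∃ M, ∀ θ ∈ openBox ι, ‖R θ‖ * bdry θ ^ k ≤ M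

theorem Adm.mono {k l : ℕ} {R : (ι → ℝ) → ℂ} (h : Adm k R) (hkl : k ≤ l) : Adm l R := by
  obtain ⟨h1, M, h2⟩ := h
  refine ⟨h1, M, fun θ hθ => le_trans ?_ (h2 θ hθ)⟩
  refine mul_le_mul_of_nonneg_left ?_ (norm_nonneg _)
  exact pow_le_pow_of_le_one (bdry_pos hθ).le (bdry_le_one hθ) hkl

theorem Adm.add {k : ℕ} {R R' : (ι → ℝ) → ℂ} (h : Adm k R) (h' : Adm k R') :
    Adm k fun θ => R θ + R' θ := by
  obtain ⟨h1, M, h2⟩ := h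
  obtain ⟨h3, M', h4⟩ := h'
  refine ⟨h1.add h3, M + M', fun θ hθ => ?_⟩
  have h5 := h2 θ hθ
  have h6 := h4 θ hθ
  have h7 := norm_add_le (R θ) (R' θ)
  have h8 : 0 ≤ bdry θ ^ k := pow_nonneg (bdry_pos hθ).le k
  nlinarith

theorem Adm.mul {k l : ℕ} {R R' : (ι → ℝ) → ℂ} (h : Adm k R) (h' : Adm l R') :
    Adm (k + l) fun θ => R θ * R' θ := by
  obtain ⟨h1, M, h2⟩ := h
  obtain ⟨h3, M', h4⟩ := h'
  refine ⟨h1.mul h3, M * M', fun θ hθ => ?_⟩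
  have h5 := h2 θ hθ
  have h6 := h4 θ hθ
  have h8 : 0 ≤ bdry θ := (bdry_pos hθ).le
  calc ‖R θ * R' θ‖ * bdry θ ^ (k + l) = (‖R θ‖ * bdry θ ^ k) * (‖R' θ‖ * bdry θ ^ l) := by
        rw [norm_mul, pow_add]; ring
    _ ≤ M * M' := mul_le_mul h5 h6 (by positivity) (le_trans (by positivity) h5)

theorem Adm.of_closedBox {R : (ι → ℝ) → ℂ} (h : ContinuousOn R (closedBox ι)) : Adm 0 R := by
  obtain ⟨M, hM⟩ := isCompact_closedBox.exists_bound_of_continuousOn h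
  exact ⟨h.mono openBox_subset_closedBox, M, fun θ hθ => by
    simpa using hM θ (openBox_subset_closedBox hθ)⟩

theorem Adm.const (c : ℂ) (k : ℕ) : Adm k fun _ : ι → ℝ => c :=
  (Adm.of_closedBox continuousOn_const).mono (Nat.zero_le k)

theorem Adm.const_mul {k : ℕ} {R : (ι → ℝ) → ℂ} (h : Adm k R) (c : ℂ) :
    Adm k fun θ => c * R θ := by
  simpa using (Adm.const c 0).mul h

theorem Adm.sum {κ : Type*} {k : ℕ} {R : κ → (ι → ℝ) → ℂ} (u : Finset κ)
    (h : ∀ j ∈ u, Adm k (R j)) : Adm k fun θ => ∑ j ∈ u, R j θ := by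
  classical
  induction u using Finset.induction_on with
  | empty => simpa using Adm.const 0 k
  | insert j u hj ih =>
    simp only [Finset.sum_insert hj]
    exact (h j (Finset.mem_insert_self _ _)).add
      (ih fun j' hj' => h j' (Finset.mem_insert_of_mem hj'))

end Admissible

/-! ### Observables against the integrand with large endpoint charges -/

section System

variable {P ι : Type*} [Fintype P] [DecidableEq P] [Fintype ι] [LinearOrder ι] {a b : ι → P}
  {x : P → ℝ} {η : ℝ} {μ : ι → P → ℂ} {ν : ι → ι → ℂ}

/-- The charges at the endpoints of the contours have real part at least `k`. -/
def Big (a b : ι → P) (k : ℕ) (μ : ι → P → ℂ) : Prop :=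
  ∀ r, (k : ℝ) ≤ (μ r (a r)).re ∧ (k : ℝ) ≤ (μ r (b r)).re

theorem Big.mono {k l : ℕ} (h : Big a b k μ) (hl : l ≤ k) : Big a b l μ := fun r =>
  ⟨le_trans (by exact_mod_cast hl) (h r).1, le_trans (by exact_mod_cast hl) (h r).2⟩

theorem continuousOn_density (h : Config a b x) (hη : 0 < η) :
    ContinuousOn (density a b μ ν (fun i => (x i : ℂ)) η) (openBox ι) := by
  unfold density
  refine (continuousOn_endWeight _ _).mul ?_
  exact continuousOn_expReg_mul (X := ι → ℝ) (x := fun _ i => (x i : ℂ)) (η := fun _ => (η : ℂ))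
    (S := sn) (C := cs) (μ := fun _ => μ) (ν := fun _ => ν) (fun _ => continuous_const)
    continuous_const continuous_sn continuous_cs (fun _ _ => continuous_const)
    (fun _ _ => continuous_const) fun θ hθ => h.regSlit hη (openBox_subset_closedBox hθ)

theorem exists_norm_density_le (h : Config a b x) (hη : 0 < η) {k : ℕ} (hμ : Big a b k μ) :
    ∃ M, 0 ≤ M ∧ ∀ θ ∈ openBox ι,
      ‖density a b μ ν (fun i => (x i : ℂ)) η θ‖ ≤ M * bdry θ ^ k := by
  have h1 := continuousOn_expReg_mul (X := ι → ℝ) (U := closedBox ι) (x := fun _ i => (x i : ℂ))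
    (η := fun _ => (η : ℂ))
    (S := sn) (C := cs) (μ := fun _ => μ) (ν := fun _ => ν) (fun _ => continuous_const)
    continuous_const continuous_sn continuous_cs (fun _ _ => continuous_const)
    (fun _ _ => continuous_const) fun θ hθ => h.regSlit hη hθ
  obtain ⟨M, hM⟩ := isCompact_closedBox.exists_bound_of_continuousOn h1
  refine ⟨|M|, abs_nonneg M, fun θ hθ => ?_⟩
  rw [density, norm_mul, mul_comm]
  refine mul_le_mul ((hM θ (openBox_subset_closedBox hθ)).trans (le_abs_self M)) ?_
    (norm_nonneg _) (abs_nonneg M)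
  refine (norm_endWeight_le (p := fun _ => (k : ℝ)) (q := fun _ => (k : ℝ)) (fun r => (hμ r).1)
    (fun r => (hμ r).2) hθ).trans (le_of_eq ?_)
  simp only [Real.rpow_natCast, bdry, ← Finset.prod_pow, mul_pow]

/-- Zeros of order `k` of the integrand compensate poles of order `k`: the product is bounded on a
set of finite measure. -/
theorem integrableOn_adm_mul_density (h : Config a b x) (hη : 0 < η) {k : ℕ} (hμ : Big a b k μ)
    {R : (ι → ℝ) → ℂ} (hR : Adm k R) :
    IntegrableOn (fun θ => R θ * density a b μ ν (fun i => (x i : ℂ)) η θ) (openBox ι) := by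
  obtain ⟨M, hM0, hM⟩ := exists_norm_density_le (ν := ν) h hη hμ
  obtain ⟨hc, M', hM'⟩ := hR
  have hfin : volume (openBox ι) < ⊤ :=
    lt_of_le_of_lt (measure_mono openBox_subset_closedBox) isCompact_closedBox.measure_lt_top
  have : IsFiniteMeasure ((volume : Measure (ι → ℝ)).restrict (openBox ι)) :=
    ⟨by simpa using hfin⟩
  refine Integrable.of_bound (C := M * M')
    ((hc.mul (continuousOn_density h hη)).aestronglyMeasurable measurableSet_openBox) ?_
  refine (ae_restrict_iff' measurableSet_openBox).2 (.of_forall fun θ hθ => ?_)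
  rw [norm_mul]
  have h1 := hM θ hθ
  have h2 := hM' θ hθ
  have h3 := norm_nonneg (R θ)
  nlinarith

/-- The point on the contour `r`. -/
abbrev rpt (a b : ι → P) (x : P → ℝ) (η : ℝ) (θ : ι → ℝ) : ι → ℂ :=
  pt a b (fun i => (x i : ℂ)) η (sn θ) (cs θ)

theorem continuous_rpt (r : ι) : Continuous fun θ => rpt a b x η θ r := by
  have h1 := continuous_sn r
  have h2 := continuous_cs r
  unfold rpt pt
  fun_prop

theorem continuous_rvel (r : ι) :
    Continuous fun θ => vel a b (fun i => (x i : ℂ)) η (sn θ) (cs θ) r := by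
  have h1 := continuous_sn r
  have h2 := continuous_cs r
  unfold vel
  fun_prop

theorem rpt_sub_ne_zero (h : Config a b x) (hη : 0 < η) {θ : ι → ℝ} (hθ : θ ∈ openBox ι) (r : ι)
    (i : P) : rpt a b x η θ r - x i ≠ 0 := by
  intro h0
  have h1 : (rpt a b x η θ r).im = 0 := by
    rw [sub_eq_zero.1 h0, Complex.ofReal_im]
  rw [rpt, pt_im] at h1
  have := mul_pos (sub_pos.2 (h.lt r))
    (mul_pos (sin_half_pos (hθ r trivial)) (cos_half_pos (hθ r trivial)))
  exact (mul_pos hη this).ne' h1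

theorem rpt_sub_rpt_ne_zero (h : Config a b x) (hη : 0 < η) {θ : ι → ℝ} (hθ : θ ∈ closedBox ι)
    {r s : ι} (hrs : r ≠ s) : rpt a b x η θ r - rpt a b x η θ s ≠ 0 := by
  have key : ∀ r s, r < s → rpt a b x η θ r - rpt a b x η θ s ≠ 0 := fun r s hrs h0 => by
    have := Complex.slitPlane_ne_zero ((h.regSlit hη hθ).pair r s hrs)
    exact this (by simp only [rpt] at h0; rw [h0, mul_zero])
  rcases lt_or_gt_of_ne hrs with h1 | h1
  · exact key r s h1
  · intro h0
    exact key s r h1 (by rw [← neg_eq_zero, neg_sub]; exact h0)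

/-- At an endpoint of the contour, `pt_sub_left` and `pt_sub_right` show a simple pole in the sine
or the cosine, which `bdry` absorbs; at every other point the reciprocal is continuous on the closed
box. -/
theorem adm_inv_rpt_sub (h : Config a b x) (hη : 0 < η) (r : ι) (i : P) :
    Adm 1 fun θ => (rpt a b x η θ r - x i)⁻¹ := by
  have hc : ContinuousOn (fun θ => (rpt a b x η θ r - x i)⁻¹) (openBox ι) :=
    ((continuous_rpt r).sub continuous_const).continuousOn.inv₀
      fun θ hθ => rpt_sub_ne_zero h hη hθ r i
  by_cases hi : i = a r ∨ i = b r
  · set T : (ι → ℝ) → ℂ := fun θ => if i = a r then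
      ((x (b r) - x (a r) : ℂ) * (η * cs θ r - I * sn θ r))⁻¹ else
      ((x (b r) - x (a r) : ℂ) * (η * sn θ r + I * cs θ r))⁻¹ with hT
    have hTc : ContinuousOn T (closedBox ι) := by
      have h1 := continuous_sn (ι := ι) r
      have h2 := continuous_cs (ι := ι) r
      by_cases hia : i = a r
      · simp only [hT, if_pos hia]
        refine ContinuousOn.inv₀ (by fun_prop) fun θ hθ => mul_ne_zero
          (Complex.slitPlane_ne_zero ((h.regSlit hη hθ).diff r))
          (Complex.slitPlane_ne_zero ((h.regSlit hη hθ).left r))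
      · simp only [hT, if_neg hia]
        refine ContinuousOn.inv₀ (by fun_prop) fun θ hθ => mul_ne_zero
          (Complex.slitPlane_ne_zero ((h.regSlit hη hθ).diff r))
          (Complex.slitPlane_ne_zero ((h.regSlit hη hθ).right r))
    obtain ⟨M, hM⟩ := isCompact_closedBox.exists_bound_of_continuousOn hTc
    refine ⟨hc, M, fun θ hθ => ?_⟩
    refine le_trans ?_ (hM θ (openBox_subset_closedBox hθ))
    have s0 := sin_half_pos (hθ r trivial)
    have c0 := cos_half_pos (hθ r trivial)
    have hb := bdry_le_single hθ r
    have hb0 := bdry_pos hθ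
    have hI : ∀ z : ℂ, ‖z‖ = ‖-I * z‖ := fun z => by simp
    rw [pow_one, norm_inv, hI]
    by_cases hia : i = a r
    · subst hia
      have e := pt_sub_left (a := a) (b := b) (fun i => (x i : ℂ)) η (sn θ) (cs θ) r
      rw [e, norm_mul _ (sn θ r), mul_inv, hT]
      simp only [if_true]
      rw [norm_inv, mul_assoc]
      refine mul_le_of_le_one_right (by positivity) ?_
      rw [sn, Complex.norm_real, Real.norm_of_nonneg s0.le, inv_mul_le_one₀ s0]
      exact hb.trans (mul_le_of_le_one_right s0.le (Real.cos_le_one _))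
    · have hib : i = b r := hi.resolve_left hia
      have e := pt_sub_right (a := a) (b := b) (fun i => (x i : ℂ)) η (sn_sq_add_cs_sq θ r)
      simp only [hT, if_neg hia]
      rw [hib, e, norm_mul _ (cs θ r), mul_inv]
      rw [norm_inv, mul_assoc]
      refine mul_le_of_le_one_right (by positivity) ?_
      rw [cs, Complex.norm_real, Real.norm_of_nonneg c0.le, inv_mul_le_one₀ c0]
      exact hb.trans (mul_le_of_le_one_left c0.le (Real.sin_le_one _))
  · push Not at hi
    refine (Adm.of_closedBox ?_).mono (Nat.zero_le 1)
    refine ((continuous_rpt r).sub continuous_const).continuousOn.inv₀ fun θ hθ h0 => ?_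
    exact Complex.slitPlane_ne_zero ((h.regSlit hη hθ).point r i hi.1 hi.2)
      (by rw [show pt a b _ η (sn θ) (cs θ) r - (x i : ℂ) = 0 from h0, mul_zero])

theorem adm_inv_rpt_sub_rpt (h : Config a b x) (hη : 0 < η) {r s : ι} (hrs : r ≠ s) :
    Adm 0 fun θ => (rpt a b x η θ r - rpt a b x η θ s)⁻¹ := by
  refine Adm.of_closedBox ?_
  exact ((continuous_rpt r).sub (continuous_rpt s)).continuousOn.inv₀
    fun θ hθ => rpt_sub_rpt_ne_zero h hη hθ hrs

theorem adm_logDer (h : Config a b x) (hη : 0 < η) (ξ : P → ℂ) (ζ : ι → ℂ) :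
    Adm 1 fun θ => logDer μ ν (fun i => (x i : ℂ)) (rpt a b x η θ) ξ ζ := by
  unfold logDer
  refine (Adm.sum _ fun r _ => Adm.sum _ fun i _ => ?_).add
    (Adm.sum _ fun r _ => Adm.sum _ fun s hs => ?_)
  · have := (adm_inv_rpt_sub h hη r i).const_mul (μ r i * (ζ r - ξ i))
    simpa only [div_eq_mul_inv, mul_assoc] using this
  · have := ((adm_inv_rpt_sub_rpt h hη (r := r) (s := s)
      (by simp at hs; exact hs.ne)).mono (Nat.zero_le 1)).const_mul (ν r s * (ζ r - ζ s))
    simpa only [div_eq_mul_inv, mul_assoc] using this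

/-- The dependence of the logarithmic derivative on the speeds of the `u_r`. -/
def logDerLin (μ : ι → P → ℂ) (ν : ι → ι → ℂ) (x : P → ℂ) (u : ι → ℂ) : (ι → ℂ) →ₗ[ℂ] ℂ where
  toFun ζ := logDer μ ν x u 0 ζ
  map_add' ζ ζ' := by
    simp only [logDer, Pi.zero_apply, sub_zero, Pi.add_apply, add_div, mul_add,
      sum_add_distrib, sub_div, mul_sub, sum_sub_distrib]
    ring
  map_smul' c ζ := by
    simp only [logDer, Pi.zero_apply, sub_zero, Pi.smul_apply, smul_eq_mul, RingHom.id_apply,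
      mul_add, mul_sum]
    congr 1 <;> refine sum_congr rfl fun _ _ => sum_congr rfl fun _ _ => by ring

/-- The contribution of the moving `u_r` is separated from that of the moving points, so that it can
be removed by total derivatives. -/
theorem logDer_eq (μ : ι → P → ℂ) (ν : ι → ι → ℂ) (x : P → ℂ) (u : ι → ℂ) (ξ : P → ℂ)
    (ζ : ι → ℂ) : logDer μ ν x u ξ ζ =
      logDer μ ν x u ξ 0 + ∑ r, ζ r * logDer μ ν x u 0 (Pi.single r 1) := by
  have h1 : logDer μ ν x u ξ ζ = logDer μ ν x u ξ 0 + logDerLin μ ν x u ζ := by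
    simp only [logDerLin, LinearMap.coe_mk, AddHom.coe_mk, logDer, Pi.zero_apply, sub_zero,
      zero_sub, zero_div, mul_zero, Finset.sum_const_zero, add_zero]
    rw [← add_assoc]
    congr 1
    rw [← sum_add_distrib]
    refine sum_congr rfl fun r _ => ?_
    rw [← sum_add_distrib]
    exact sum_congr rfl fun i _ => by ring
  rw [h1, LinearMap.pi_apply_eq_sum_univ]
  congr 1
  refine sum_congr rfl fun r _ => ?_
  have : (fun j => if r = j then (1 : ℂ) else 0) = Pi.single r 1 := by
    ext j; simp [Pi.single_apply, eq_comm]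
  rw [this]
  rfl

theorem logDer_single (μ : ι → P → ℂ) (ν : ι → ι → ℂ) (x : P → ℂ) (u : ι → ℂ) (r : ι) (c : ℂ) :
    logDer μ ν x u 0 (Pi.single r c) = c * logDer μ ν x u 0 (Pi.single r 1) := by
  have h := (logDerLin μ ν x u).map_smul c (Pi.single r 1)
  rw [← Pi.single_smul, smul_eq_mul, mul_one, smul_eq_mul] at h
  exact h

end System

/-! ### Vanishing of total derivatives; moving points and contours -/

section System

variable {P ι : Type*} [Fintype P] [DecidableEq P] [Fintype ι] [LinearOrder ι] {a b : ι → P}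
  {x : P → ℝ} {η : ℝ} {μ : ι → P → ℂ} {ν : ι → ι → ℂ}

/-- The velocity of the contour `r`. -/
abbrev rvel (a b : ι → P) (x : P → ℝ) (η : ℝ) (θ : ι → ℝ) : ι → ℂ :=
  vel a b (fun i => (x i : ℂ)) η (sn θ) (cs θ)

theorem hasDerivAt_ofReal_sin_half (t : ℝ) :
    HasDerivAt (fun t : ℝ => ((sin (t / 2) : ℝ) : ℂ)) ((cos (t / 2) : ℝ) / 2) t := by
  have := ((Real.hasDerivAt_sin (t / 2)).comp t ((hasDerivAt_id t).div_const 2)).ofReal_comp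
  refine this.congr_deriv ?_
  push_cast; ring

theorem hasDerivAt_ofReal_cos_half (t : ℝ) :
    HasDerivAt (fun t : ℝ => ((cos (t / 2) : ℝ) : ℂ)) (-(sin (t / 2) : ℝ) / 2) t := by
  have := ((Real.hasDerivAt_cos (t / 2)).comp t ((hasDerivAt_id t).div_const 2)).ofReal_comp
  refine this.congr_deriv ?_
  push_cast; ring

theorem hasDerivAt_sn_update (θ : ι → ℝ) (r s : ι) :
    HasDerivAt (fun t : ℝ => sn (update θ r t) s)
      ((Pi.single r (cs θ r / 2) : ι → ℂ) s) (θ r) := by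
  by_cases h : s = r
  · subst h
    simpa [sn, cs] using hasDerivAt_ofReal_sin_half (θ s)
  · simpa [sn, h] using hasDerivAt_const (θ r) ((sin (θ s / 2) : ℝ) : ℂ)

theorem hasDerivAt_cs_update (θ : ι → ℝ) (r s : ι) :
    HasDerivAt (fun t : ℝ => cs (update θ r t) s)
      ((Pi.single r (-sn θ r / 2) : ι → ℂ) s) (θ r) := by
  by_cases h : s = r
  · subst h
    simpa [sn, cs] using hasDerivAt_ofReal_cos_half (θ s)
  · simpa [cs, h] using hasDerivAt_const (θ r) ((cos (θ s / 2) : ℝ) : ℂ)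

theorem hasDerivAt_pt_update (x : P → ℂ) (η : ℂ) (θ : ι → ℝ) (r s : ι) :
    HasDerivAt (fun t : ℝ => pt a b x η (sn (update θ r t)) (cs (update θ r t)) s)
      ((Pi.single r (vel a b x η (sn θ) (cs θ) r) : ι → ℂ) s) (θ r) := by
  have h1 := hasDerivAt_sn_update θ r s
  have h2 := hasDerivAt_cs_update θ r s
  have h3 := ((h1.fun_mul (h1.fun_add (h2.const_mul (I * η)))).const_mul
    (x (b s) - x (a s))).const_add (x (a s))
  unfold pt
  refine h3.congr_deriv ?_
  by_cases h : s = r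
  · subst h
    simp only [Pi.single_eq_same, Function.update_eq_self, vel]
    ring
  · simp [Pi.single_eq_of_ne h]

theorem update_mem_openBox {θ : ι → ℝ} (hθ : θ ∈ openBox ι) (r : ι) :
    ∀ᶠ t in 𝓝 (θ r), update θ r t ∈ openBox ι := by
  have : Continuous fun t => update θ r t := continuous_const.update r continuous_id
  refine this.continuousAt.eventually (isOpen_openBox.mem_nhds ?_)
  simpa using hθ

/-- Total derivatives along a contour integrate to zero, for large endpoint charges. -/
theorem integral_total_derivative (h : Config a b x) (hη : 0 < η) (hμ : Big a b 2 μ) (r : ι)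
    {c c' : ℝ → ℂ} (hc : ∀ t, HasDerivAt c (c' t) t) (hc' : Continuous c') :
    IntegrableOn (fun θ => (c' (θ r) / rvel a b x η θ r + c (θ r) *
      logDer μ ν (fun i => (x i : ℂ)) (rpt a b x η θ) 0 (Pi.single r 1)) *
      density a b μ ν (fun i => (x i : ℂ)) η θ) (openBox ι) ∧
    ∫ θ in openBox ι, (c' (θ r) / rvel a b x η θ r + c (θ r) *
      logDer μ ν (fun i => (x i : ℂ)) (rpt a b x η θ) 0 (Pi.single r 1)) *
      density a b μ ν (fun i => (x i : ℂ)) η θ = 0 := by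
  have hcc : Continuous c := continuous_iff_continuousAt.2 fun t => (hc t).continuousAt
  have hvel : ∀ θ, rvel a b x η θ r ≠ 0 := fun θ => vel_ne_zero (h.lt r) hη
  have hquot : ∀ {f : ℝ → ℂ}, Continuous f → Adm 0 fun θ => f (θ r) / rvel a b x η θ r :=
    fun hf => Adm.of_closedBox
      ((hf.comp (continuous_apply r)).div (continuous_rvel r) hvel).continuousOn
  have hA : Adm 2 fun θ => c' (θ r) / rvel a b x η θ r + c (θ r) *
      logDer μ ν (fun i => (x i : ℂ)) (rpt a b x η θ) 0 (Pi.single r 1) := by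
    refine ((hquot hc').mono (Nat.zero_le 2)).add (Adm.mono ?_ (show 1 ≤ 2 by norm_num))
    have h0 : Adm 0 fun θ : ι → ℝ => c (θ r) :=
      Adm.of_closedBox (hcc.comp (continuous_apply r)).continuousOn
    simpa using h0.mul (adm_logDer h hη 0 (Pi.single r 1))
  have hintg := integrableOn_adm_mul_density (ν := ν) h hη hμ hA
  have hint0 := integrableOn_adm_mul_density (ν := ν) h hη hμ ((hquot hcc).mono (Nat.zero_le 2))
  refine ⟨hintg, ?_⟩
  obtain ⟨M, hM0, hM⟩ := exists_norm_density_le (ν := ν) h hη hμ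
  obtain ⟨-, M', hM'⟩ := hquot hcc
  refine integral_openBox_partial_eq_zero (r := r) (M := |M'| * M) hint0 hintg ?_ ?_
  · intro θ hθ
    -- The function differentiated is `c` times the integrand divided by the velocity of `r`; what
    -- remains of the velocities is `K`, which does not depend on `θ r`.
    set K : ℂ := ∏ s ∈ Finset.univ.erase r, rvel a b x η θ s with hK
    have hprod : ∀ t, ∏ s, rvel a b x η (update θ r t) s =
        rvel a b x η (update θ r t) r * K := by
      intro t
      rw [← Finset.mul_prod_erase _ _ (Finset.mem_univ r), hK]
      congr 1
      refine prod_congr rfl fun s hs => ?_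
      simp [rvel, vel, sn, cs, Finset.ne_of_mem_erase hs]
    set E : ℝ → ℂ := fun t => expFull a b μ ν (fun i => (x i : ℂ)) η (sn (update θ r t))
      (cs (update θ r t)) with hE
    have hE' : HasDerivAt E (rvel a b x η θ r * logDer μ ν (fun i => (x i : ℂ))
        (rpt a b x η θ) 0 (Pi.single r 1)) (θ r) := by
      have key := hasDerivAt_expFull (𝕜 := ℝ) (a := a) (b := b) (x := fun _ i => (x i : ℂ))
        (η := fun _ => (η : ℂ)) (S := fun t => sn (update θ r t))
        (C := fun t => cs (update θ r t)) (y := θ r) (ξ := 0) (η' := 0)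
        (ζ := Pi.single r (rvel a b x η θ r)) (S' := Pi.single r (cs θ r / 2))
        (C' := Pi.single r (-sn θ r / 2)) μ ν h.ne (fun i => hasDerivAt_const _ _)
        (hasDerivAt_const _ _) (hasDerivAt_sn_update θ r) (hasDerivAt_cs_update θ r)
        (hasDerivAt_pt_update _ _ θ r) (fun t s => sn_sq_add_cs_sq _ s)
        (by simpa using h.regSlit hη (openBox_subset_closedBox hθ))
        (fun s => by
          simp only [Function.update_eq_self, sn]
          exact Complex.ofReal_mem_slitPlane.2 (sin_half_pos (hθ s trivial)))
        (fun s => by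
          simp only [Function.update_eq_self, cs]
          exact Complex.ofReal_mem_slitPlane.2 (cos_half_pos (hθ s trivial)))
      simp only [Function.update_eq_self] at key
      rw [logDer_single] at key
      exact key
    have h1 : HasDerivAt (fun t => c t * (exp (E t) * K))
        (c' (θ r) * (exp (E (θ r)) * K) + c (θ r) * (exp (E (θ r)) *
        (rvel a b x η θ r * logDer μ ν (fun i => (x i : ℂ))
        (rpt a b x η θ) 0 (Pi.single r 1)) * K)) (θ r) :=
      (hc (θ r)).fun_mul (hE'.cexp.mul_const K)
    refine HasDerivAt.congr_of_eventuallyEq (h1.congr_deriv ?_) ?_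
    · rw [density_eq _ _ _ _ θ hθ]
      have e1 := hprod (θ r)
      simp only [Function.update_eq_self, rvel] at e1
      have e2 : E (θ r) = expFull a b μ ν (fun i => (x i : ℂ)) η (sn θ) (cs θ) := by simp [hE]
      rw [e1, ← e2]
      field_simp [hvel θ]
    · filter_upwards [update_mem_openBox hθ r] with t ht
      rw [density_eq _ _ _ _ _ ht, hprod t, Function.update_self]
      field_simp [hvel (update θ r t)]
      simp only [hE]
      ring
  · intro θ hθ
    rw [norm_mul]
    have h1 := hM θ hθ
    have h2 := hM' θ hθ
    rw [pow_zero, mul_one] at h2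
    have h3 := bdry_le_single hθ r
    have h4 := bdry_pos hθ
    -- Since sin θ is twice the factor of `bdry` for `r`, charges of size 2 give the second-order
    -- vanishing in sin θ that `integral_openBox_partial_eq_zero` requires.
    have h5 : sin (θ r) = 2 * (sin (θ r / 2) * cos (θ r / 2)) := by
      rw [← mul_assoc, ← Real.sin_two_mul]; ring_nf
    have h6 : bdry θ ^ 2 ≤ sin (θ r) ^ 2 := by
      rw [h5]
      refine pow_le_pow_left₀ h4.le ?_ 2
      linarith
    rw [mul_assoc]
    refine mul_le_mul (h2.trans (le_abs_self M')) (h1.trans ?_) (norm_nonneg _) (abs_nonneg _)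
    exact mul_le_mul_of_nonneg_left h6 hM0

theorem integral_logDer_single (h : Config a b x) (hη : 0 < η) (hμ : Big a b 2 μ) (r : ι) :
    ∫ θ in openBox ι, logDer μ ν (fun i => (x i : ℂ)) (rpt a b x η θ) 0 (Pi.single r 1) *
      density a b μ ν (fun i => (x i : ℂ)) η θ = 0 := by
  have := (integral_total_derivative (ν := ν) h hη hμ r (c := fun _ => 1) (c' := fun _ => 0)
    (fun t => hasDerivAt_const t 1) continuous_const).2
  simpa using this

/-- The derivative of the integral with respect to the points and the eccentricity of the contours,
for large endpoint charges. -/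
theorem hasDerivAt_integral_moving (h : Config a b x) (hη : 0 < η) (hμ : Big a b 2 μ)
    (ξ : P → ℂ) (η' : ℂ) :
    HasDerivAt (fun y : ℂ => ∫ θ in openBox ι,
      density a b μ ν (fun i => (x i : ℂ) + y * ξ i) (η + y * η') θ)
      (∫ θ in openBox ι, logDer μ ν (fun i => (x i : ℂ)) (rpt a b x η θ) ξ 0 *
        density a b μ ν (fun i => (x i : ℂ)) η θ) 0 := by
  have hpos : ∀ r, -1 < (μ r (a r)).re ∧ -1 < (μ r (b r)).re := fun r =>
    ⟨lt_of_lt_of_le (by norm_num) (hμ r).1, lt_of_lt_of_le (by norm_num) (hμ r).2⟩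
  have key := hasDerivAt_integral_density (a := a) (b := b)
    (x := fun y i => (x i : ℂ) + y * ξ i) (η := fun y => (η : ℂ) + y * η')
    (μ := fun _ => μ) (ν := fun _ => ν) (z := 0)
    (fun i => by fun_prop) (by fun_prop) (fun r i => by fun_prop) (fun r s => by fun_prop)
    (fun θ hθ => by simpa using h.regSlit hη hθ) (fun r => (hpos r).1) (fun r => (hpos r).2)
  refine key.congr_deriv ?_
  -- `ζ` is the speed of `u_r` at fixed parameter when points and eccentricity move; `ω` is both its
  -- derivative in the parameter and the rate of change of the velocity.
  set ζ : (ι → ℝ) → ι → ℂ := fun θ r => ξ (a r) + ((ξ (b r) - ξ (a r)) *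
    (sn θ r * (sn θ r + I * η * cs θ r)) + (x (b r) - x (a r)) *
    (sn θ r * (I * η' * cs θ r))) with hζ
  set ω : (ι → ℝ) → ι → ℂ := fun θ r => (ξ (b r) - ξ (a r)) *
    (sn θ r * cs θ r + I * η * (cs θ r ^ 2 - sn θ r ^ 2) / 2) + (x (b r) - x (a r)) *
    (I * η' * (cs θ r ^ 2 - sn θ r ^ 2) / 2) with hω
  -- The effect of dragging the contour `r` along is the total derivative of `ζ` times the
  -- integrand, hence integrates to zero. Only the explicit dependence on the points survives; in
  -- particular the derivative does not involve `η'`.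
  have htot : ∀ r, IntegrableOn (fun θ => (ω θ r / rvel a b x η θ r + ζ θ r *
      logDer μ ν (fun i => (x i : ℂ)) (rpt a b x η θ) 0 (Pi.single r 1)) *
      density a b μ ν (fun i => (x i : ℂ)) η θ) (openBox ι) ∧
    ∫ θ in openBox ι, (ω θ r / rvel a b x η θ r + ζ θ r *
      logDer μ ν (fun i => (x i : ℂ)) (rpt a b x η θ) 0 (Pi.single r 1)) *
      density a b μ ν (fun i => (x i : ℂ)) η θ = 0 := by
    intro r
    refine integral_total_derivative (ν := ν) h hη hμ r
      (c := fun t => ξ (a r) + ((ξ (b r) - ξ (a r)) * ((sin (t / 2) : ℝ) *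
        ((sin (t / 2) : ℝ) + I * η * (cos (t / 2) : ℝ))) + (x (b r) - x (a r)) *
        ((sin (t / 2) : ℝ) * (I * η' * (cos (t / 2) : ℝ)))))
      (c' := fun t => (ξ (b r) - ξ (a r)) * ((sin (t / 2) : ℝ) * (cos (t / 2) : ℝ) +
        I * η * ((cos (t / 2) : ℝ) ^ 2 - (sin (t / 2) : ℝ) ^ 2) / 2) +
        (x (b r) - x (a r)) *
        (I * η' * ((cos (t / 2) : ℝ) ^ 2 - (sin (t / 2) : ℝ) ^ 2) / 2))
      (fun t => ?_) (by fun_prop)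
    have h1 := hasDerivAt_ofReal_sin_half t
    have h2 := hasDerivAt_ofReal_cos_half t
    refine ((((h1.fun_mul (h1.fun_add (h2.const_mul (I * η)))).const_mul
      (ξ (b r) - ξ (a r))).fun_add ((h1.fun_mul (h2.const_mul (I * η'))).const_mul
      (x (b r) - x (a r) : ℂ))).const_add (ξ (a r))).congr_deriv ?_
    ring
  have hpt : ∀ θ ∈ openBox ι,
      deriv (fun y : ℂ => density a b μ ν (fun i => (x i : ℂ) + y * ξ i) (η + y * η') θ) 0 =
      logDer μ ν (fun i => (x i : ℂ)) (rpt a b x η θ) ξ 0 *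
        density a b μ ν (fun i => (x i : ℂ)) η θ + ∑ r, (ω θ r / rvel a b x η θ r + ζ θ r *
      logDer μ ν (fun i => (x i : ℂ)) (rpt a b x η θ) 0 (Pi.single r 1)) *
      density a b μ ν (fun i => (x i : ℂ)) η θ := by
    intro θ hθ
    have hX : ∀ i, HasDerivAt (fun y : ℂ => (x i : ℂ) + y * ξ i) (ξ i) 0 := fun i => by
      simpa using ((hasDerivAt_id (0 : ℂ)).mul_const (ξ i)).const_add (x i : ℂ)
    have hH : HasDerivAt (fun y : ℂ => (η : ℂ) + y * η') η' 0 := by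
      simpa using ((hasDerivAt_id (0 : ℂ)).mul_const η').const_add (η : ℂ)
    have hu : ∀ r, HasDerivAt (fun y : ℂ => pt a b (fun i => (x i : ℂ) + y * ξ i) (η + y * η')
        (sn θ) (cs θ) r) (ζ θ r) 0 := by
      intro r
      unfold pt
      refine ((hX (a r)).fun_add (((hX (b r)).fun_sub (hX (a r))).fun_mul
        (((((hH.const_mul I).mul_const (cs θ r)).const_add
          (sn θ r)).const_mul (sn θ r))))).congr_deriv ?_
      simp only [hζ]
      simp
    have hv : ∀ r, HasDerivAt (fun y : ℂ => vel a b (fun i => (x i : ℂ) + y * ξ i) (η + y * η')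
        (sn θ) (cs θ) r) (ω θ r) 0 := by
      intro r
      unfold vel
      refine (((hX (b r)).fun_sub (hX (a r))).fun_mul
        ((((hH.const_mul I).mul_const (cs θ r ^ 2 - sn θ r ^ 2)).div_const 2).const_add
          (sn θ r * cs θ r))).congr_deriv ?_
      simp only [hω]
      simp
    have hE := hasDerivAt_expFull (𝕜 := ℂ) (a := a) (b := b) (x := fun y i => (x i : ℂ) + y * ξ i)
        (η := fun y => (η : ℂ) + y * η') (S := fun _ => sn θ)
        (C := fun _ => cs θ) (y := 0) (ξ := ξ) (η' := η')
        (ζ := ζ θ) (S' := 0) (C' := 0) μ ν h.ne hX hH (fun r => hasDerivAt_const _ _)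
        (fun r => hasDerivAt_const _ _) hu (fun t s => sn_sq_add_cs_sq _ s)
        (by simpa using h.regSlit hη (openBox_subset_closedBox hθ))
        (fun s => Complex.ofReal_mem_slitPlane.2 (sin_half_pos (hθ s trivial)))
        (fun s => Complex.ofReal_mem_slitPlane.2 (cos_half_pos (hθ s trivial)))
    have hprod := HasDerivAt.fun_finsetProd (u := Finset.univ) fun r _ => hv r
    have htotal := hE.cexp.fun_mul hprod
    simp only [zero_mul, add_zero] at htotal
    have e : (fun y : ℂ => density a b μ ν (fun i => (x i : ℂ) + y * ξ i) (η + y * η') θ) =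
        fun y : ℂ => exp (expFull a b μ ν (fun i => (x i : ℂ) + y * ξ i) (η + y * η')
          (sn θ) (cs θ)) * ∏ r, vel a b (fun i => (x i : ℂ) + y * ξ i) (η + y * η') (sn θ) (cs θ) r :=
      funext fun y => density_eq _ _ _ _ θ hθ
    rw [e, htotal.deriv, logDer_eq μ ν _ _ ξ (ζ θ), density_eq _ _ _ _ θ hθ]
    have hvel : ∀ r, rvel a b x η θ r ≠ 0 := fun r => vel_ne_zero (h.lt r) hη
    have e2 : ∀ r, (∏ s ∈ Finset.univ.erase r, vel a b (fun i => (x i : ℂ)) η (sn θ) (cs θ) s) =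
        (∏ s, vel a b (fun i => (x i : ℂ)) η (sn θ) (cs θ) s) / rvel a b x η θ r := by
      intro r
      rw [← Finset.mul_prod_erase _ _ (Finset.mem_univ r), mul_div_cancel_left₀ _ (hvel r)]
    simp only [e2, smul_eq_mul]
    rw [← Finset.sum_mul, sum_add_distrib]
    have e3 : ∑ r, (∏ s, vel a b (fun i => (x i : ℂ)) η (sn θ) (cs θ) s) / rvel a b x η θ r * ω θ r
      = (∏ s, vel a b (fun i => (x i : ℂ)) η (sn θ) (cs θ) s) *
        ∑ r, ω θ r / rvel a b x η θ r := by
      rw [mul_sum]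
      exact sum_congr rfl fun r _ => by ring
    rw [e3]
    ring
  rw [setIntegral_congr_fun measurableSet_openBox hpt, integral_add, integral_finsetSum]
  · simp only [(htot _).2, Finset.sum_const_zero, add_zero]
  · exact fun r _ => (htot r).1
  · exact integrableOn_adm_mul_density h hη (hμ.mono (show 1 ≤ 2 by norm_num)) (adm_logDer h hη ξ 0)
  · exact integrable_finsetSum _ fun r _ => (htot r).1

end System

/-! ### Comparison of the branches of the logarithm -/

theorem log_eq_log_neg_I_mul {z : ℂ} (h : 0 < z.im) :
    log z = log (-I * z) + I * π / 2 := by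
  have hz : -I * z ≠ 0 := by
    refine mul_ne_zero (by simp) ?_
    rintro rfl; simp at h
  have h2 : |(-I * z).arg| < π / 2 := by
    rw [Complex.abs_arg_lt_pi_div_two_iff]; left; simpa using h
  have h3 := abs_lt.1 h2
  have e : z = I * (-I * z) := by
    linear_combination z * Complex.I_mul_I
  conv_lhs => rw [e]
  rw [Complex.log_mul Complex.I_ne_zero hz (by
    rw [Complex.arg_I]; constructor <;> linarith), Complex.log_I]
  ring

theorem log_neg_eq_log_neg_I_mul {z : ℂ} (h : 0 < z.im) :
    log (-z) = log (-I * z) - I * π / 2 := by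
  have hz : -I * z ≠ 0 := by
    refine mul_ne_zero (by simp) ?_
    rintro rfl; simp at h
  have h2 : |(-I * z).arg| < π / 2 := by
    rw [Complex.abs_arg_lt_pi_div_two_iff]; left; simpa using h
  have h3 := abs_lt.1 h2
  have e : -z = (-I) * (-I * z) := by
    linear_combination (-z) * Complex.I_mul_I
  conv_lhs => rw [e]
  rw [Complex.log_mul (by simp) hz (by
    rw [Complex.arg_neg_I]; constructor <;> linarith), Complex.log_neg_I]
  ring

section System

variable {P ι : Type*} [Fintype P] [DecidableEq P] [Fintype ι] [LinearOrder ι] {a b : ι → P}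
  {x : P → ℝ} {η : ℝ}

theorem rpt_im_pos (h : Config a b x) (hη : 0 < η) {θ : ι → ℝ} (hθ : θ ∈ openBox ι) (r : ι) :
    0 < (rpt a b x η θ r).im := by
  rw [rpt, pt_im]
  exact mul_pos hη (mul_pos (sub_pos.2 (h.lt r))
    (mul_pos (sin_half_pos (hθ r trivial)) (cos_half_pos (hθ r trivial))))

theorem log_mul_ofReal_pos {D S : ℝ} (hD : 0 < D) (hS : 0 < S) {z : ℂ} (hz : z ≠ 0) :
    log (D * z * S) = log D + log z + log S := by
  rw [mul_comm, Complex.log_ofReal_mul hS (mul_ne_zero (by exact_mod_cast hD.ne') hz),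
    Complex.log_ofReal_mul hD hz, Complex.ofReal_log hD.le, Complex.ofReal_log hS.le]
  ring

/-- Two of the three factors at an endpoint are positive real numbers, so splitting the principal
logarithm costs no multiple of 2πi. -/
theorem logFull_eq (h : Config a b x) (hη : 0 < η) {θ : ι → ℝ} (hθ : θ ∈ openBox ι) (r : ι)
    (i : P) : logFull a b (fun i => (x i : ℂ)) η (sn θ) (cs θ) r i =
      log (-I * (rpt a b x η θ r - x i)) := by
  have hr := h.regSlit hη (openBox_subset_closedBox hθ)
  have hD := sub_pos.2 (h.lt r)
  unfold logFull logReg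
  by_cases h1 : i = a r
  · have h2 : i ≠ b r := fun e => h.ne r (h1 ▸ e)
    rw [if_pos h1, if_pos h1, if_neg h2, h1, rpt, pt_sub_left (fun i => (x i : ℂ))]
    have := log_mul_ofReal_pos hD (sin_half_pos (hθ r trivial))
      (Complex.slitPlane_ne_zero (hr.left r))
    rw [Complex.ofReal_sub] at this
    rw [add_zero]
    exact this.symm
  · rw [if_neg h1, if_neg h1]
    by_cases h2 : i = b r
    · rw [if_pos h2, if_pos h2, h2, rpt, pt_sub_right (fun i => (x i : ℂ)) _ (sn_sq_add_cs_sq θ r)]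
      have := log_mul_ofReal_pos hD (cos_half_pos (hθ r trivial))
        (Complex.slitPlane_ne_zero (hr.right r))
      rw [Complex.ofReal_sub] at this
      rw [add_zero]
      exact this.symm
    · rw [if_neg h2, if_neg h2, add_zero, add_zero]

end System

/-! ### The Coulomb gas integral of a link pattern in terms of `density` -/

namespace LinkPattern

variable {N : ℕ}

/-- The left endpoint of a link. -/
abbrev lo (β : LinkPattern N) (r : β.Link) : Fin (2 * N) := r.1

/-- The right endpoint of a link. -/
abbrev hi (β : LinkPattern N) (r : β.Link) : Fin (2 * N) := β.pair r.1

/-- Planarity: a link that starts later is either entirely to the right or nested inside. -/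
theorem hi_lt_lo_or (β : LinkPattern N) {r s : β.Link} (h : r < s) :
    β.hi r < β.lo s ∨ (β.lo r < β.lo s ∧ β.hi s < β.hi r) := by
  have hrs : r.1 < s.1 := h
  have p := β.planar r.1 s.1
  by_cases h1 : β.hi r < β.lo s
  · exact Or.inl h1
  refine Or.inr ⟨hrs, ?_⟩
  have h2 : β.pair r.1 ≠ s.1 := by
    intro e
    have := s.2
    rw [← e, β.pair_pair] at this
    exact absurd (this.trans r.2) (lt_irrefl _)
  have h3 : β.pair r.1 ≠ β.pair s.1 := fun e => hrs.ne (β.pair_inj e)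
  simp only [lo, hi] at *
  omega

theorem config (β : LinkPattern N) {x : Fin (2 * N) → ℝ} (hx : x ∈ chamber N) :
    Config β.lo β.hi x where
  lt r := hx r.2
  inj := StrictMono.injective hx
  pair _ _ hrs := (β.hi_lt_lo_or hrs).imp (fun h => hx h) fun h => ⟨hx h.1, hx h.2⟩

/-- The system of charges of the Coulomb gas with parameter `t = 1 / κ`. -/
abbrev chg (β : LinkPattern N) (t : ℂ) : β.Link → Fin (2 * N) → ℂ := fun _ _ => -(4 * t)

/-- The mutual charges of the screening variables. -/
abbrev cch (β : LinkPattern N) (t : ℂ) : β.Link → β.Link → ℂ := fun _ _ => 8 * t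

/-- The constant phase relating the branches. -/
def phase (β : LinkPattern N) (t : ℂ) : ℂ :=
  (∏ r : β.Link, ∏ i, exp (-(4 * t) *
    ((if i ≤ r.1 then 1 else -1) * (I * π / 2)))) *
  ∏ r : β.Link, ∏ s with r < s, exp (-(8 * t) * (I * π / 2))

/-- The semicircle is the semi-ellipse of eccentricity 1, by the double-angle formulas for exp(-iθ).
-/
theorem contour_eq (β : LinkPattern N) (x : Fin (2 * N) → ℝ) (θ : β.Link → ℝ) (r : β.Link) :
    β.contour x r (θ r) = rpt β.lo β.hi x 1 θ r := by
  have e : exp (-(θ r * I)) = 1 - 2 * sn θ r ^ 2 - 2 * I * (sn θ r * cs θ r) := by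
    rw [← neg_mul, Complex.exp_mul_I, Complex.cos_neg, Complex.sin_neg]
    have h1 : (θ r : ℂ) = 2 * (θ r / 2) := by ring
    rw [h1, Complex.cos_two_mul, Complex.sin_two_mul]
    simp only [sn, cs]
    push_cast
    linear_combination (2 : ℂ) * Complex.sin_sq_add_cos_sq (θ r / 2)
  rw [contour, e, rpt, pt]
  push_cast
  ring

theorem deriv_contour_eq (β : LinkPattern N) (x : Fin (2 * N) → ℝ) (θ : β.Link → ℝ) (r : β.Link) :
    deriv (β.contour x r) (θ r) = rvel β.lo β.hi x 1 θ r := by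
  have e : β.contour x r = fun t => rpt β.lo β.hi x 1 (update θ r t) r := by
    funext t
    rw [← contour_eq, Function.update_self]
  have h := hasDerivAt_pt_update (a := β.lo) (b := β.hi) (fun i => (x i : ℂ)) ((1 : ℝ) : ℂ) θ r r
  rw [e]
  rw [Pi.single_eq_same] at h
  exact h.deriv

/-- The product of the powers of the differences of the points. -/
def vand (N : ℕ) (t : ℝ) (x : Fin (2 * N) → ℝ) : ℝ := ∏ i, ∏ j with i < j, (x j - x i) ^ (2 * t)

/-- Every factor of the prescribed branch differs from the rotated one by a constant. In the upper
half-plane log z and log(-z) are log(-iz) ± iπ/2, with the sign decided by `i ≤ r.1`; `powCutUp`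
contains the rotated logarithm of u_r - u_s exactly, shifted by -iπ/2. -/
theorem pullback_eq (β : LinkPattern N) (κ : ℝ) {x : Fin (2 * N) → ℝ} (hx : x ∈ chamber N)
    {θ : β.Link → ℝ} (hθ : θ ∈ openBox β.Link) :
    β.pullback κ x θ = vand N (1 / κ) x * β.phase (1 / κ : ℝ) *
      density β.lo β.hi (β.chg (1 / κ : ℝ)) (β.cch (1 / κ : ℝ)) (fun i => (x i : ℂ)) (1 : ℝ) θ := by
  have hc := β.config hx
  rw [pullback, integrand, density_eq _ _ _ _ _ hθ]
  simp only [contour_eq, deriv_contour_eq]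
  rw [← mul_assoc, mul_assoc ((vand N (1 / κ) x : ℝ) : ℂ), mul_assoc ((_ : ℝ) : ℂ) _ (∏ r, ∏ i, _)]
  have e1 : (∏ i, ∏ j with i < j, (x j - x i) ^ (2 / κ) : ℝ) = vand N (1 / κ) x := by
    rw [vand]; congr! 3; ring
  rw [e1]
  congr 2
  rw [expFull, phase, exp_add, mul_comm, mul_mul_mul_comm]
  congr 1
  · rw [exp_sum, ← prod_mul_distrib]
    refine prod_congr rfl fun r _ => ?_
    rw [exp_sum, ← prod_mul_distrib]
    refine prod_congr rfl fun i _ => ?_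
    rw [logFull_eq hc one_pos hθ, ← exp_add]
    have him : 0 < (rpt β.lo β.hi x 1 θ r - x i).im := by
      simpa using rpt_im_pos hc one_pos hθ r
    have hne := rpt_sub_ne_zero hc one_pos hθ r i
    split_ifs with h
    · rw [Complex.cpow_def_of_ne_zero hne, log_eq_log_neg_I_mul him]
      congr 1; push_cast; ring
    · rw [← neg_sub (rpt β.lo β.hi x 1 θ r) (x i : ℂ), Complex.cpow_def_of_ne_zero (neg_ne_zero.2 hne),
        log_neg_eq_log_neg_I_mul him]
      congr 1; push_cast; ring
  · rw [exp_sum, ← prod_mul_distrib]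
    refine prod_congr rfl fun r _ => ?_
    rw [exp_sum, ← prod_mul_distrib]
    refine prod_congr rfl fun s _ => ?_
    rw [← exp_add, powCutUp]
    congr 1
    have : I * (rpt β.lo β.hi x 1 θ s - rpt β.lo β.hi x 1 θ r) =
      -I * (rpt β.lo β.hi x 1 θ r - rpt β.lo β.hi x 1 θ s) := by ring
    rw [this]
    simp only [rpt]
    push_cast
    ring

/-- The endpoint charges are -4/κ, which exceeds -1 exactly because κ > 4. -/
theorem integrableOn_pullback (β : LinkPattern N) {κ : ℝ} (hκ : 4 < κ) {x : Fin (2 * N) → ℝ}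
    (hx : x ∈ chamber N) : IntegrableOn (β.pullback κ x) (box β) := by
  have h1 : -1 < (-(4 * ((1 / κ : ℝ) : ℂ))).re := by
    rw [Complex.neg_re, show (4 : ℂ) = ((4 : ℝ) : ℂ) by norm_num, Complex.re_ofReal_mul,
      Complex.ofReal_re, neg_lt_neg_iff, mul_one_div, div_lt_one (by linarith)]
    exact hκ
  have h := (differentiableAt_integral_density (Z := ℂ) (a := β.lo) (b := β.hi)
    (x := fun _ i => (x i : ℂ)) (η := fun _ => ((1 : ℝ) : ℂ)) (z := 0)
    (μ := fun _ => β.chg (1 / κ : ℝ)) (ν := fun _ => β.cch (1 / κ : ℝ)) (by fun_prop) (by fun_prop)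
    (by fun_prop) (by fun_prop) (fun θ hθ => (β.config hx).regSlit one_pos hθ)
    (fun _ => h1) (fun _ => h1)).1
  refine IntegrableOn.congr_fun (h.const_mul (vand N (1 / κ) x * β.phase (1 / κ : ℝ)))
    (fun θ hθ => (β.pullback_eq κ hx hθ).symm) measurableSet_openBox

/-- The normalization constant of a screening integral. -/
def normC (κ : ℝ) : ℝ :=
  Real.sqrt (clusterWeight κ) * Gamma (2 - 8 / κ) / Gamma (1 - 4 / κ) ^ 2

theorem G_eq (β : LinkPattern N) (κ : ℝ) {x : Fin (2 * N) → ℝ} (hx : x ∈ chamber N) :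
    G κ β x = (normC κ : ℂ) ^ N * β.phase (1 / κ : ℝ) * (vand N (1 / κ) x *
      ∫ θ in openBox β.Link, density β.lo β.hi (β.chg (1 / κ : ℝ)) (β.cch (1 / κ : ℝ))
        (fun i => (x i : ℂ)) (1 : ℝ) θ) := by
  have : ∫ θ in box β, β.pullback κ x θ = _ :=
    setIntegral_congr_fun measurableSet_openBox fun θ hθ => β.pullback_eq κ hx hθ
  rw [G, this, integral_const_mul, normC, show box β = openBox β.Link from rfl]
  ring

end LinkPattern

/-! ### Integer shifts of the charges, rational identities, means -/

section System

variable {P ι : Type*} [Fintype P] [DecidableEq P] [Fintype ι] [LinearOrder ι] {a b : ι → P}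
  {x : P → ℝ} {η : ℝ} {μ : ι → P → ℂ} {ν : ι → ι → ℂ}

theorem exp_int_mul_log {z : ℂ} (hz : z ≠ 0) (k : ℤ) : exp (k * log z) = z ^ k := by
  rw [Complex.exp_int_mul, Complex.exp_log hz]

/-- Shifting the charges by integers multiplies the integrand by a rational function. -/
theorem density_shift (h : Config a b x) (hη : 0 < η) (k : ι → P → ℤ) (l : ι → ι → ℤ)
    {θ : ι → ℝ} (hθ : θ ∈ openBox ι) :
    density a b (fun r i => μ r i + k r i) (fun r s => ν r s + l r s) (fun i => (x i : ℂ)) η θ =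
      (∏ r, ∏ i, (-I * (rpt a b x η θ r - x i)) ^ k r i) *
      (∏ r, ∏ s with r < s, (-I * (rpt a b x η θ r - rpt a b x η θ s)) ^ l r s) *
      density a b μ ν (fun i => (x i : ℂ)) η θ := by
  rw [density_eq _ _ _ _ _ hθ, density_eq _ _ _ _ _ hθ, ← mul_assoc]
  congr 1
  have hI : -I ≠ 0 := by simp
  have e : expFull a b (fun r i => μ r i + k r i) (fun r s => ν r s + l r s) (fun i => (x i : ℂ)) η
      (sn θ) (cs θ) = (∑ r, ∑ i, k r i * log (-I * (rpt a b x η θ r - x i))) +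
      (∑ r, ∑ s with r < s, l r s *
        log (-I * (rpt a b x η θ r - rpt a b x η θ s))) +
      expFull a b μ ν (fun i => (x i : ℂ)) η (sn θ) (cs θ) := by
    simp only [expFull, add_mul, sum_add_distrib, logFull_eq h hη hθ]
    ring
  rw [e, exp_add, exp_add, exp_sum, exp_sum]
  congr 2
  · refine prod_congr rfl fun r _ => ?_
    rw [exp_sum]
    exact prod_congr rfl fun i _ =>
      exp_int_mul_log (mul_ne_zero hI (rpt_sub_ne_zero h hη hθ r i)) _
  · refine prod_congr rfl fun r _ => ?_
    rw [exp_sum]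
    exact prod_congr rfl fun s hs => exp_int_mul_log (mul_ne_zero hI
      (rpt_sub_rpt_ne_zero h hη (openBox_subset_closedBox hθ) (Finset.mem_filter.1 hs).2.ne)) _

theorem density_shift_single (h : Config a b x) (hη : 0 < η) (r : ι) (j : P)
    {θ : ι → ℝ} (hθ : θ ∈ openBox ι) :
    density a b (fun s i => μ s i + (if s = r ∧ i = j then (-1 : ℤ) else 0 : ℤ)) ν
      (fun i => (x i : ℂ)) η θ =
      I * ((rpt a b x η θ r - x j)⁻¹ * density a b μ ν (fun i => (x i : ℂ)) η θ) := by
  have := density_shift (μ := μ) (ν := ν) h hη (fun s i => if s = r ∧ i = j then (-1 : ℤ) else 0)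
    (fun _ _ => 0) hθ
  simp only [Int.cast_zero, add_zero, zpow_zero, Finset.prod_const_one, mul_one] at this
  rw [this, ← mul_assoc]
  congr 1
  rw [Finset.prod_eq_single r, Finset.prod_eq_single j]
  · simp [mul_comm]
  · intro i _ hi; simp [hi]
  · simp
  · intro s _ hs; simp [hs]
  · simp

/-- Symmetry of `ν` merges the pairs in which `r` comes first with those in which it comes second.
The term `s = r` is harmless because the inverse of zero is zero. -/
theorem logDer_right_single (hν : ∀ r s, ν r s = ν s r) (x : P → ℂ) (u : ι → ℂ) (r : ι) :
    logDer μ ν x u 0 (Pi.single r 1) =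
      ∑ i, μ r i * (u r - x i)⁻¹ + ∑ s, ν r s * (u r - u s)⁻¹ := by
  unfold logDer
  congr 1
  · rw [Finset.sum_eq_single r]
    · simp
    · intro s _ hs; simp [Pi.single_eq_of_ne hs]
    · simp
  · have e : ∀ p, ∑ q with p < q, ν p q * (((Pi.single r 1 : ι → ℂ) p - (Pi.single r 1 : ι → ℂ) q) /
        (u p - u q)) = (∑ q, if p < q then ν p q * ((Pi.single r 1 : ι → ℂ) p / (u p - u q)) else 0)
        - ∑ q, if p < q then ν p q * ((Pi.single r 1 : ι → ℂ) q / (u p - u q)) else 0 := by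
      intro p
      rw [sum_filter, ← sum_sub_distrib]
      refine sum_congr rfl fun q _ => ?_
      split_ifs
      · ring
      · simp
    simp only [e]
    rw [sum_sub_distrib, Finset.sum_comm (s := Finset.univ) (t := Finset.univ)
      (f := fun p q => if p < q then ν p q * ((Pi.single r 1 : ι → ℂ) q / (u p - u q)) else 0),
      Finset.sum_eq_single_of_mem r (Finset.mem_univ r),
      Finset.sum_eq_single_of_mem (s := Finset.univ) (f := fun q => ∑ p, if p < q then
        ν p q * ((Pi.single r 1 : ι → ℂ) q / (u p - u q)) else 0) r (Finset.mem_univ r),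
      ← sum_sub_distrib]
    · refine sum_congr rfl fun q _ => ?_
      rcases lt_trichotomy r q with h | h | h
      · rw [if_pos h, if_neg h.not_gt]; simp
      · subst h; simp
      · rw [if_neg h.not_gt, if_pos h, hν q r, ← neg_sub (u r) (u q), inv_eq_one_div]
        simp only [Pi.single_eq_same, div_neg, mul_neg, zero_sub, neg_neg]
    · intro s _ hs; simp [Pi.single_eq_of_ne hs]
    · intro s _ hs; simp [Pi.single_eq_of_ne hs]

theorem logDer_left (x : P → ℂ) (u : ι → ℂ) (ξ : P → ℂ) :
    logDer μ ν x u ξ 0 = ∑ r, ∑ i, -(μ r i * ξ i * (u r - x i)⁻¹) := by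
  unfold logDer
  simp only [Pi.zero_apply, sub_self, zero_div, mul_zero, Finset.sum_const_zero, add_zero]
  refine sum_congr rfl fun r _ => sum_congr rfl fun i _ => ?_
  rw [zero_sub, neg_div, div_eq_mul_inv]; ring

/-- Exchanging r and s and averaging removes the difference u_r - u_s from the denominator, leaving
-1/((u_r - y)(u_s - y)). The diagonal terms on the left are zero by convention and are subtracted on
the right. -/
theorem sum_sum_inv_sub {κ : Type*} [DecidableEq κ] (S : Finset κ) (u : κ → ℂ) (y : ℂ)
    (hu : ∀ r ∈ S, ∀ s ∈ S, r ≠ s → u r ≠ u s) (hy : ∀ r ∈ S, u r ≠ y) :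
    ∑ r ∈ S, ∑ s ∈ S, (u r - y)⁻¹ * (u r - u s)⁻¹ =
      -((∑ r ∈ S, (u r - y)⁻¹) ^ 2 - ∑ r ∈ S, (u r - y)⁻¹ ^ 2) / 2 := by
  have h1 : ∑ r ∈ S, ∑ s ∈ S, (u r - y)⁻¹ * (u r - u s)⁻¹ =
      ∑ r ∈ S, ∑ s ∈ S, -((u s - y)⁻¹ * (u r - u s)⁻¹) := by
    rw [Finset.sum_comm]
    refine sum_congr rfl fun r _ => sum_congr rfl fun s _ => ?_
    rw [← neg_sub (u r) (u s), inv_neg]; ring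
  have h2 : ∑ r ∈ S, ∑ s ∈ S, ((u r - y)⁻¹ * (u r - u s)⁻¹ + -((u s - y)⁻¹ * (u r - u s)⁻¹)) =
      ∑ r ∈ S, ∑ s ∈ S, (-((u r - y)⁻¹ * (u s - y)⁻¹) + if r = s then (u r - y)⁻¹ ^ 2 else 0) := by
    refine sum_congr rfl fun r hr => sum_congr rfl fun s hs => ?_
    by_cases hrs : r = s
    · subst hrs; rw [if_pos rfl]; simp [sq]
    · rw [if_neg hrs]
      have h3 := sub_ne_zero.2 (hu r hr s hs hrs)
      have h4 := sub_ne_zero.2 (hy r hr)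
      have h5 := sub_ne_zero.2 (hy s hs)
      field_simp
      ring
  simp only [sum_add_distrib] at h2
  rw [← h1] at h2
  have h3 : ∑ r ∈ S, ∑ s ∈ S, (if r = s then (u r - y)⁻¹ ^ 2 else 0) = ∑ r ∈ S, (u r - y)⁻¹ ^ 2 := by
    refine sum_congr rfl fun r hr => ?_
    rw [Finset.sum_ite_eq, if_pos hr]
  have h4 : ∑ r ∈ S, ∑ s ∈ S, -((u r - y)⁻¹ * (u s - y)⁻¹) = -(∑ r ∈ S, (u r - y)⁻¹) ^ 2 := by
    simp only [Finset.sum_neg_distrib]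
    rw [sq, Finset.sum_mul_sum]
  rw [h3, h4] at h2
  linear_combination h2 / 2

/-- The integral of a function of the parameters against the integrand. -/
def mean (a b : ι → P) (μ : ι → P → ℂ) (ν : ι → ι → ℂ) (x : P → ℝ) (R : (ι → ℝ) → ℂ) : ℂ :=
  ∫ θ in openBox ι, R θ * density a b μ ν (fun i => (x i : ℂ)) (1 : ℝ) θ

section Mean

variable {k : ℕ}

theorem mean_add (h : Config a b x) (hμ : Big a b k μ) {R R' : (ι → ℝ) → ℂ}
    (hR : Adm k R) (hR' : Adm k R') :
    mean a b μ ν x (fun θ => R θ + R' θ) = mean a b μ ν x R + mean a b μ ν x R' := by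
  unfold mean
  simp only [add_mul]
  exact integral_add (integrableOn_adm_mul_density h one_pos hμ hR)
    (integrableOn_adm_mul_density h one_pos hμ hR')

theorem mean_sum (h : Config a b x) (hμ : Big a b k μ) {κ : Type*} (u : Finset κ)
    {R : κ → (ι → ℝ) → ℂ} (hR : ∀ i ∈ u, Adm k (R i)) :
    mean a b μ ν x (fun θ => ∑ i ∈ u, R i θ) = ∑ i ∈ u, mean a b μ ν x (R i) := by
  unfold mean
  simp only [Finset.sum_mul]
  exact integral_finsetSum _ fun i hi => integrableOn_adm_mul_density h one_pos hμ (hR i hi)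

end Mean

theorem mean_const_mul (c : ℂ) (R : (ι → ℝ) → ℂ) :
    mean a b μ ν x (fun θ => c * R θ) = c * mean a b μ ν x R := by
  unfold mean
  simp only [mul_assoc]
  exact integral_const_mul _ _

theorem mean_congr {R R' : (ι → ℝ) → ℂ} (h : ∀ θ ∈ openBox ι, R θ = R' θ) :
    mean a b μ ν x R = mean a b μ ν x R' :=
  setIntegral_congr_fun measurableSet_openBox fun θ hθ => by
    simp only [h θ hθ]

end System

/-! ### The integral as a holomorphic function of the points and of t = 1/κ -/

section Screened

variable {n : ℕ} {ι : Type*} [Fintype ι] [LinearOrder ι]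

/-- The product of the powers `(x_j - x_i) ^ (2 t)`. -/
def vandC (t : ℂ) (x : Fin n → ℂ) : ℂ :=
  exp (∑ i, ∑ j with i < j, 2 * t * log (x j - x i))

/-- The unnormalized Coulomb gas integral, as a function of the points and the parameter. -/
def screened (a b : ι → Fin n) (p : (Fin n → ℂ) × ℂ) : ℂ :=
  vandC p.2 p.1 * ∫ θ in openBox ι,
    density a b (fun _ _ => -(4 * p.2)) (fun _ _ => 8 * p.2) p.1 (1 : ℝ) θ

/-- A domain of holomorphy of the Coulomb gas integral. -/
def dom (a b : ι → Fin n) : Set ((Fin n → ℂ) × ℂ) :=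
  {p | (∀ i j, i < j → p.1 j - p.1 i ∈ slitPlane) ∧
    (∀ θ ∈ closedBox ι, RegSlit a b p.1 (1 : ℝ) (sn θ) (cs θ)) ∧ p.2.re < 1 / 4}

variable {a b : ι → Fin n}

theorem isOpen_dom : IsOpen (dom a b) := by
  have e : dom a b = {p | ∀ i j, i < j → p.1 j - p.1 i ∈ slitPlane} ∩
      ({p | ∀ θ ∈ closedBox ι, RegSlit a b p.1 (1 : ℝ) (sn θ) (cs θ)} ∩ {p | p.2.re < 1 / 4}) := rfl
  rw [e]
  refine IsOpen.inter ?_ (IsOpen.inter ?_ ?_)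
  · exact isOpen_setOf_forall fun i => isOpen_setOf_forall fun j => isOpen_setOf_imp
      (Complex.isOpen_slitPlane.preimage (by fun_prop))
  -- An open condition holding for all θ in a compact box persists, uniformly in θ, under small
  -- changes of the points.
  · rw [isOpen_iff_eventually]
    intro p hp
    refine isCompact_closedBox.eventually_forall_of_forall_eventually fun θ hθ => ?_
    have ho : IsOpen {q : ((Fin n → ℂ) × ℂ) × (ι → ℝ) |
        RegSlit a b q.1.1 (1 : ℝ) (sn q.2) (cs q.2)} :=
      isOpen_setOf_regSlit (x := fun q : ((Fin n → ℂ) × ℂ) × (ι → ℝ) => q.1.1)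
        (η := fun _ => ((1 : ℝ) : ℂ)) (S := fun q => sn q.2) (C := fun q => cs q.2)
        (fun i => by fun_prop) continuous_const (fun r => (continuous_sn r).comp continuous_snd)
        (fun r => (continuous_cs r).comp continuous_snd)
    exact ho.mem_nhds (hp θ hθ)
  · exact isOpen_lt (Complex.continuous_re.comp continuous_snd) continuous_const

/-- The condition Re t < 1/4 says that the endpoint exponents -4t have real part above -1. The
domain therefore contains both t = 1/κ with κ > 4 and the whole region Re t ≤ -1, where no boundary
terms occur. -/
theorem differentiableOn_screened : DifferentiableOn ℂ (screened a b) (dom a b) := by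
  rintro p ⟨h1, h2, h3⟩
  apply DifferentiableAt.differentiableWithinAt
  refine DifferentiableAt.mul (DifferentiableAt.cexp ?_) ?_
  · refine DifferentiableAt.fun_sum fun i _ => DifferentiableAt.fun_sum fun j hj => ?_
    refine DifferentiableAt.mul (by fun_prop) (DifferentiableAt.clog (by fun_prop) ?_)
    exact h1 i j (Finset.mem_filter.1 hj).2
  · have h4 : -1 < (-(4 * p.2)).re := by
      rw [Complex.neg_re, show (4 : ℂ) = ((4 : ℝ) : ℂ) by norm_num, Complex.re_ofReal_mul]
      linarith
    exact (differentiableAt_integral_density (Z := (Fin n → ℂ) × ℂ) (a := a) (b := b)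
      (x := fun q => q.1) (η := fun _ => ((1 : ℝ) : ℂ)) (μ := fun q _ _ => -(4 * q.2))
      (ν := fun q _ _ => 8 * q.2) (z := p) (fun i => by fun_prop) (by fun_prop)
      (fun _ _ => by fun_prop) (fun _ _ => by fun_prop) h2 (fun _ => h4) (fun _ => h4)).2

theorem Config.mem_dom {x : Fin n → ℝ} (h : Config a b x) (hx : StrictMono x) {t : ℂ}
    (ht : t.re < 1 / 4) : ((fun i => (x i : ℂ)), t) ∈ dom a b := by
  refine ⟨fun i j hij => ?_, fun θ hθ => h.regSlit one_pos hθ, ht⟩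
  simp only
  rw [← Complex.ofReal_sub, Complex.ofReal_mem_slitPlane]
  exact sub_pos.2 (hx hij)

/-- The directional derivative in the points. -/
def dpt (a b : ι → Fin n) (ξ : Fin n → ℂ) (p : (Fin n → ℂ) × ℂ) : ℂ :=
  fderiv ℂ (screened a b) p (ξ, 0)

theorem differentiableOn_dpt (ξ : Fin n → ℂ) : DifferentiableOn ℂ (dpt a b ξ) (dom a b) :=
  differentiableOn_fderiv_apply isOpen_dom differentiableOn_screened (ξ, 0)

theorem hasDerivAt_line (ξ : Fin n → ℂ) (p : (Fin n → ℂ) × ℂ) (y : ℂ) :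
    HasDerivAt (fun y : ℂ => ((fun i => p.1 i + y * ξ i), p.2)) (ξ, (0 : ℂ)) y := by
  refine HasDerivAt.prodMk ?_ (hasDerivAt_const _ _)
  rw [hasDerivAt_pi]
  intro i
  simpa using ((hasDerivAt_id y).mul_const (ξ i)).const_add (p.1 i)

theorem hasDerivAt_comp_line {f : (Fin n → ℂ) × ℂ → ℂ} {Ω : Set ((Fin n → ℂ) × ℂ)} (hΩ : IsOpen Ω)
    (hf : DifferentiableOn ℂ f Ω) (ξ : Fin n → ℂ) {p : (Fin n → ℂ) × ℂ} (hp : p ∈ Ω) :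
    HasDerivAt (fun y : ℂ => f ((fun i => p.1 i + y * ξ i), p.2)) (fderiv ℂ f p (ξ, 0)) 0 := by
  have e : ((fun i => p.1 i + (0 : ℂ) * ξ i), p.2) = p := by simp
  have h1 : HasFDerivAt f (fderiv ℂ f p) ((fun i => p.1 i + (0 : ℂ) * ξ i), p.2) := by
    rw [e]
    exact ((hf p hp).differentiableAt (hΩ.mem_nhds hp)).hasFDerivAt
  exact h1.comp_hasDerivAt (0 : ℂ) (hasDerivAt_line ξ p 0)

theorem hasDerivAt_vandC (t : ℂ) {x : Fin n → ℂ} (hx : ∀ i j, i < j → x j - x i ∈ slitPlane)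
    (ξ : Fin n → ℂ) :
    HasDerivAt (fun y : ℂ => vandC t fun i => x i + y * ξ i)
      (vandC t x * ∑ i, ∑ j with i < j, 2 * t * ((ξ j - ξ i) / (x j - x i))) 0 := by
  have h : HasDerivAt (fun y : ℂ => ∑ i, ∑ j with i < j, 2 * t *
      log ((x j + y * ξ j) - (x i + y * ξ i)))
      (∑ i, ∑ j with i < j, 2 * t * ((ξ j - ξ i) / (x j - x i))) 0 := by
    refine HasDerivAt.fun_sum fun i _ => HasDerivAt.fun_sum fun j hj => ?_
    have h1 : HasDerivAt (fun y : ℂ => (x j + y * ξ j) - (x i + y * ξ i)) (ξ j - ξ i) 0 := by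
      have := (((hasDerivAt_id (0 : ℂ)).mul_const (ξ j)).const_add (x j)).fun_sub
        (((hasDerivAt_id (0 : ℂ)).mul_const (ξ i)).const_add (x i))
      simpa using this
    have h2 := (hasDerivAt_clog_comp h1 (by simpa using hx i j (Finset.mem_filter.1 hj).2)).const_mul
      (2 * t)
    simpa using h2
  have := h.cexp
  simpa [vandC] using this

variable {x : Fin n → ℝ} {t : ℂ}

theorem big_const {k : ℕ} (ht : (k : ℝ) ≤ -4 * t.re) : Big a b k fun _ _ => -(4 * t) := by
  have h4 : (k : ℝ) ≤ (-(4 * t)).re := by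
    rw [Complex.neg_re, show (4 : ℂ) = ((4 : ℝ) : ℂ) by norm_num, Complex.re_ofReal_mul]
    linarith
  exact fun r => ⟨h4, h4⟩

/-- The first derivatives, for very negative values of the parameter. -/
theorem dpt_eq_mean (h : Config a b x) (hx : StrictMono x) (ht : t.re ≤ -1) (ξ : Fin n → ℂ) :
    dpt a b ξ ((fun i => (x i : ℂ)), t) = vandC t (fun i => (x i : ℂ)) *
      mean a b (fun _ _ => -(4 * t)) (fun _ _ => 8 * t) x
        (fun θ => (∑ i, ∑ j with i < j, 2 * t * ((ξ j - ξ i) / (x j - x i))) +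
          4 * t * ∑ r, ∑ i, ξ i * (rpt a b x 1 θ r - x i)⁻¹) := by
  have hd := h.mem_dom hx (show t.re < 1 / 4 by linarith)
  have h1 := hasDerivAt_comp_line isOpen_dom differentiableOn_screened ξ hd
  have hB : Big a b 2 (fun _ _ => -(4 * t)) := big_const (by push_cast; linarith)
  have h2 := hasDerivAt_integral_moving (ν := fun _ _ => 8 * t) h one_pos hB ξ 0
  have h3 := hasDerivAt_vandC t hd.1 ξ
  have h4 := h3.fun_mul h2
  simp only [mul_zero, add_zero, zero_mul] at h4
  rw [dpt, h1.unique h4]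
  rw [mean_add h hB (Adm.const _ _), mean_const_mul]
  · rw [mul_add, mul_assoc]
    congr 2
    · rw [mean, integral_const_mul]
    · rw [← mean_const_mul, mean]
      refine setIntegral_congr_fun measurableSet_openBox fun θ _ => ?_
      simp only [logDer_left]
      congr 1
      rw [mul_sum]
      refine sum_congr rfl fun r _ => ?_
      rw [mul_sum]
      exact sum_congr rfl fun i _ => by ring
  · exact ((Adm.sum _ fun r _ => Adm.sum _ fun i _ =>
      (adm_inv_rpt_sub h one_pos r i).const_mul _).const_mul _).mono (by norm_num)

theorem screened_eq_mean (x : Fin n → ℝ) (t : ℂ) :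
    screened a b ((fun i => (x i : ℂ)), t) = vandC t (fun i => (x i : ℂ)) *
      mean a b (fun _ _ => -(4 * t)) (fun _ _ => 8 * t) x (fun _ => 1) := by
  simp [screened, mean]

end Screened

/-! ### The BPZ equations: total derivatives for Re t ≤ -1, then continuation in t -/

section Screened

variable {n : ℕ} {ι : Type*} [Fintype ι] [LinearOrder ι] {a b : ι → Fin n} {x : Fin n → ℝ} {t : ℂ}

/-- The points play the role of the screening variables in `logDer_right_single`, with all charges
to further points equal to zero. -/
theorem sum_pair_single (c : ℂ) (x : Fin n → ℂ) (j : Fin n) :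
    ∑ i, ∑ k with i < k, c * (((Pi.single j 1 : Fin n → ℂ) k - (Pi.single j 1 : Fin n → ℂ) i) /
      (x k - x i)) = c * ∑ i, (x j - x i)⁻¹ := by
  have := logDer_right_single (P := Fin n) (μ := fun _ _ => 0) (ν := fun _ _ : Fin n => c)
    (fun _ _ => rfl) 0 x j
  simp only [logDer, zero_mul, Finset.sum_const_zero, zero_add] at this
  rw [mul_sum, ← this]
  refine sum_congr rfl fun i _ => sum_congr rfl fun k _ => ?_
  rw [← neg_sub (x i) (x k), ← neg_sub ((Pi.single j 1 : Fin n → ℂ) i), neg_div_neg_eq]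

theorem eventually_strictMono (hx : StrictMono x) (j : Fin n) :
    ∀ᶠ y : ℝ in 𝓝 0, StrictMono fun i => x i + y * (Pi.single j 1 : Fin n → ℝ) i := by
  have : ∀ᶠ y : ℝ in 𝓝 0, ∀ i k, i < k → x i + y * (Pi.single j 1 : Fin n → ℝ) i <
      x k + y * (Pi.single j 1 : Fin n → ℝ) k := by
    rw [eventually_all]; intro i
    rw [eventually_all]; intro k
    by_cases hik : i < k
    · have h1 : Continuous fun y : ℝ => x i + y * (Pi.single j 1 : Fin n → ℝ) i := by fun_prop
      have h2 : Continuous fun y : ℝ => x k + y * (Pi.single j 1 : Fin n → ℝ) k := by fun_prop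
      filter_upwards [(isOpen_lt h1 h2).mem_nhds (show (0 : ℝ) ∈ _ by simpa using hx hik)]
        with y hy _ using hy
    · simp [hik]
  filter_upwards [this] with y hy i k hik using hy i k hik

/-- The charges after division by `u_r - x_j`. -/
def shiftChg (t : ℂ) (r : ι) (j : Fin n) (s : ι) (i : Fin n) : ℂ :=
  -(4 * t) + ((if s = r ∧ i = j then (-1 : ℤ) else 0 : ℤ) : ℂ)

theorem big_shiftChg (ht : t.re ≤ -1) (r : ι) (j : Fin n) : Big a b 2 (shiftChg t r j) := by
  have h4 : ∀ s i, ((2 : ℕ) : ℝ) ≤ (shiftChg t r j s i).re := by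
    intro s i
    have : (-(4 * t)).re = -4 * t.re := by
      rw [Complex.neg_re, show (4 : ℂ) = ((4 : ℝ) : ℂ) by norm_num, Complex.re_ofReal_mul]
      ring
    rw [shiftChg, Complex.add_re, this, Complex.intCast_re]
    split_ifs <;> push_cast <;> linarith
  exact fun r => ⟨h4 _ _, h4 _ _⟩

/-- Division by u_r - x_j stays within the class of Coulomb gas integrands, with one charge lowered
by 1. Thus all results on total derivatives and moving points also apply to such means. -/
theorem mean_shiftChg (h : Config a b x) (r : ι) (j : Fin n) (R : (ι → ℝ) → ℂ) :
    mean a b (shiftChg t r j) (fun _ _ => 8 * t) x R =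
      I * mean a b (fun _ _ => -(4 * t)) (fun _ _ => 8 * t) x
        (fun θ => R θ * (rpt a b x 1 θ r - x j)⁻¹) := by
  unfold mean
  rw [← integral_const_mul]
  refine setIntegral_congr_fun measurableSet_openBox fun θ hθ => ?_
  have := density_shift_single (μ := fun _ _ => -(4 * t)) (ν := fun _ _ => 8 * t) h one_pos r j hθ
  simp only
  rw [show shiftChg t r j = fun s i => -(4 * t) + ((if s = r ∧ i = j then (-1 : ℤ) else 0 : ℤ) : ℂ)
    from rfl, this]
  ring

/-- This is the total derivative in u_r of the integrand divided by u_r - x_j, seen as the plain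
total derivative for the shifted charges. -/
theorem mean_total_derivative (h : Config a b x) (ht : t.re ≤ -1) (r : ι) (j : Fin n) :
    mean a b (fun _ _ => -(4 * t)) (fun _ _ => 8 * t) x
      (fun θ => (-(4 * t) * ∑ i, (rpt a b x 1 θ r - x i)⁻¹ - (rpt a b x 1 θ r - x j)⁻¹ +
        8 * t * ∑ s, (rpt a b x 1 θ r - rpt a b x 1 θ s)⁻¹) * (rpt a b x 1 θ r - x j)⁻¹) = 0 := by
  have h1 := integral_logDer_single (ν := fun _ _ => 8 * t) h one_pos
    (big_shiftChg (a := a) (b := b) ht r j) r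
  have h2 := mean_shiftChg (t := t) h r j (fun θ => logDer (shiftChg t r j) (fun _ _ => 8 * t)
    (fun i => (x i : ℂ)) (rpt a b x 1 θ) 0 (Pi.single r 1))
  rw [mean, h1] at h2
  have h3 := (mul_eq_zero.1 h2.symm).resolve_left Complex.I_ne_zero
  rw [← h3]
  refine mean_congr fun θ _ => ?_
  rw [logDer_right_single fun _ _ => rfl]
  congr 1
  rw [mul_sum _ _ (8 * t)]
  congr 1
  simp only [shiftChg, add_mul, sum_add_distrib, true_and]
  rw [mul_sum, sub_eq_add_neg]
  congr 1
  rw [Finset.sum_eq_single j]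
  · simp
  · intro i _ hi; simp [hi]
  · simp

/-- The pure second derivatives, for very negative values of the parameter. -/
theorem dpt_dpt_eq_mean (h : Config a b x) (hx : StrictMono x) (ht : t.re ≤ -1)
    (hcfg : ∀ x : Fin n → ℝ, StrictMono x → Config a b x) (j : Fin n) :
    fderiv ℂ (dpt a b (Pi.single j 1)) ((fun i => (x i : ℂ)), t) (Pi.single j 1, 0) =
      vandC t (fun i => (x i : ℂ)) * mean a b (fun _ _ => -(4 * t)) (fun _ _ => 8 * t) x
        (fun θ => (((2 * t * ∑ i, (x j - x i : ℂ)⁻¹) ^ 2 - 2 * t * ∑ i, (x j - x i : ℂ)⁻¹ ^ 2) +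
          2 * (2 * t * ∑ i, (x j - x i : ℂ)⁻¹) * (4 * t) * ∑ r, (rpt a b x 1 θ r - x j)⁻¹) +
          4 * t * ∑ r, (4 * t * ∑ s, (rpt a b x 1 θ s - x j)⁻¹ + (rpt a b x 1 θ r - x j)⁻¹) *
            (rpt a b x 1 θ r - x j)⁻¹) := by
  have hd := h.mem_dom hx (show t.re < 1 / 4 by linarith)
  have hB2 : Big a b 2 (fun _ _ => -(4 * t)) := big_const (by push_cast; linarith)
  have hB1 : Big a b 1 (fun _ _ => -(4 * t)) := hB2.mono (by norm_num)
  set ξ : Fin n → ℂ := Pi.single j 1 with hξ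
  have eI : ∀ z : ℂ, -I * (I * z) = z := fun z => by
    linear_combination (-z) * Complex.I_mul_I
  have h1 := hasDerivAt_comp_line isOpen_dom (differentiableOn_dpt ξ) ξ hd
  -- an explicit formula for the first derivative along the line
  have hV := hasDerivAt_vandC t hd.1 ξ
  have hS := hasDerivAt_integral_moving (ν := fun _ _ => 8 * t) h one_pos hB2 ξ 0
  -- The first derivative contains means of 1/(u_r - x_j). As integrals with shifted charges they
  -- can be differentiated once more by the same lemma.
  have hSr := fun r => hasDerivAt_integral_moving (ν := fun _ _ => 8 * t) h one_pos
    (big_shiftChg (a := a) (b := b) ht r j) ξ 0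
  have hA : HasDerivAt (fun y : ℂ => 2 * t * ∑ i, (((x j : ℂ) + y * ξ j) - (x i + y * ξ i))⁻¹)
      (-(2 * t * ∑ i, (x j - x i : ℂ)⁻¹ ^ 2)) 0 := by
    rw [← mul_neg, ← Finset.sum_neg_distrib]
    refine HasDerivAt.const_mul _ (HasDerivAt.fun_sum fun i _ => ?_)
    by_cases hi : i = j
    · subst hi
      simpa using hasDerivAt_const (0 : ℂ) (0 : ℂ)
    · have h3 : HasDerivAt (fun y : ℂ => ((x j : ℂ) + y * ξ j) - (x i + y * ξ i)) (ξ j - ξ i) 0 := by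
        have := (((hasDerivAt_id (0 : ℂ)).mul_const (ξ j)).const_add (x j : ℂ)).fun_sub
          (((hasDerivAt_id (0 : ℂ)).mul_const (ξ i)).const_add (x i : ℂ))
        simpa using this
      have hne : (x j : ℂ) - x i ≠ 0 := by
        rw [sub_ne_zero]
        exact_mod_cast fun e => hi (hx.injective e).symm
      have h4 := h3.fun_inv (by simpa using hne)
      refine h4.congr_deriv ?_
      simp only [hξ, Pi.single_eq_same, Pi.single_eq_of_ne hi, zero_mul, add_zero]
      field_simp
      ring
  have hg := hV.fun_mul ((hA.fun_mul hS).fun_add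
    ((HasDerivAt.fun_sum (u := Finset.univ) fun r _ => (hSr r).const_mul (-I)).const_mul
      (4 * t)))
  simp only [mul_zero, add_zero, zero_mul] at hg
  -- The formula for the first derivative is available only at real positions of the points, so the
  -- two functions are compared along the real line.
  have h1r := h1.comp_ofReal (z := 0)
  have hgr := hg.comp_ofReal (z := 0)
  refine (h1r.unique (hgr.congr_of_eventuallyEq ?_)).trans ?_
  · filter_upwards [eventually_strictMono hx j] with y hy
    have hy' := hcfg _ hy
    have key := dpt_eq_mean hy' hy ht ξ
    have e1 : (fun i => ((x i + y * (Pi.single j 1 : Fin n → ℝ) i : ℝ) : ℂ)) =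
        fun i => (x i : ℂ) + y * ξ i := by
      funext i
      by_cases hi : i = j
      · subst hi; simp [hξ]
      · simp [hξ, Pi.single_eq_of_ne hi]
    rw [e1] at key
    rw [key]
    have e2 := fun i => congrFun e1 i
    simp only [e2]
    rw [hξ, sum_pair_single, ← hξ]
    have hA0 : Adm 2 (fun θ : ι → ℝ => ∑ r, ∑ i, ξ i *
        (rpt a b (fun i => x i + y * (Pi.single j 1 : Fin n → ℝ) i) 1 θ r -
          ((x i : ℂ) + y * ξ i))⁻¹) := by
      refine (Adm.sum _ fun r _ => Adm.sum _ fun i _ => ?_).mono (show 1 ≤ 2 by norm_num)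
      have := (adm_inv_rpt_sub hy' one_pos r i).const_mul (ξ i)
      simpa only [e2] using this
    rw [mean_add hy' hB2 (Adm.const _ 2) (hA0.const_mul _)]
    have e3 : mean a b (fun _ _ => -(4 * t)) (fun _ _ => 8 * t)
        (fun i => x i + y * (Pi.single j 1 : Fin n → ℝ) i) (fun θ => 4 * t * ∑ r, ∑ i, ξ i *
        (rpt a b (fun i => x i + y * (Pi.single j 1 : Fin n → ℝ) i) 1 θ r -
          ((x i : ℂ) + y * ξ i))⁻¹) = 4 * t * ∑ r, -I * ∫ θ in openBox ι,
          density a b (shiftChg t r j) (fun _ _ => 8 * t) (fun i => (x i : ℂ) + y * ξ i)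
            (1 : ℝ) θ := by
      rw [mean_const_mul]
      congr 1
      have e4 : ∀ (θ : ι → ℝ) r, ∑ i, ξ i *
        (rpt a b (fun i => x i + y * (Pi.single j 1 : Fin n → ℝ) i) 1 θ r -
          ((x i : ℂ) + y * ξ i))⁻¹ =
          (rpt a b (fun i => x i + y * (Pi.single j 1 : Fin n → ℝ) i) 1 θ r -
            ((x j + y * (Pi.single j 1 : Fin n → ℝ) j : ℝ) : ℂ))⁻¹ := by
        intro θ r
        rw [e2, Finset.sum_eq_single j]
        · simp [hξ]
        · intro i _ hi; simp [hξ, Pi.single_eq_of_ne hi]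
        · simp
      simp only [e4]
      rw [mean_sum hy' hB1 _ fun r _ => adm_inv_rpt_sub hy' one_pos r j]
      refine sum_congr rfl fun r _ => ?_
      have e5 := mean_shiftChg (t := t) hy' r j fun _ => 1
      simp only [mean, one_mul, e2] at e5 ⊢
      rw [e5, eI]
    rw [e3, mean, integral_const_mul]
    simp only [e2]
  rw [hξ, sum_pair_single, ← hξ]
  -- rewriting everything through means
  have eL : ∀ θ : ι → ℝ, logDer (fun _ _ => -(4 * t)) (fun _ _ => 8 * t) (fun i => (x i : ℂ))
      (rpt a b x 1 θ) ξ 0 = 4 * t * ∑ s, (rpt a b x 1 θ s - x j)⁻¹ := by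
    intro θ
    rw [logDer_left, mul_sum]
    refine sum_congr rfl fun s _ => ?_
    rw [Finset.sum_eq_single j]
    · simp [hξ]
    · intro i _ hi; simp [hξ, Pi.single_eq_of_ne hi]
    · simp
  have eLr : ∀ r (θ : ι → ℝ), logDer (shiftChg t r j) (fun _ _ => 8 * t) (fun i => (x i : ℂ))
      (rpt a b x 1 θ) ξ 0 = 4 * t * ∑ s, (rpt a b x 1 θ s - x j)⁻¹ + (rpt a b x 1 θ r - x j)⁻¹ := by
    intro r θ
    rw [logDer_left]
    have : ∀ s, ∑ i, -(shiftChg t r j s i * ξ i * (rpt a b x 1 θ s - x i)⁻¹) =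
        4 * t * (rpt a b x 1 θ s - x j)⁻¹ + if s = r then (rpt a b x 1 θ r - x j)⁻¹ else 0 := by
      intro s
      rw [Finset.sum_eq_single j]
      · by_cases hs : s = r
        · subst hs; simp [hξ, shiftChg]; ring
        · simp [hξ, shiftChg, hs]
      · intro i _ hi; simp [hξ, Pi.single_eq_of_ne hi]
      · simp
    simp only [this, sum_add_distrib, Finset.sum_ite_eq', Finset.mem_univ, if_true,
      mul_sum]
  have m0 : ∫ θ in openBox ι, density a b (fun _ _ => -(4 * t)) (fun _ _ => 8 * t)
      (fun i => (x i : ℂ)) (1 : ℝ) θ =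
      mean a b (fun _ _ => -(4 * t)) (fun _ _ => 8 * t) x fun _ => 1 := by simp [mean]
  have mr : ∀ r, ∫ θ in openBox ι, density a b (shiftChg t r j) (fun _ _ => 8 * t)
      (fun i => (x i : ℂ)) (1 : ℝ) θ =
      I * mean a b (fun _ _ => -(4 * t)) (fun _ _ => 8 * t) x
        fun θ => (rpt a b x 1 θ r - x j)⁻¹ := by
    intro r
    have := mean_shiftChg (t := t) h r j fun _ => 1
    simpa [mean] using this
  have mL : ∫ θ in openBox ι, logDer (fun _ _ => -(4 * t)) (fun _ _ => 8 * t) (fun i => (x i : ℂ))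
      (rpt a b x 1 θ) ξ 0 * density a b (fun _ _ => -(4 * t)) (fun _ _ => 8 * t)
      (fun i => (x i : ℂ)) (1 : ℝ) θ = 4 * t * ∑ r, mean a b (fun _ _ => -(4 * t))
        (fun _ _ => 8 * t) x fun θ => (rpt a b x 1 θ r - x j)⁻¹ := by
    simp only [eL]
    rw [← mean_sum h hB1 _ fun r _ => adm_inv_rpt_sub h one_pos r j, ← mean_const_mul, mean]
  have mLr : ∀ r, ∫ θ in openBox ι, logDer (shiftChg t r j) (fun _ _ => 8 * t)
      (fun i => (x i : ℂ)) (rpt a b x 1 θ) ξ 0 * density a b (shiftChg t r j) (fun _ _ => 8 * t)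
      (fun i => (x i : ℂ)) (1 : ℝ) θ = I * mean a b (fun _ _ => -(4 * t)) (fun _ _ => 8 * t) x
        fun θ => (4 * t * ∑ s, (rpt a b x 1 θ s - x j)⁻¹ + (rpt a b x 1 θ r - x j)⁻¹) *
          (rpt a b x 1 θ r - x j)⁻¹ := by
    intro r
    simp only [eLr]
    exact mean_shiftChg h r j _
  have hM := fun r => adm_inv_rpt_sub h (one_pos : (0 : ℝ) < 1) r j
  have hMM : ∀ r, Adm 2 fun θ => (4 * t * ∑ s, (rpt a b x 1 θ s - x j)⁻¹ +
      (rpt a b x 1 θ r - x j)⁻¹) * (rpt a b x 1 θ r - x j)⁻¹ := fun r =>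
    (((Adm.sum _ fun s _ => hM s).const_mul _).add (hM r)).mul (hM r)
  rw [m0, mL]
  simp only [mr, mLr]
  rw [mean_add h hB2 ((Adm.const _ 2).add (((Adm.sum _ fun s _ => hM s).mono
    (by norm_num)).const_mul _)) ((Adm.sum _ fun r _ => hMM r).const_mul _),
    mean_add h hB2 (Adm.const _ 2) (((Adm.sum _ fun s _ => hM s).mono
    (by norm_num)).const_mul _), mean_const_mul, mean_const_mul,
    mean_sum h hB1 _ fun r _ => hM r, mean_sum h hB2 _ fun r _ => hMM r]
  have mc : ∀ c : ℂ, mean a b (fun _ _ => -(4 * t)) (fun _ _ => 8 * t) x (fun _ => c) =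
      c * mean a b (fun _ _ => -(4 * t)) (fun _ _ => 8 * t) x (fun _ => 1) := by
    intro c
    rw [← mean_const_mul]; simp
  rw [mc (_ - _)]
  simp only [eI]
  ring

/-- The left side is t times the BPZ operator applied to the integrand, divided by the integrand;
note 2ht = t(6t - 1). The right side is -2t times the sum of the total derivatives of f/(u_r - x_j),
again divided by f. Partial fractions in the u's, in the x's and in the mixed terms reduce both
sides to the same few power sums. -/
theorem bpz_algebra (hx : Injective x) (t : ℂ) (j : Fin n) (u : ι → ℂ)
    (hu : ∀ r s, r ≠ s → u r ≠ u s) (hux : ∀ r i, u r ≠ x i) :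
    1 / 2 * ((((2 * t * ∑ i, (x j - x i : ℂ)⁻¹) ^ 2 - 2 * t * ∑ i, (x j - x i : ℂ)⁻¹ ^ 2) +
          2 * (2 * t * ∑ i, (x j - x i : ℂ)⁻¹) * (4 * t) * ∑ r, (u r - x j)⁻¹) +
          4 * t * ∑ r, (4 * t * ∑ s, (u s - x j)⁻¹ + (u r - x j)⁻¹) * (u r - x j)⁻¹) +
      ∑ i with i ≠ j, (2 * t / (x i - x j) * (2 * t * ∑ k, (x i - x k : ℂ)⁻¹ +
          4 * t * ∑ r, (u r - x i)⁻¹) - t * (6 * t - 1) / (x i - x j : ℂ) ^ 2) =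
    -(2 * t) * ∑ r, (-(4 * t) * ∑ i, (u r - x i)⁻¹ - (u r - x j)⁻¹ +
        8 * t * ∑ s, (u r - u s)⁻¹) * (u r - x j)⁻¹ := by
  have hx0 : ∀ i k, i ≠ k → (x i : ℂ) - x k ≠ 0 := fun i k hik => by
    rw [sub_ne_zero]; exact_mod_cast fun e => hik (hx e)
  have hu0 : ∀ r i, u r - x i ≠ 0 := fun r i => sub_ne_zero.2 (hux r i)
  have hS : (Finset.univ.filter fun i : Fin n => i ≠ j) = Finset.univ.erase j := by
    ext i; simp
  -- sums over all points versus sums over the points other than `j`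
  set S : Finset (Fin n) := Finset.univ.erase j with hSdef
  set D1 := ∑ i ∈ S, (x i - x j : ℂ)⁻¹ with hD1
  set D2 := ∑ i ∈ S, (x i - x j : ℂ)⁻¹ ^ 2 with hD2
  set M1 := ∑ r, (u r - x j)⁻¹ with hM1
  set M2 := ∑ r, (u r - x j)⁻¹ ^ 2 with hM2
  have s1 : ∑ i, (x j - x i : ℂ)⁻¹ = -D1 := by
    rw [← Finset.add_sum_erase _ _ (Finset.mem_univ j), sub_self, inv_zero, zero_add, hD1,
      ← Finset.sum_neg_distrib]
    exact sum_congr rfl fun i _ => by rw [← neg_sub, inv_neg]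
  have s2 : ∑ i, (x j - x i : ℂ)⁻¹ ^ 2 = D2 := by
    rw [← Finset.add_sum_erase _ _ (Finset.mem_univ j), sub_self, inv_zero, hD2]
    rw [zero_pow two_ne_zero, zero_add]
    exact sum_congr rfl fun i _ => by rw [← neg_sub, inv_neg, neg_sq]
  have s3 : ∑ r, (4 * t * M1 + (u r - x j)⁻¹) * (u r - x j)⁻¹ = 4 * t * M1 ^ 2 + M2 := by
    simp only [add_mul, sum_add_distrib, hM2, sq, ← mul_sum]
    rw [← hM1]; ring
  have p1 := sum_sum_inv_sub (Finset.univ : Finset ι) u (x j) (fun r _ s _ hrs => hu r s hrs)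
    fun r _ => hux r j
  have p2 := sum_sum_inv_sub S (fun i => (x i : ℂ)) (x j)
    (fun r _ s _ hrs => sub_ne_zero.1 (hx0 r s hrs))
    fun r hr => sub_ne_zero.1 (hx0 r j (Finset.ne_of_mem_erase hr))
  rw [← hM1, ← hM2] at p1
  rw [← hD1, ← hD2] at p2
  -- the mixed sum
  set Q := ∑ i ∈ S, ∑ r, (x i - x j : ℂ)⁻¹ * (u r - x i)⁻¹ with hQ
  -- Partial fractions: 1/((u - x_i)(u - x_j)) is the difference of 1/(u - x_i) and 1/(u - x_j),
  -- divided by x_i - x_j.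
  have s4 : ∑ r, ∑ i ∈ S, (u r - x i)⁻¹ * (u r - x j)⁻¹ = Q - D1 * M1 := by
    rw [Finset.sum_comm, hQ, hD1, hM1, Finset.sum_mul_sum, ← sum_sub_distrib]
    refine sum_congr rfl fun i hi => ?_
    rw [← sum_sub_distrib]
    refine sum_congr rfl fun r _ => ?_
    have h1 := hx0 i j (Finset.ne_of_mem_erase hi)
    have h2 := hu0 r i
    have h3 := hu0 r j
    field_simp
    ring
  have s5 : ∑ i ∈ S, (2 * t / (x i - x j) * (2 * t * ∑ k, (x i - x k : ℂ)⁻¹ +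
          4 * t * ∑ r, (u r - x i)⁻¹) - t * (6 * t - 1) / (x i - x j : ℂ) ^ 2) =
      4 * t ^ 2 * (-(D1 ^ 2 - D2) / 2) + 4 * t ^ 2 * D2 + 8 * t ^ 2 * Q - t * (6 * t - 1) * D2 := by
    rw [← p2, hQ, hD2, mul_sum, mul_sum, mul_sum, mul_sum,
      ← sum_add_distrib, ← sum_add_distrib, ← sum_sub_distrib]
    refine sum_congr rfl fun i _ => ?_
    rw [← Finset.add_sum_erase _ _ (Finset.mem_univ j), ← mul_sum, ← mul_sum,
      div_eq_mul_inv, div_eq_mul_inv, ← inv_pow]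
    ring
  have s6 : ∑ r, (-(4 * t) * ∑ i, (u r - x i)⁻¹ - (u r - x j)⁻¹ +
        8 * t * ∑ s, (u r - u s)⁻¹) * (u r - x j)⁻¹ =
      -(4 * t) * (M2 + (Q - D1 * M1)) - M2 + 8 * t * (-(M1 ^ 2 - M2) / 2) := by
    rw [← p1, ← s4, hM2, ← sum_add_distrib, mul_sum, mul_sum,
      ← sum_sub_distrib, ← sum_add_distrib]
    refine sum_congr rfl fun r _ => ?_
    rw [← Finset.add_sum_erase _ _ (Finset.mem_univ j), ← mul_sum, ← Finset.sum_mul]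
    ring
  rw [hS, s1, s2, s3, s5, s6]
  ring

/-- The second-order differential equations, for very negative values of the parameter. -/
theorem bpz_of_re_le (hcfg : ∀ x : Fin n → ℝ, StrictMono x → Config a b x)
    (hx : StrictMono x) (ht : t.re ≤ -1) (j : Fin n) :
    1 / 2 * fderiv ℂ (dpt a b (Pi.single j 1)) ((fun i => (x i : ℂ)), t) (Pi.single j 1, 0) +
      ∑ i with i ≠ j, (2 * t / (x i - x j) * dpt a b (Pi.single i 1) ((fun i => (x i : ℂ)), t) -
        t * (6 * t - 1) / (x i - x j : ℂ) ^ 2 * screened a b ((fun i => (x i : ℂ)), t)) = 0 := by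
  have h := hcfg x hx
  have hB : Big a b 2 (fun _ _ => -(4 * t)) := big_const (by push_cast; linarith)
  have hM := fun r i => adm_inv_rpt_sub h (one_pos : (0 : ℝ) < 1) r i
  have hM1 : ∀ i, Adm 2 fun θ => ∑ r, (rpt a b x 1 θ r - x i)⁻¹ := fun i =>
    (Adm.sum _ fun r _ => hM r i).mono (by norm_num)
  have hMM : Adm 2 fun θ => ∑ r, (4 * t * ∑ s, (rpt a b x 1 θ s - x j)⁻¹ +
      (rpt a b x 1 θ r - x j)⁻¹) * (rpt a b x 1 θ r - x j)⁻¹ := Adm.sum _ fun r _ =>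
    (((Adm.sum _ fun s _ => hM s j).const_mul _).add (hM r j)).mul (hM r j)
  have e1 : ∀ i, dpt a b (Pi.single i 1) ((fun i => (x i : ℂ)), t) = vandC t (fun i => (x i : ℂ)) *
      mean a b (fun _ _ => -(4 * t)) (fun _ _ => 8 * t) x fun θ =>
        2 * t * ∑ k, (x i - x k : ℂ)⁻¹ + 4 * t * ∑ r, (rpt a b x 1 θ r - x i)⁻¹ := by
    intro i
    rw [dpt_eq_mean h hx ht, sum_pair_single]
    congr 2
    funext θ
    congr 2
    refine sum_congr rfl fun r _ => ?_
    rw [Finset.sum_eq_single i]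
    · simp
    · intro k _ hk; simp [Pi.single_eq_of_ne hk]
    · simp
  rw [dpt_dpt_eq_mean h hx ht hcfg j, screened_eq_mean]
  simp only [e1]
  have hA2 : Adm 2 fun θ => (((2 * t * ∑ i, (x j - x i : ℂ)⁻¹) ^ 2 -
          2 * t * ∑ i, (x j - x i : ℂ)⁻¹ ^ 2) +
          2 * (2 * t * ∑ i, (x j - x i : ℂ)⁻¹) * (4 * t) * ∑ r, (rpt a b x 1 θ r - x j)⁻¹) +
          4 * t * ∑ r, (4 * t * ∑ s, (rpt a b x 1 θ s - x j)⁻¹ + (rpt a b x 1 θ r - x j)⁻¹) *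
            (rpt a b x 1 θ r - x j)⁻¹ :=
    ((Adm.const _ 2).add ((hM1 j).const_mul _)).add (hMM.const_mul _)
  have hA1 : ∀ i, Adm 2 fun θ => 2 * t / (x i - x j) * (2 * t * ∑ k, (x i - x k : ℂ)⁻¹ +
      4 * t * ∑ r, (rpt a b x 1 θ r - x i)⁻¹) := fun i =>
    ((Adm.const _ 2).add ((hM1 i).const_mul _)).const_mul _
  have e2 : ∑ i with i ≠ j, (2 * t / (x i - x j) * (vandC t (fun i => (x i : ℂ)) *
      mean a b (fun _ _ => -(4 * t)) (fun _ _ => 8 * t) x fun θ =>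
        2 * t * ∑ k, (x i - x k : ℂ)⁻¹ + 4 * t * ∑ r, (rpt a b x 1 θ r - x i)⁻¹) -
        t * (6 * t - 1) / (x i - x j : ℂ) ^ 2 * (vandC t (fun i => (x i : ℂ)) *
      mean a b (fun _ _ => -(4 * t)) (fun _ _ => 8 * t) x fun _ => 1)) =
      vandC t (fun i => (x i : ℂ)) * mean a b (fun _ _ => -(4 * t)) (fun _ _ => 8 * t) x fun θ =>
        ∑ i with i ≠ j, (2 * t / (x i - x j) * (2 * t * ∑ k, (x i - x k : ℂ)⁻¹ +
          4 * t * ∑ r, (rpt a b x 1 θ r - x i)⁻¹) +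
            (-(t * (6 * t - 1) / (x i - x j : ℂ) ^ 2)) * 1) := by
    rw [mean_sum h hB _ fun i _ => (hA1 i).add ((Adm.const 1 2).const_mul _), mul_sum]
    refine sum_congr rfl fun i _ => ?_
    rw [mean_add h hB (hA1 i) ((Adm.const 1 2).const_mul _), mean_const_mul, mean_const_mul]
    generalize mean a b (fun _ _ => -(4 * t)) (fun _ _ => 8 * t) x (fun _ => 1) = K1
    generalize mean a b (fun _ _ => -(4 * t)) (fun _ _ => 8 * t) x (fun θ =>
      2 * t * ∑ k, (x i - x k : ℂ)⁻¹ + 4 * t * ∑ r, (rpt a b x 1 θ r - x i)⁻¹) = K2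
    ring
  rw [e2, mul_left_comm, ← mul_add, ← mean_const_mul, ← mean_add h hB (hA2.const_mul _)
    (Adm.sum _ fun i _ => (hA1 i).add ((Adm.const 1 2).const_mul _))]
  refine mul_eq_zero_of_right _ ?_
  have e3 : mean a b (fun _ _ => -(4 * t)) (fun _ _ => 8 * t) x (fun θ => -(2 * t) *
      ∑ r, (-(4 * t) * ∑ i, (rpt a b x 1 θ r - x i)⁻¹ - (rpt a b x 1 θ r - x j)⁻¹ +
        8 * t * ∑ s, (rpt a b x 1 θ r - rpt a b x 1 θ s)⁻¹) * (rpt a b x 1 θ r - x j)⁻¹) = 0 := by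
    rw [mean_const_mul, mean_sum h hB, Finset.sum_eq_zero, mul_zero]
    · exact fun r _ => mean_total_derivative h ht r j
    · intro r _
      have hp : Adm 1 fun θ => ∑ s, (rpt a b x 1 θ r - rpt a b x 1 θ s)⁻¹ := by
        refine Adm.sum _ fun s _ => ?_
        by_cases hrs : r = s
        · subst hrs; simpa using Adm.const 0 1
        · exact (adm_inv_rpt_sub_rpt h one_pos hrs).mono (by norm_num)
      have hq : Adm 1 fun θ => -(4 * t) * ∑ i, (rpt a b x 1 θ r - x i)⁻¹ -
          (rpt a b x 1 θ r - x j)⁻¹ := by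
        simpa [sub_eq_add_neg] using ((Adm.sum _ fun i _ => hM r i).const_mul (-(4 * t))).add
          ((hM r j).const_mul (-1))
      exact (hq.add (hp.const_mul (8 * t))).mul (hM r j)
  rw [← e3]
  refine mean_congr fun θ hθ => ?_
  rw [← bpz_algebra hx.injective t j (rpt a b x 1 θ)
    (fun r s hrs => sub_ne_zero.1 (rpt_sub_rpt_ne_zero h one_pos (openBox_subset_closedBox hθ) hrs))
    fun r i => sub_ne_zero.1 (rpt_sub_ne_zero h one_pos hθ r i)]
  simp only [mul_one, ← sub_eq_add_neg]

/-- Identity theorem on a half-plane, which is convex and hence connected. The base point lies to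
the left of both `m` and `c`. -/
theorem eq_zero_of_re_lt {f : ℂ → ℂ} {c : ℝ} (hf : DifferentiableOn ℂ f {t | t.re < c}) {m : ℝ}
    (h0 : ∀ t : ℂ, t.re ≤ m → f t = 0) {t : ℂ} (ht : t.re < c) : f t = 0 := by
  have ho : IsOpen {t : ℂ | t.re < c} := isOpen_lt Complex.continuous_re continuous_const
  have hc : IsPreconnected {t : ℂ | t.re < c} := (convex_halfSpace_re_lt c).isPreconnected
  have hz : ((min m c - 1 : ℝ) : ℂ) ∈ {t : ℂ | t.re < c} := by
    show (min m c - 1 : ℝ) < c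
    linarith [min_le_right m c]
  refine (hf.analyticOnNhd ho).eqOn_zero_of_preconnected_of_eventuallyEq_zero hc hz ?_ ht
  have ho' : IsOpen {t : ℂ | t.re < m} := isOpen_lt Complex.continuous_re continuous_const
  filter_upwards [ho'.mem_nhds (show (min m c - 1 : ℝ) < m by linarith [min_le_left m c])] with z hz
  exact h0 z (le_of_lt hz)

/-- For fixed real points every term is holomorphic in t on Re t < 1/4 and the identity is known for
Re t ≤ -1, so it continues. -/
theorem bpz (hcfg : ∀ x : Fin n → ℝ, StrictMono x → Config a b x)
    (hx : StrictMono x) (ht : t.re < 1 / 4) (j : Fin n) :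
    1 / 2 * fderiv ℂ (dpt a b (Pi.single j 1)) ((fun i => (x i : ℂ)), t) (Pi.single j 1, 0) +
      ∑ i with i ≠ j, (2 * t / (x i - x j) * dpt a b (Pi.single i 1) ((fun i => (x i : ℂ)), t) -
        t * (6 * t - 1) / (x i - x j : ℂ) ^ 2 * screened a b ((fun i => (x i : ℂ)), t)) = 0 := by
  have hcomp : ∀ {f : (Fin n → ℂ) × ℂ → ℂ}, DifferentiableOn ℂ f (dom a b) →
      DifferentiableOn ℂ (fun t => f ((fun i => (x i : ℂ)), t)) {t | t.re < 1 / 4} :=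
    fun hf => hf.comp (f := fun t : ℂ => ((fun i => (x i : ℂ)), t)) (by fun_prop)
      fun t ht => (hcfg x hx).mem_dom hx ht
  refine eq_zero_of_re_lt (c := 1 / 4) (m := -1) (f := fun t => 1 / 2 * fderiv ℂ
    (dpt a b (Pi.single j 1)) ((fun i => (x i : ℂ)), t) (Pi.single j 1, 0) +
      ∑ i with i ≠ j, (2 * t / (x i - x j) * dpt a b (Pi.single i 1) ((fun i => (x i : ℂ)), t) -
        t * (6 * t - 1) / (x i - x j : ℂ) ^ 2 * screened a b ((fun i => (x i : ℂ)), t))) ?_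
    (fun t ht => bpz_of_re_le hcfg hx ht j) ht
  refine DifferentiableOn.add ?_ (DifferentiableOn.fun_sum fun i _ => DifferentiableOn.sub ?_ ?_)
  · exact (hcomp (differentiableOn_fderiv_apply isOpen_dom (differentiableOn_dpt _) _)).const_mul _
  · exact DifferentiableOn.mul (by fun_prop) (hcomp (differentiableOn_dpt _))
  · exact DifferentiableOn.mul (by fun_prop) (hcomp differentiableOn_screened)

end Screened

/-! ### The BPZ equations for the normalized integral -/

theorem isOpen_chamber (N : ℕ) : IsOpen (chamber N) := by
  have e : chamber N = {x | ∀ i j, i < j → x i < x j} := by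
    ext x; exact ⟨fun h i j hij => h hij, fun h i j hij => h i j hij⟩
  rw [e]
  exact isOpen_setOf_forall fun i => isOpen_setOf_forall fun j => isOpen_setOf_imp
    (isOpen_lt (continuous_apply i) (continuous_apply j))

theorem eventually_update_mem_chamber {N : ℕ} {x : Fin (2 * N) → ℝ} (hx : x ∈ chamber N)
    (i : Fin (2 * N)) : ∀ᶠ y in 𝓝 (x i), update x i y ∈ chamber N := by
  have hc : Continuous fun y : ℝ => update x i y := by fun_prop
  exact hc.continuousAt.eventually ((isOpen_chamber N).mem_nhds (by simpa using hx))

theorem pderiv_congr {N : ℕ} {F F' : (Fin (2 * N) → ℝ) → ℂ} (h : EqOn F F' (chamber N))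
    {x : Fin (2 * N) → ℝ} (hx : x ∈ chamber N) (i : Fin (2 * N)) : pderiv i F x = pderiv i F' x := by
  refine Filter.EventuallyEq.deriv_eq ?_
  filter_upwards [eventually_update_mem_chamber hx i] with y hy using h hy

theorem hasDerivAt_comp_update {n : ℕ} {f : (Fin n → ℂ) × ℂ → ℂ} {Ω : Set ((Fin n → ℂ) × ℂ)}
    (hΩ : IsOpen Ω) (hf : DifferentiableOn ℂ f Ω) {x : Fin n → ℝ} {t : ℂ}
    (hp : ((fun i => (x i : ℂ)), t) ∈ Ω) (i : Fin n) :
    HasDerivAt (fun y : ℝ => f ((fun k => ((update x i y k : ℝ) : ℂ)), t))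
      (fderiv ℂ f ((fun i => (x i : ℂ)), t) (Pi.single i 1, 0)) (x i) := by
  have h1 : HasFDerivAt f (fderiv ℂ f ((fun i => (x i : ℂ)), t))
      ((fun k => ((update x i (x i) k : ℝ) : ℂ)), t) := by
    simpa using ((hf _ hp).differentiableAt (hΩ.mem_nhds hp)).hasFDerivAt
  have h2 : HasDerivAt (fun y : ℝ => ((fun k => ((update x i y k : ℝ) : ℂ)), t))
      ((Pi.single i 1 : Fin n → ℂ), (0 : ℂ)) (x i) := by
    refine HasDerivAt.prodMk ?_ (hasDerivAt_const _ _)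
    rw [hasDerivAt_pi]
    intro k
    by_cases hk : k = i
    · subst hk
      simpa using (hasDerivAt_id (x k)).ofReal_comp
    · simpa [hk] using hasDerivAt_const (x i) (x k : ℂ)
  exact (h1.restrictScalars ℝ).comp_hasDerivAt (x i) h2

namespace LinkPattern

variable {N : ℕ} (β : LinkPattern N)

theorem vandC_eq_vand {t : ℝ} {x : Fin (2 * N) → ℝ} (hx : x ∈ chamber N) :
    vandC (t : ℂ) (fun i => (x i : ℂ)) = vand N t x := by
  rw [vandC, vand, exp_sum, Complex.ofReal_prod]
  refine prod_congr rfl fun i _ => ?_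
  rw [exp_sum, Complex.ofReal_prod]
  refine prod_congr rfl fun j hj => ?_
  have hd : 0 < x j - x i := sub_pos.2 (hx (Finset.mem_filter.1 hj).2)
  rw [Real.rpow_def_of_pos hd, Complex.ofReal_exp, ← Complex.ofReal_sub, ← Complex.ofReal_log hd.le]
  congr 1
  push_cast
  ring

theorem G_eq_screened (κ : ℝ) : EqOn (G κ β) (fun x => (normC κ : ℂ) ^ N * β.phase (1 / κ : ℝ) *
    screened β.lo β.hi ((fun i => (x i : ℂ)), ((1 / κ : ℝ) : ℂ))) (chamber N) := by
  intro x hx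
  simp only
  rw [β.G_eq κ hx, screened, vandC_eq_vand hx]

theorem mem_dom {κ : ℝ} (hκ : 4 < κ) {x : Fin (2 * N) → ℝ} (hx : x ∈ chamber N) :
    ((fun i => (x i : ℂ)), ((1 / κ : ℝ) : ℂ)) ∈ dom β.lo β.hi := by
  refine (β.config hx).mem_dom hx ?_
  rw [Complex.ofReal_re]
  exact one_div_lt_one_div_of_lt (by norm_num) hκ

/-- On the chamber `G` is a constant multiple of the restriction of a holomorphic function to real
points. Hence it is smooth, its partial derivatives are complex directional derivatives, and `bpz`
multiplied by κ is the claim. -/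
theorem satisfiesBPZ {κ : ℝ} (hκ : 4 < κ) : SatisfiesBPZ κ (G κ β) := by
  have hκ0 : (κ : ℂ) ≠ 0 := by exact_mod_cast (by linarith : κ ≠ 0)
  set c := (normC κ : ℂ) ^ N * β.phase (1 / κ : ℝ) with hc
  have hG := β.G_eq_screened κ
  constructor
  · refine ContDiffOn.congr ?_ hG
    have h1 : ContDiffOn ℝ 2 (screened β.lo β.hi) (dom β.lo β.hi) :=
      (contDiffOn_of_holomorphic isOpen_dom differentiableOn_screened 2).restrict_scalars ℝ
    have h2 : ContDiff ℝ 2 fun x : Fin (2 * N) → ℝ =>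
        ((fun i => (x i : ℂ)), ((1 / κ : ℝ) : ℂ)) := by
      refine ContDiff.prodMk (contDiff_pi.2 fun i => ?_) contDiff_const
      exact Complex.ofRealCLM.contDiff.comp (contDiff_apply ℝ ℝ i)
    exact contDiffOn_const.mul (h1.comp h2.contDiffOn fun x hx => β.mem_dom hκ hx)
  · have hp1 : ∀ i, EqOn (pderiv i (G κ β)) (fun x => c * dpt β.lo β.hi (Pi.single i 1)
        ((fun i => (x i : ℂ)), ((1 / κ : ℝ) : ℂ))) (chamber N) := by
      intro i x hx
      rw [pderiv_congr hG hx]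
      exact ((hasDerivAt_comp_update isOpen_dom differentiableOn_screened (β.mem_dom hκ hx)
        i).const_mul c).deriv
    intro x hx j
    have hp2 : pderiv j (pderiv j (G κ β)) x = c * fderiv ℂ (dpt β.lo β.hi (Pi.single j 1))
        ((fun i => (x i : ℂ)), ((1 / κ : ℝ) : ℂ)) (Pi.single j 1, 0) := by
      rw [pderiv_congr (hp1 j) hx]
      exact ((hasDerivAt_comp_update isOpen_dom (differentiableOn_dpt _) (β.mem_dom hκ hx)
        j).const_mul c).deriv
    have key := bpz (a := β.lo) (b := β.hi) (fun x hx => β.config hx) hx (β.mem_dom hκ hx).2.2 j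
    have e : ∀ i, 2 / (x i - x j : ℂ) * pderiv i (G κ β) x
          - 2 * weight κ / (x i - x j : ℂ) ^ 2 * G κ β x = (κ * c) *
        (2 * ((1 / κ : ℝ) : ℂ) / (x i - x j) * dpt β.lo β.hi (Pi.single i 1)
          ((fun i => (x i : ℂ)), ((1 / κ : ℝ) : ℂ)) - ((1 / κ : ℝ) : ℂ) *
          (6 * ((1 / κ : ℝ) : ℂ) - 1) / (x i - x j : ℂ) ^ 2 *
          screened β.lo β.hi ((fun i => (x i : ℂ)), ((1 / κ : ℝ) : ℂ))) := by
      intro i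
      rw [hp1 i hx, hG hx]
      simp only [← hc, weight]
      generalize dpt β.lo β.hi _ _ = A
      generalize screened β.lo β.hi _ = B
      push_cast
      field_simp
    simp only [e]
    rw [← mul_sum, hp2]
    linear_combination (κ * c) * key

end LinkPattern

/-! ### Sum of residues of a rational function with double poles -/

section Residues

open Polynomial

theorem eval_derivative_prod_X_sub_C {κ : Type*} (S : Finset κ) (v : κ → ℂ) (z : ℂ)
    (h : ∀ i ∈ S, z ≠ v i) :
    (derivative (∏ i ∈ S, (X - C (v i)))).eval z =
      (∏ i ∈ S, (z - v i)) * ∑ i ∈ S, (z - v i)⁻¹ := by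
  classical
  induction S using Finset.induction_on with
  | empty => simp
  | insert i S hi ih =>
    rw [Finset.prod_insert hi, Finset.prod_insert hi, Finset.sum_insert hi, derivative_mul, eval_add,
      eval_mul, eval_mul, ih fun k hk => h k (Finset.mem_insert_of_mem hk), eval_prod]
    have h1 := sub_ne_zero.2 (h i (Finset.mem_insert_self _ _))
    simp only [derivative_sub, derivative_X, derivative_C, sub_zero, eval_one, eval_sub, eval_X,
      eval_C]
    field_simp

/-- The sum of the residues of `∏ (z - x_i) / ∏ (z - u_r) ^ 2`. -/
theorem sum_residues {ι κ : Type*} [Fintype ι] [DecidableEq ι] [Fintype κ] (u : ι → ℂ) (x : κ → ℂ)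
    (hu : Injective u) (hux : ∀ r i, u r ≠ x i)
    (hcard : Fintype.card κ = 2 * Fintype.card ι) :
    ∑ r, (∏ i, (u r - x i)) * (∏ s ∈ Finset.univ.erase r, (u r - u s) ^ 2)⁻¹ *
      (∑ i, (u r - x i)⁻¹ - 2 * ∑ s, (u r - u s)⁻¹) = 2 * ∑ r, u r - ∑ i, x i := by
  rcases isEmpty_or_nonempty ι with hι | hι
  · have : IsEmpty κ := by
      rw [← Fintype.card_eq_zero_iff, hcard, Fintype.card_eq_zero]
    simp
  set n := Fintype.card ι with hn
  have hn0 : 0 < n := Fintype.card_pos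
  set f : ℂ[X] := ∏ i, (X - C (x i)) with hf
  set P : ι → ℂ[X] := fun r => ∏ k ∈ Finset.univ.erase r, (X - C (u k)) ^ 2 with hP
  set Q : ℂ[X] := ∏ k : ι, (X - C (u k)) ^ 2 with hQ
  -- Partial fraction expansion of `f` over the squares (X - u_r)²; the coefficient `c r 1`
  -- introduced below is the residue at u_r.
  obtain ⟨q, ρ, hdeg, hfq⟩ := eq_quo_mul_prod_pow_add_sum_rem_mul_prod_pow (s := Finset.univ) f
    (g := fun r => X - C (u r)) (fun r _ => monic_X_sub_C _)
    (fun r _ s _ hrs => isCoprime_X_sub_C_of_isUnit_sub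
      (sub_ne_zero.2 (hu.ne hrs)).isUnit) (fun _ => 2)
  have hρ : ∀ r k, ∃ c, ρ r k = C c := fun r k => by
    have := hdeg r (Finset.mem_univ r) k
    rw [degree_X_sub_C] at this
    exact ⟨_, eq_C_of_degree_le_zero (Nat.WithBot.lt_one_iff_le_zero.1 this)⟩
  choose c hc using hρ
  have hfq' : f = q * Q + ∑ r, (C (c r 0) + C (c r 1) * (X - C (u r))) * P r := by
    rw [hfq]
    congr 1
    refine sum_congr rfl fun r _ => ?_
    rw [Fin.sum_univ_two, hc, hc]
    simp only [Fin.val_zero, Fin.val_one, pow_zero, pow_one, mul_one, hP]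
    ring
  have hPm : ∀ r, (P r).Monic := fun r => monic_prod_of_monic _ _ fun k _ => (monic_X_sub_C _).pow 2
  have hQm : Q.Monic := monic_prod_of_monic _ _ fun k _ => (monic_X_sub_C _).pow 2
  have hfm : f.Monic := monic_prod_of_monic _ _ fun k _ => monic_X_sub_C _
  have hPd : ∀ r, (P r).natDegree = 2 * n - 2 := fun r => by
    rw [hP, natDegree_prod_of_monic _ _ fun k _ => (monic_X_sub_C _).pow 2]
    simp only [natDegree_pow, natDegree_X_sub_C, Finset.sum_const, Finset.card_erase_of_mem
      (Finset.mem_univ r), Finset.card_univ, smul_eq_mul, ← hn]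
    omega
  have hQd : Q.natDegree = 2 * n := by
    rw [hQ, natDegree_prod_of_monic _ _ fun k _ => (monic_X_sub_C _).pow 2]
    simp only [natDegree_pow, natDegree_X_sub_C, Finset.sum_const, Finset.card_univ, smul_eq_mul,
      ← hn]
    omega
  have hfd : f.natDegree = 2 * n := by
    rw [hf, natDegree_prod_of_monic _ _ fun k _ => monic_X_sub_C _]
    simp only [natDegree_X_sub_C, Finset.sum_const, Finset.card_univ, smul_eq_mul, hcard]
    omega
  -- values and derivatives at the nodes
  have hQz : ∀ r, Q = (X - C (u r)) ^ 2 * P r := fun r =>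
    (Finset.mul_prod_erase _ _ (Finset.mem_univ r)).symm
  have hPz : ∀ r s, s ≠ r → ∃ T : ℂ[X], P s = (X - C (u r)) ^ 2 * T := fun r s hs =>
    ⟨_, (Finset.mul_prod_erase (Finset.univ.erase s) (fun k => (X - C (u k)) ^ 2)
      (Finset.mem_erase.2 ⟨hs.symm, Finset.mem_univ r⟩)).symm⟩
  have hloc : ∀ r, ∃ T : ℂ[X], f = (X - C (u r)) ^ 2 * T +
      (C (c r 0) + C (c r 1) * (X - C (u r))) * P r := by
    intro r
    have : (X - C (u r)) ^ 2 ∣ q * Q + ∑ s ∈ Finset.univ.erase r,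
        (C (c s 0) + C (c s 1) * (X - C (u s))) * P s := by
      refine dvd_add (dvd_mul_of_dvd_right ⟨_, hQz r⟩ _) (Finset.dvd_sum fun s hs => ?_)
      exact dvd_mul_of_dvd_right (hPz r s (Finset.ne_of_mem_erase hs)) _
    obtain ⟨T, hT⟩ := this
    refine ⟨T, ?_⟩
    rw [← hT, hfq', ← Finset.add_sum_erase _ _ (Finset.mem_univ r)]
    ring
  have hPe : ∀ r, (P r).eval (u r) = ∏ s ∈ Finset.univ.erase r, (u r - u s) ^ 2 := fun r => by
    simp [hP, eval_prod]
  have hP0 : ∀ r, (P r).eval (u r) ≠ 0 := fun r => by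
    rw [hPe, Finset.prod_ne_zero_iff]
    exact fun s hs => pow_ne_zero 2 (sub_ne_zero.2 (hu.ne (Finset.ne_of_mem_erase hs).symm))
  have hPder : ∀ r, (derivative (P r)).eval (u r) = (P r).eval (u r) * (2 * ∑ s, (u r - u s)⁻¹) := by
    intro r
    have e : P r = (∏ k ∈ Finset.univ.erase r, (X - C (u k))) ^ 2 := Finset.prod_pow _ _ _
    rw [e, derivative_pow, eval_mul, eval_mul, eval_derivative_prod_X_sub_C _ _ _ fun s hs =>
      hu.ne (Finset.ne_of_mem_erase hs).symm, ← Finset.add_sum_erase _ (fun s => (u r - u s)⁻¹)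
      (Finset.mem_univ r)]
    simp [eval_prod]
    ring
  have hres : ∀ r, c r 1 = (∏ i, (u r - x i)) * (∏ s ∈ Finset.univ.erase r, (u r - u s) ^ 2)⁻¹ *
      (∑ i, (u r - x i)⁻¹ - 2 * ∑ s, (u r - u s)⁻¹) := by
    intro r
    obtain ⟨T, hT⟩ := hloc r
    have e0 : ∏ i, (u r - x i) = c r 0 * (P r).eval (u r) := by
      have := congrArg (eval (u r)) hT
      simpa [hf, eval_prod] using this
    have e1 : (∏ i, (u r - x i)) * ∑ i, (u r - x i)⁻¹ = c r 1 * (P r).eval (u r) +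
        c r 0 * ((P r).eval (u r) * (2 * ∑ s, (u r - u s)⁻¹)) := by
      have := congrArg (fun p => eval (u r) (derivative p)) hT
      simp only [hf, eval_derivative_prod_X_sub_C _ _ _ fun i _ => hux r i] at this
      rw [this, ← hPder]
      simp [derivative_mul, derivative_pow]
    rw [← hPe]
    have h3 := hP0 r
    generalize ∑ s, (u r - u s)⁻¹ = A at *
    generalize ∑ i, (u r - x i)⁻¹ = B at *
    generalize ∏ i, (u r - x i) = D at *
    field_simp
    linear_combination (-1 : ℂ) * e1 + (2 * A) * e0
  simp only [← hres]
  -- the quotient is one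
  have hRd : (∑ r, (C (c r 0) + C (c r 1) * (X - C (u r))) * P r).degree < Q.degree := by
    rw [degree_eq_natDegree hQm.ne_zero, hQd]
    refine lt_of_le_of_lt (degree_sum_le _ _) ?_
    rw [Finset.sup_lt_iff (by exact_mod_cast WithBot.bot_lt_coe _)]
    intro r _
    have h1 : (C (c r 0) + C (c r 1) * (X - C (u r))).degree ≤ 1 := by
      refine (degree_add_le _ _).trans (max_le (degree_C_le.trans zero_le_one) ?_)
      refine (degree_mul_le _ _).trans ?_
      rw [degree_X_sub_C]
      exact (add_le_add degree_C_le le_rfl).trans (by simp)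
    refine lt_of_le_of_lt (degree_mul_le _ _) ?_
    rw [degree_eq_natDegree (hPm r).ne_zero, hPd]
    refine lt_of_le_of_lt (add_le_add h1 le_rfl) ?_
    exact_mod_cast (by omega : 1 + (2 * n - 2) < 2 * n)
  -- Both `f` and `Q` are monic of degree 2n, so division of `f` by `Q` has quotient 1 and remainder
  -- `f - Q`; uniqueness identifies this remainder with the partial fraction part.
  have u1 := div_modByMonic_unique (f := f) q _ hQm ⟨by rw [hfq']; ring, hRd⟩
  have u2 := div_modByMonic_unique (f := f) 1 (f - Q) hQm ⟨by ring, by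
    have : Q.degree = f.degree := by
      rw [degree_eq_natDegree hQm.ne_zero, degree_eq_natDegree hfm.ne_zero, hQd, hfd]
    rw [this]
    exact degree_sub_lt_left this.symm hfm.ne_zero (by rw [hfm.leadingCoeff, hQm.leadingCoeff])⟩
  have hR := u1.2.symm.trans u2.2
  -- The coefficient of X^(2n-1) is the sum of the residues on one side and, by Vieta, the
  -- difference of the root sums of `Q` and `f` on the other.
  have hco := congrArg (fun p => p.coeff (2 * n - 1)) hR
  simp only [finsetSum_coeff, coeff_sub] at hco
  have k1 : ∀ r, ((C (c r 0) + C (c r 1) * (X - C (u r))) * P r).coeff (2 * n - 1) = c r 1 := by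
    intro r
    have m1 : ((X - C (u r)) * P r).coeff (2 * n - 1) = 1 := by
      have hm := (monic_X_sub_C (u r)).mul (hPm r)
      have hd : ((X - C (u r)) * P r).natDegree = 2 * n - 1 := by
        rw [(monic_X_sub_C (u r)).natDegree_mul (hPm r), hPd, natDegree_X_sub_C]
        omega
      have := hm.coeff_natDegree
      rwa [hd] at this
    rw [add_mul, coeff_add, coeff_C_mul, mul_assoc, coeff_C_mul, m1,
      coeff_eq_zero_of_natDegree_lt (by rw [hPd]; omega)]
    ring
  have k2 : f.coeff (2 * n - 1) = -∑ i, x i := by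
    have := prod_X_sub_C_coeff_card_pred (Finset.univ : Finset κ) x (by
      rw [Finset.card_univ, hcard]; omega)
    rwa [Finset.card_univ, hcard] at this
  have k3 : Q.coeff (2 * n - 1) = -(2 * ∑ r, u r) := by
    have e : Q = ∏ p : ι × Bool, (X - C (u p.1)) := by
      rw [Fintype.prod_prod_type]
      simp [hQ, sq]
    have := prod_X_sub_C_coeff_card_pred (Finset.univ : Finset (ι × Bool)) (fun p => u p.1) (by
      rw [Finset.card_univ, Fintype.card_prod, Fintype.card_bool]; omega)
    rw [Finset.card_univ, Fintype.card_prod, Fintype.card_bool, ← hn, mul_comm n 2, ← e] at this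
    rw [this, Fintype.sum_prod_type]
    simp [← two_mul, mul_sum]
  simp only [k1] at hco
  rw [hco, k2, k3]
  ring

end Residues

/-- Only the pairs containing `r` contribute, and symmetry of `F` lets `r` be written first in each.
-/
theorem prod_pairs {ι : Type*} [Fintype ι] [LinearOrder ι] (F : ι → ι → ℂ)
    (hF : ∀ p q, F p q = F q p) (r : ι) (h1 : ∀ p q, p ≠ r → q ≠ r → F p q = 1) :
    ∏ p, ∏ q with p < q, F p q = ∏ s ∈ Finset.univ.erase r, F r s := by
  have e : ∀ p, ∏ q with p < q, F p q = (∏ q, if p < q then (if p = r then F r q else 1) else 1) *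
      ∏ q, if p < q then (if q = r then F p r else 1) else 1 := by
    intro p
    rw [Finset.prod_filter, ← prod_mul_distrib]
    refine prod_congr rfl fun q _ => ?_
    by_cases hpq : p < q
    · simp only [if_pos hpq]
      by_cases hp : p = r
      · subst hp; simp [hpq.ne']
      · by_cases hq : q = r
        · subst hq; simp [hp]
        · simp [hp, hq, h1 p q hp hq]
    · simp [hpq]
  have e1 : ∏ p, ∏ q, (if p < q then (if p = r then F r q else 1) else 1) =
      ∏ q, if r < q then F r q else 1 := by
    rw [Finset.prod_eq_single_of_mem r (Finset.mem_univ r)]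
    · simp
    · intro p _ hp; simp [hp]
  have e2 : ∏ p, ∏ q, (if p < q then (if q = r then F p r else 1) else 1) =
      ∏ p, if p < r then F p r else 1 := by
    refine prod_congr rfl fun p _ => ?_
    rw [Finset.prod_eq_single_of_mem r (Finset.mem_univ r)]
    · simp
    · intro q _ hq; simp [hq]
  simp only [e]
  rw [prod_mul_distrib, e1, e2, ← prod_mul_distrib,
    ← Finset.mul_prod_erase _ _ (Finset.mem_univ r)]
  simp only [lt_self_iff_false, if_false, one_mul]
  refine prod_congr rfl fun s hs => ?_
  rcases lt_or_gt_of_ne (Finset.ne_of_mem_erase hs) with h | h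
  · rw [if_neg h.not_gt, if_pos h, one_mul, hF]
  · rw [if_pos h, if_neg h.not_gt, mul_one]

theorem two_mul_sum_pairs {ι : Type*} [Fintype ι] [LinearOrder ι] (F : ι → ι → ℂ)
    (hF : ∀ p q, F p q = F q p) :
    2 * ∑ p, ∑ q with p < q, F p q = ∑ p, ∑ q, F p q - ∑ p, F p p := by
  have e1 : ∑ p, ∑ q with p < q, F p q = ∑ p, ∑ q, if p < q then F p q else 0 := by
    simp only [sum_filter]
  have e2 : ∑ p, ∑ q with p < q, F p q = ∑ p, ∑ q, if q < p then F p q else 0 := by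
    rw [e1, Finset.sum_comm]
    exact sum_congr rfl fun p _ => sum_congr rfl fun q _ => by rw [hF]
  have e3 : ∑ p, F p p = ∑ p, ∑ q, if p = q then F p q else 0 := by
    simp
  rw [two_mul]
  nth_rewrite 1 [e1]
  rw [e2, e3, ← sum_add_distrib, ← sum_sub_distrib]
  refine sum_congr rfl fun p _ => ?_
  rw [← sum_add_distrib, ← sum_sub_distrib]
  refine sum_congr rfl fun q _ => ?_
  rcases lt_trichotomy p q with h | h | h
  · simp [h, h.not_gt, h.ne]
  · simp [h]
  · simp [h, h.not_gt, h.ne']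

/-- Symmetrization turns the summand into (u_r² - u_s²)/(u_r - u_s) = u_r + u_s; the diagonal, zero
by convention, accounts for the -1. -/
theorem sum_sum_sq_mul_inv {ι : Type*} [Fintype ι] [DecidableEq ι] (u : ι → ℂ)
    (hu : Injective u) :
    ∑ r, ∑ s, u r ^ 2 * (u r - u s)⁻¹ = (Fintype.card ι - 1) * ∑ r, u r := by
  have h1 : ∑ r, ∑ s, u r ^ 2 * (u r - u s)⁻¹ = ∑ r, ∑ s, -(u s ^ 2 * (u r - u s)⁻¹) := by
    rw [Finset.sum_comm]
    refine sum_congr rfl fun r _ => sum_congr rfl fun s _ => ?_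
    rw [← neg_sub (u r) (u s), inv_neg]; ring
  have h2 : ∑ r, ∑ s, (u r ^ 2 * (u r - u s)⁻¹ + -(u s ^ 2 * (u r - u s)⁻¹)) =
      ∑ r, ∑ s, (u r + u s - if r = s then 2 * u r else 0) := by
    refine sum_congr rfl fun r _ => sum_congr rfl fun s _ => ?_
    by_cases hrs : r = s
    · subst hrs; simp; ring
    · have h3 := sub_ne_zero.2 (hu.ne hrs)
      rw [if_neg hrs]
      field_simp
      ring
  simp only [sum_add_distrib, sum_sub_distrib, Finset.sum_ite_eq, Finset.mem_univ,
    if_true, Finset.sum_const, Finset.card_univ, nsmul_eq_mul, ← mul_sum] at h1 h2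
  rw [← h1] at h2
  simp only [← mul_sum]
  linear_combination h2 / 2

/-! ### The special conformal Ward identity -/

section Ward

variable {n : ℕ} {ι : Type*} [Fintype ι] [LinearOrder ι] {a b : ι → Fin n} {x : Fin n → ℝ} {t : ℂ}

/-- Total derivative of the integrand times ∏_i (u_r - x_i) / ∏_{s ≠ r} (u_r - u_s)². The shifts are
chosen so that the new charges 1 - 4t and 8t - 2 are in the ratio 1 : -2 of the shifts themselves;
hence 1 - 4t factors out and the residue at u_r remains. -/
theorem mean_residue (h : Config a b x) (ht : t.re ≤ -1) (r : ι) :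
    mean a b (fun _ _ => -(4 * t)) (fun _ _ => 8 * t) x (fun θ => (1 - 4 * t) *
      ((∏ i, (rpt a b x 1 θ r - x i)) *
        (∏ s ∈ Finset.univ.erase r, (rpt a b x 1 θ r - rpt a b x 1 θ s) ^ 2)⁻¹ *
        (∑ i, (rpt a b x 1 θ r - x i)⁻¹ - 2 * ∑ s, (rpt a b x 1 θ r - rpt a b x 1 θ s)⁻¹))) = 0 := by
  set k : ι → Fin n → ℤ := fun s _ => if s = r then 1 else 0 with hk
  set l : ι → ι → ℤ := fun p q => if p = r ∨ q = r then -2 else 0 with hl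
  have hB : Big a b 2 fun s i => -(4 * t) + k s i := by
    have h4 : ∀ s i, ((2 : ℕ) : ℝ) ≤ (-(4 * t) + k s i).re := by
      intro s i
      have : (-(4 * t)).re = -4 * t.re := by
        rw [Complex.neg_re, show (4 : ℂ) = ((4 : ℝ) : ℂ) by norm_num, Complex.re_ofReal_mul]
        ring
      rw [Complex.add_re, this, Complex.intCast_re, hk]
      simp only
      split_ifs <;> push_cast <;> linarith
    exact fun s => ⟨h4 s (a s), h4 s (b s)⟩
  have h1 := integral_logDer_single (ν := fun p q => 8 * t + l p q) h one_pos hB r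
  set K : ℂ := (-I) ^ n * (-1) ^ (Finset.univ.erase r).card with hK
  have hK0 : K ≠ 0 := mul_ne_zero (pow_ne_zero _ (by simp)) (pow_ne_zero _ (by norm_num))
  refine (mul_eq_zero.1 ?_).resolve_left hK0
  rw [← h1, mean, ← integral_const_mul]
  refine setIntegral_congr_fun measurableSet_openBox fun θ hθ => ?_
  rw [density_shift (μ := fun _ _ => -(4 * t)) (ν := fun _ _ => 8 * t) h one_pos k l hθ]
  have e1 : ∏ s, ∏ i, (-I * (rpt a b x 1 θ s - x i)) ^ k s i =
      (-I) ^ n * ∏ i, (rpt a b x 1 θ r - x i) := by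
    rw [Finset.prod_eq_single_of_mem r (Finset.mem_univ r)]
    · simp only [hk, if_true, zpow_one, prod_mul_distrib, Finset.prod_const,
        Finset.card_univ, Fintype.card_fin]
    · intro s _ hs; simp [hk, hs]
  have e2 : ∏ p, ∏ q with p < q, (-I * (rpt a b x 1 θ p - rpt a b x 1 θ q)) ^ l p q =
      (-1) ^ (Finset.univ.erase r).card *
        (∏ s ∈ Finset.univ.erase r, (rpt a b x 1 θ r - rpt a b x 1 θ s) ^ 2)⁻¹ := by
    rw [prod_pairs _ _ r, ← Finset.prod_const, ← Finset.prod_inv_distrib, ← prod_mul_distrib]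
    · refine prod_congr rfl fun s _ => ?_
      simp only [hl, true_or, if_true]
      rw [zpow_neg, show (2 : ℤ) = ((2 : ℕ) : ℤ) by norm_num, zpow_natCast, mul_pow, neg_sq,
        Complex.I_sq, neg_one_mul, inv_neg, neg_one_mul]
    · intro p q hp hq; simp [hl, hp, hq]
    · intro p q
      simp only [hl, or_comm (a := p = r)]
      split_ifs
      · rw [zpow_neg, zpow_neg, show (2 : ℤ) = ((2 : ℕ) : ℤ) by norm_num, zpow_natCast, zpow_natCast]
        congr 1
        ring
      · simp
  rw [e1, e2, logDer_right_single]
  · have e3 : ∑ i, (-(4 * t) + k r i) * (rpt a b x 1 θ r - x i)⁻¹ +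
        ∑ s, (8 * t + l r s) * (rpt a b x 1 θ r - rpt a b x 1 θ s)⁻¹ = (1 - 4 * t) *
        (∑ i, (rpt a b x 1 θ r - x i)⁻¹ - 2 * ∑ s, (rpt a b x 1 θ r - rpt a b x 1 θ s)⁻¹) := by
      simp only [hk, hl, true_or, if_true, ← mul_sum]
      push_cast
      ring
    rw [e3, hK]
    ring
  · intro p q; simp only [hl, or_comm (a := p = r)]

/-- Total derivative of u_r² times the integrand, the infinitesimal special conformal motion of the
screening variable. -/
theorem mean_square (h : Config a b x) (ht : t.re ≤ -1) (r : ι) :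
    mean a b (fun _ _ => -(4 * t)) (fun _ _ => 8 * t) x (fun θ => 2 * rpt a b x 1 θ r +
      rpt a b x 1 θ r ^ 2 * (∑ i, -(4 * t) * (rpt a b x 1 θ r - x i)⁻¹ +
        ∑ s, 8 * t * (rpt a b x 1 θ r - rpt a b x 1 θ s)⁻¹)) = 0 := by
  have hB : Big a b 2 (fun _ _ => -(4 * t)) := big_const (by push_cast; linarith)
  set w : ℝ → ℂ := fun y => (x (a r) : ℂ) + (x (b r) - x (a r)) * ((sin (y / 2) : ℝ) *
    ((sin (y / 2) : ℝ) + I * (1 : ℝ) * (cos (y / 2) : ℝ))) with hw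
  set v : ℝ → ℂ := fun y => (x (b r) - x (a r) : ℂ) * ((sin (y / 2) : ℝ) *
    (cos (y / 2) : ℝ) + I * (1 : ℝ) *
      ((cos (y / 2) : ℝ) ^ 2 - (sin (y / 2) : ℝ) ^ 2) / 2) with hv
  have hwd : ∀ y, HasDerivAt w (v y) y := by
    intro y
    have h1 := hasDerivAt_ofReal_sin_half y
    have h2 := hasDerivAt_ofReal_cos_half y
    refine (((h1.fun_mul (h1.fun_add (h2.const_mul (I * (1 : ℝ))))).const_mul
      (x (b r) - x (a r) : ℂ)).const_add (x (a r) : ℂ)).congr_deriv ?_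
    simp only [hv]
    ring
  have key := (integral_total_derivative (ν := fun _ _ => 8 * t) h one_pos hB r
    (c := fun y => w y ^ 2) (c' := fun y => 2 * w y * v y)
    (fun y => ((hwd y).fun_pow 2).congr_deriv (by simp)) (by
      simp only [hw, hv]; fun_prop)).2
  rw [← key, mean]
  refine setIntegral_congr_fun measurableSet_openBox fun θ hθ => ?_
  have e1 : w (θ r) = rpt a b x 1 θ r := rfl
  have e2 : v (θ r) = rvel a b x 1 θ r := rfl
  have e3 : rvel a b x 1 θ r ≠ 0 := vel_ne_zero (h.lt r) one_pos
  simp only [e1, e2]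
  rw [logDer_right_single fun _ _ => rfl, mul_div_cancel_right₀ _ e3]

/-- The special conformal Ward identity, for very negative values of the parameter. -/
theorem ward_of_re_le (h : Config a b x) (hx : StrictMono x) (ht : t.re ≤ -1)
    (hcard : n = 2 * Fintype.card ι) :
    dpt a b (fun i => (x i : ℂ) ^ 2) ((fun i => (x i : ℂ)), t) +
      (6 * t - 1) * (∑ i, (x i : ℂ)) * screened a b ((fun i => (x i : ℂ)), t) = 0 := by
  have hB : Big a b 2 (fun _ _ => -(4 * t)) := big_const (by push_cast; linarith)
  have hM := fun r i => adm_inv_rpt_sub h (one_pos : (0 : ℝ) < 1) r i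
  have hpair : ∀ r, Adm 1 fun θ => ∑ s, (rpt a b x 1 θ r - rpt a b x 1 θ s)⁻¹ := by
    refine fun r => Adm.sum _ fun s _ => ?_
    by_cases hrs : r = s
    · subst hrs; simpa using Adm.const 0 1
    · exact (adm_inv_rpt_sub_rpt h one_pos hrs).mono (by norm_num)
  have hu : ∀ r, Adm 0 fun θ => rpt a b x 1 θ r := fun r =>
    Adm.of_closedBox (continuous_rpt r).continuousOn
  have hres : ∀ r, Adm 2 fun θ => (1 - 4 * t) *
      ((∏ i, (rpt a b x 1 θ r - x i)) *
        (∏ s ∈ Finset.univ.erase r, (rpt a b x 1 θ r - rpt a b x 1 θ s) ^ 2)⁻¹ *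
        (∑ i, (rpt a b x 1 θ r - x i)⁻¹ - 2 * ∑ s, (rpt a b x 1 θ r - rpt a b x 1 θ s)⁻¹)) := by
    intro r
    have h1 : Adm 0 fun θ => (∏ i, (rpt a b x 1 θ r - x i)) *
        (∏ s ∈ Finset.univ.erase r, (rpt a b x 1 θ r - rpt a b x 1 θ s) ^ 2)⁻¹ := by
      refine Adm.of_closedBox (ContinuousOn.mul (Continuous.continuousOn ?_)
        (ContinuousOn.inv₀ (Continuous.continuousOn ?_) fun θ hθ => ?_))
      · exact continuous_finsetProd _ fun i _ => (continuous_rpt r).sub continuous_const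
      · exact continuous_finsetProd _ fun s _ => ((continuous_rpt r).sub (continuous_rpt s)).pow 2
      · rw [Finset.prod_ne_zero_iff]
        exact fun s hs => pow_ne_zero 2
          (rpt_sub_rpt_ne_zero h one_pos hθ (Finset.ne_of_mem_erase hs).symm)
    have h2 : Adm 1 fun θ => ∑ i, (rpt a b x 1 θ r - x i)⁻¹ -
        2 * ∑ s, (rpt a b x 1 θ r - rpt a b x 1 θ s)⁻¹ := by
      simpa [sub_eq_add_neg] using (Adm.sum _ fun i _ => hM r i).add ((hpair r).const_mul (-2))
    exact ((h1.mul h2).const_mul _).mono (by norm_num)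
  have hsq : ∀ r, Adm 2 fun θ => 2 * rpt a b x 1 θ r +
      rpt a b x 1 θ r ^ 2 * (∑ i, -(4 * t) * (rpt a b x 1 θ r - x i)⁻¹ +
        ∑ s, 8 * t * (rpt a b x 1 θ r - rpt a b x 1 θ s)⁻¹) := by
    intro r
    refine (((hu r).const_mul 2).mono (Nat.zero_le 2)).add (Adm.mono ?_ (show 1 ≤ 2 by norm_num))
    have h0 : Adm 0 fun θ => rpt a b x 1 θ r ^ 2 :=
      Adm.of_closedBox ((continuous_rpt r).pow 2).continuousOn
    have h1 : Adm 1 fun θ => ∑ i, -(4 * t) * (rpt a b x 1 θ r - x i)⁻¹ +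
        ∑ s, 8 * t * (rpt a b x 1 θ r - rpt a b x 1 θ s)⁻¹ := by
      simp only [← mul_sum]
      exact ((Adm.sum _ fun i _ => hM r i).const_mul _).add ((hpair r).const_mul _)
    simpa using h0.mul h1
  have hlin : Adm 2 fun θ => (∑ i, ∑ j with i < j, 2 * t * (((x j : ℂ) ^ 2 - (x i : ℂ) ^ 2) /
      (x j - x i))) + 4 * t * ∑ r, ∑ i, (x i : ℂ) ^ 2 * (rpt a b x 1 θ r - x i)⁻¹ :=
    (Adm.const _ 2).add ((Adm.mono (Adm.sum _ fun r _ => Adm.sum _ fun i _ =>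
      (hM r i).const_mul _) (by norm_num)).const_mul _)
  rw [dpt_eq_mean h hx ht, screened_eq_mean, mul_left_comm, ← mul_add, ← mean_const_mul,
    ← mean_add h hB hlin ((Adm.const 1 2).const_mul _)]
  refine mul_eq_zero_of_right _ ?_
  -- After subtracting the derivatives of u_r² f, what is left of the Ward identity is (1 - 4t)(2 ∑
  -- u_r - ∑ x_i). By `sum_residues` this is the sum of the terms of `mean_residue`.
  have z1 : mean a b (fun _ _ => -(4 * t)) (fun _ _ => 8 * t) x (fun θ =>
      (-1) * (∑ r, (2 * rpt a b x 1 θ r +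
      rpt a b x 1 θ r ^ 2 * (∑ i, -(4 * t) * (rpt a b x 1 θ r - x i)⁻¹ +
        ∑ s, 8 * t * (rpt a b x 1 θ r - rpt a b x 1 θ s)⁻¹))) + ∑ r, (1 - 4 * t) *
      ((∏ i, (rpt a b x 1 θ r - x i)) *
        (∏ s ∈ Finset.univ.erase r, (rpt a b x 1 θ r - rpt a b x 1 θ s) ^ 2)⁻¹ *
        (∑ i, (rpt a b x 1 θ r - x i)⁻¹ -
          2 * ∑ s, (rpt a b x 1 θ r - rpt a b x 1 θ s)⁻¹))) = 0 := by
    rw [mean_add h hB ((Adm.sum _ fun r _ => hsq r).const_mul _) (Adm.sum _ fun r _ => hres r),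
      mean_const_mul, mean_sum h hB _ fun r _ => hsq r, mean_sum h hB _ fun r _ => hres r,
      Finset.sum_eq_zero fun r _ => mean_square h ht r,
      Finset.sum_eq_zero fun r _ => mean_residue h ht r]
    simp
  rw [← z1]
  refine mean_congr fun θ hθ => ?_
  set u : ι → ℂ := rpt a b x 1 θ with hudef
  have hui : Injective u := fun r s hrs => by
    by_contra hne
    exact rpt_sub_rpt_ne_zero h one_pos (openBox_subset_closedBox hθ) hne (sub_eq_zero.2 hrs)
  have hux : ∀ r i, u r - x i ≠ 0 := fun r i => rpt_sub_ne_zero h one_pos hθ r i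
  have hxi : Injective fun i => (x i : ℂ) := Complex.ofReal_injective.comp hx.injective
  rw [← mul_sum, sum_residues u (fun i => (x i : ℂ)) hui
    (fun r i => sub_ne_zero.1 (hux r i)) (by simpa using hcard)]
  have s1 : ∑ i, ∑ j with i < j, 2 * t * (((x j : ℂ) ^ 2 - (x i : ℂ) ^ 2) / (x j - x i)) =
      2 * t * ((n - 1) * ∑ i, (x i : ℂ)) := by
    have e1 : ∀ i j, i < j → 2 * t * (((x j : ℂ) ^ 2 - (x i : ℂ) ^ 2) / (x j - x i)) =
        2 * t * (x i + x j) := by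
      intro i j hij
      have h3 : (x j : ℂ) - x i ≠ 0 := sub_ne_zero.2 (hxi.ne hij.ne')
      field_simp
      ring
    have e2 := two_mul_sum_pairs (fun i j => 2 * t * ((x i : ℂ) + x j)) fun i j => by ring
    have e3 : ∑ i, ∑ j with i < j, 2 * t * (((x j : ℂ) ^ 2 - (x i : ℂ) ^ 2) / (x j - x i)) =
        ∑ i, ∑ j with i < j, 2 * t * ((x i : ℂ) + x j) :=
      sum_congr rfl fun i _ => sum_congr rfl fun j hj =>
        e1 i j (Finset.mem_filter.1 hj).2
    rw [e3]
    simp only [← mul_sum, sum_add_distrib, Finset.sum_const, Finset.card_univ,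
      Fintype.card_fin, nsmul_eq_mul] at e2 ⊢
    linear_combination e2 / 2
  have s2 : ∑ r, (2 * u r + u r ^ 2 * (∑ i, -(4 * t) * (u r - x i)⁻¹ +
      ∑ s, 8 * t * (u r - u s)⁻¹)) = 2 * ∑ r, u r - 4 * t * (∑ r, ∑ i, u r ^ 2 * (u r - x i)⁻¹) +
      8 * t * ((Fintype.card ι - 1) * ∑ r, u r) := by
    rw [← sum_sum_sq_mul_inv u hui]
    simp only [sum_add_distrib, mul_add, mul_sum]
    have : ∀ r i, u r ^ 2 * (-(4 * t) * (u r - x i)⁻¹) = -(4 * t * (u r ^ 2 * (u r - x i)⁻¹)) :=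
      fun r i => by ring
    simp only [this, Finset.sum_neg_distrib]
    rw [sub_eq_add_neg, add_assoc]
    congr 2
    exact sum_congr rfl fun r _ => sum_congr rfl fun s _ => by ring
  have s3 : ∑ r, ∑ i, (x i : ℂ) ^ 2 * (u r - x i)⁻¹ = ∑ r, ∑ i, u r ^ 2 * (u r - x i)⁻¹ -
      (n * ∑ r, u r + Fintype.card ι * ∑ i, (x i : ℂ)) := by
    have e1 : ∀ r i, (x i : ℂ) ^ 2 * (u r - x i)⁻¹ = u r ^ 2 * (u r - x i)⁻¹ - (u r + x i) := by
      intro r i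
      have := hux r i
      field_simp
      ring
    simp only [e1, sum_sub_distrib, sum_add_distrib, Finset.sum_const,
      Finset.card_univ, Fintype.card_fin, nsmul_eq_mul, ← mul_sum]
  have hn : (n : ℂ) = 2 * Fintype.card ι := by exact_mod_cast hcard
  rw [s1, s2, s3, hn]
  ring

/-- Continuation in t of `ward_of_re_le`, exactly as for the BPZ equations. -/
theorem ward (h : Config a b x) (hx : StrictMono x) (ht : t.re < 1 / 4)
    (hcard : n = 2 * Fintype.card ι) :
    dpt a b (fun i => (x i : ℂ) ^ 2) ((fun i => (x i : ℂ)), t) +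
      (6 * t - 1) * (∑ i, (x i : ℂ)) * screened a b ((fun i => (x i : ℂ)), t) = 0 := by
  have hcomp : ∀ {f : (Fin n → ℂ) × ℂ → ℂ}, DifferentiableOn ℂ f (dom a b) →
      DifferentiableOn ℂ (fun t => f ((fun i => (x i : ℂ)), t)) {t | t.re < 1 / 4} :=
    fun hf => hf.comp (f := fun t : ℂ => ((fun i => (x i : ℂ)), t)) (by fun_prop)
      fun t ht => h.mem_dom hx ht
  refine eq_zero_of_re_lt (c := 1 / 4) (m := -1) (f := fun t =>
    dpt a b (fun i => (x i : ℂ) ^ 2) ((fun i => (x i : ℂ)), t) +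
      (6 * t - 1) * (∑ i, (x i : ℂ)) * screened a b ((fun i => (x i : ℂ)), t)) ?_
    (fun t ht => ward_of_re_le h hx ht hcard) ht
  refine (hcomp (differentiableOn_dpt _)).add (DifferentiableOn.mul ?_
    (hcomp differentiableOn_screened))
  fun_prop

end Ward

/-! ### Translations and dilations of the integrand -/

section Affine

variable {P ι : Type*} [Fintype P] [DecidableEq P] [Fintype ι] [LinearOrder ι] {a b : ι → P}
  {x : P → ℝ} {η : ℝ} {μ : ι → P → ℂ} {ν : ι → ι → ℂ}

theorem pt_add (x : P → ℂ) (c η : ℂ) (S C : ι → ℂ) (r : ι) :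
    pt a b (fun i => x i + c) η S C r = pt a b x η S C r + c := by
  simp only [pt]; ring

theorem density_add (μ : ι → P → ℂ) (ν : ι → ι → ℂ) (x : P → ℂ) (c η : ℂ) (θ : ι → ℝ) :
    density a b μ ν (fun i => x i + c) η θ = density a b μ ν x η θ := by
  simp only [density, expReg, logReg, vel, pt_add, add_sub_add_right_eq_sub]

theorem pt_mul (x : P → ℂ) (c η : ℂ) (S C : ι → ℂ) (r : ι) :
    pt a b (fun i => c * x i) η S C r = c * pt a b x η S C r := by
  simp only [pt]; ring

theorem density_mul (h : Config a b x) (hη : 0 < η) {c : ℝ} (hc : 0 < c) {θ : ι → ℝ}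
    (hθ : θ ∈ openBox ι) :
    density a b μ ν (fun i => ((c * x i : ℝ) : ℂ)) η θ =
      exp (Real.log c * (∑ r, ∑ i, μ r i + ∑ r, ∑ s with r < s, ν r s + Fintype.card ι)) *
        density a b μ ν (fun i => (x i : ℂ)) η θ := by
  have hr := h.regSlit hη (openBox_subset_closedBox hθ)
  have hlog : ∀ {z : ℂ}, z ∈ slitPlane →
      log (c * z) = Real.log c + log z := fun hz =>
    Complex.log_ofReal_mul hc (Complex.slitPlane_ne_zero hz)
  have e0 : (fun i => ((c * x i : ℝ) : ℂ)) = fun i => (c : ℂ) * (x i : ℂ) := by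
    funext i; push_cast; ring
  have e1 : ∀ r i, logReg a b (fun i => (c : ℂ) * (x i : ℂ)) η (sn θ) (cs θ) r i =
      Real.log c + logReg a b (fun i => (x i : ℂ)) η (sn θ) (cs θ) r i := by
    intro r i
    unfold logReg
    split_ifs with h1 h2
    · rw [← mul_sub, hlog (hr.diff r)]; ring
    · rw [← mul_sub, hlog (hr.diff r)]; ring
    · rw [pt_mul (a := a) (b := b) (fun i => (x i : ℂ)), ← mul_sub, mul_left_comm,
        hlog (hr.point r i h1 h2)]
  have e2 : expReg a b μ ν (fun i => (c : ℂ) * (x i : ℂ)) η (sn θ) (cs θ) =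
      Real.log c * (∑ r, ∑ i, μ r i + ∑ r, ∑ s with r < s, ν r s) +
        expReg a b μ ν (fun i => (x i : ℂ)) η (sn θ) (cs θ) := by
    unfold expReg
    have e3 : ∑ r, ∑ s with r < s, ν r s * log (-I *
        (pt a b (fun i => (c : ℂ) * (x i : ℂ)) η (sn θ) (cs θ) r -
          pt a b (fun i => (c : ℂ) * (x i : ℂ)) η (sn θ) (cs θ) s)) =
        ∑ r, ∑ s with r < s, (Real.log c * ν r s + ν r s * log (-I *
        (pt a b (fun i => (x i : ℂ)) η (sn θ) (cs θ) r -
          pt a b (fun i => (x i : ℂ)) η (sn θ) (cs θ) s))) := by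
      refine sum_congr rfl fun r _ => sum_congr rfl fun s hs => ?_
      rw [pt_mul (a := a) (b := b) (fun i => (x i : ℂ)), pt_mul (a := a) (b := b)
        (fun i => (x i : ℂ)), ← mul_sub, mul_left_comm,
        hlog (hr.pair r s (Finset.mem_filter.1 hs).2)]
      ring
    rw [e3]
    simp only [e1, mul_add, sum_add_distrib, ← mul_sum]
    simp only [← Finset.sum_mul]
    ring
  have e4 : ∏ r, vel a b (fun i => (c : ℂ) * (x i : ℂ)) η (sn θ) (cs θ) r =
      exp (Real.log c * Fintype.card ι) *
        ∏ r, vel a b (fun i => (x i : ℂ)) η (sn θ) (cs θ) r := by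
    have : ∀ r, vel a b (fun i => (c : ℂ) * (x i : ℂ)) η (sn θ) (cs θ) r =
        c * vel a b (fun i => (x i : ℂ)) η (sn θ) (cs θ) r := fun r => by
      simp only [vel]; ring
    simp only [this, prod_mul_distrib, Finset.prod_const, Finset.card_univ]
    rw [mul_comm ((Real.log c : ℝ) : ℂ), Complex.exp_nat_mul, ← Complex.ofReal_exp, Real.exp_log hc]
  have e5 : exp (Real.log c * (∑ r, ∑ i, μ r i + ∑ r, ∑ s with r < s, ν r s +
      Fintype.card ι)) = exp (Real.log c * (∑ r, ∑ i, μ r i + ∑ r, ∑ s with r < s, ν r s)) *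
      exp (Real.log c * Fintype.card ι) := by
    rw [← exp_add, ← mul_add]
  rw [e0, density, density, e2, e4, e5, exp_add]
  ring

end Affine

theorem constant_of_hasDerivAt_zero {f : ℝ → ℂ} (hf : ∀ s ∈ Icc (0 : ℝ) 1, HasDerivAt f 0 s) :
    f 1 = f 0 :=
  constant_of_has_deriv_right_zero (fun s hs => (hf s hs).continuousAt.continuousWithinAt)
    (fun s hs => (hf s (Ico_subset_Icc_self hs)).hasDerivWithinAt) 1 ⟨zero_le_one, le_rfl⟩

/-! ### Covariance under translations, dilations and special conformal maps -/

section Covariance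

variable {n : ℕ} {ι : Type*} [Fintype ι] [LinearOrder ι] {a b : ι → Fin n} {x : Fin n → ℝ} {t : ℝ}

theorem screened_add (x : Fin n → ℝ) (c : ℝ) (t : ℂ) :
    screened a b ((fun i => ((x i + c : ℝ) : ℂ)), t) = screened a b ((fun i => (x i : ℂ)), t) := by
  simp only [screened, vandC, Complex.ofReal_add, add_sub_add_right_eq_sub]
  simp only [density_add (a := a) (b := b) _ _ (fun i => (x i : ℂ))]

theorem sum_pairs_const {ι : Type*} [Fintype ι] [LinearOrder ι] (c : ℂ) :
    ∑ r : ι, ∑ s with r < s, c = c * (Fintype.card ι * (Fintype.card ι - 1) / 2) := by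
  have := two_mul_sum_pairs (fun _ _ : ι => c) fun _ _ => rfl
  simp only [Finset.sum_const, Finset.card_univ, nsmul_eq_mul] at this ⊢
  linear_combination this / 2

/-- Power counting with n = 2N points and N variables: the quadratic terms in N cancel and the
exponent is N(1 - 6t) = -2Nh. -/
theorem screened_mul (h : Config a b x) (hx : StrictMono x) (hcard : n = 2 * Fintype.card ι)
    {c : ℝ} (hc : 0 < c) (t : ℝ) :
    screened a b ((fun i => ((c * x i : ℝ) : ℂ)), (t : ℂ)) =
      exp (Real.log c * (Fintype.card ι * (1 - 6 * t))) *
        screened a b ((fun i => (x i : ℂ)), (t : ℂ)) := by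
  have e1 : vandC (t : ℂ) (fun i => ((c * x i : ℝ) : ℂ)) =
      exp (Real.log c * (2 * t * (n * (n - 1) / 2))) * vandC (t : ℂ) (fun i => (x i : ℂ)) := by
    rw [vandC, vandC, ← exp_add]
    congr 1
    have e2 : ∑ i, ∑ j with i < j, 2 * (t : ℂ) * log (((c * x j : ℝ) : ℂ) - (c * x i : ℝ)) =
        ∑ i, ∑ j with i < j, (Real.log c * (2 * t) + 2 * (t : ℂ) * log (x j - x i)) := by
      refine sum_congr rfl fun i _ => sum_congr rfl fun j hj => ?_
      have hd : 0 < x j - x i := sub_pos.2 (hx (Finset.mem_filter.1 hj).2)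
      rw [← Complex.ofReal_sub, ← mul_sub, Complex.ofReal_mul, Complex.log_ofReal_mul hc
        (by exact_mod_cast hd.ne'), Complex.ofReal_sub]
      ring
    rw [e2]
    simp only [sum_add_distrib]
    rw [sum_pairs_const, Fintype.card_fin]
    ring
  simp only [screened]
  rw [e1, setIntegral_congr_fun measurableSet_openBox fun θ hθ =>
    density_mul (μ := fun _ _ => -(4 * (t : ℂ))) (ν := fun _ _ => 8 * (t : ℂ)) h one_pos hc hθ,
    integral_const_mul, mul_mul_mul_comm, ← exp_add, sum_pairs_const]
  congr 2
  simp only [Finset.sum_const, Finset.card_univ, Fintype.card_fin, nsmul_eq_mul]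
  have hn : (n : ℂ) = 2 * Fintype.card ι := by exact_mod_cast hcard
  rw [hn]
  ring

/-- Covariance under the maps `z ↦ z / (1 + c z)`. -/
theorem screened_inversion (hcfg : ∀ x : Fin n → ℝ, StrictMono x → Config a b x)
    (hx : StrictMono x) (ht : t < 1 / 4) (hcard : n = 2 * Fintype.card ι) {c : ℝ}
    (hc : ∀ i, 0 < 1 + c * x i) :
    screened a b ((fun i => (x i : ℂ)), (t : ℂ)) =
      exp (((1 - 6 * t) * ∑ i, Real.log (1 + c * x i) : ℝ)) *
        screened a b ((fun i => ((x i / (1 + c * x i) : ℝ) : ℂ)), (t : ℂ)) := by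
  have hpos : ∀ s ∈ Icc (0 : ℝ) 1, ∀ i, 0 < 1 + s * c * x i := by
    rintro s ⟨h0, h1⟩ i
    have e : 1 + s * c * x i = (1 - s) + s * (1 + c * x i) := by ring
    rw [e]
    rcases h0.eq_or_lt with h | h
    · rw [← h]; norm_num
    · exact add_pos_of_nonneg_of_pos (sub_nonneg.2 h1) (mul_pos h (hc i))
  -- The orbit of the special conformal flow from `x` at `s = 0` to the image at `s = 1`; its
  -- velocity is -c w², the direction of the Ward identity.
  set w : ℝ → Fin n → ℝ := fun s i => x i / (1 + s * c * x i) with hw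
  have hmono : ∀ s ∈ Icc (0 : ℝ) 1, StrictMono (w s) := by
    intro s hs i j hij
    simp only [hw]
    rw [div_lt_div_iff₀ (hpos s hs i) (hpos s hs j)]
    nlinarith [hx hij]
  have hwd : ∀ s ∈ Icc (0 : ℝ) 1, ∀ i, HasDerivAt (fun s => w s i) (-(c * w s i ^ 2)) s := by
    intro s hs i
    have h1 : HasDerivAt (fun s : ℝ => 1 + s * c * x i) (c * x i) s := by
      simpa using (((hasDerivAt_id s).mul_const c).mul_const (x i)).const_add 1
    have := (hasDerivAt_const s (x i)).fun_div h1 (hpos s hs i).ne'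
    refine this.congr_deriv ?_
    have := (hpos s hs i).ne'
    simp only [hw]
    field_simp
    ring
  have hld : ∀ s ∈ Icc (0 : ℝ) 1, HasDerivAt (fun s => (1 - 6 * t) *
      ∑ i, Real.log (1 + s * c * x i)) ((1 - 6 * t) * ∑ i, c * w s i) s := by
    intro s hs
    refine HasDerivAt.const_mul _ (HasDerivAt.fun_sum fun i _ => ?_)
    have h1 : HasDerivAt (fun s : ℝ => 1 + s * c * x i) (c * x i) s := by
      simpa using (((hasDerivAt_id s).mul_const c).mul_const (x i)).const_add 1
    refine (h1.log (hpos s hs i).ne').congr_deriv ?_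
    simp only [hw]
    ring
  have ht' : ((t : ℂ)).re < 1 / 4 := by simpa using ht
  -- The derivative of this function is -c times its exponential factor times the left side of
  -- `ward` at `w s`, hence zero.
  have key := constant_of_hasDerivAt_zero (f := fun s =>
    exp (((1 - 6 * t) * ∑ i, Real.log (1 + s * c * x i) : ℝ)) *
      screened a b ((fun i => (w s i : ℂ)), (t : ℂ))) (by
    intro s hs
    have hd := (hcfg _ (hmono s hs)).mem_dom (hmono s hs) ht'
    have h1 : HasFDerivAt (screened a b) (fderiv ℂ (screened a b) ((fun i => (w s i : ℂ)), (t : ℂ)))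
        ((fun i => (w s i : ℂ)), (t : ℂ)) :=
      ((differentiableOn_screened _ hd).differentiableAt (isOpen_dom.mem_nhds hd)).hasFDerivAt
    have h2 : HasDerivAt (fun s : ℝ => ((fun i => (w s i : ℂ)), (t : ℂ)))
        ((-(c : ℂ)) • ((fun i => (w s i : ℂ) ^ 2), (0 : ℂ))) s := by
      have e : (-(c : ℂ)) • ((fun i => (w s i : ℂ) ^ 2), (0 : ℂ)) =
          ((fun i => ((-(c * w s i ^ 2) : ℝ) : ℂ)), (0 : ℂ)) := by
        rw [Prod.smul_mk, smul_zero]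
        congr 1
        funext i
        simp
      rw [e]
      refine HasDerivAt.prodMk ?_ (hasDerivAt_const _ _)
      rw [hasDerivAt_pi]
      exact fun i => (hwd s hs i).ofReal_comp
    have h3 := (h1.restrictScalars ℝ).comp_hasDerivAt s h2
    have h4 := (hld s hs).ofReal_comp.cexp
    refine (h4.fun_mul h3).congr_deriv ?_
    have hW := ward (hcfg _ (hmono s hs)) (hmono s hs) ht' hcard
    simp only [ContinuousLinearMap.coe_restrictScalars', map_smul, smul_eq_mul, dpt,
      Function.comp_apply] at hW ⊢
    push_cast
    rw [← mul_sum]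
    linear_combination (-(c : ℂ)) * exp ((1 - 6 * (t : ℂ)) *
      ∑ i, ((Real.log (1 + s * c * x i) : ℝ) : ℂ)) * hW)
  simp only [hw, one_mul, zero_mul, add_zero, Real.log_one, Finset.sum_const_zero, mul_zero,
    Complex.ofReal_zero, Complex.exp_zero, div_one] at key
  exact key.symm

end Covariance

namespace LinkPattern

variable {N : ℕ} (β : LinkPattern N)

theorem card_link : Fintype.card β.Link = N := by
  have h1 : Fintype.card β.Link = (Finset.univ.filter fun i => i < β.pair i).card :=
    Fintype.card_subtype _
  have h2 : (Finset.univ.filter fun i => i < β.pair i).card =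
      (Finset.univ.filter fun i => ¬ i < β.pair i).card := by
    refine Finset.card_nbij' β.pair β.pair ?_ ?_ (fun i _ => β.pair_pair i) fun i _ => β.pair_pair i
    · intro i hi
      simp only [Finset.coe_filter, Finset.mem_univ, true_and, mem_ofPred_eq, β.pair_pair] at hi ⊢
      exact hi.not_gt
    · intro i hi
      simp only [Finset.coe_filter, Finset.mem_univ, true_and, mem_ofPred_eq, β.pair_pair] at hi ⊢
      exact lt_of_le_of_ne (not_lt.1 hi) (β.pair_ne i)
  have h3 := Finset.card_filter_add_card_filter_not (s := Finset.univ) fun i => i < β.pair i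
  rw [Finset.card_univ, Fintype.card_fin] at h3
  omega

theorem deriv_mobius {a b c d y : ℝ} (h : c * y + d ≠ 0) :
    deriv (mobius a b c d) y = (a * d - b * c) / (c * y + d) ^ 2 := by
  have h1 : HasDerivAt (fun y : ℝ => a * y + b) a y := by
    simpa using ((hasDerivAt_id y).const_mul a).add_const b
  have h2 : HasDerivAt (fun y : ℝ => c * y + d) c y := by
    simpa using ((hasDerivAt_id y).const_mul c).add_const d
  have := (h1.fun_div h2 h).deriv
  rw [show mobius a b c d = fun y => (a * y + b) / (c * y + d) from rfl, this]
  congr 1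
  ring

theorem mobius_sub {a b c d y w : ℝ} (h : c * y + d ≠ 0) (h' : c * w + d ≠ 0) :
    mobius a b c d y - mobius a b c d w =
      (a * d - b * c) * (y - w) / ((c * y + d) * (c * w + d)) := by
  rw [mobius, mobius, div_sub_div _ _ h h']
  congr 1
  ring

/-- Relative to the first point x_o, the Möbius map decomposes into the translation by -x_o, a map
z/(1 + cz/e) with e = c x_o + d, the dilation by its derivative `A` at x_o, and a final translation.
-/
theorem mobiusCovariant {κ : ℝ} (hκ : 4 < κ) : MobiusCovariant κ (G κ β) := by
  intro x hx a b c d hΔ hne hφ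
  rcases Nat.eq_zero_or_pos N with hN | hN
  · subst hN
    have : IsEmpty (Fin (2 * 0)) := by rw [mul_zero]; infer_instance
    rw [Subsingleton.elim (fun i => mobius a b c d (x i)) x]
    simp
  set o : Fin (2 * N) := ⟨0, by omega⟩ with ho
  set e := c * x o + d with he
  have he0 : e ≠ 0 := hne o
  set A := (a * d - b * c) / e ^ 2 with hA
  have hA0 : 0 < A := div_pos hΔ (by positivity)
  -- Preservation of the order means that no point is beyond the pole of the map: every c x_i + d
  -- has the sign of c x_o + d.
  have hsign : ∀ i, 0 < 1 + c / e * (x i - x o) := by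
    intro i
    have e1 : 1 + c / e * (x i - x o) = (c * x i + d) / e := by
      field_simp; rw [he]; ring
    rw [e1]
    rcases lt_trichotomy i o with h | h | h
    · exact absurd h (by simp [ho, Fin.lt_def])
    · rw [h, ← he, div_self he0]; norm_num
    · have h1 := hφ h
      have h2 := hx h
      have h3 : mobius a b c d (x i) - mobius a b c d (x o) =
          (a * d - b * c) * (x i - x o) / e ^ 2 / ((c * x i + d) / e) := by
        rw [mobius_sub (hne i) he0, ← he]
        have := hne i
        generalize c * x i + d = D at *
        field_simp
      have h4 : 0 < mobius a b c d (x i) - mobius a b c d (x o) := sub_pos.2 h1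
      rw [h3] at h4
      refine (div_pos_iff_of_pos_left ?_).1 h4
      exact div_pos (mul_pos hΔ (sub_pos.2 h2)) (by positivity)
  set z : Fin (2 * N) → ℝ := fun i => x i + (-x o) with hz
  have hzm : StrictMono z := fun i j hij => by simpa [hz] using hx hij
  have hzs : ∀ i, 0 < 1 + c / e * z i := fun i => by
    simpa [hz, sub_eq_add_neg] using hsign i
  set y : Fin (2 * N) → ℝ := fun i => z i / (1 + c / e * z i) with hy
  have hym : StrictMono y := by
    intro i j hij
    simp only [hy]
    rw [div_lt_div_iff₀ (hzs i) (hzs j)]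
    nlinarith [hzm hij]
  have hφy : (fun i => mobius a b c d (x i)) = fun i => A * y i + mobius a b c d (x o) := by
    funext i
    have h1 := hne i
    have e1 : 1 + c / e * z i = (c * x i + d) / e := by
      simp only [hz]
      field_simp; rw [he]; ring
    rw [← sub_eq_iff_eq_add, mobius_sub h1 he0, ← he]
    simp only [hy, hA]
    rw [e1]
    simp only [hz, ← sub_eq_add_neg]
    generalize c * x i + d = D at *
    field_simp
  have ht : 1 / κ < 1 / 4 := one_div_lt_one_div_of_lt (by norm_num) hκ
  have hcard : 2 * N = 2 * Fintype.card β.Link := by rw [β.card_link]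
  have hcfg : ∀ x : Fin (2 * N) → ℝ, StrictMono x → Config β.lo β.hi x := fun x hx => β.config hx
  rw [β.G_eq_screened κ hx, β.G_eq_screened κ hφ, hφy]
  simp only
  rw [screened_add (fun i => A * y i), screened_mul (hcfg y hym) hym hcard hA0,
    ← screened_add x (-x o), screened_inversion hcfg hzm ht hcard hzs]
  have hprod : ((∏ i, deriv (mobius a b c d) (x i) ^ weight κ : ℝ) : ℂ) =
      exp (((1 - 6 * (1 / κ)) * ∑ i, Real.log (1 + c / e * z i) : ℝ)) *
        exp (-(Real.log A * (N * (1 - 6 * ((1 / κ : ℝ) : ℂ))))) := by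
    have h1 : ∀ i, deriv (mobius a b c d) (x i) ^ weight κ =
        Real.exp (Real.log A * weight κ + (1 - 6 * (1 / κ)) * Real.log (1 + c / e * z i)) := by
      intro i
      have e1 : 1 + c / e * z i = (c * x i + d) / e := by
        simp only [hz]
        field_simp; rw [he]; ring
      have e2 : deriv (mobius a b c d) (x i) = A / (1 + c / e * z i) ^ 2 := by
        rw [deriv_mobius (hne i), e1, hA]
        have := hne i
        field_simp
      have h2 := hzs i
      rw [e2, Real.rpow_def_of_pos (by positivity), Real.log_div hA0.ne' (by positivity),
        Real.log_pow]
      congr 1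
      have : κ ≠ 0 := by linarith
      simp only [weight]
      field_simp
      push_cast
      ring
    simp only [h1]
    rw [← Real.exp_sum, Complex.ofReal_exp, ← exp_add]
    congr 1
    rw [sum_add_distrib, ← mul_sum _ _ (1 - 6 * (1 / κ))]
    simp only [Finset.sum_const, Finset.card_univ, Fintype.card_fin, nsmul_eq_mul, weight]
    have : (κ : ℂ) ≠ 0 := by exact_mod_cast (by linarith : κ ≠ 0)
    generalize ∑ i, Real.log (1 + c / e * z i) = T
    push_cast
    field_simp
    ring
  rw [hprod, β.card_link, Complex.exp_neg]
  change _ * (_ * screened β.lo β.hi ((fun i => (y i : ℂ)), _)) = _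
  generalize screened β.lo β.hi _ = S
  have := Complex.exp_ne_zero (Real.log A * (N * (1 - 6 * ((1 / κ : ℝ) : ℂ))))
  field_simp

end LinkPattern

/-! ### Independence of the eccentricity of the contours -/

section Eccentricity

variable {P ι : Type*} [Fintype P] [DecidableEq P] [Fintype ι] [LinearOrder ι] {a b : ι → P}
  {x : P → ℝ} {η : ℝ}

/-- Cauchy's theorem in disguise: `hasDerivAt_integral_moving` with resting points gives derivative
zero in η. -/
theorem integral_density_eccentricity_of_re_le (h : Config a b x) (hη : 0 < η) {t : ℂ}
    (ht : t.re ≤ -1) :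
    ∫ θ in openBox ι, density a b (fun _ _ => -(4 * t)) (fun _ _ => 8 * t) (fun i => (x i : ℂ)) η θ =
    ∫ θ in openBox ι, density a b (fun _ _ => -(4 * t)) (fun _ _ => 8 * t) (fun i => (x i : ℂ))
      (1 : ℝ) θ := by
  have hB : Big a b 2 (fun _ _ => -(4 * t)) := by
    have h4 : ((2 : ℕ) : ℝ) ≤ (-(4 * t)).re := by
      rw [Complex.neg_re, show (4 : ℂ) = ((4 : ℝ) : ℂ) by norm_num, Complex.re_ofReal_mul]
      push_cast
      linarith
    exact fun r => ⟨h4, h4⟩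
  set φ : ℂ → ℂ := fun e => ∫ θ in openBox ι, density a b (fun _ _ => -(4 * t)) (fun _ _ => 8 * t)
    (fun i => (x i : ℂ)) e θ with hφ
  have hd : ∀ s : ℝ, 0 < s → HasDerivAt φ 0 s := by
    intro s hs
    have h1 := hasDerivAt_integral_moving (ν := fun _ _ => 8 * t) h hs hB 0 1
    have h2 : ∀ θ : ι → ℝ, logDer (fun _ _ => -(4 * t)) (fun _ _ => 8 * t) (fun i => (x i : ℂ))
        (rpt a b x s θ) 0 0 = 0 := fun θ => by simp [logDer]
    simp only [h2, zero_mul, integral_zero, Pi.zero_apply, mul_zero, add_zero, mul_one] at h1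
    have h3 : HasDerivAt (fun y : ℂ => φ (s + y)) 0 0 := h1
    simpa using (HasDerivAt.comp_sub_const (s : ℂ) (s : ℂ) (f := fun y => φ (s + y)) (f' := 0)
      (by simpa using h3))
  -- The substitution η = exp s turns the half-line η > 0 into ℝ, where a zero derivative implies
  -- constancy.
  have hc : ∀ s : ℝ, HasDerivAt (fun s : ℝ => φ ((Real.exp s : ℝ) : ℂ)) 0 s := by
    intro s
    have := (hd (Real.exp s) (Real.exp_pos s)).comp_ofReal.scomp s (Real.hasDerivAt_exp s)
    rw [smul_zero] at this
    exact this
  have := is_const_of_deriv_eq_zero (fun s => (hc s).differentiableAt) (fun s => (hc s).deriv)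
    (Real.log η) 0
  simpa [Real.exp_log hη] using this

/-- The integral does not depend on the eccentricity of the contours. -/
theorem integral_density_eccentricity (h : Config a b x) (hη : 0 < η) {t : ℂ} (ht : t.re < 1 / 4) :
    ∫ θ in openBox ι, density a b (fun _ _ => -(4 * t)) (fun _ _ => 8 * t) (fun i => (x i : ℂ)) η θ =
    ∫ θ in openBox ι, density a b (fun _ _ => -(4 * t)) (fun _ _ => 8 * t) (fun i => (x i : ℂ))
      (1 : ℝ) θ := by
  have hd : ∀ {η : ℝ}, 0 < η → DifferentiableOn ℂ (fun t => ∫ θ in openBox ι, density a b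
      (fun _ _ => -(4 * t)) (fun _ _ => 8 * t) (fun i => (x i : ℂ)) η θ) {t | t.re < 1 / 4} := by
    intro η hη t ht
    have h4 : -1 < (-(4 * t)).re := by
      rw [Complex.neg_re, show (4 : ℂ) = ((4 : ℝ) : ℂ) by norm_num, Complex.re_ofReal_mul]
      have : t.re < 1 / 4 := ht
      linarith
    exact (differentiableAt_integral_density (Z := ℂ) (a := a) (b := b)
      (x := fun _ i => (x i : ℂ)) (η := fun _ => (η : ℂ)) (μ := fun q _ _ => -(4 * q))
      (ν := fun q _ _ => 8 * q) (z := t) (fun i => by fun_prop) (by fun_prop)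
      (fun _ _ => by fun_prop) (fun _ _ => by fun_prop) (fun θ hθ => h.regSlit hη hθ)
      (fun _ => h4) (fun _ => h4)).2.differentiableWithinAt
  refine sub_eq_zero.1 (eq_zero_of_re_lt ((hd hη).sub (hd one_pos)) (m := -1) (fun t ht => ?_) ht)
  exact sub_eq_zero.2 (integral_density_eccentricity_of_re_le h hη ht)

end Eccentricity

/-! ### Integrability of products of powers of distances -/

section Powers

theorem integrableOn_abs_sub_rpow {p : ℝ} (hp : -1 < p) (c A B : ℝ) :
    IntegrableOn (fun y : ℝ => |y - c| ^ p) (Ioo A B) := by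
  have h0 : ∀ R : ℝ, 0 < R → IntegrableOn (fun y : ℝ => |y| ^ p) (Ioo 0 R) := fun R hR =>
    ((intervalIntegral.integrableOn_Ioo_rpow_iff hR).2 hp).congr_fun
      (fun y hy => by simp only [abs_of_pos hy.1]) measurableSet_Ioo
  have h1 : ∀ R : ℝ, 0 < R → IntegrableOn (fun y : ℝ => |y| ^ p) (Ioo (-R) 0) := fun R hR => by
    have := ((Measure.measurePreserving_neg (volume : Measure ℝ)).integrableOn_comp_preimage
      (Homeomorph.neg ℝ).measurableEmbedding).2 (h0 R hR)
    simpa [Function.comp_def] using this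
  obtain ⟨R, hR, hA, hB⟩ : ∃ R : ℝ, 0 < R ∧ -R ≤ A - c ∧ B - c ≤ R :=
    ⟨|A - c| + |B - c| + 1, by positivity, by linarith [neg_abs_le (A - c), abs_nonneg (B - c)],
      by linarith [le_abs_self (B - c), abs_nonneg (A - c)]⟩
  have h2 : IntegrableOn (fun y : ℝ => |y| ^ p) (Ioo (-R) R) := by
    rw [← Ioc_union_Ioo_eq_Ioo (neg_lt_zero.2 hR).le hR]
    refine IntegrableOn.union ?_ (h0 R hR)
    rw [integrableOn_Ioc_iff_integrableOn_Ioo]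
    exact h1 R hR
  have h3 := ((measurePreserving_sub_right volume c).integrableOn_comp_preimage
      (MeasurableEquiv.subRight c).measurableEmbedding).2 h2
  refine IntegrableOn.mono_set h3 fun y hy => ?_
  constructor <;> simp only <;> linarith [hy.1, hy.2]

variable {P : Type*} [Fintype P] [DecidableEq P]

theorem measurable_prod_abs_sub_rpow (x p : P → ℝ) :
    Measurable fun y : ℝ => ∏ i, |y - x i| ^ p i :=
  measurable_prod _ fun _ _ => ((measurable_id.sub_const _).abs).pow_const _

/-- Let x_k be nearest to y. Every other x_i is at distance at least |x_i - x_k|/2 from y, so only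
one factor can be singular. The summand 1 covers the empty product. -/
theorem prod_abs_sub_rpow_le {x p : P → ℝ} (hx : Injective x) (hp : ∀ i, p i ≤ 0)
    (y : ℝ) :
    ∏ i, |y - x i| ^ p i ≤
      1 + ∑ k, (∏ i ∈ Finset.univ.erase k, (|x i - x k| / 2) ^ p i) * |y - x k| ^ p k := by
  have hnn : ∀ k, 0 ≤ (∏ i ∈ Finset.univ.erase k, (|x i - x k| / 2) ^ p i) * |y - x k| ^ p k :=
    fun k => mul_nonneg (prod_nonneg fun i _ => by positivity) (by positivity)
  rcases isEmpty_or_nonempty P with hP | hP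
  · simp
  obtain ⟨k, hk⟩ := Finite.exists_min fun i => |y - x i|
  refine le_trans ?_ (le_trans (Finset.single_le_sum (f := fun k =>
    (∏ i ∈ Finset.univ.erase k, (|x i - x k| / 2) ^ p i) * |y - x k| ^ p k) (fun k _ => hnn k)
    (Finset.mem_univ k)) (by linarith))
  rw [← Finset.prod_erase_mul _ _ (Finset.mem_univ k)]
  refine mul_le_mul_of_nonneg_right (prod_le_prod (fun i _ => by positivity) fun i hi => ?_)
    (by positivity)
  have hik : x i ≠ x k := fun e => (Finset.ne_of_mem_erase hi) (hx e)
  refine Real.rpow_le_rpow_of_nonpos (by have := abs_pos.2 (sub_ne_zero.2 hik); linarith) ?_ (hp i)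
  have h1 : |x i - x k| ≤ |y - x i| + |y - x k| := by
    rw [← abs_neg (y - x i)]
    refine le_trans (le_of_eq ?_) (abs_add_le _ _)
    congr 1; ring
  linarith [hk i]

theorem integrableOn_prod_abs_sub_rpow {x p : P → ℝ} (hx : Injective x)
    (hp : ∀ i, p i ≤ 0) (hp' : ∀ i, -1 < p i) (A B : ℝ) :
    IntegrableOn (fun y : ℝ => ∏ i, |y - x i| ^ p i) (Ioo A B) := by
  have h1 : IntegrableOn (fun y : ℝ => 1 + ∑ k, (∏ i ∈ Finset.univ.erase k,
      (|x i - x k| / 2) ^ p i) * |y - x k| ^ p k) (Ioo A B) :=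
    (integrable_const _).add (integrable_finsetSum _ fun k _ =>
      (integrableOn_abs_sub_rpow (hp' k) (x k) A B).const_mul _)
  refine Integrable.mono' h1 (measurable_prod_abs_sub_rpow x p).aestronglyMeasurable ?_
  refine .of_forall fun y => ?_
  rw [Real.norm_of_nonneg (prod_nonneg fun i _ => by positivity)]
  exact prod_abs_sub_rpow_le hx hp y

end Powers

/-! ### Flattening the contours onto the real line -/

section Flattening

theorem ae_apply_ne_apply {ι : Type*} [Fintype ι] {r s : ι} (h : r ≠ s) :
    ∀ᵐ X : ι → ℝ, X r ≠ X s := by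
  classical
  have h1 := Measure.addHaar_submodule (volume : Measure (ι → ℝ))
    (LinearMap.ker ((LinearMap.proj r : (ι → ℝ) →ₗ[ℝ] ℝ) - LinearMap.proj s)) (by
      intro h2
      have h3 : (Pi.single r 1 : ι → ℝ) ∈ LinearMap.ker
          ((LinearMap.proj r : (ι → ℝ) →ₗ[ℝ] ℝ) - LinearMap.proj s) := h2 ▸ Submodule.mem_top
      simp [LinearMap.mem_ker, h.symm] at h3)
  refine measure_mono_null (fun X hX => ?_) h1
  simp only [mem_compl_iff, mem_ofPred_eq, not_not] at hX
  simp [LinearMap.mem_ker, hX]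

theorem ae_injective (ι : Type*) [Fintype ι] : ∀ᵐ X : ι → ℝ, Injective X := by
  have : ∀ᵐ X : ι → ℝ, ∀ r s, r ≠ s → X r ≠ X s :=
    ae_all_iff.2 fun r => ae_all_iff.2 fun s => by
      by_cases h : r = s
      · simp [h]
      · simpa [h] using ae_apply_ne_apply h
  filter_upwards [this] with X hX r s e
  by_contra h
  exact hX r s h e

theorem norm_exp_mul_log (c : ℝ) {z : ℂ} (hz : z ≠ 0) :
    ‖exp (c * log z)‖ = ‖z‖ ^ c := by
  rw [Complex.norm_exp, Complex.re_ofReal_mul, Complex.log_re,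
    Real.rpow_def_of_pos (norm_pos_iff.2 hz), mul_comm]

/-- As η → 0 the factors L and R at the two ends may both degenerate in the limit, but the velocity
V compensates: V ≤ 1 and V ≤ LR imply V ≤ V^A ≤ (LR)^A. The bound obtained does not involve η. -/
theorem endpoint_bound {D S C η A : ℝ} (hD : 0 < D) (hS : 0 < S) (hC : 0 < C)
    (hSC : S ^ 2 + C ^ 2 = 1) (hη : 0 < η) (hη1 : η ≤ 1) (hA : 0 < A) (hA1 : A < 1) :
    (D * ‖(η * C - I * S : ℂ)‖ * S) ^ (-A) *
      (D * ‖(η * S + I * C : ℂ)‖ * C) ^ (-A) *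
      (D * ‖(S * C + I * η * (C ^ 2 - S ^ 2) / 2 : ℂ)‖) ≤
    D ^ (1 - A) * (D * (S * C)) ^ (-A) := by
  set L := ‖(η * C - I * S : ℂ)‖ with hL
  set R := ‖(η * S + I * C : ℂ)‖ with hR
  set V := ‖(S * C + I * η * (C ^ 2 - S ^ 2) / 2 : ℂ)‖ with hV
  have eL : L ^ 2 = (η * C) ^ 2 + S ^ 2 := by
    rw [hL, ← Complex.normSq_eq_norm_sq, Complex.normSq_apply]; simp; ring
  have eR : R ^ 2 = (η * S) ^ 2 + C ^ 2 := by
    rw [hR, ← Complex.normSq_eq_norm_sq, Complex.normSq_apply]; simp; ring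
  have eV : V ^ 2 = (S * C) ^ 2 + (η * (C ^ 2 - S ^ 2) / 2) ^ 2 := by
    rw [hV, show (S * C + I * η * (C ^ 2 - S ^ 2) / 2 : ℂ) =
      ((S * C : ℝ) : ℂ) + ((η * (C ^ 2 - S ^ 2) / 2 : ℝ) : ℂ) * I by push_cast; ring,
      ← Complex.normSq_eq_norm_sq, Complex.normSq_add_mul_I]
  have hL0 : 0 < L := by
    have := norm_nonneg (η * C - I * S : ℂ)
    rcases this.lt_or_eq with h | h
    · exact h
    · rw [← hL] at h; rw [← h] at eL; nlinarith [sq_nonneg (η * C), pow_pos hS 2]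
  have hR0 : 0 < R := by
    have := norm_nonneg (η * S + I * C : ℂ)
    rcases this.lt_or_eq with h | h
    · exact h
    · rw [← hR] at h; rw [← h] at eR; nlinarith [sq_nonneg (η * S), pow_pos hC 2]
  have hV0 : 0 ≤ V := norm_nonneg _
  have hV1 : V ≤ 1 := by
    rw [← abs_of_nonneg hV0, ← sq_le_one_iff_abs_le_one, eV]
    have h1 : η ^ 2 ≤ 1 := pow_le_one₀ hη.le hη1
    have h2 : (C ^ 2 - S ^ 2) ^ 2 ≤ 1 := by nlinarith [sq_nonneg (S * C)]
    have h3 : (S * C) ^ 2 ≤ 1 / 4 := by nlinarith [sq_nonneg (C ^ 2 - S ^ 2)]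
    have h4 : (η * (C ^ 2 - S ^ 2) / 2) ^ 2 ≤ 1 / 4 := by
      rw [show (η * (C ^ 2 - S ^ 2) / 2) ^ 2 = η ^ 2 * (C ^ 2 - S ^ 2) ^ 2 / 4 by ring]
      have := mul_le_mul h1 h2 (sq_nonneg _) zero_le_one
      linarith
    linarith
  have hVLR : V ≤ L * R := by
    refine (sq_le_sq₀ hV0 (by positivity)).1 ?_
    rw [mul_pow, eL, eR, eV]
    have e1 : ((η * C) ^ 2 + S ^ 2) * ((η * S) ^ 2 + C ^ 2) =
      (S * C * (1 + η ^ 2)) ^ 2 + (η * (C ^ 2 - S ^ 2)) ^ 2 := by ring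
    rw [e1]
    have h2 : (S * C) ^ 2 ≤ (S * C * (1 + η ^ 2)) ^ 2 := by
      refine pow_le_pow_left₀ (by positivity) ?_ 2
      exact le_mul_of_one_le_right (by positivity) (by nlinarith [sq_nonneg η])
    nlinarith [sq_nonneg (η * (C ^ 2 - S ^ 2))]
  have hVA : V ≤ (L * R) ^ A := by
    rcases hV0.lt_or_eq with h | h
    · calc V = V ^ (1 : ℝ) := (Real.rpow_one V).symm
        _ ≤ V ^ A := Real.rpow_le_rpow_of_exponent_ge h hV1 hA1.le
        _ ≤ (L * R) ^ A := Real.rpow_le_rpow hV0 hVLR hA.le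
    · rw [← h]; positivity
  have e2 : (D * L * S) ^ (-A) * (D * R * C) ^ (-A) =
      D ^ (-A) * (D * (S * C)) ^ (-A) * (L * R) ^ (-A) := by
    rw [← Real.mul_rpow (by positivity) (by positivity), ← Real.mul_rpow hD.le (by positivity),
      ← Real.mul_rpow (by positivity) (by positivity)]
    congr 1; ring
  have e3 : D ^ (1 - A) = D * D ^ (-A) := by
    rw [sub_eq_add_neg, Real.rpow_add hD, Real.rpow_one]
  rw [e2, e3]
  have h5 : (L * R) ^ (-A) * V ≤ 1 := by
    rw [Real.rpow_neg (by positivity), inv_mul_le_iff₀ (by positivity), mul_one]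
    exact hVA
  calc D ^ (-A) * (D * (S * C)) ^ (-A) * (L * R) ^ (-A) * (D * V)
      = (D * D ^ (-A) * (D * (S * C)) ^ (-A)) * ((L * R) ^ (-A) * V) := by ring
    _ ≤ (D * D ^ (-A) * (D * (S * C)) ^ (-A)) * 1 :=
        mul_le_mul_of_nonneg_left h5 (by positivity)
    _ = _ := by ring

variable {P ι : Type*} [Fintype P] [DecidableEq P] [Fintype ι] [LinearOrder ι] {a b : ι → P}
  {x : P → ℝ} {η t : ℝ} {θ : ι → ℝ}

/-- The real parts of the points of the contours. -/
def flat (a b : ι → P) (x : P → ℝ) (θ : ι → ℝ) (r : ι) : ℝ :=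
  x (a r) + (x (b r) - x (a r)) * sin (θ r / 2) ^ 2

/-- The integrand on the real line, as boundary value from the upper half-plane. -/
def flatDensity (t : ℝ) (x : P → ℝ) (X : ι → ℝ) : ℂ :=
  exp (∑ r, ∑ i, -(4 * (t : ℂ)) * log (-I * (X r - x i)) +
    ∑ r, ∑ s with r < s, 8 * (t : ℂ) * log (-I * (X r - X s)))

theorem norm_density (h : Config a b x) (hη : 0 < η) (hθ : θ ∈ openBox ι) :
    ‖density a b (fun _ _ => -(4 * (t : ℂ))) (fun _ _ => 8 * (t : ℂ)) (fun i => (x i : ℂ)) η θ‖ =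
      (∏ r, ((∏ i, ‖rpt a b x η θ r - x i‖ ^ (-(4 * t))) * ‖rvel a b x η θ r‖)) *
      ∏ r, ∏ s with r < s, ‖rpt a b x η θ r - rpt a b x η θ s‖ ^ (8 * t) := by
  rw [density_eq _ _ _ _ _ hθ, norm_mul, expFull, exp_add, norm_mul, prod_mul_distrib,
    norm_prod, exp_sum, exp_sum, norm_prod, norm_prod, mul_right_comm]
  congr 1
  · congr 1
    refine prod_congr rfl fun r _ => ?_
    rw [exp_sum, norm_prod]
    refine prod_congr rfl fun i _ => ?_
    rw [logFull_eq h hη hθ, show (-(4 * (t : ℂ))) = ((-(4 * t) : ℝ) : ℂ) by push_cast; ring,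
      norm_exp_mul_log _ (mul_ne_zero (neg_ne_zero.2 Complex.I_ne_zero)
        (rpt_sub_ne_zero h hη hθ r i))]
    simp
  · refine prod_congr rfl fun r _ => ?_
    rw [exp_sum, norm_prod]
    refine prod_congr rfl fun s hs => ?_
    rw [show (8 * (t : ℂ)) = ((8 * t : ℝ) : ℂ) by push_cast; ring,
      norm_exp_mul_log _ (mul_ne_zero (neg_ne_zero.2 Complex.I_ne_zero)
        (rpt_sub_rpt_ne_zero h hη (openBox_subset_closedBox hθ) (Finset.mem_filter.1 hs).2.ne))]
    simp

theorem prod_eq_prod_erase_erase_mul {M : Type*} [CommMonoid M] (f : P → M) {i k : P} (h : i ≠ k) :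
    ∏ j, f j = (∏ j ∈ (Finset.univ.erase i).erase k, f j) * f k * f i := by
  rw [Finset.prod_erase_mul _ _ (Finset.mem_erase.2 ⟨h.symm, Finset.mem_univ k⟩),
    Finset.prod_erase_mul _ _ (Finset.mem_univ i)]

theorem flat_sub_left (r : ι) :
    flat a b x θ r - x (a r) = (x (b r) - x (a r)) * sin (θ r / 2) ^ 2 := by
  rw [flat]; ring

theorem flat_sub_right (r : ι) :
    x (b r) - flat a b x θ r = (x (b r) - x (a r)) * cos (θ r / 2) ^ 2 := by
  rw [flat, Real.cos_sq']; ring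

/-- The exponents of the dominating function. -/
def domExp (a b : ι → P) (A : ℝ) (r : ι) (i : P) : ℝ :=
  if i = a r ∨ i = b r then -((A + 1) / 2) else -A

/-- A bound uniform in η ≤ 1 in terms of the real parts only. After extraction of the Jacobian D·SC
of `flat`, the power (D·SC)^(-(A+1)) remains; since (D·SC)² is the product of the distances to the
two endpoints, each gets the exponent -(A+1)/2, which still exceeds -1. -/
theorem prod_norm_mul_norm_rvel_le (h : Config a b x) (hη : 0 < η) (hη1 : η ≤ 1)
    (hθ : θ ∈ openBox ι) {A : ℝ} (hA : 0 < A) (hA1 : A < 1) (r : ι)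
    (hg : ∀ i, flat a b x θ r ≠ x i) :
    (∏ i, ‖rpt a b x η θ r - x i‖ ^ (-A)) * ‖rvel a b x η θ r‖ ≤
      (x (b r) - x (a r)) ^ (1 - A) *
        ((x (b r) - x (a r)) * (sin (θ r / 2) * cos (θ r / 2)) *
          ∏ i, |flat a b x θ r - x i| ^ domExp a b A r i) := by
  have hS := sin_half_pos (hθ r trivial)
  have hC := cos_half_pos (hθ r trivial)
  have hSC := Real.sin_sq_add_cos_sq (θ r / 2)
  have hD := sub_pos.2 (h.lt r)
  have hl := flat_sub_left (a := a) (b := b) (x := x) (θ := θ) r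
  have hr := flat_sub_right (a := a) (b := b) (x := x) (θ := θ) r
  have h1 : ‖rpt a b x η θ r - x (a r)‖ = (x (b r) - x (a r)) *
      ‖((η : ℂ) * (cos (θ r / 2) : ℝ) - I * (sin (θ r / 2) : ℝ))‖ *
        sin (θ r / 2) := by
    have e := congrArg norm (pt_sub_left (a := a) (b := b) (fun i => (x i : ℂ)) η (sn θ) (cs θ) r)
    simp only [norm_mul, norm_neg, Complex.norm_I, one_mul] at e
    rw [← Complex.ofReal_sub, Complex.norm_of_nonneg hD.le] at e
    rw [rpt, e]
    simp only [sn, cs, Complex.norm_of_nonneg hS.le]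
  have h2 : ‖rpt a b x η θ r - x (b r)‖ = (x (b r) - x (a r)) *
      ‖((η : ℂ) * (sin (θ r / 2) : ℝ) + I * (cos (θ r / 2) : ℝ))‖ *
        cos (θ r / 2) := by
    have e := congrArg norm (pt_sub_right (a := a) (b := b) (fun i => (x i : ℂ)) η
      (sn_sq_add_cs_sq θ r))
    simp only [norm_mul, norm_neg, Complex.norm_I, one_mul] at e
    rw [← Complex.ofReal_sub, Complex.norm_of_nonneg hD.le] at e
    rw [rpt, e]
    simp only [sn, cs, Complex.norm_of_nonneg hC.le]
  have h3 : ‖rvel a b x η θ r‖ = (x (b r) - x (a r)) *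
      ‖((sin (θ r / 2) : ℝ) * (cos (θ r / 2) : ℝ) + I * η *
        (((cos (θ r / 2) : ℝ) : ℂ) ^ 2 - (sin (θ r / 2) : ℝ) ^ 2) / 2 : ℂ)‖ := by
    rw [rvel, vel, norm_mul, ← Complex.ofReal_sub, Complex.norm_of_nonneg hD.le]
    rfl
  have key := endpoint_bound hD hS hC hSC hη hη1 hA hA1
  rw [prod_eq_prod_erase_erase_mul _ (h.ne r),
    prod_eq_prod_erase_erase_mul (fun i => |flat a b x θ r - x i| ^ domExp a b A r i) (h.ne r)]
  have h4 : ∏ i ∈ (Finset.univ.erase (a r)).erase (b r), ‖rpt a b x η θ r - x i‖ ^ (-A) ≤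
      ∏ i ∈ (Finset.univ.erase (a r)).erase (b r), |flat a b x θ r - x i| ^ domExp a b A r i := by
    refine prod_le_prod (fun i _ => by positivity) fun i hi => ?_
    have hi1 := Finset.mem_erase.1 hi
    have hi2 := Finset.mem_erase.1 hi1.2
    rw [domExp, if_neg (by simp [hi1.1, hi2.1])]
    refine Real.rpow_le_rpow_of_nonpos (abs_pos.2 (sub_ne_zero.2 (hg i))) ?_ (by linarith)
    refine le_trans (le_of_eq ?_) (Complex.abs_re_le_norm _)
    rw [Complex.sub_re, rpt, pt_re, Complex.ofReal_re, flat]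
  have h5 : |flat a b x θ r - x (b r)| ^ domExp a b A r (b r) *
      |flat a b x θ r - x (a r)| ^ domExp a b A r (a r) =
      ((x (b r) - x (a r)) * (sin (θ r / 2) * cos (θ r / 2))) ^ (-(A + 1)) := by
    rw [abs_sub_comm, hr, hl, abs_of_pos (by positivity), abs_of_pos (by positivity)]
    simp only [domExp, true_or, or_true, if_true]
    rw [← Real.mul_rpow (by positivity) (by positivity)]
    generalize sin (θ r / 2) = S at *
    generalize cos (θ r / 2) = C at *
    rw [show (x (b r) - x (a r)) * C ^ 2 * ((x (b r) - x (a r)) * S ^ 2) =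
      ((x (b r) - x (a r)) * (S * C)) ^ (2 : ℕ) by ring, ← Real.rpow_natCast,
      ← Real.rpow_mul (by positivity)]
    congr 1; push_cast; ring
  set Q := ∏ i ∈ (Finset.univ.erase (a r)).erase (b r), ‖rpt a b x η θ r - x i‖ ^ (-A) with hQ
  set Q' := ∏ i ∈ (Finset.univ.erase (a r)).erase (b r),
    |flat a b x θ r - x i| ^ domExp a b A r i with hQ'
  rw [mul_assoc Q', h5, h1, h2, h3]
  have hQ0 : 0 ≤ Q := prod_nonneg fun i _ => by positivity
  have e6 : ∀ z : ℝ, 0 < z → z ^ (-A) = z * z ^ (-(A + 1)) := fun z hz => by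
    rw [show -A = 1 + (-(A + 1)) by ring, Real.rpow_add hz, Real.rpow_one]
  rw [e6 ((x (b r) - x (a r)) * (sin (θ r / 2) * cos (θ r / 2))) (by positivity)] at key
  generalize sin (θ r / 2) = S at *
  generalize cos (θ r / 2) = C at *
  generalize (x (b r) - x (a r)) = D at *
  generalize ‖((η : ℂ) * (C : ℝ) - I * (S : ℝ))‖ = L at *
  generalize ‖((η : ℂ) * (S : ℝ) + I * (C : ℝ))‖ = R at *
  generalize ‖((S : ℝ) * (C : ℝ) + I * η * ((C : ℂ) ^ 2 - (S : ℝ) ^ 2) / 2 : ℂ)‖ = V at *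
  calc Q * (D * R * C) ^ (-A) * (D * L * S) ^ (-A) * (D * V)
      = Q * ((D * L * S) ^ (-A) * (D * R * C) ^ (-A) * (D * V)) := by ring
    _ ≤ Q * (D ^ (1 - A) * (D * (S * C) * (D * (S * C)) ^ (-(A + 1)))) :=
        mul_le_mul_of_nonneg_left key hQ0
    _ ≤ Q' * (D ^ (1 - A) * (D * (S * C) * (D * (S * C)) ^ (-(A + 1)))) :=
        mul_le_mul_of_nonneg_right h4 (by positivity)
    _ = _ := by ring

end Flattening

section Flattening

variable {P ι : Type*} [Fintype P] [DecidableEq P] [Fintype ι] [LinearOrder ι] {a b : ι → P}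
  {x : P → ℝ} {η t : ℝ} {θ : ι → ℝ}

theorem hasDerivAt_flat_apply (A D s : ℝ) :
    HasDerivAt (fun s : ℝ => A + D * sin (s / 2) ^ 2)
      (D * (sin (s / 2) * cos (s / 2))) s := by
  have h1 : HasDerivAt (fun s : ℝ => sin (s / 2)) (cos (s / 2) * (1 / 2)) s :=
    ((hasDerivAt_id s).div_const 2).sin
  have h2 := ((h1.fun_pow 2).const_mul D).const_add A
  refine h2.congr_deriv ?_
  push_cast
  ring

theorem hasFDerivAt_flat (θ : ι → ℝ) :
    HasFDerivAt (flat a b x) (ContinuousLinearMap.pi fun r =>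
      (((x (b r) - x (a r)) * (sin (θ r / 2) * cos (θ r / 2))) •
        ContinuousLinearMap.id ℝ ℝ).comp (ContinuousLinearMap.proj r)) θ := by
  rw [hasFDerivAt_pi']
  intro r
  have h1 := (hasDerivAt_flat_apply (x (a r)) (x (b r) - x (a r)) (θ r)).comp_hasFDerivAt θ
    (ContinuousLinearMap.proj (R := ℝ) (φ := fun _ : ι => ℝ) r).hasFDerivAt
  refine h1.congr_fderiv ?_
  ext v
  simp

theorem det_fderiv_flat (θ : ι → ℝ) :
    (ContinuousLinearMap.pi fun r => (((x (b r) - x (a r)) *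
      (sin (θ r / 2) * cos (θ r / 2))) • ContinuousLinearMap.id ℝ ℝ).comp
        (ContinuousLinearMap.proj (R := ℝ) (φ := fun _ : ι => ℝ) r)).det =
      ∏ r, (x (b r) - x (a r)) * (sin (θ r / 2) * cos (θ r / 2)) := by
  rw [ContinuousLinearMap.det_pi]
  refine prod_congr rfl fun r _ => ?_
  simp [ContinuousLinearMap.det]

theorem sin_half_sq_injOn : InjOn (fun s : ℝ => sin (s / 2) ^ 2) (Ioo 0 π) := by
  intro s hs s' hs' e
  have h1 : sin (s / 2) = sin (s' / 2) :=
    (sq_eq_sq₀ (sin_half_pos hs).le (sin_half_pos hs').le).1 e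
  have h2 := Real.injOn_sin (⟨by linarith [hs.1, Real.pi_pos], by linarith [hs.2]⟩ :
    s / 2 ∈ Icc (-(π / 2)) (π / 2))
    ⟨by linarith [hs'.1, Real.pi_pos], by linarith [hs'.2]⟩ h1
  linarith

theorem injOn_flat (h : Config a b x) : InjOn (flat a b x) (openBox ι) := by
  intro θ hθ θ' hθ' e
  funext r
  refine sin_half_sq_injOn (hθ r trivial) (hθ' r trivial) ?_
  have h1 := congrFun e r
  simp only [flat, add_right_inj] at h1
  exact mul_left_cancel₀ (sub_pos.2 (h.lt r)).ne' h1

/-- The product of the intervals between the linked points. -/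
def intervals (a b : ι → P) (x : P → ℝ) : Set (ι → ℝ) := univ.pi fun r => Ioo (x (a r)) (x (b r))

theorem flat_image (h : Config a b x) : flat a b x '' openBox ι = intervals a b x := by
  ext X
  constructor
  · rintro ⟨θ, hθ, rfl⟩ r -
    have h1 := flat_sub_left (a := a) (b := b) (x := x) (θ := θ) r
    have h2 := flat_sub_right (a := a) (b := b) (x := x) (θ := θ) r
    have hD := sub_pos.2 (h.lt r)
    have h3 := sin_half_pos (hθ r trivial)
    have h4 := cos_half_pos (hθ r trivial)
    constructor
    · have : 0 < (x (b r) - x (a r)) * sin (θ r / 2) ^ 2 := by positivity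
      linarith
    · have : 0 < (x (b r) - x (a r)) * cos (θ r / 2) ^ 2 := by positivity
      linarith
  · intro hX
    have : ∀ r, ∃ s ∈ Ioo (0 : ℝ) π,
        x (a r) + (x (b r) - x (a r)) * sin (s / 2) ^ 2 = X r := by
      intro r
      have hc : ContinuousOn (fun s : ℝ => x (a r) + (x (b r) - x (a r)) * sin (s / 2) ^ 2)
        (Icc 0 π) := by fun_prop
      have := intermediate_value_Ioo Real.pi_pos.le hc
      simp only [zero_div, Real.sin_zero, Real.sin_pi_div_two] at this
      have h2 := this (by simpa using hX r trivial : X r ∈ _)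
      exact h2
    choose θ hθ e using this
    exact ⟨θ, fun r _ => hθ r, funext fun r => e r⟩

/-- The map `flat` is injective on the open box with nonvanishing Jacobian, so by the
change-of-variables formula the preimage of a null set is null. -/
theorem ae_flat_of_ae (h : Config a b x) {p : (ι → ℝ) → Prop} (hp : ∀ᵐ X : ι → ℝ, p X) :
    ∀ᵐ θ ∂(volume.restrict (openBox ι)), p (flat a b x θ) := by
  obtain ⟨s, hs, hsm, hs0⟩ := exists_measurable_superset_of_null (ae_iff.1 hp)
  have h1 := lintegral_image_eq_lintegral_abs_det_fderiv_mul (volume : Measure (ι → ℝ))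
    measurableSet_openBox
    (fun θ _ => (hasFDerivAt_flat (a := a) (b := b) (x := x) θ).hasFDerivWithinAt) (injOn_flat h)
    (s.indicator 1)
  have h2 : ∫⁻ X in flat a b x '' openBox ι, s.indicator 1 X = 0 := by
    rw [lintegral_indicator hsm]
    simp only [Pi.one_apply, lintegral_one]
    rw [Measure.restrict_restrict hsm, Measure.restrict_apply_univ]
    exact measure_mono_null inter_subset_left hs0
  rw [h2] at h1
  have hcont : Continuous (flat a b x) := continuous_iff_continuousAt.2
    fun θ => (hasFDerivAt_flat θ).continuousAt
  have h3 := (lintegral_eq_zero_iff (by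
    refine Measurable.mul ?_ ((measurable_one.indicator hsm).comp hcont.measurable)
    simp only [det_fderiv_flat]
    refine (Continuous.measurable ?_).ennreal_ofReal
    fun_prop)).1 h1.symm
  filter_upwards [h3, ae_restrict_mem measurableSet_openBox] with θ hθ hb
  by_contra hn
  have h4 : flat a b x θ ∈ s := hs hn
  simp only [det_fderiv_flat, indicator_of_mem h4, Pi.one_apply, mul_one, Pi.zero_apply,
    ENNReal.ofReal_eq_zero] at hθ
  have h5 : 0 < ∏ r, (x (b r) - x (a r)) * (sin (θ r / 2) * cos (θ r / 2)) :=
    Finset.prod_pos fun r _ => mul_pos (sub_pos.2 (h.lt r))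
      (mul_pos (sin_half_pos (hb r trivial)) (cos_half_pos (hb r trivial)))
  have h6 := abs_pos.2 h5.ne'
  linarith

theorem integral_intervals (h : Config a b x) (g : (ι → ℝ) → ℂ) :
    ∫ X in intervals a b x, g X = ∫ θ in openBox ι,
      (∏ r, (((x (b r) - x (a r)) * (sin (θ r / 2) * cos (θ r / 2)) : ℝ) : ℂ)) *
        g (flat a b x θ) := by
  rw [← flat_image h, integral_image_eq_integral_abs_det_fderiv_smul (volume : Measure (ι → ℝ))
    measurableSet_openBox (fun θ _ => (hasFDerivAt_flat θ).hasFDerivWithinAt) (injOn_flat h)]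
  refine setIntegral_congr_fun measurableSet_openBox fun θ hθ => ?_
  simp only [det_fderiv_flat]
  rw [abs_of_nonneg (prod_nonneg fun r _ => mul_nonneg (sub_pos.2 (h.lt r)).le
    (mul_nonneg (sin_half_pos (hθ r trivial)).le (cos_half_pos (hθ r trivial)).le)),
    Complex.real_smul]
  push_cast
  rfl

theorem rpt_eq_flat (θ : ι → ℝ) (r : ι) : rpt a b x η θ r = flat a b x θ r + η * (I *
    ((x (b r) - x (a r)) * (sin (θ r / 2) * cos (θ r / 2)) : ℝ)) := by
  apply Complex.ext
  · rw [rpt, pt_re, Complex.add_re, Complex.re_ofReal_mul, Complex.re_mul_ofReal,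
      Complex.ofReal_re, Complex.I_re, zero_mul, mul_zero, add_zero, flat]
  · rw [rpt, pt_im, Complex.add_im, Complex.im_ofReal_mul, Complex.im_mul_ofReal]
    simp

theorem norm_rpt_le (h : Config a b x) (hη : 0 < η) (hη1 : η ≤ 1) (θ : ι → ℝ) (r : ι) :
    ‖rpt a b x η θ r‖ ≤ |x (a r)| + 2 * (x (b r) - x (a r)) := by
  have hD := sub_pos.2 (h.lt r)
  refine (Complex.norm_le_abs_re_add_abs_im _).trans ?_
  rw [rpt, pt_re, pt_im]
  have h1 : |(x (b r) - x (a r)) * sin (θ r / 2) ^ 2| ≤ x (b r) - x (a r) := by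
    rw [abs_of_nonneg (by positivity)]
    exact mul_le_of_le_one_right hD.le (Real.sin_sq_le_one _)
  have h2 : |η * ((x (b r) - x (a r)) * (sin (θ r / 2) * cos (θ r / 2)))| ≤
      x (b r) - x (a r) := by
    rw [abs_mul, abs_mul, abs_of_pos hη, abs_of_pos hD, abs_mul]
    have h3 := mul_le_mul (Real.abs_sin_le_one (θ r / 2)) (Real.abs_cos_le_one (θ r / 2))
      (abs_nonneg _) zero_le_one
    have h4 := mul_le_mul hη1 (mul_le_of_le_one_right hD.le (h3.trans_eq (one_mul 1)))
      (by positivity) zero_le_one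
    linarith
  have h3 := abs_add_le (x (a r)) ((x (b r) - x (a r)) * sin (θ r / 2) ^ 2)
  linarith

theorem integrableOn_domExp (h : Config a b x) {A : ℝ} (hA : 0 < A) (hA1 : A < 1) (r : ι) :
    IntegrableOn (fun s : ℝ => (x (b r) - x (a r)) * (sin (s / 2) * cos (s / 2)) *
      ∏ i, |x (a r) + (x (b r) - x (a r)) * sin (s / 2) ^ 2 - x i| ^ domExp a b A r i)
      (Ioo 0 π) := by
  have hD := sub_pos.2 (h.lt r)
  have h1 := integrableOn_prod_abs_sub_rpow (p := domExp a b A r) h.inj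
    (fun i => by rw [domExp]; split_ifs <;> linarith)
    (fun i => by rw [domExp]; split_ifs <;> linarith) (x (a r)) (x (b r))
  have h2 := (integrableOn_image_iff_integrableOn_abs_deriv_smul measurableSet_Ioo (s := Ioo 0 π)
    (fun s _ => (hasDerivAt_flat_apply (x (a r)) (x (b r) - x (a r)) s).hasDerivWithinAt)
    (fun s hs s' hs' e => sin_half_sq_injOn hs hs'
      (mul_left_cancel₀ hD.ne' (add_left_cancel e)))
    (fun y : ℝ => ∏ i, |y - x i| ^ domExp a b A r i)).1 (h1.mono_set ?_)
  · refine h2.congr_fun (fun s hs => ?_) measurableSet_Ioo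
    have h3 := sin_half_pos hs
    have h4 := cos_half_pos hs
    simp only [smul_eq_mul]
    rw [abs_of_pos (by positivity)]
  · rintro _ ⟨s, hs, rfl⟩
    have h3 := sin_half_pos hs
    have h4 := cos_half_pos hs
    have h5 : 0 < (x (b r) - x (a r)) * sin (s / 2) ^ 2 := by positivity
    have h6 : 0 < (x (b r) - x (a r)) * cos (s / 2) ^ 2 := by positivity
    rw [Real.cos_sq'] at h6
    constructor <;> simp only <;> linarith

/-- Away from coincidences all limiting differences are nonzero real numbers, where log(-i·) is
continuous. -/
theorem tendsto_density (h : Config a b x) (hθ : θ ∈ openBox ι)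
    (hg : ∀ r i, flat a b x θ r ≠ x i) (hi : Injective (flat a b x θ)) :
    Tendsto (fun η : ℝ => density a b (fun _ _ => -(4 * (t : ℂ))) (fun _ _ => 8 * (t : ℂ))
      (fun i => (x i : ℂ)) η θ) (𝓝[>] 0)
      (𝓝 ((∏ r, (((x (b r) - x (a r)) * (sin (θ r / 2) * cos (θ r / 2)) : ℝ) : ℂ)) *
        flatDensity t x (flat a b x θ))) := by
  have hr : ∀ r, Tendsto (fun η : ℝ => rpt a b x η θ r) (𝓝[>] 0) (𝓝 (flat a b x θ r)) := by
    intro r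
    have : Continuous fun η : ℝ => rpt a b x η θ r := by
      simp only [rpt_eq_flat]; fun_prop
    have h2 := this.tendsto 0
    rw [rpt_eq_flat] at h2
    simp only [Complex.ofReal_zero, zero_mul, add_zero] at h2
    exact h2.mono_left nhdsWithin_le_nhds
  have hv : ∀ r, Tendsto (fun η : ℝ => rvel a b x η θ r) (𝓝[>] 0)
      (𝓝 (((x (b r) - x (a r)) * (sin (θ r / 2) * cos (θ r / 2)) : ℝ) : ℂ)) := by
    intro r
    have : Continuous fun η : ℝ => rvel a b x η θ r := by
      simp only [rvel, vel]; fun_prop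
    have h2 := this.tendsto 0
    refine (h2.mono_left nhdsWithin_le_nhds).trans (le_of_eq ?_)
    simp [rvel, vel, sn, cs]
  have hlog : ∀ {y : ℝ} {f : ℝ → ℂ}, y ≠ 0 → Tendsto f (𝓝[>] 0) (𝓝 (y : ℂ)) →
      Tendsto (fun η => log (-I * f η)) (𝓝[>] 0)
        (𝓝 (log (-I * y))) := by
    intro y f hy hf
    exact (hf.const_mul _).clog (neg_I_mul_mem_slitPlane (Or.inr (by simpa using hy)))
  have main : Tendsto (fun η : ℝ => exp
      (∑ r, ∑ i, -(4 * (t : ℂ)) * log (-I * (rpt a b x η θ r - x i)) +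
        ∑ r, ∑ s with r < s, 8 * (t : ℂ) *
          log (-I * (rpt a b x η θ r - rpt a b x η θ s))) *
      ∏ r, rvel a b x η θ r) (𝓝[>] 0)
      (𝓝 (flatDensity t x (flat a b x θ) *
        ∏ r, (((x (b r) - x (a r)) * (sin (θ r / 2) * cos (θ r / 2)) : ℝ) : ℂ))) := by
    refine Tendsto.mul ?_ (tendsto_finsetProd _ fun r _ => hv r)
    refine (Complex.continuous_exp.tendsto _).comp (Tendsto.add ?_ ?_)
    · refine tendsto_finsetSum _ fun r _ => tendsto_finsetSum _ fun i _ => Tendsto.const_mul _ ?_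
      have := hlog (sub_ne_zero.2 (hg r i)) (f := fun η => rpt a b x η θ r - x i)
        (by push_cast; exact (hr r).sub_const _)
      simpa using this
    · refine tendsto_finsetSum _ fun r _ => tendsto_finsetSum _ fun s hs => Tendsto.const_mul _ ?_
      have := hlog (sub_ne_zero.2 fun e => (Finset.mem_filter.1 hs).2.ne (hi e))
        (f := fun η => rpt a b x η θ r - rpt a b x η θ s)
        (by push_cast; exact (hr r).sub (hr s))
      simpa using this
  rw [mul_comm (∏ r, _)]
  refine main.congr' ?_
  filter_upwards [self_mem_nhdsWithin] with η hη
  rw [density_eq _ _ _ _ _ hθ, expFull]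
  simp only [logFull_eq h hη hθ]

/-- The integral is constant in η, so it equals its limit as η → 0, computed by dominated
convergence. The velocities converge to the Jacobian of `flat`, which turns the limit into an
integral over real intervals. -/
theorem integral_density_eq_flat (h : Config a b x) (ht : 0 < t) (ht1 : t < 1 / 4) :
    ∫ θ in openBox ι, density a b (fun _ _ => -(4 * (t : ℂ))) (fun _ _ => 8 * (t : ℂ))
      (fun i => (x i : ℂ)) (1 : ℝ) θ = ∫ X in intervals a b x, flatDensity t x X := by
  rw [integral_intervals h]
  have hgood : ∀ᵐ θ ∂(volume.restrict (openBox ι)),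
      (∀ r i, flat a b x θ r ≠ x i) ∧ Injective (flat a b x θ) := by
    refine ae_flat_of_ae h (p := fun X => (∀ r i, X r ≠ x i) ∧ Injective X) ?_
    have h1 : ∀ᵐ X : ι → ℝ, ∀ r i, X r ≠ x i := ae_all_iff.2 fun r => ae_all_iff.2 fun i =>
      Measure.ae_eval_ne (μ := fun _ : ι => (volume : Measure ℝ)) r (x i)
    filter_upwards [h1, ae_injective ι] with X h1 h2 using ⟨h1, h2⟩
  set K : ι → ℝ := fun r => |x (a r)| + 2 * (x (b r) - x (a r)) with hK
  have hK0 : ∀ r, 0 ≤ K r := fun r => by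
    have := sub_pos.2 (h.lt r)
    positivity
  have hlim : Tendsto (fun η : ℝ => ∫ θ in openBox ι, density a b (fun _ _ => -(4 * (t : ℂ)))
      (fun _ _ => 8 * (t : ℂ)) (fun i => (x i : ℂ)) η θ) (𝓝[>] 0)
      (𝓝 (∫ θ in openBox ι,
        (∏ r, (((x (b r) - x (a r)) * (sin (θ r / 2) * cos (θ r / 2)) : ℝ) : ℂ)) *
          flatDensity t x (flat a b x θ))) := by
    refine tendsto_integral_filter_of_dominated_convergence
      (fun θ => (∏ r, (x (b r) - x (a r)) ^ (1 - 4 * t) *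
        ((x (b r) - x (a r)) * (sin (θ r / 2) * cos (θ r / 2)) *
          ∏ i, |flat a b x θ r - x i| ^ domExp a b (4 * t) r i)) *
        ∏ r, ∏ s with r < s, (K r + K s) ^ (8 * t)) ?_ ?_ ?_ ?_
    · filter_upwards [self_mem_nhdsWithin] with η hη
      exact (continuousOn_density h hη).aestronglyMeasurable measurableSet_openBox
    · filter_upwards [self_mem_nhdsWithin, Ioc_mem_nhdsGT one_pos] with η hη hη1
      filter_upwards [hgood, ae_restrict_mem measurableSet_openBox] with θ hθ hb
      rw [norm_density h hη hb]
      refine mul_le_mul (prod_le_prod (fun r _ => ?_) fun r _ => ?_)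
        (prod_le_prod (fun r _ => ?_) fun r _ => prod_le_prod (fun s _ => ?_)
          fun s _ => ?_) ?_ ?_
      · exact mul_nonneg (prod_nonneg fun i _ => by positivity) (norm_nonneg _)
      · exact prod_norm_mul_norm_rvel_le h hη hη1.2 hb (by linarith) (by linarith) r (hθ.1 r)
      · exact prod_nonneg fun s _ => by positivity
      · positivity
      · refine Real.rpow_le_rpow (norm_nonneg _) ?_ (by linarith)
        exact (norm_sub_le _ _).trans (add_le_add (norm_rpt_le h hη hη1.2 θ r)
          (norm_rpt_le h hη hη1.2 θ s))
      · exact prod_nonneg fun r _ => prod_nonneg fun s _ => by positivity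
      · refine prod_nonneg fun r _ => mul_nonneg (Real.rpow_nonneg (sub_pos.2 (h.lt r)).le _)
          (mul_nonneg (mul_nonneg (sub_pos.2 (h.lt r)).le (mul_nonneg
            (sin_half_pos (hb r trivial)).le (cos_half_pos (hb r trivial)).le))
          (prod_nonneg fun i _ => by positivity))
    · refine Integrable.mul_const ?_ _
      exact integrableOn_openBox_prod (f := fun r s => (x (b r) - x (a r)) ^ (1 - 4 * t) *
        ((x (b r) - x (a r)) * (sin (s / 2) * cos (s / 2)) *
          ∏ i, |x (a r) + (x (b r) - x (a r)) * sin (s / 2) ^ 2 - x i| ^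
            domExp a b (4 * t) r i))
        fun r => (integrableOn_domExp h (by linarith) (by linarith) r).const_mul _
    · filter_upwards [hgood, ae_restrict_mem measurableSet_openBox] with θ hθ hb
      exact tendsto_density h hb hθ.1 hθ.2
  refine tendsto_nhds_unique (tendsto_const_nhds.congr' ?_) hlim
  filter_upwards [self_mem_nhdsWithin] with η hη
  exact (integral_density_eccentricity h hη (t := t) (by simpa using ht1)).symm

end Flattening

/-! ### Sums of phases over relabellings and quantum numbers -/

section Symmetrization

/-- The quantum number `[m] = sin (π A m) / sin (π A)`. -/
def qnum (A m : ℝ) : ℝ := sin (π * A * m) / sin (π * A)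

theorem qnum_add_one {A : ℝ} (hA : sin (π * A) ≠ 0) (m : ℝ) :
    (qnum A (m + 1) : ℂ) = exp (I * (π * A) * (-1 : ℝ)) * qnum A m +
      exp (I * (π * A) * m) := by
  have hA' : ((sin (π * A) : ℝ) : ℂ) ≠ 0 := by exact_mod_cast hA
  rw [qnum, qnum, mul_add, Real.sin_add, mul_one]
  have e : ∀ y : ℝ, exp (I * (π * A) * y) =
      (cos (π * A * y) : ℝ) + (sin (π * A * y) : ℝ) * I := by
    intro y
    rw [show I * (π * A) * y = ((π * A * y : ℝ) : ℂ) * I by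
      push_cast; ring, Complex.exp_mul_I]
    push_cast
    rfl
  rw [e, e, mul_neg_one, Real.cos_neg, Real.sin_neg]
  generalize sin (π * A) = s at *
  generalize cos (π * A) = c
  generalize sin (π * A * m) = s'
  generalize cos (π * A * m) = c'
  push_cast
  field_simp
  ring

/-- The phase of each point is governed by the number of points below it minus the number above it,
so the sum is a geometric progression symmetric about 0. Inserting a new maximum multiplies the old
terms by exp(-iπA) and adds exp(iπA|S|), which is the recursion `qnum_add_one`. -/
theorem sum_exp_sign {ι : Type*} [DecidableEq ι] {A : ℝ} (hA : sin (π * A) ≠ 0)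
    {Y : ι → ℝ} (hY : Injective Y) (S : Finset ι) :
    ∑ p ∈ S, exp (I * (π * A) * (∑ l ∈ S, Real.sign (Y p - Y l) : ℝ)) =
      qnum A S.card := by
  induction S using Finset.induction_on_max_value Y with
  | empty => simp [qnum]
  | insert p S hp hmax ih =>
    have hlt : ∀ l ∈ S, Y l < Y p := fun l hl => lt_of_le_of_ne (hmax l hl) fun e =>
      hp (hY e ▸ hl)
    rw [Finset.sum_insert hp, Finset.card_insert_of_notMem hp]
    rw [Nat.cast_add, Nat.cast_one, qnum_add_one hA, add_comm, ← ih,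
      mul_sum]
    congr 1
    · refine sum_congr rfl fun l hl => ?_
      rw [Finset.sum_insert hp, Real.sign_of_neg (sub_neg.2 (hlt l hl)), ← exp_add]
      congr 1
      push_cast
      ring
    · congr 1
      rw [Finset.sum_insert hp, sub_self, Real.sign_zero, sum_congr rfl fun l hl =>
        Real.sign_of_pos (sub_pos.2 (hlt l hl))]
      simp

/-- The indicator of an interval. -/
def ind (J : Set ℝ) (y : ℝ) : ℝ := J.indicator 1 y

theorem ind_of_mem {J : Set ℝ} {y : ℝ} (h : y ∈ J) : ind J y = 1 := by simp [ind, h]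

theorem ind_of_notMem {J : Set ℝ} {y : ℝ} (h : y ∉ J) : ind J y = 0 := by simp [ind, h]

/-- The weight of an assignment of the variables `Y` to the intervals `J`. -/
def wt {n : ℕ} (A : ℝ) (J : Fin n → Set ℝ) (Y : Fin n → ℝ) : ℂ :=
  ∏ k, ((ind (J k) (Y k) : ℂ) * exp (I * (π * A) *
    (∑ l, if k < l then ind (J k) (Y l) * Real.sign (Y k - Y l) else 0 : ℝ)))

theorem sum_ind_mul_exp {n : ℕ} {A : ℝ} (hA : sin (π * A) ≠ 0) (J : Set ℝ) {Y : Fin n → ℝ}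
    (hY : Injective Y) :
    ∑ p, (ind J (Y p) : ℂ) * exp (I * (π * A) *
      (∑ l, ind J (Y l) * Real.sign (Y p - Y l) : ℝ)) = qnum A (∑ l, ind J (Y l)) := by
  classical
  have h := sum_exp_sign hA hY (Finset.univ.filter fun l => Y l ∈ J)
  have e : ∀ f : Fin n → ℝ, ∑ l with Y l ∈ J, f l = ∑ l, ind J (Y l) * f l := fun f => by
    rw [sum_filter]
    refine sum_congr rfl fun l _ => ?_
    split_ifs with h
    · rw [ind_of_mem h, one_mul]
    · rw [ind_of_notMem h, zero_mul]
  have e' : ∀ f : Fin n → ℂ, ∑ l with Y l ∈ J, f l = ∑ l, (ind J (Y l) : ℂ) * f l := fun f => by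
    rw [sum_filter]
    refine sum_congr rfl fun l _ => ?_
    split_ifs with h
    · rw [ind_of_mem h, Complex.ofReal_one, one_mul]
    · rw [ind_of_notMem h, Complex.ofReal_zero, zero_mul]
  rw [e'] at h
  simp only [e] at h
  rw [h]
  congr 2
  rw [Finset.card_eq_sum_ones, Nat.cast_sum]
  simp only [Nat.cast_one, e, mul_one]

/-- First choose the variable assigned to J 0. Its phase involves exactly the variables present in J
0, so summing over the choices gives the quantum number of their count. The remaining variables are
treated by induction. An interval containing J 0 has lost one variable, which is the correction by
`nest`. -/
theorem sum_perm_wt {A : ℝ} (hA : sin (π * A) ≠ 0) : ∀ {n : ℕ} (J : Fin n → Set ℝ)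
    (nest : Fin n → Fin n → ℝ) (_ : ∀ k l, k < l → ∀ y ∈ J k, ind (J l) y = nest k l)
    {Y : Fin n → ℝ} (_ : Injective Y),
    ∑ σ : Equiv.Perm (Fin n), wt A J (fun k => Y (σ k)) =
      ∏ k, (qnum A (∑ l, ind (J k) (Y l) - ∑ l, if l < k then nest l k else 0) : ℂ)
  | 0, J, nest, hn, Y, hY => by simp [wt]
  | n + 1, J, nest, hn, Y, hY => by
    rw [← Equiv.sum_comp Equiv.Perm.decomposeFin.symm, Fintype.sum_prod_type, Fin.prod_univ_succ]
    have hswap : ∀ (p : Fin (n + 1)) (f : ℝ → ℝ),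
        ∑ k : Fin n, f (Y (Equiv.swap 0 p k.succ)) = ∑ l, f (Y l) - f (Y p) := by
      intro p f
      rw [← Equiv.sum_comp (Equiv.swap 0 p) fun l => f (Y l), Fin.sum_univ_succ,
        Equiv.swap_apply_left]
      ring
    have hinj : ∀ p : Fin (n + 1), Injective fun k : Fin n => Y (Equiv.swap 0 p k.succ) :=
      fun p => hY.comp ((Equiv.injective _).comp (Fin.succ_injective n))
    have hw : ∀ (p : Fin (n + 1)) (τ : Equiv.Perm (Fin n)),
        wt A J (fun k => Y (Equiv.Perm.decomposeFin.symm (p, τ) k)) =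
          ((ind (J 0) (Y p) : ℂ) * exp (I * (π * A) *
            (∑ l, ind (J 0) (Y l) * Real.sign (Y p - Y l) : ℝ))) *
          wt A (fun k => J k.succ) (fun k => (fun k => Y (Equiv.swap 0 p k.succ)) (τ k)) := by
      intro p τ
      rw [wt, Fin.prod_univ_succ]
      simp only [Fin.sum_univ_succ, Equiv.Perm.decomposeFin_symm_apply_zero,
        Equiv.Perm.decomposeFin_symm_apply_succ, Fin.succ_pos, if_true, lt_irrefl, if_false,
        zero_add, Fin.not_lt_zero, Fin.succ_lt_succ_iff]
      rw [wt]
      congr 3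
      rw [Equiv.sum_comp τ fun l => ind (J 0) (Y (Equiv.swap 0 p l.succ)) *
        Real.sign (Y p - Y (Equiv.swap 0 p l.succ)),
        hswap p fun y => ind (J 0) y * Real.sign (Y p - y), sub_self, Real.sign_zero, mul_zero,
        sub_zero, Fin.sum_univ_succ]
    have hih := fun p => sum_perm_wt hA (fun k : Fin n => J k.succ) (fun k l => nest k.succ l.succ)
      (fun k l hkl y hy => hn k.succ l.succ (Fin.succ_lt_succ_iff.2 hkl) y hy) (hinj p)
    -- Since J 0 is either contained in or disjoint from each later interval, the counts after
    -- removal do not depend on which variable of J 0 was removed. This is why the sum factorizes.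
    have hm : ∀ p, Y p ∈ J 0 → ∀ k : Fin n,
        (∑ l : Fin n, ind (J k.succ) (Y (Equiv.swap 0 p l.succ)) -
          ∑ l : Fin n, if l < k then nest l.succ k.succ else 0) =
        ∑ l, ind (J k.succ) (Y l) - ∑ l, if l < k.succ then nest l k.succ else 0 := by
      intro p hp k
      rw [hswap p fun y => ind (J k.succ) y, hn 0 k.succ (Fin.succ_pos k) _ hp,
        Fin.sum_univ_succ (fun l => if l < k.succ then nest l k.succ else 0)]
      simp only [Fin.succ_pos, if_true, Fin.succ_lt_succ_iff]
      ring
    have hsum : ∀ p, ∑ τ : Equiv.Perm (Fin n),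
        wt A J (fun k => Y (Equiv.Perm.decomposeFin.symm (p, τ) k)) =
        ((ind (J 0) (Y p) : ℂ) * exp (I * (π * A) *
            (∑ l, ind (J 0) (Y l) * Real.sign (Y p - Y l) : ℝ))) *
        ∏ k : Fin n, (qnum A (∑ l, ind (J k.succ) (Y l) -
          ∑ l, if l < k.succ then nest l k.succ else 0) : ℂ) := by
      intro p
      simp only [hw]
      rw [← mul_sum, hih p]
      by_cases hp : Y p ∈ J 0
      · simp only [hm p hp]
      · simp only [ind_of_notMem hp, Complex.ofReal_zero, zero_mul]
    simp only [hsum]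
    rw [← Finset.sum_mul, sum_ind_mul_exp hA (J 0) hY]
    simp

end Symmetrization

/-! ### Counting points and links below a link -/

namespace LinkPattern

variable {N : ℕ} (β : LinkPattern N)

theorem sum_eq_sum_link {M : Type*} [AddCommMonoid M] (f : Fin (2 * N) → M) :
    ∑ i, f i = ∑ r : β.Link, (f (β.lo r) + f (β.hi r)) := by
  rw [sum_add_distrib, ← Finset.sum_filter_add_sum_filter_not Finset.univ fun i => i < β.pair i]
  congr 1
  · rw [Finset.sum_subtype (p := fun i => i < β.pair i) _ (by simp)]
  · rw [Finset.sum_bij' (s := (Finset.univ : Finset β.Link))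
      (t := Finset.univ.filter fun i => ¬ i < β.pair i) (g := f)
      (fun r _ => β.hi r) (fun i hi => ⟨β.pair i, by
        rw [β.pair_pair]
        exact lt_of_le_of_ne (not_lt.1 (Finset.mem_filter.1 hi).2) (β.pair_ne i)⟩)]
    · intro r _
      simpa [β.pair_pair] using r.2.le
    · simp
    · intro r _
      exact Subtype.ext (β.pair_pair r.1)
    · intro i _
      exact β.pair_pair i
    · intro r _
      rfl

/-- The number of links strictly below the link `s`. -/
theorem sum_points_below (s : β.Link) :
    (∑ i, if β.lo s < i ∧ i < β.hi s then (1 : ℝ) else 0) / 2 =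
      ∑ r : β.Link, if s < r ∧ β.hi r < β.hi s then (1 : ℝ) else 0 := by
  rw [β.sum_eq_sum_link, Finset.sum_div]
  refine sum_congr rfl fun r _ => ?_
  have hr := r.2
  have hs := s.2
  have hsr : s < r ↔ β.lo s < β.lo r := Iff.rfl
  rcases lt_trichotomy s r with h | h | h
  · rcases β.hi_lt_lo_or h with h1 | h1
    · rw [if_neg (by simp only [lo, hi] at *; omega), if_neg (by simp only [lo, hi] at *; omega),
        if_neg (by simp only [lo, hi] at *; omega)]
      simp
    · rw [if_pos (by simp only [lo, hi] at *; omega), if_pos (by simp only [lo, hi] at *; omega),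
        if_pos ⟨h, h1.2⟩]
      norm_num
  · subst h
    simp
  · have h' : β.lo r < β.lo s := h
    rcases β.hi_lt_lo_or h with h1 | h1
    · rw [if_neg (by simp only [lo, hi] at *; omega), if_neg (by simp only [lo, hi] at *; omega),
        if_neg (fun h2 => absurd h2.1 h.not_gt)]
      simp
    · rw [if_neg (by simp only [lo, hi] at *; omega), if_neg (by simp only [lo, hi] at *; omega),
        if_neg (fun h2 => absurd h2.1 h.not_gt)]
      simp

end LinkPattern

/-! ### The symmetric absolute value of the integrand -/

section Gas

/-- In `repulsion` every unordered pair occurs twice, so its exponent A stands for 2A = 8/κ. -/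
theorem prod_prod_ite_eq {ι : Type*} [Fintype ι] [LinearOrder ι] (f : ι → ι → ℝ)
    (hf : ∀ p q, f p q = f q p) :
    ∏ p, ∏ q, (if p = q then 1 else f p q) = ∏ p, ∏ q with p < q, f p q * f p q := by
  have e1 : ∀ p q, (if p = q then 1 else f p q) =
      (if p < q then f p q else 1) * (if q < p then f p q else 1) := by
    intro p q
    rcases lt_trichotomy p q with h | h | h
    · simp [h, h.ne, h.not_gt]
    · simp [h]
    · simp [h, h.ne', h.not_gt]
  simp only [e1, prod_mul_distrib, Finset.prod_filter]
  have e2 : ∏ p, ∏ q, (if q < p then f p q else 1) = ∏ p, ∏ q, if p < q then f p q else 1 := by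
    rw [Finset.prod_comm]
    exact prod_congr rfl fun p _ => prod_congr rfl fun q _ => by rw [hf]
  rw [e2, ← prod_mul_distrib]

variable {P ι : Type*} [Fintype P] [DecidableEq P] [Fintype ι] [DecidableEq ι]

/-- The interaction of a screening variable with the points, cut off at distance `R`. -/
def charge (A R : ℝ) (x : P → ℝ) (y : ℝ) : ℝ :=
  (Ioo (-R) R).indicator (fun y => ∏ i, |y - x i| ^ (-A)) y

/-- The mutual interaction of the screening variables. -/
def repulsion (A : ℝ) (X : ι → ℝ) : ℝ := ∏ r, ∏ s, if r = s then 1 else |X r - X s| ^ A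

/-- The absolute value of the integrand on the real line, cut off at distance `R`. -/
def gas (A R : ℝ) (x : P → ℝ) (X : ι → ℝ) : ℝ := (∏ r, charge A R x (X r)) * repulsion A X

variable {A R : ℝ} {x : P → ℝ}

theorem charge_nonneg (y : ℝ) : 0 ≤ charge A R x y :=
  indicator_nonneg (fun y _ => prod_nonneg fun i _ => by positivity) y

theorem repulsion_nonneg (X : ι → ℝ) : 0 ≤ repulsion A X :=
  prod_nonneg fun r _ => prod_nonneg fun s _ => by split_ifs <;> positivity

theorem gas_nonneg (X : ι → ℝ) : 0 ≤ gas A R x X :=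
  mul_nonneg (prod_nonneg fun _ _ => charge_nonneg _) (repulsion_nonneg X)

theorem measurable_charge : Measurable (charge A R x) :=
  Measurable.indicator (measurable_prod_abs_sub_rpow x fun _ => -A) measurableSet_Ioo

theorem measurable_repulsion : Measurable (repulsion A : (ι → ℝ) → ℝ) := by
  refine measurable_prod _ fun r _ => measurable_prod _ fun s _ => ?_
  split_ifs
  · exact measurable_const
  · exact (((measurable_pi_apply r).sub (measurable_pi_apply s)).abs).pow_const _

theorem measurable_gas : Measurable (gas A R x : (ι → ℝ) → ℝ) :=
  (measurable_prod _ fun r _ => measurable_charge.comp (measurable_pi_apply r)).mul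
    measurable_repulsion

theorem integrable_charge (hx : Injective x) (hA : 0 ≤ A) (hA1 : A < 1) :
    Integrable (charge A R x) := by
  refine (integrable_indicator_iff measurableSet_Ioo).2 ?_
  exact integrableOn_prod_abs_sub_rpow hx (fun _ => by linarith) (fun _ => by linarith) _ _

theorem gas_le (hA : 0 ≤ A) (X : ι → ℝ) :
    gas A R x X ≤ (∏ r, charge A R x (X r)) * ∏ _r : ι, ∏ _s : ι, (1 + 2 * |R|) ^ A := by
  by_cases h : ∀ r, X r ∈ Ioo (-R) R
  · refine mul_le_mul_of_nonneg_left ?_ (prod_nonneg fun r _ => charge_nonneg _)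
    refine prod_le_prod (fun r _ => prod_nonneg fun s _ => by split_ifs <;> positivity)
      fun r _ => prod_le_prod (fun s _ => by split_ifs <;> positivity) fun s _ => ?_
    split_ifs
    · exact Real.one_le_rpow (by linarith [abs_nonneg R]) hA
    · refine Real.rpow_le_rpow (abs_nonneg _) ?_ hA
      have h1 := h r
      have h2 := h s
      have h3 := le_abs_self R
      rw [abs_le]
      constructor <;> linarith [h1.1, h1.2, h2.1, h2.2]
  · push Not at h
    obtain ⟨r, hr⟩ := h
    have h0 : ∏ r, charge A R x (X r) = 0 :=
      Finset.prod_eq_zero (Finset.mem_univ r) (indicator_of_notMem hr _)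
    rw [gas, h0, zero_mul, zero_mul]

/-- The cutoff at R provides integrability over the whole space. It is harmless when all points lie
in (-R, R), because each labelled variable stays between two of them. -/
theorem integrable_gas (hx : Injective x) (hA : 0 ≤ A) (hA1 : A < 1) :
    Integrable (gas A R x : (ι → ℝ) → ℝ) := by
  have h1 : Integrable fun X : ι → ℝ => ∏ r, charge A R x (X r) :=
    Integrable.fintype_prod fun _ => integrable_charge hx hA hA1
  refine Integrable.mono' (h1.mul_const (∏ _r : ι, ∏ _s : ι, (1 + 2 * |R|) ^ A)) measurable_gas.aestronglyMeasurable
    (.of_forall fun X => ?_)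
  rw [Real.norm_of_nonneg (gas_nonneg X)]
  exact gas_le hA X

theorem gas_comp_equiv {κ : Type*} [Fintype κ] [DecidableEq κ] (e : κ ≃ ι) (X : ι → ℝ) :
    gas A R x (fun k => X (e k)) = gas A R x X := by
  rw [gas, gas, Equiv.prod_comp e fun r => charge A R x (X r), repulsion, repulsion,
    ← Equiv.prod_comp e fun r => ∏ s, if r = s then 1 else |X r - X s| ^ A]
  congr 1
  refine prod_congr rfl fun r _ => ?_
  rw [← Equiv.prod_comp e fun s => if e r = s then 1 else |X (e r) - X s| ^ A]
  refine prod_congr rfl fun s _ => ?_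
  simp only [e.apply_eq_iff_eq]

theorem integral_comp_equiv {κ E : Type*} [Fintype κ] [NormedAddCommGroup E] [NormedSpace ℝ E]
    (e : κ ≃ ι) (f : (ι → ℝ) → E) :
    ∫ Y : κ → ℝ, f (fun r => Y (e.symm r)) = ∫ X, f X := by
  have h := volume_measurePreserving_piCongrLeft (fun _ : ι => ℝ) e
  rw [← h.integral_comp']
  refine integral_congr_ae (.of_forall fun Y => ?_)
  simp only
  congr 1
  funext r
  obtain ⟨k, rfl⟩ := e.surjective r
  rw [MeasurableEquiv.coe_piCongrLeft, Equiv.piCongrLeft_apply_apply, e.symm_apply_apply]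

theorem log_neg_I_mul_ofReal {y : ℝ} (hy : y ≠ 0) :
    log (-I * y) = Real.log |y| - I * π / 2 * Real.sign y := by
  rcases lt_or_gt_of_ne hy with h | h
  · rw [show -I * (y : ℂ) = ((-y : ℝ) : ℂ) * I by push_cast; ring,
      Complex.log_ofReal_mul (by linarith) Complex.I_ne_zero, Complex.log_I, Real.sign_of_neg h,
      abs_of_neg h]
    push_cast; ring
  · rw [show -I * (y : ℂ) = (y : ℂ) * -I by ring,
      Complex.log_ofReal_mul h (neg_ne_zero.2 Complex.I_ne_zero), Complex.log_neg_I,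
      Real.sign_of_pos h, abs_of_pos h]
    push_cast; ring

/-- The boundary value at a real point is the power of the modulus times a phase that depends only
on the sign. -/
theorem exp_mul_log_neg_I_mul {y : ℝ} (hy : y ≠ 0) (c : ℝ) :
    exp (c * log (-I * y)) =
      (|y| ^ c : ℝ) * exp (-(c * (I * π / 2 * Real.sign y))) := by
  rw [log_neg_I_mul_ofReal hy, Real.rpow_def_of_pos (abs_pos.2 hy), Complex.ofReal_exp,
    ← exp_add]
  congr 1
  push_cast
  ring

theorem measurable_real_sign : Measurable Real.sign := by
  unfold Real.sign
  exact Measurable.ite measurableSet_Iio measurable_const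
    (Measurable.ite measurableSet_Ioi measurable_const measurable_const)

theorem measurable_ind {J : Set ℝ} (hJ : MeasurableSet J) : Measurable (ind J) :=
  measurable_one.indicator hJ

theorem measurable_wt {n : ℕ} {J : Fin n → Set ℝ} (hJ : ∀ k, MeasurableSet (J k)) :
    Measurable (wt A J) := by
  refine measurable_prod _ fun k _ => Measurable.mul ?_ ?_
  · exact Complex.measurable_ofReal.comp ((measurable_ind (hJ k)).comp (measurable_pi_apply k))
  · refine Complex.measurable_exp.comp (Measurable.const_mul (Complex.measurable_ofReal.comp ?_) _)
    refine measurable_sum _ fun l _ => ?_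
    split_ifs
    · exact ((measurable_ind (hJ k)).comp (measurable_pi_apply l)).mul
        (measurable_real_sign.comp ((measurable_pi_apply k).sub (measurable_pi_apply l)))
    · exact measurable_const

theorem norm_wt_le {n : ℕ} (J : Fin n → Set ℝ) (Y : Fin n → ℝ) : ‖wt A J Y‖ ≤ 1 := by
  rw [wt, norm_prod]
  refine Finset.prod_le_one (fun k _ => norm_nonneg _) fun k _ => ?_
  have e : ∀ T : ℝ, ‖exp (I * (π * A) * T)‖ = 1 := fun T => by
    rw [show I * (π * A) * (T : ℂ) = ((π * A * T : ℝ) : ℂ) * I by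
      push_cast; ring, Complex.norm_exp_ofReal_mul_I]
  rw [norm_mul, e, mul_one, Complex.norm_real]
  by_cases h : Y k ∈ J k
  · rw [ind_of_mem h]; simp
  · rw [ind_of_notMem h]; simp

/-- As `gas` is symmetric, each of the n! relabellings of the weight has the same integral; their
sum is evaluated by `sum_perm_wt` off the null set of coincidences. -/
theorem factorial_mul_integral_wt {n : ℕ} {J : Fin n → Set ℝ} (hJ : ∀ k, MeasurableSet (J k))
    (hA : sin (π * A) ≠ 0) {nest : Fin n → Fin n → ℝ}
    (hn : ∀ k l, k < l → ∀ y ∈ J k, ind (J l) y = nest k l)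
    (hx : Injective x) (hA0 : 0 ≤ A) (hA1 : A < 1) :
    (n.factorial : ℂ) * ∫ Y : Fin n → ℝ, wt A J Y * gas A R x Y =
      ((∫ Y : Fin n → ℝ, (∏ k, qnum A (∑ l, ind (J k) (Y l) - ∑ l, if l < k then nest l k else 0)) *
        gas A R x Y : ℝ) : ℂ) := by
  have h1 : ∀ σ : Equiv.Perm (Fin n), ∫ Y : Fin n → ℝ, wt A J (fun k => Y (σ k)) * gas A R x Y =
      ∫ Y : Fin n → ℝ, wt A J Y * gas A R x Y := by
    intro σ
    rw [← integral_comp_equiv σ.symm fun Y => wt A J Y * (gas A R x Y : ℂ)]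
    refine integral_congr_ae (.of_forall fun Y => ?_)
    simp only [Equiv.symm_symm]
    rw [gas_comp_equiv σ Y]
  have h2 : ∀ σ : Equiv.Perm (Fin n),
      Integrable fun Y : Fin n → ℝ => wt A J (fun k => Y (σ k)) * (gas A R x Y : ℂ) := by
    intro σ
    refine Integrable.bdd_mul (c := 1) (integrable_gas hx hA0 hA1).ofReal
      ((measurable_wt hJ).comp (measurable_pi_lambda _ fun k =>
        measurable_pi_apply (σ k))).aestronglyMeasurable
      (.of_forall fun Y => norm_wt_le J _)
  have h3 := sum_congr (s₁ := Finset.univ) rfl fun σ (_ : σ ∈ Finset.univ) => h1 σ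
  rw [Finset.sum_const, Finset.card_univ, Fintype.card_perm, Fintype.card_fin, nsmul_eq_mul] at h3
  rw [← h3, ← integral_finsetSum _ fun σ _ => h2 σ, ← integral_complex_ofReal]
  refine integral_congr_ae ?_
  filter_upwards [ae_injective (Fin n)] with Y hY
  rw [← Finset.sum_mul, sum_perm_wt hA J nest hn hY]
  push_cast
  rfl

end Gas

/-! ### The Coulomb gas integral as a real integral over unlabelled variables -/

namespace LinkPattern

variable {N : ℕ} (β : LinkPattern N) {x : Fin (2 * N) → ℝ} {t R : ℝ}

/-- The interval between the endpoints of a link. -/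
def ival (x : Fin (2 * N) → ℝ) (s : β.Link) : Set ℝ := Ioo (x (β.lo s)) (x (β.hi s))

/-- The total phase of the integrand on the real line, in units of `π A`. -/
def turn (x : Fin (2 * N) → ℝ) (X : β.Link → ℝ) : ℝ :=
  ∑ r, ∑ s, if r < s then ind (β.ival x s) (X r) * Real.sign (X s - X r) else 0

theorem half_sign_sub (hx : StrictMono x) {r : β.Link} {X : ℝ} (hX : X ∈ β.ival x r)
    {i : Fin (2 * N)} (hi : X ≠ x i) :
    (Real.sign (X - x i) - if i ≤ β.lo r then 1 else -1) / 2 =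
      if β.lo r < i ∧ x i < X then 1 else 0 := by
  by_cases h1 : i ≤ β.lo r
  · have h2 : x i < X := (hx.monotone h1).trans_lt hX.1
    rw [Real.sign_of_pos (sub_pos.2 h2), if_pos h1, if_neg (fun h => absurd h.1 h1.not_gt)]
    norm_num
  · rw [if_neg h1]
    rcases lt_or_gt_of_ne hi with h2 | h2
    · rw [Real.sign_of_neg (sub_neg.2 h2), if_neg (fun h => absurd h.2 h2.not_gt)]
      norm_num
    · rw [Real.sign_of_pos (sub_pos.2 h2), if_pos ⟨not_le.1 h1, h2⟩]
      norm_num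

/-- In units of πA, moving u_r from the interval after x_{a_r} to X_r costs 1 for every point
passed. A later link passed completely contributes 2, cancelled by its pair term as X_s < X_r. A
later link with X_r between its endpoints contributes 1, and together with the pair term leaves the
sign of X_s - X_r. By planarity earlier links contribute nothing. -/
theorem sum_half_sign (hx : StrictMono x) {X : β.Link → ℝ} (hX : ∀ r, X r ∈ β.ival x r)
    (hXx : ∀ r i, X r ≠ x i) (hXi : Injective X) :
    ∑ r : β.Link, ∑ i, (Real.sign (X r - x i) - if i ≤ β.lo r then 1 else -1) / 2 -
      ∑ r, ∑ s with r < s, (Real.sign (X r - X s) + 1) = β.turn x X := by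
  rw [turn, ← sum_sub_distrib]
  refine sum_congr rfl fun r _ => ?_
  simp only [half_sign_sub β hx (hX r) (hXx r _)]
  rw [β.sum_eq_sum_link, sum_filter, ← sum_sub_distrib]
  refine sum_congr rfl fun s _ => ?_
  have hs := hx s.2
  have hr := hX r
  have hs' := hX s
  rcases lt_trichotomy r s with h | h | h
  · have hlo : β.lo r < β.lo s := h
    have hhi : β.lo r < β.hi s := hlo.trans s.2
    rw [if_pos h, if_pos h]
    simp only [hlo, hhi, true_and]
    have hne := hXi.ne h.ne
    by_cases h1 : X r < x (β.lo s)
    · have h3 : ¬ x (β.hi s) < X r := by intro h; simp only [lo, hi] at *; linarith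
      have h4 : X r ∉ β.ival x s := fun h => by have := h.1; linarith
      have h5 : X r < X s := h1.trans hs'.1
      rw [if_neg h1.not_gt, if_neg h3, ind_of_notMem h4, Real.sign_of_neg (sub_neg.2 h5)]
      norm_num
    · have h2 : x (β.lo s) < X r := lt_of_le_of_ne (not_lt.1 h1) (hXx r _).symm
      by_cases h3 : x (β.hi s) < X r
      · have h4 : X r ∉ β.ival x s := fun h => by have := h.2; linarith
        have h5 : X s < X r := hs'.2.trans h3
        rw [if_pos h2, if_pos h3, ind_of_notMem h4, Real.sign_of_pos (sub_pos.2 h5)]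
        norm_num
      · have h4 : X r ∈ β.ival x s := ⟨h2, lt_of_le_of_ne (not_lt.1 h3) (hXx r _)⟩
        rw [if_pos h2, if_neg h3, ind_of_mem h4, ← neg_sub (X s) (X r)]
        rcases lt_or_gt_of_ne hne with h5 | h5
        · rw [Real.sign_of_neg (by linarith), Real.sign_of_pos (by linarith)]
          norm_num
        · rw [Real.sign_of_pos (by linarith), Real.sign_of_neg (by linarith)]
          norm_num
  · subst h
    have h3 : ¬ x (β.hi r) < X r := not_lt.2 hr.2.le
    rw [if_neg (fun h => lt_irrefl _ h.1), if_neg (fun h => h3 h.2), if_neg (lt_irrefl _),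
      if_neg (lt_irrefl _)]
    norm_num
  · have hlo : β.lo s < β.lo r := h
    rw [if_neg (fun h => absurd h.1 hlo.not_gt), if_neg ?_, if_neg h.not_gt, if_neg h.not_gt]
    · norm_num
    · rintro ⟨h1, h2⟩
      rcases β.hi_lt_lo_or h with h3 | h3
      · exact absurd h1 h3.not_gt
      · have h4 := hx h3.2
        have h5 := hr.2
        linarith

theorem phase_mul_flatDensity (hx : StrictMono x) (hR : ∀ i, |x i| < R) {X : β.Link → ℝ}
    (hX : ∀ r, X r ∈ β.ival x r) (hXx : ∀ r i, X r ≠ x i) (hXi : Injective X) :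
    β.phase t * flatDensity t x X = exp (I * (π * (4 * t : ℝ)) * β.turn x X) *
      gas (4 * t) R x X := by
  have hch : ∀ r, charge (4 * t) R x (X r) = ∏ i, |X r - x i| ^ (-(4 * t)) := fun r => by
    refine indicator_of_mem ?_ _
    have h1 := abs_lt.1 (hR (β.lo r))
    have h2 := abs_lt.1 (hR (β.hi r))
    exact ⟨h1.1.trans (hX r).1, (hX r).2.trans h2.2⟩
  have h1 : ∀ r i, exp (-(4 * (t : ℂ)) * ((if i ≤ r.1 then 1 else -1) *
      (I * π / 2))) * exp (-(4 * (t : ℂ)) * log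
        (-I * (X r - x i))) = (|X r - x i| ^ (-(4 * t)) : ℝ) *
      exp (I * (π * (4 * t : ℝ)) *
        ((Real.sign (X r - x i) - if i ≤ β.lo r then 1 else -1) / 2 : ℝ)) := by
    intro r i
    have e := exp_mul_log_neg_I_mul (sub_ne_zero.2 (hXx r i)) (-(4 * t))
    push_cast at e
    rw [e, mul_left_comm, ← exp_add]
    congr 2
    split_ifs
    all_goals push_cast; ring
  have h2 : ∀ r s : β.Link, r < s → exp (-(8 * (t : ℂ)) * (I * π / 2)) *
      exp (8 * (t : ℂ) * log (-I * (X r - X s))) =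
      ((|X r - X s| ^ (4 * t) * |X r - X s| ^ (4 * t) : ℝ) : ℂ) *
      exp (I * (π * (4 * t : ℝ)) * (-(Real.sign (X r - X s) + 1) : ℝ)) := by
    intro r s hrs
    have e := exp_mul_log_neg_I_mul (sub_ne_zero.2 (hXi.ne hrs.ne)) (8 * t)
    push_cast at e
    rw [e, mul_left_comm, ← exp_add,
      ← Real.rpow_add (abs_pos.2 (sub_ne_zero.2 (hXi.ne hrs.ne)))]
    congr 2
    · congr 2; ring
    · push_cast; ring
  have h3 : (∏ r : β.Link, ∏ i, exp (-(4 * (t : ℂ)) * ((if i ≤ r.1 then 1 else -1) *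
      (I * π / 2)))) * ∏ r : β.Link, ∏ i, exp (-(4 * (t : ℂ)) * log
        (-I * (X r - x i))) = ((∏ r, charge (4 * t) R x (X r) : ℝ) : ℂ) *
      exp (I * (π * (4 * t : ℝ)) * (∑ r : β.Link, ∑ i,
        (Real.sign (X r - x i) - if i ≤ β.lo r then 1 else -1) / 2 : ℝ)) := by
    rw [Complex.ofReal_sum, mul_sum, exp_sum, ← prod_mul_distrib,
      Complex.ofReal_prod, ← prod_mul_distrib]
    refine prod_congr rfl fun r _ => ?_
    rw [hch, Complex.ofReal_sum, mul_sum, exp_sum, ← prod_mul_distrib,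
      Complex.ofReal_prod, ← prod_mul_distrib]
    exact prod_congr rfl fun i _ => h1 r i
  have h4 : (∏ r : β.Link, ∏ s with r < s, exp (-(8 * (t : ℂ)) *
      (I * π / 2))) * ∏ r : β.Link, ∏ s with r < s,
        exp (8 * (t : ℂ) * log (-I * (X r - X s))) =
      ((repulsion (4 * t) X : ℝ) : ℂ) * exp (I * (π * (4 * t : ℝ)) *
        (-∑ r, ∑ s with r < s, (Real.sign (X r - X s) + 1) : ℝ)) := by
    have hp : repulsion (4 * t) X = ∏ p, ∏ q with p < q,
        |X p - X q| ^ (4 * t) * |X p - X q| ^ (4 * t) := by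
      rw [← prod_prod_ite_eq (fun p q => |X p - X q| ^ (4 * t)) fun p q => by rw [abs_sub_comm],
        repulsion]
      congr!
    rw [hp, ← Finset.sum_neg_distrib, Complex.ofReal_sum, mul_sum, exp_sum, ← prod_mul_distrib,
      Complex.ofReal_prod, ← prod_mul_distrib]
    refine prod_congr rfl fun r _ => ?_
    rw [← Finset.sum_neg_distrib, Complex.ofReal_sum, mul_sum, exp_sum,
      ← prod_mul_distrib, Complex.ofReal_prod, ← prod_mul_distrib]
    exact prod_congr rfl fun s hs => h2 r s (Finset.mem_filter.1 hs).2
  rw [phase, flatDensity, exp_add]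
  simp only [exp_sum]
  rw [mul_mul_mul_comm, h3, h4, ← β.sum_half_sign hx hX hXx hXi, gas, mul_mul_mul_comm,
    ← exp_add, ← mul_add, mul_comm]
  push_cast
  ring_nf

/-- The links, listed from the last to the first. -/
def revLink : Fin N ≃ β.Link := Fin.revPerm.trans (monoEquivOfFin β.Link β.card_link).toEquiv

theorem revLink_lt {k l : Fin N} : β.revLink k < β.revLink l ↔ l < k := by
  simp [revLink]

theorem wt_eq {A : ℝ} (X : β.Link → ℝ) :
    wt A (fun k => β.ival x (β.revLink k)) (fun k => X (β.revLink k)) =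
      (∏ r, (ind (β.ival x r) (X r) : ℂ)) *
        exp (I * (π * A) * β.turn x X) := by
  rw [wt, prod_mul_distrib, Equiv.prod_comp β.revLink fun r => (ind (β.ival x r) (X r) : ℂ),
    ← exp_sum, ← mul_sum, ← Complex.ofReal_sum, turn]
  congr 4
  rw [Finset.sum_comm, ← Equiv.sum_comp β.revLink fun r => ∑ s, if r < s then
    ind (β.ival x s) (X r) * Real.sign (X s - X r) else 0]
  refine sum_congr rfl fun l _ => ?_
  rw [← Equiv.sum_comp β.revLink fun s => if β.revLink l < s then
    ind (β.ival x s) (X (β.revLink l)) * Real.sign (X s - X (β.revLink l)) else 0]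
  simp only [revLink_lt]

/-- The weight of a configuration of unlabelled screening variables. -/
def cfgWeight {ι : Type*} [Fintype ι] (A : ℝ) (x : Fin (2 * N) → ℝ) (Y : ι → ℝ) : ℝ :=
  ∏ s : β.Link, qnum A (∑ l, ind (β.ival x s) (Y l) -
    (∑ i, if β.lo s < i ∧ i < β.hi s then (1 : ℝ) else 0) / 2)

/-- The links are listed from last to first, so that inner links precede those around them, as
`sum_perm_wt` requires. The integral over the product of intervals is written on the whole space
with indicators before it is symmetrized. -/
theorem phase_mul_integral (hx : StrictMono x) (hR : ∀ i, |x i| < R) (ht : 0 < t) (ht1 : t < 1 / 4) :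
    β.phase t * ∫ X in intervals β.lo β.hi x, flatDensity t x X =
      (((N.factorial : ℝ)⁻¹ * ∫ Y : Fin N → ℝ, β.cfgWeight (4 * t) x Y * gas (4 * t) R x Y : ℝ) : ℂ)
      := by
  have hm : MeasurableSet (intervals β.lo β.hi x) := MeasurableSet.univ_pi fun _ => measurableSet_Ioo
  have hsin : sin (π * (4 * t)) ≠ 0 :=
    (Real.sin_pos_of_pos_of_lt_pi (by positivity) (by nlinarith [Real.pi_pos])).ne'
  have h1 : β.phase t * ∫ X in intervals β.lo β.hi x, flatDensity t x X =
      ∫ X : β.Link → ℝ, (∏ r, (ind (β.ival x r) (X r) : ℂ)) *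
        exp (I * (π * (4 * t : ℝ)) * β.turn x X) * gas (4 * t) R x X := by
    rw [← integral_const_mul, ← integral_indicator hm]
    refine integral_congr_ae ?_
    have h1 : ∀ᵐ X : β.Link → ℝ, ∀ r i, X r ≠ x i := ae_all_iff.2 fun r => ae_all_iff.2 fun i =>
      Measure.ae_eval_ne (μ := fun _ : β.Link => (volume : Measure ℝ)) r (x i)
    filter_upwards [h1, ae_injective β.Link] with X h1 h2
    by_cases hX : X ∈ intervals β.lo β.hi x
    · have hX' : ∀ r, X r ∈ β.ival x r := fun r => hX r trivial
      rw [indicator_of_mem hX, β.phase_mul_flatDensity hx hR hX' h1 h2]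
      simp only [ind_of_mem (hX' _), Complex.ofReal_one, Finset.prod_const_one, one_mul]
    · rw [indicator_of_notMem hX]
      have : ∃ r, X r ∉ β.ival x r := by
        by_contra hn
        push Not at hn
        exact hX fun r _ => hn r
      obtain ⟨r, hr⟩ := this
      rw [Finset.prod_eq_zero (Finset.mem_univ r) (by rw [ind_of_notMem hr, Complex.ofReal_zero]),
        zero_mul, zero_mul]
  have h2 : ∫ X : β.Link → ℝ, (∏ r, (ind (β.ival x r) (X r) : ℂ)) *
        exp (I * (π * (4 * t : ℝ)) * β.turn x X) * gas (4 * t) R x X =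
      ∫ Y : Fin N → ℝ, wt (4 * t) (fun k => β.ival x (β.revLink k)) Y * gas (4 * t) R x Y := by
    rw [← integral_comp_equiv β.revLink]
    refine integral_congr_ae (.of_forall fun Y => ?_)
    simp only
    have e := β.wt_eq (A := 4 * t) (x := x) (fun r => Y (β.revLink.symm r))
    simp only [Equiv.symm_apply_apply] at e
    rw [gas_comp_equiv β.revLink.symm Y, ← e]
  have h3 := factorial_mul_integral_wt (A := 4 * t) (R := R) (x := x)
    (J := fun k => β.ival x (β.revLink k)) (fun k => measurableSet_Ioo) hsin
    (nest := fun k l => if β.hi (β.revLink k) < β.hi (β.revLink l) then 1 else 0) ?_ hx.injective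
    (by linarith) (by linarith)
  · have hN : (N.factorial : ℂ) ≠ 0 := by exact_mod_cast N.factorial_ne_zero
    rw [h1, h2, Complex.ofReal_mul, Complex.ofReal_inv, Complex.ofReal_natCast, eq_inv_mul_iff_mul_eq₀ hN,
      h3]
    congr 1
    refine integral_congr_ae (.of_forall fun Y => ?_)
    simp only
    congr 1
    rw [cfgWeight, ← Equiv.prod_comp β.revLink]
    refine prod_congr rfl fun k _ => ?_
    rw [β.sum_points_below, ← Equiv.sum_comp β.revLink]
    congr 3
    funext l
    simp only [revLink_lt, ite_and]
  -- Nesting hypothesis for the reversed list: by planarity the later link, listed first, lies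
  -- inside or outside the interval of the earlier one as a whole.
  · intro k l hkl y hy
    have h : β.revLink l < β.revLink k := β.revLink_lt.2 hkl
    rcases β.hi_lt_lo_or h with h1 | h1
    · have h4 := (β.revLink k).2
      rw [ind_of_notMem, if_neg]
      · simp only [hi, lo] at *; omega
      · intro h3
        have h5 := hx h1
        have h6 := h3.2
        have h7 := hy.1
        linarith
    · rw [if_pos h1.2, ind_of_mem]
      exact ⟨(hx h1.1).trans hy.1, hy.2.trans (hx h1.2)⟩

/-- The Coulomb gas integral as a real integral over unlabelled screening variables. -/
theorem G_eq_integral {κ : ℝ} (hκ : 4 < κ) (hx : x ∈ chamber N) (hR : ∀ i, |x i| < R) :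
    G κ β x = ((normC κ ^ N * (N.factorial : ℝ)⁻¹ * (vand N (1 / κ) x *
      ∫ Y : Fin N → ℝ, β.cfgWeight (4 / κ) x Y * gas (4 / κ) R x Y) : ℝ) : ℂ) := by
  have ht : 0 < 1 / κ := by positivity
  have ht1 : 1 / κ < 1 / 4 := one_div_lt_one_div_of_lt (by norm_num) hκ
  rw [β.G_eq κ hx, integral_density_eq_flat (β.config hx) ht ht1, mul_left_comm, mul_assoc,
    β.phase_mul_integral hx hR ht ht1, mul_one_div]
  push_cast
  ring

end LinkPattern

/-! ### Beta integrals and the normalization constant -/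

section Beta

theorem integral_beta {u v : ℝ} (hu : 0 < u) (hv : 0 < v) :
    ∫ y in Ioo (0 : ℝ) 1, y ^ (u - 1) * (1 - y) ^ (v - 1) =
      Gamma u * Gamma v / Gamma (u + v) := by
  have h := ProbabilityTheory.beta_eq_betaIntegralReal u v hu hv
  rw [ProbabilityTheory.beta] at h
  rw [h, Complex.betaIntegral, intervalIntegral.integral_of_le zero_le_one,
    integral_Ioc_eq_integral_Ioo]
  have e : ∫ y in Ioo (0 : ℝ) 1, (y : ℂ) ^ ((u : ℂ) - 1) * (1 - (y : ℂ)) ^ ((v : ℂ) - 1) =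
      ∫ y in Ioo (0 : ℝ) 1, ((y ^ (u - 1) * (1 - y) ^ (v - 1) : ℝ) : ℂ) := by
    refine setIntegral_congr_fun measurableSet_Ioo fun y hy => ?_
    rw [Complex.ofReal_mul, Complex.ofReal_cpow hy.1.le, Complex.ofReal_cpow (sub_nonneg.2 hy.2.le)]
    push_cast
    rfl
  rw [e, integral_complex_ofReal, Complex.ofReal_re]

theorem integrableOn_beta {p q : ℝ} (hp : -1 < p) (hq : -1 < q) (hp0 : p ≤ 0) (hq0 : q ≤ 0) :
    IntegrableOn (fun y : ℝ => y ^ p * (1 - y) ^ q) (Ioo 0 1) := by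
  have h := integrableOn_prod_abs_sub_rpow (x := ![(0 : ℝ), 1]) (p := ![p, q]) (by
    intro i k; fin_cases i <;> fin_cases k <;> simp) (by intro i; fin_cases i <;> simpa)
    (by intro i; fin_cases i <;> simpa) 0 1
  refine h.congr_fun (fun y hy => ?_) measurableSet_Ioo
  have h1 : |y - 1| = 1 - y := by rw [abs_sub_comm, abs_of_pos (sub_pos.2 hy.2)]
  simp [Fin.prod_univ_two, abs_of_pos hy.1, h1]

variable {A : ℝ}

/-- The substitution y = v/(1 - v) turns this into a beta integral; the second exponent 2A - 2
exceeds -1 because A > 1/2, which is convergence at infinity. -/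
theorem integral_beta_Ioi (hA : 1 / 2 < A) (hA1 : A < 1) :
    IntegrableOn (fun y : ℝ => y ^ (-A) * (1 + y) ^ (-A)) (Ioi 0) ∧
    ∫ y in Ioi (0 : ℝ), y ^ (-A) * (1 + y) ^ (-A) =
      Gamma (1 - A) * Gamma (2 * A - 1) / Gamma A := by
  have himg : (fun v : ℝ => v / (1 - v)) '' Ioo 0 1 = Ioi 0 := by
    ext y
    constructor
    · rintro ⟨v, hv, rfl⟩
      exact div_pos hv.1 (sub_pos.2 hv.2)
    · intro hy
      have hy' : 0 < y := hy
      refine ⟨y / (1 + y), ⟨by positivity, (div_lt_one (by positivity)).2 (by linarith)⟩, ?_⟩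
      simp only
      field_simp
      ring
  have hder : ∀ v ∈ Ioo (0 : ℝ) 1, HasDerivWithinAt (fun v : ℝ => v / (1 - v)) ((1 - v)⁻¹ ^ 2)
      (Ioo 0 1) v := by
    intro v hv
    have h1 : (1 - v) ≠ 0 := (sub_pos.2 hv.2).ne'
    have h2 := (hasDerivAt_id v).fun_div ((hasDerivAt_id v).const_sub 1) h1
    refine (h2.congr_deriv ?_).hasDerivWithinAt
    simp only [id]
    field_simp
    ring
  have hinj : InjOn (fun v : ℝ => v / (1 - v)) (Ioo 0 1) := by
    intro v hv w hw e
    have h1 : (1 - v) ≠ 0 := (sub_pos.2 hv.2).ne'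
    have h2 : (1 - w) ≠ 0 := (sub_pos.2 hw.2).ne'
    simp only at e
    rw [div_eq_div_iff h1 h2] at e
    linarith
  have hintg : ∀ v ∈ Ioo (0 : ℝ) 1, |(1 - v)⁻¹ ^ 2| • ((v / (1 - v)) ^ (-A) *
      (1 + v / (1 - v)) ^ (-A)) = v ^ (-A) * (1 - v) ^ (2 * A - 2) := by
    intro v hv
    have h1 : 0 < 1 - v := sub_pos.2 hv.2
    rw [show 1 + v / (1 - v) = (1 - v)⁻¹ by field_simp; ring, smul_eq_mul,
      abs_of_pos (by positivity), Real.div_rpow hv.1.le h1.le, Real.inv_rpow h1.le,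
      show 2 * A - 2 = A + A + (-2 : ℝ) by ring, Real.rpow_add h1, Real.rpow_add h1,
      Real.rpow_neg h1.le, Real.rpow_neg h1.le, inv_pow]
    norm_cast
    have := Real.rpow_pos_of_pos h1 A
    field_simp
  constructor
  · rw [← himg, integrableOn_image_iff_integrableOn_abs_deriv_smul measurableSet_Ioo hder hinj]
    exact (integrableOn_beta (p := -A) (q := 2 * A - 2) (by linarith) (by linarith) (by linarith)
      (by linarith)).congr_fun (fun v hv => (hintg v hv).symm) measurableSet_Ioo
  · rw [← himg, integral_image_eq_integral_abs_deriv_smul measurableSet_Ioo hder hinj,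
      setIntegral_congr_fun measurableSet_Ioo hintg]
    have := integral_beta (u := 1 - A) (v := 2 * A - 1) (by linarith) (by linarith)
    rw [show 1 - A - 1 = -A by ring, show 2 * A - 1 - 1 = 2 * A - 2 by ring,
      show 1 - A + (2 * A - 1) = A by ring] at this
    exact this

/-- The rescaled interaction of a screening variable with two merging points. -/
def fuseKernel (A y : ℝ) : ℝ := |y| ^ (-A) * |y - 1| ^ (-A)

theorem measurable_fuseKernel : Measurable (fuseKernel A) :=
  (measurable_id.abs.pow_const _).mul ((measurable_id.sub_const _).abs.pow_const _)

theorem fuseKernel_nonneg (y : ℝ) : 0 ≤ fuseKernel A y := by unfold fuseKernel; positivity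

theorem fuseKernel_Ioi (hA : 1 / 2 < A) (hA1 : A < 1) : IntegrableOn (fuseKernel A) (Ioi 1) ∧
    ∫ y in Ioi (1 : ℝ), fuseKernel A y =
      Gamma (1 - A) * Gamma (2 * A - 1) / Gamma A := by
  have h := integral_beta_Ioi hA hA1
  have hpre : (fun y : ℝ => y - 1) ⁻¹' Ioi 0 = Ioi 1 := by ext y; simp
  have hmp := measurePreserving_sub_right (volume : Measure ℝ) 1
  have hemb := (MeasurableEquiv.subRight (1 : ℝ)).measurableEmbedding
  have hc : ∀ y ∈ Ioi (1 : ℝ), (y - 1) ^ (-A) * (1 + (y - 1)) ^ (-A) = fuseKernel A y := by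
    intro y hy
    have hy' : (1 : ℝ) < y := hy
    rw [fuseKernel, abs_of_pos (by linarith), abs_of_pos (by linarith), mul_comm]
    congr 2; ring
  constructor
  · have := (hmp.integrableOn_comp_preimage hemb).2 h.1
    rw [hpre] at this
    exact this.congr_fun hc measurableSet_Ioi
  · have := hmp.setIntegral_preimage_emb hemb (fun y : ℝ => y ^ (-A) * (1 + y) ^ (-A)) (Ioi 0)
    rw [hpre, h.2] at this
    rw [← this]
    exact setIntegral_congr_fun measurableSet_Ioi fun y hy => (hc y hy).symm

theorem fuseKernel_Iio (hA : 1 / 2 < A) (hA1 : A < 1) : IntegrableOn (fuseKernel A) (Iio 0) ∧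
    ∫ y in Iio (0 : ℝ), fuseKernel A y =
      Gamma (1 - A) * Gamma (2 * A - 1) / Gamma A := by
  have h := integral_beta_Ioi hA hA1
  have hpre : (fun y : ℝ => -y) ⁻¹' Ioi 0 = Iio 0 := by ext y; simp
  have hmp := Measure.measurePreserving_neg (volume : Measure ℝ)
  have hemb := (Homeomorph.neg ℝ).measurableEmbedding
  have hc : ∀ y ∈ Iio (0 : ℝ), (-y) ^ (-A) * (1 + (-y)) ^ (-A) = fuseKernel A y := by
    intro y hy
    have hy' : y < 0 := hy
    rw [fuseKernel, abs_of_neg hy', abs_of_neg (by linarith)]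
    congr 2; ring
  constructor
  · have := (hmp.integrableOn_comp_preimage hemb).2 h.1
    change IntegrableOn _ ((fun y : ℝ => -y) ⁻¹' Ioi 0) at this
    rw [hpre] at this
    exact this.congr_fun hc measurableSet_Iio
  · have := hmp.setIntegral_preimage_emb hemb (fun y : ℝ => y ^ (-A) * (1 + y) ^ (-A)) (Ioi 0)
    change ∫ y in ((fun y : ℝ => -y) ⁻¹' Ioi 0), _ = _ at this
    rw [hpre, h.2] at this
    rw [← this]
    exact setIntegral_congr_fun measurableSet_Iio fun y hy => (hc y hy).symm

theorem fuseKernel_Ioo (hA : 1 / 2 < A) (hA1 : A < 1) : IntegrableOn (fuseKernel A) (Ioo 0 1) ∧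
    ∫ y in Ioo (0 : ℝ) 1, fuseKernel A y =
      Gamma (1 - A) ^ 2 / Gamma (2 - 2 * A) := by
  have hc : ∀ y ∈ Ioo (0 : ℝ) 1, y ^ (-A) * (1 - y) ^ (-A) = fuseKernel A y := by
    intro y hy
    rw [fuseKernel, abs_of_pos hy.1, abs_sub_comm, abs_of_pos (sub_pos.2 hy.2)]
  constructor
  · exact (integrableOn_beta (p := -A) (q := -A) (by linarith) (by linarith) (by linarith)
      (by linarith)).congr_fun hc measurableSet_Ioo
  · rw [← setIntegral_congr_fun measurableSet_Ioo hc]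
    have := integral_beta (u := 1 - A) (v := 1 - A) (by linarith) (by linarith)
    rw [show 1 - A - 1 = -A by ring, show 1 - A + (1 - A) = 2 - 2 * A by ring, ← sq] at this
    exact this

theorem integrable_fuseKernel (hA : 1 / 2 < A) (hA1 : A < 1) : Integrable (fuseKernel A) := by
  rw [← integrableOn_univ]
  have h1 : IntegrableOn (fuseKernel A) (Iic 0) := by
    rw [integrableOn_Iic_iff_integrableOn_Iio]
    exact (fuseKernel_Iio hA hA1).1
  have h2 : IntegrableOn (fuseKernel A) (Ioc 0 1) := by
    rw [integrableOn_Ioc_iff_integrableOn_Ioo]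
    exact (fuseKernel_Ioo hA hA1).1
  refine ((h1.union h2).union (fuseKernel_Ioi hA hA1).1).mono_set fun y _ => ?_
  rcases le_or_gt y 0 with h | h
  · exact Or.inl (Or.inl h)
  · rcases le_or_gt y 1 with h' | h'
    · exact Or.inl (Or.inr ⟨h, h'⟩)
    · exact Or.inr h'

theorem integral_fuseKernel_mul (hA : 1 / 2 < A) (hA1 : A < 1) (c₁ c₂ c₃ : ℝ) :
    ∫ y, fuseKernel A y * (if y < 0 then c₁ else if y < 1 then c₂ else c₃) =
      Gamma (1 - A) * Gamma (2 * A - 1) / Gamma A * (c₁ + c₃) +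
        Gamma (1 - A) ^ 2 / Gamma (2 - 2 * A) * c₂ := by
  have hi : Integrable fun y => fuseKernel A y * (if y < 0 then c₁ else if y < 1 then c₂ else c₃) := by
    refine (integrable_fuseKernel hA hA1).mul_bdd (c := |c₁| + |c₂| + |c₃|) ?_ ?_
    · exact (Measurable.ite measurableSet_Iio measurable_const (Measurable.ite measurableSet_Iio
        measurable_const measurable_const)).aestronglyMeasurable
    · refine .of_forall fun y => ?_
      rw [Real.norm_eq_abs]
      have := abs_nonneg c₁
      have := abs_nonneg c₂
      have := abs_nonneg c₃
      split_ifs <;> linarith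
  have h1 : ∫ y in Iio (0 : ℝ), fuseKernel A y * (if y < 0 then c₁ else if y < 1 then c₂ else c₃) =
      (∫ y in Iio (0 : ℝ), fuseKernel A y) * c₁ := by
    rw [← integral_mul_const]
    exact setIntegral_congr_fun measurableSet_Iio fun y hy => by
      simp only [if_pos (show y < 0 from hy)]
  have h2 : ∫ y in Ico (0 : ℝ) 1, fuseKernel A y * (if y < 0 then c₁ else if y < 1 then c₂ else c₃) =
      (∫ y in Ioo (0 : ℝ) 1, fuseKernel A y) * c₂ := by
    rw [← integral_mul_const, integral_Ico_eq_integral_Ioo]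
    exact setIntegral_congr_fun measurableSet_Ioo fun y hy => by
      simp only [if_neg hy.1.not_gt, if_pos hy.2]
  have h3 : ∫ y in Ici (1 : ℝ), fuseKernel A y * (if y < 0 then c₁ else if y < 1 then c₂ else c₃) =
      (∫ y in Ioi (1 : ℝ), fuseKernel A y) * c₃ := by
    rw [← integral_mul_const, integral_Ici_eq_integral_Ioi]
    refine setIntegral_congr_fun measurableSet_Ioi fun y hy => ?_
    have hy' : (1 : ℝ) < y := hy
    simp only [if_neg hy'.not_gt, if_neg (zero_lt_one.trans hy').not_gt]
  rw [← integral_add_compl measurableSet_Iio hi (s := Iio (0 : ℝ)), h1, compl_Iio,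
    ← Ico_union_Ici_eq_Ici (zero_le_one (α := ℝ)), setIntegral_union (by
      rw [Set.disjoint_left]; intro y hy hy'; exact absurd hy.2 (not_lt.2 hy')) measurableSet_Ici
      hi.integrableOn hi.integrableOn, h2, h3, (fuseKernel_Iio hA hA1).2, (fuseKernel_Ioo hA hA1).2,
    (fuseKernel_Ioi hA hA1).2]
  ring

/-- For 4 < κ < 8 the angle 4π/κ lies in (π/2, π), so the cosine is negative and the square root
takes the sign -2cos. -/
theorem sqrt_clusterWeight {κ : ℝ} (hκ : κ ∈ Ioo (4 : ℝ) 8) :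
    Real.sqrt (clusterWeight κ) = -2 * cos (π * (4 / κ)) ∧
      cos (π * (4 / κ)) < 0 := by
  obtain ⟨h4, h8⟩ := hκ
  have hc : cos (π * (4 / κ)) < 0 := by
    refine Real.cos_neg_of_pi_div_two_lt_of_lt ?_ ?_
    · have : 1 / 2 < 4 / κ := by rw [div_lt_div_iff₀] <;> linarith
      nlinarith [Real.pi_pos]
    · have : 4 / κ < 1 := (div_lt_one (by linarith)).2 h4
      nlinarith [Real.pi_pos]
  refine ⟨?_, hc⟩
  rw [clusterWeight, show 4 * π / κ = π * (4 / κ) by ring,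
    show 4 * cos (π * (4 / κ)) ^ 2 = (-2 * cos (π * (4 / κ))) ^ 2 by ring,
    Real.sqrt_sq (by linarith)]

theorem normC_pos {κ : ℝ} (hκ : κ ∈ Ioo (4 : ℝ) 8) : 0 < LinkPattern.normC κ := by
  have h1 := sqrt_clusterWeight hκ
  have h3 : 4 / κ < 1 := (div_lt_one (by linarith [hκ.1])).2 hκ.1
  have h4 : 8 / κ = 2 * (4 / κ) := by ring
  rw [LinkPattern.normC, h1.1, h4]
  exact div_pos (mul_pos (by linarith [h1.2]) (Real.Gamma_pos_of_pos (by linarith)))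
    (pow_pos (Real.Gamma_pos_of_pos (by linarith)) 2)

theorem inner_beta_eq {κ : ℝ} (hκ : κ ∈ Ioo (4 : ℝ) 8) :
    Gamma (1 - 4 / κ) ^ 2 / Gamma (2 - 2 * (4 / κ)) =
      (LinkPattern.normC κ)⁻¹ * (-2 * cos (π * (4 / κ))) := by
  have h1 := sqrt_clusterWeight hκ
  have h3 : 4 / κ < 1 := (div_lt_one (by linarith [hκ.1])).2 hκ.1
  have h4 : 8 / κ = 2 * (4 / κ) := by ring
  have h5 := (Real.Gamma_pos_of_pos (show 0 < 1 - 4 / κ by linarith)).ne'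
  have h6 := (Real.Gamma_pos_of_pos (show 0 < 2 - 2 * (4 / κ) by linarith)).ne'
  have h7 : -2 * cos (π * (4 / κ)) ≠ 0 := by linarith [h1.2]
  rw [LinkPattern.normC, h1.1, h4]
  generalize Gamma (1 - 4 / κ) = a at *
  generalize Gamma (2 - 2 * (4 / κ)) = b at *
  generalize -2 * cos (π * (4 / κ)) = c at *
  field_simp

/-- The reflection formula at A and at 2A - 1, together with sin 2πA = 2 sin πA cos πA, gives
Γ(2A-1)Γ(2-2A)(-2cos πA) = Γ(A)Γ(1-A). Hence the integral outside the two points is that between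
them divided by √q. -/
theorem outer_beta_eq {κ : ℝ} (hκ : κ ∈ Ioo (4 : ℝ) 8) :
    Gamma (1 - 4 / κ) * Gamma (2 * (4 / κ) - 1) / Gamma (4 / κ) =
      (LinkPattern.normC κ)⁻¹ := by
  have h1 := sqrt_clusterWeight hκ
  have h2 : 1 / 2 < 4 / κ := by rw [div_lt_div_iff₀] <;> linarith [hκ.1, hκ.2]
  have h3 : 4 / κ < 1 := (div_lt_one (by linarith [hκ.1])).2 hκ.1
  have h4 : 8 / κ = 2 * (4 / κ) := by ring
  have hc : cos (π * (4 / κ)) ≠ 0 := h1.2.ne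
  rw [LinkPattern.normC, h1.1, h4]
  generalize 4 / κ = A at *
  have h5 := (Real.Gamma_pos_of_pos (show 0 < 1 - A by linarith)).ne'
  have h6 := (Real.Gamma_pos_of_pos (show 0 < 2 - 2 * A by linarith)).ne'
  have h7 := (Real.Gamma_pos_of_pos (show 0 < A by linarith)).ne'
  have h8 := (Real.Gamma_pos_of_pos (show 0 < 2 * A - 1 by linarith)).ne'
  have hs : sin (π * A) ≠ 0 :=
    (Real.sin_pos_of_pos_of_lt_pi (by nlinarith [Real.pi_pos]) (by nlinarith [Real.pi_pos])).ne'
  have e1 := Real.Gamma_mul_Gamma_one_sub A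
  have e2 := Real.Gamma_mul_Gamma_one_sub (2 * A - 1)
  rw [show 1 - (2 * A - 1) = 2 - 2 * A by ring,
    show π * (2 * A - 1) = 2 * (π * A) - π by ring, Real.sin_sub_pi,
    Real.sin_two_mul] at e2
  generalize Gamma (1 - A) = a at *
  generalize Gamma (2 - 2 * A) = b at *
  generalize Gamma A = c at *
  generalize Gamma (2 * A - 1) = d at *
  generalize sin (π * A) = s at *
  generalize cos (π * A) = z at *
  rw [eq_div_iff hs] at e1
  rw [eq_div_iff (neg_ne_zero.2 (by positivity))] at e2
  have e3 : d * b * (-2 * z) = c * a := mul_right_cancel₀ hs (by linear_combination e2 - e1)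
  rw [inv_div, div_eq_div_iff h7 (by positivity)]
  linear_combination a * e3

end Beta

/-! ### Concentration of one screening variable at two merging points -/

section Kernel

/-- The filter of pairs `p.1 < p.2` merging at `ξ`. -/
abbrev merge (ξ : ℝ) : Filter (ℝ × ℝ) := 𝓝[{p | p.1 < p.2}] (ξ, ξ)

variable {A ξ : ℝ}

theorem eventually_merge_lt : ∀ᶠ p in merge ξ, p.1 < p.2 := self_mem_nhdsWithin

theorem tendsto_merge_fst : Tendsto (fun p : ℝ × ℝ => p.1) (merge ξ) (𝓝 ξ) :=
  (continuous_fst.tendsto (ξ, ξ)).mono_left nhdsWithin_le_nhds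

theorem tendsto_merge_snd : Tendsto (fun p : ℝ × ℝ => p.2) (merge ξ) (𝓝 ξ) :=
  (continuous_snd.tendsto (ξ, ξ)).mono_left nhdsWithin_le_nhds

theorem tendsto_merge_sub : Tendsto (fun p : ℝ × ℝ => p.2 - p.1) (merge ξ) (𝓝 0) := by
  simpa using tendsto_merge_snd.sub (tendsto_merge_fst (ξ := ξ))

theorem tendsto_merge_point (y : ℝ) :
    Tendsto (fun p : ℝ × ℝ => p.1 + (p.2 - p.1) * y) (merge ξ) (𝓝 ξ) := by
  simpa using tendsto_merge_fst.add ((tendsto_merge_sub (ξ := ξ)).mul_const y)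

theorem tendsto_merge_rpow {c : ℝ} (hc : 0 < c) :
    Tendsto (fun p : ℝ × ℝ => (p.2 - p.1) ^ c) (merge ξ) (𝓝 0) := by
  have := (tendsto_merge_sub (ξ := ξ)).rpow_const (p := c) (Or.inr hc.le)
  rwa [Real.zero_rpow hc.ne'] at this

/-- The interaction of a screening variable with two merging points, normalized. -/
def mergeKernel (A : ℝ) (p : ℝ × ℝ) (y : ℝ) : ℝ :=
  (p.2 - p.1) ^ (2 * A - 1) * (|y - p.1| ^ (-A) * |y - p.2| ^ (-A))

theorem mergeKernel_nonneg {p : ℝ × ℝ} (hp : p.1 < p.2) (y : ℝ) : 0 ≤ mergeKernel A p y := by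
  have := sub_pos.2 hp
  unfold mergeKernel
  positivity

theorem measurable_mergeKernel (p : ℝ × ℝ) : Measurable (mergeKernel A p) :=
  (((measurable_id.sub_const _).abs.pow_const _).mul
    ((measurable_id.sub_const _).abs.pow_const _)).const_mul _

theorem mergeKernel_eq {p : ℝ × ℝ} (hp : p.1 < p.2) (y : ℝ) :
    mergeKernel A p y = (p.2 - p.1)⁻¹ * fuseKernel A ((y - p.1) / (p.2 - p.1)) := by
  have h := sub_pos.2 hp
  have e1 : y - p.2 = (p.2 - p.1) * ((y - p.1) / (p.2 - p.1) - 1) := by field_simp; ring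
  have e2 : |y - p.1| = (p.2 - p.1) * |(y - p.1) / (p.2 - p.1)| := by
    rw [abs_div, abs_of_pos h]; field_simp
  rw [mergeKernel, fuseKernel, e1, abs_mul, abs_of_pos h, e2, Real.mul_rpow h.le (abs_nonneg _),
    Real.mul_rpow h.le (abs_nonneg _)]
  have e3 : (p.2 - p.1)⁻¹ = (p.2 - p.1) ^ (2 * A - 1) * ((p.2 - p.1) ^ (-A) * (p.2 - p.1) ^ (-A)) := by
    rw [← Real.rpow_add h, ← Real.rpow_add h, ← Real.rpow_neg_one]
    congr 1; ring
  rw [e3]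
  ring

theorem integrable_mergeKernel (hA : 1 / 2 < A) (hA1 : A < 1) {p : ℝ × ℝ} (hp : p.1 < p.2) :
    Integrable (mergeKernel A p) := by
  have h := (((integrable_fuseKernel hA hA1).comp_div (sub_pos.2 hp).ne').comp_sub_right
    p.1).const_mul (p.2 - p.1)⁻¹
  exact h.congr (.of_forall fun y => (mergeKernel_eq hp y).symm)

theorem integral_mergeKernel_mul {p : ℝ × ℝ} (hp : p.1 < p.2) (Φ : ℝ → ℝ) :
    ∫ y, mergeKernel A p y * Φ y = ∫ y, fuseKernel A y * Φ (p.1 + (p.2 - p.1) * y) := by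
  have h := sub_pos.2 hp
  have e : ∀ y, fuseKernel A y * Φ (p.1 + (p.2 - p.1) * y) =
      (p.2 - p.1) * (fun z => mergeKernel A p (p.1 + z) * Φ (p.1 + z)) ((p.2 - p.1) * y) := by
    intro y
    simp only
    rw [mergeKernel_eq hp, add_sub_cancel_left, mul_div_cancel_left₀ _ h.ne']
    field_simp
  simp only [e]
  rw [integral_const_mul, Measure.integral_comp_mul_left
    (fun z => mergeKernel A p (p.1 + z) * Φ (p.1 + z)), abs_of_pos (inv_pos.2 h), smul_eq_mul,
    mul_inv_cancel_left₀ h.ne', integral_add_left_eq_self fun z => mergeKernel A p z * Φ z]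

/-- The kernel concentrates at ξ on the scale p.2 - p.1. The function `Φ` may have different limits
on the three sides of the two points, and each is weighted by the mass of the rescaled kernel there.
The part near ξ is handled by rescaling and dominated convergence. -/
theorem tendsto_integral_mergeKernel (hA : 1 / 2 < A) (hA1 : A < 1) {Φ : ℝ × ℝ → ℝ → ℝ}
    {g : ℝ → ℝ} (hg : Integrable g) {M ρ : ℝ} (hρ : 0 < ρ) (hM : ∀ y, |y - ξ| < ρ → g y ≤ M)
    (hm : ∀ᶠ p in merge ξ, Measurable (Φ p)) (hΦ : ∀ᶠ p in merge ξ, ∀ y, |Φ p y| ≤ g y)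
    {c₁ c₂ c₃ : ℝ}
    (h1 : ∀ y < 0, Tendsto (fun p => Φ p (p.1 + (p.2 - p.1) * y)) (merge ξ) (𝓝 c₁))
    (h2 : ∀ y, 0 < y → y < 1 → Tendsto (fun p => Φ p (p.1 + (p.2 - p.1) * y)) (merge ξ) (𝓝 c₂))
    (h3 : ∀ y, 1 < y → Tendsto (fun p => Φ p (p.1 + (p.2 - p.1) * y)) (merge ξ) (𝓝 c₃)) :
    (∀ᶠ p in merge ξ, Integrable fun y => mergeKernel A p y * Φ p y) ∧
    Tendsto (fun p => ∫ y, mergeKernel A p y * Φ p y) (merge ξ)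
      (𝓝 (Gamma (1 - A) * Gamma (2 * A - 1) / Gamma A * (c₁ + c₃) +
        Gamma (1 - A) ^ 2 / Gamma (2 - 2 * A) * c₂)) := by
  classical
  set near : ℝ × ℝ → ℝ → ℝ := fun p y => if |y - ξ| < ρ then Φ p y else 0 with hnear
  have hball : MeasurableSet {y : ℝ | |y - ξ| < ρ} :=
    measurableSet_lt (measurable_id.sub_const ξ).abs measurable_const
  have hnm : ∀ᶠ p in merge ξ, Measurable (near p) := by
    filter_upwards [hm] with p hp using Measurable.ite hball hp measurable_const
  have hnb : ∀ᶠ p in merge ξ, ∀ y, ‖near p y‖ ≤ |M| := by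
    filter_upwards [hΦ] with p hp y
    simp only [hnear]
    split_ifs with h
    · exact (hp y).trans ((hM y h).trans (le_abs_self M))
    · simp
  have hN : Tendsto (fun p => ∫ y, mergeKernel A p y * near p y) (merge ξ)
      (𝓝 (Gamma (1 - A) * Gamma (2 * A - 1) / Gamma A * (c₁ + c₃) +
        Gamma (1 - A) ^ 2 / Gamma (2 - 2 * A) * c₂)) := by
    rw [← integral_fuseKernel_mul hA hA1]
    have : Tendsto (fun p => ∫ y, fuseKernel A y * near p (p.1 + (p.2 - p.1) * y)) (merge ξ)
        (𝓝 (∫ y, fuseKernel A y * (if y < 0 then c₁ else if y < 1 then c₂ else c₃))) := by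
      refine tendsto_integral_filter_of_dominated_convergence (fun y => fuseKernel A y * |M|) ?_ ?_
        ((integrable_fuseKernel hA hA1).mul_const _) ?_
      · filter_upwards [hnm] with p hp
        exact (measurable_fuseKernel.mul (hp.comp (by fun_prop))).aestronglyMeasurable
      · filter_upwards [hnb] with p hp
        refine .of_forall fun y => ?_
        rw [norm_mul, Real.norm_of_nonneg (fuseKernel_nonneg y)]
        exact mul_le_mul_of_nonneg_left (hp _) (fuseKernel_nonneg y)
      · filter_upwards [Measure.ae_ne volume (0 : ℝ), Measure.ae_ne volume (1 : ℝ)] with y hy0 hy1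
        refine Tendsto.const_mul _ ?_
        have hev : ∀ᶠ p in merge ξ, Φ p (p.1 + (p.2 - p.1) * y) =
            near p (p.1 + (p.2 - p.1) * y) := by
          have := (tendsto_merge_point (ξ := ξ) y).eventually (ball_mem_nhds ξ hρ)
          filter_upwards [this] with p hp
          rw [Real.dist_eq] at hp
          simp only [hnear, if_pos hp]
        refine Tendsto.congr' hev ?_
        rcases lt_or_gt_of_ne hy0 with h | h
        · rw [if_pos h]
          exact h1 y h
        · rw [if_neg h.not_gt]
          rcases lt_or_gt_of_ne hy1 with h' | h'
          · rw [if_pos h']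
            exact h2 y h h'
          · rw [if_neg h'.not_gt]
            exact h3 y h'
    refine this.congr' ?_
    filter_upwards [eventually_merge_lt] with p hp
    exact (integral_mergeKernel_mul hp (near p)).symm
  -- Away from ξ the two singular factors are bounded and the prefactor tends to 0, since 2A - 1 >
  -- 0.
  have hfar : ∀ᶠ p in merge ξ, ∀ y, ‖mergeKernel A p y * (Φ p y - near p y)‖ ≤
      (p.2 - p.1) ^ (2 * A - 1) * ((ρ / 2) ^ (-A) * (ρ / 2) ^ (-A)) * g y := by
    have e1 := tendsto_merge_fst.eventually (ball_mem_nhds ξ (half_pos hρ))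
    have e2 := tendsto_merge_snd.eventually (ball_mem_nhds ξ (half_pos hρ))
    filter_upwards [hΦ, eventually_merge_lt, e1, e2] with p hp hlt h1 h2 y
    have hg0 : 0 ≤ g y := (abs_nonneg _).trans (hp y)
    have hε := sub_pos.2 hlt
    by_cases h : |y - ξ| < ρ
    · simp only [hnear, if_pos h, sub_self, mul_zero, norm_zero]
      positivity
    · simp only [hnear, if_neg h, sub_zero]
      rw [norm_mul, Real.norm_of_nonneg (mergeKernel_nonneg hlt y)]
      refine mul_le_mul ?_ (hp y) (norm_nonneg _) (by positivity)
      rw [Real.dist_eq] at h1 h2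
      have hy : ρ ≤ |y - ξ| := not_lt.1 h
      have a1 : ρ / 2 ≤ |y - p.1| := by
        have := abs_sub_abs_le_abs_sub (y - ξ) (p.1 - ξ)
        rw [sub_sub_sub_cancel_right] at this
        linarith
      have a2 : ρ / 2 ≤ |y - p.2| := by
        have := abs_sub_abs_le_abs_sub (y - ξ) (p.2 - ξ)
        rw [sub_sub_sub_cancel_right] at this
        linarith
      refine mul_le_mul_of_nonneg_left (mul_le_mul ?_ ?_ (by positivity) (by positivity))
        (by positivity)
      · exact Real.rpow_le_rpow_of_nonpos (by positivity) a1 (by linarith)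
      · exact Real.rpow_le_rpow_of_nonpos (by positivity) a2 (by linarith)
  have hF : Tendsto (fun p => ∫ y, mergeKernel A p y * (Φ p y - near p y)) (merge ξ) (𝓝 0) := by
    refine squeeze_zero_norm' (a := fun p : ℝ × ℝ =>
      (p.2 - p.1) ^ (2 * A - 1) * ((ρ / 2) ^ (-A) * (ρ / 2) ^ (-A)) * ∫ y, g y) ?_ ?_
    · filter_upwards [hfar] with p hp
      rw [← integral_const_mul]
      exact norm_integral_le_of_norm_le (hg.const_mul _) (.of_forall hp)
    · have := ((tendsto_merge_rpow (ξ := ξ) (show 0 < 2 * A - 1 by linarith)).mul_const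
        ((ρ / 2) ^ (-A) * (ρ / 2) ^ (-A))).mul_const (∫ y, g y)
      simpa using this
  have hsplit : ∀ᶠ p in merge ξ, Integrable (fun y => mergeKernel A p y * near p y) ∧
      Integrable (fun y => mergeKernel A p y * (Φ p y - near p y)) := by
    filter_upwards [hm, hnm, hnb, hfar, eventually_merge_lt] with p hm hnm hnb hfar hlt
    exact ⟨(integrable_mergeKernel hA hA1 hlt).mul_bdd (c := |M|) hnm.aestronglyMeasurable
      (.of_forall hnb), Integrable.mono' (hg.const_mul _)
      ((measurable_mergeKernel p).mul (hm.sub hnm)).aestronglyMeasurable (.of_forall hfar)⟩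
  have hadd : ∀ p y, mergeKernel A p y * near p y + mergeKernel A p y * (Φ p y - near p y) =
      mergeKernel A p y * Φ p y := fun p y => by ring
  constructor
  · filter_upwards [hsplit] with p hp
    simpa only [hadd] using hp.1.fun_add hp.2
  · have := hN.add hF
    rw [add_zero] at this
    refine this.congr' ?_
    filter_upwards [hsplit] with p hp
    rw [← integral_add hp.1 hp.2]
    simp only [hadd]

/-- Truncate `F p` to the interval [-G, G]. Ordinary dominated convergence applies to the
truncation, and the truncation error is at most `E p`, whose integral tends to 0. -/
theorem tendsto_integral_of_dominated_add {α Q : Type*} [MeasurableSpace α] {μ : Measure α}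
    {l : Filter Q} [l.IsCountablyGenerated] {F : Q → α → ℝ} {f G : α → ℝ} {E : Q → α → ℝ}
    (hF : ∀ᶠ p in l, AEStronglyMeasurable (F p) μ) (hG : Integrable G μ)
    (hE : ∀ᶠ p in l, Integrable (E p) μ) (hG0 : ∀ a, 0 ≤ G a) (hE0 : ∀ᶠ p in l, ∀ a, 0 ≤ E p a)
    (hb : ∀ᶠ p in l, ∀ a, |F p a| ≤ G a + E p a)
    (hEi : Tendsto (fun p => ∫ a, E p a ∂μ) l (𝓝 0))
    (hlim : ∀ᵐ a ∂μ, Tendsto (F · a) l (𝓝 (f a))) (hf : ∀ᵐ a ∂μ, |f a| ≤ G a) :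
    Tendsto (fun p => ∫ a, F p a ∂μ) l (𝓝 (∫ a, f a ∂μ)) := by
  set c : Q → α → ℝ := fun p a => max (-G a) (min (G a) (F p a)) with hc
  have hcm : ∀ᶠ p in l, AEStronglyMeasurable (c p) μ := by
    filter_upwards [hF] with p hp
    exact hG.aestronglyMeasurable.neg.sup (hG.aestronglyMeasurable.inf hp)
  have hcb : ∀ p a, ‖c p a‖ ≤ G a := fun p a => by
    have := hG0 a
    rw [Real.norm_eq_abs, abs_le]
    exact ⟨le_max_left _ _, max_le (by linarith) (min_le_left _ _)⟩
  have h1 : Tendsto (fun p => ∫ a, c p a ∂μ) l (𝓝 (∫ a, f a ∂μ)) := by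
    refine tendsto_integral_filter_of_dominated_convergence G hcm
      (.of_forall fun p => .of_forall (hcb p)) hG ?_
    filter_upwards [hlim, hf] with a ha hfa
    have h2 : Tendsto (c · a) l (𝓝 (max (-G a) (min (G a) (f a)))) :=
      tendsto_const_nhds.max (tendsto_const_nhds.min ha)
    rwa [min_eq_right (abs_le.1 hfa).2, max_eq_right (abs_le.1 hfa).1] at h2
  have hd : ∀ᶠ p in l, ∀ a, ‖F p a - c p a‖ ≤ E p a := by
    filter_upwards [hb, hE0] with p hp h0 a
    have h2 := abs_le.1 (hp a)
    have h3 := h0 a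
    have h4 := hG0 a
    rw [Real.norm_eq_abs, abs_le]
    simp only [hc]
    rcases max_cases (-G a) (min (G a) (F p a)) with h | h <;>
      rcases min_cases (G a) (F p a) with h' | h' <;> constructor <;> linarith
  have h2 : Tendsto (fun p => ∫ a, (F p a - c p a) ∂μ) l (𝓝 0) := by
    refine squeeze_zero_norm' ?_ hEi
    filter_upwards [hd, hE] with p hp hi
    exact norm_integral_le_of_norm_le hi (.of_forall hp)
  have := h1.add h2
  rw [add_zero] at this
  refine this.congr' ?_
  filter_upwards [hF, hcm, hd, hE] with p hF hcm hd hE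
  rw [← integral_add]
  · simp
  · exact hG.mono' hcm (.of_forall (hcb p))
  · exact hE.mono' (hF.sub hcm) (.of_forall hd)

end Kernel

/-! ### Singling out the variable nearest to the merging points -/

section Argmin

variable {ι : Type*} [Fintype ι]

open Classical in
/-- The indicator that `d` is minimal at `r`. -/
def isArgmin (d : ι → ℝ) (r : ι) : ℝ := if ∀ s, d r ≤ d s then 1 else 0

/-- The uniform distribution on the set where `d` is minimal. -/
def argminWeight (d : ι → ℝ) (r : ι) : ℝ := isArgmin d r / ∑ s, isArgmin d s

theorem isArgmin_nonneg (d : ι → ℝ) (r : ι) : 0 ≤ isArgmin d r := by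
  unfold isArgmin; split_ifs <;> norm_num

/-- Sharing ties equally makes the weights an exact, permutation-equivariant partition of unity,
without any discussion of coincidences. -/
theorem sum_argminWeight [Nonempty ι] (d : ι → ℝ) : ∑ r, argminWeight d r = 1 := by
  obtain ⟨r, hr⟩ := Finite.exists_min d
  have h1 : isArgmin d r = 1 := by rw [isArgmin, if_pos hr]
  have h2 : 1 ≤ ∑ s, isArgmin d s := h1 ▸ Finset.single_le_sum (f := isArgmin d)
    (fun s _ => isArgmin_nonneg d s) (Finset.mem_univ r)
  simp only [argminWeight]
  rw [← Finset.sum_div, div_self (by linarith)]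

theorem argminWeight_nonneg (d : ι → ℝ) (r : ι) : 0 ≤ argminWeight d r :=
  div_nonneg (isArgmin_nonneg d r) (Finset.sum_nonneg fun s _ => isArgmin_nonneg d s)

theorem argminWeight_le_one (d : ι → ℝ) (r : ι) : argminWeight d r ≤ 1 :=
  div_le_one_of_le₀ (Finset.single_le_sum (fun s _ => isArgmin_nonneg d s) (Finset.mem_univ r))
    (Finset.sum_nonneg fun s _ => isArgmin_nonneg d s)

theorem argminWeight_eq_zero {d : ι → ℝ} {r : ι} (h : ¬ ∀ s, d r ≤ d s) : argminWeight d r = 0 := by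
  rw [argminWeight, isArgmin, if_neg h, zero_div]

theorem argminWeight_eq_one {d : ι → ℝ} {r : ι} (h : ∀ s, s ≠ r → d r < d s) :
    argminWeight d r = 1 := by
  have h1 : isArgmin d r = 1 := by
    refine if_pos fun s => ?_
    by_cases e : s = r
    · rw [e]
    · exact (h s e).le
  have h2 : ∑ s, isArgmin d s = isArgmin d r :=
    Finset.sum_eq_single r (fun s _ hs => if_neg fun h3 => absurd (h3 r) (h s hs).not_ge) (by simp)
  rw [argminWeight, h2, h1, div_one]

theorem argminWeight_comp (d : ι → ℝ) (σ : Equiv.Perm ι) (r : ι) :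
    argminWeight (fun s => d (σ s)) r = argminWeight d (σ r) := by
  have h : ∀ r, isArgmin (fun s => d (σ s)) r = isArgmin d (σ r) := by
    intro r
    unfold isArgmin
    congr 1
    exact propext (σ.forall_congr_right (q := fun s => d (σ r) ≤ d s))
  simp only [argminWeight, h]
  rw [Equiv.sum_comp σ fun s => isArgmin d s]

theorem measurable_argminWeight (r : ι) : Measurable fun d : ι → ℝ => argminWeight d r := by
  have h : ∀ r : ι, Measurable fun d : ι → ℝ => isArgmin d r := by
    intro r
    refine Measurable.ite ?_ measurable_const measurable_const
    rw [show {d : ι → ℝ | ∀ s, d r ≤ d s} = ⋂ s, {d | d r ≤ d s} by ext; simp]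
    exact MeasurableSet.iInter fun s =>
      measurableSet_le (measurable_pi_apply r) (measurable_pi_apply s)
  exact (h r).div (measurable_sum _ fun s _ => h s)

/-- A symmetric integral is a multiple of the integral over the region where the variable with
index `0` is closest to `c`. -/
theorem integral_eq_mul_argmin {n : ℕ} (c : ℝ) {F : (Fin (n + 1) → ℝ) → ℝ} (hF : Integrable F)
    (hs : ∀ (σ : Equiv.Perm (Fin (n + 1))) X, F (fun r => X (σ r)) = F X) :
    ∫ X, F X = (n + 1) * ∫ X, argminWeight (fun r => |X r - c|) 0 * F X := by
  have hm : ∀ r : Fin (n + 1), Measurable fun X : Fin (n + 1) → ℝ =>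
      argminWeight (fun r => |X r - c|) r := fun r =>
    (measurable_argminWeight r).comp (Continuous.measurable (by fun_prop :
      Continuous fun (X : Fin (n + 1) → ℝ) s => |X s - c|))
  have hi : ∀ r : Fin (n + 1), Integrable fun X : Fin (n + 1) → ℝ =>
      argminWeight (fun r => |X r - c|) r * F X := fun r =>
    hF.bdd_mul (c := 1) (hm r).aestronglyMeasurable (.of_forall fun X => by
      rw [Real.norm_of_nonneg (argminWeight_nonneg _ _)]
      exact argminWeight_le_one _ _)
  have he : ∀ r : Fin (n + 1), ∫ X : Fin (n + 1) → ℝ, argminWeight (fun r => |X r - c|) r * F X =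
      ∫ X, argminWeight (fun r => |X r - c|) 0 * F X := by
    intro r
    rw [← integral_comp_equiv (Equiv.swap 0 r) fun X => argminWeight (fun r => |X r - c|) r * F X]
    refine integral_congr_ae (.of_forall fun X => ?_)
    simp only [Equiv.symm_swap]
    rw [hs, argminWeight_comp fun s => |X s - c|, Equiv.swap_apply_right]
  have h1 : ∫ X, F X = ∫ X : Fin (n + 1) → ℝ, ∑ r, argminWeight (fun r => |X r - c|) r * F X := by
    simp only [← Finset.sum_mul, sum_argminWeight, one_mul]
  rw [h1, integral_finsetSum _ fun r _ => hi r, sum_congr rfl fun r _ => he r,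
    Finset.sum_const, Finset.card_univ, Fintype.card_fin, nsmul_eq_mul]
  push_cast
  rfl

end Argmin

/-! ### Splitting off the first variable -/

section Cons

theorem integral_cons {n : ℕ} {F : (Fin (n + 1) → ℝ) → ℝ} (hF : Integrable F) :
    Integrable (fun X : Fin n → ℝ => ∫ y : ℝ, F (Fin.cons y X)) ∧
    ∫ X, F X = ∫ X : Fin n → ℝ, ∫ y : ℝ, F (Fin.cons y X) := by
  have hp := (volume_preserving_piFinSuccAbove (fun _ : Fin (n + 1) => ℝ) 0).symm
  have h1 : Integrable fun z : ℝ × (Fin n → ℝ) => F (Fin.cons z.1 z.2) := by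
    have := (hp.integrable_comp_emb (MeasurableEquiv.measurableEmbedding _)).2 hF
    refine this.congr (.of_forall fun z => ?_)
    simp [MeasurableEquiv.piFinSuccAbove_symm_apply, Fin.insertNthEquiv]
  have h2 : ∫ X, F X = ∫ z : ℝ × (Fin n → ℝ), F (Fin.cons z.1 z.2) := by
    rw [← hp.integral_comp']
    refine integral_congr_ae (.of_forall fun z => ?_)
    simp [MeasurableEquiv.piFinSuccAbove_symm_apply, Fin.insertNthEquiv]
  rw [Measure.volume_eq_prod] at h1 h2
  refine ⟨h1.integral_prod_right, ?_⟩
  rw [h2, integral_prod_symm _ h1]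

theorem measurable_cons {n : ℕ} (X : Fin n → ℝ) :
    Measurable fun y : ℝ => (Fin.cons y X : Fin (n + 1) → ℝ) := by
  refine measurable_pi_lambda _ fun k => ?_
  refine Fin.cases ?_ (fun k => ?_) k
  · exact measurable_id
  · exact measurable_const

theorem repulsion_cons {n : ℕ} (A y : ℝ) (X : Fin n → ℝ) :
    repulsion A (Fin.cons y X : Fin (n + 1) → ℝ) =
      (∏ s, (|y - X s| ^ A * |y - X s| ^ A)) * repulsion A X := by
  simp only [repulsion, Fin.prod_univ_succ, Fin.cons_zero, Fin.cons_succ, if_true,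
    (Fin.succ_ne_zero _).symm, if_false, one_mul, Fin.succ_ne_zero, Fin.succ_inj]
  rw [prod_mul_distrib, ← mul_assoc, ← prod_mul_distrib]
  simp only [abs_sub_comm (X _) y]

end Cons

/-! ### Bounds on the interaction of the other variables with the close one -/

section Bounds

variable {A : ℝ} {p : ℝ × ℝ}

/-- The interaction of a screening variable `z` with two points and with a screening variable
`y` close to them. -/
def pairFactor (A : ℝ) (p : ℝ × ℝ) (y z : ℝ) : ℝ :=
  |z - p.1| ^ (-A) * |z - p.2| ^ (-A) * (|y - z| ^ A * |y - z| ^ A)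

theorem pairFactor_nonneg (y z : ℝ) : 0 ≤ pairFactor A p y z := by unfold pairFactor; positivity

theorem measurable_pairFactor (z : ℝ) : Measurable fun y => pairFactor A p y z :=
  (((measurable_id.sub_const z).abs.pow_const A).mul
    ((measurable_id.sub_const z).abs.pow_const A)).const_mul _

/-- If y is at least as close to p.1 as z is, then |y - z| ≤ 2|z - p.1|, and the repulsion between y
and z cancels the attraction of z to p.1. What remains, (|z - p.1|/|z - p.2|)^A, is controlled by
subadditivity of the power A ≤ 1. -/
theorem pairFactor_le (hA : 0 < A) (hA1 : A < 1) (hp : p.1 < p.2) {y z : ℝ}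
    (h : |y - p.1| ≤ |z - p.1|) :
    pairFactor A p y z ≤ 4 ^ A * (1 + (p.2 - p.1) ^ A * |z - p.2| ^ (-A)) := by
  have hε := sub_pos.2 hp
  rcases eq_or_ne z p.1 with e | e
  -- At z = p.1 the factor is zero by the convention that zero to a nonzero real power is zero.
  · rw [pairFactor, e, sub_self, abs_zero, Real.zero_rpow (by linarith)]
    simp only [zero_mul]
    positivity
  have hd : 0 < |z - p.1| := abs_pos.2 (sub_ne_zero.2 e)
  have h1 : |y - z| ≤ 2 * |z - p.1| := by
    have : |y - z| ≤ |y - p.1| + |z - p.1| := by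
      rw [← abs_neg (z - p.1)]
      refine le_trans (le_of_eq ?_) (abs_add_le _ _)
      congr 1; ring
    linarith
  have h2 : |y - z| ^ A * |y - z| ^ A ≤ 4 ^ A * (|z - p.1| ^ A * |z - p.1| ^ A) := by
    rw [← Real.mul_rpow (abs_nonneg _) (abs_nonneg _), ← Real.mul_rpow hd.le hd.le,
      ← Real.mul_rpow (by norm_num) (by positivity)]
    refine Real.rpow_le_rpow (by positivity) ?_ hA.le
    nlinarith [abs_nonneg (y - z)]
  have h3 : |z - p.1| ^ A ≤ |z - p.2| ^ A + (p.2 - p.1) ^ A := by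
    refine (Real.rpow_le_rpow hd.le ?_ hA.le).trans
      (Real.rpow_add_le_add_rpow (abs_nonneg _) hε.le hA.le hA1.le)
    rw [← abs_of_pos hε]
    refine le_trans (le_of_eq ?_) (abs_add_le _ _)
    congr 1; ring
  have h4 : |z - p.1| ^ (-A) * |z - p.1| ^ A = 1 := by
    rw [← Real.rpow_add hd, neg_add_cancel, Real.rpow_zero]
  have h5 : |z - p.2| ^ (-A) * |z - p.2| ^ A ≤ 1 := by
    rcases eq_or_ne z p.2 with e | e
    · rw [e, sub_self, abs_zero, Real.zero_rpow hA.ne']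
      simp
    · rw [← Real.rpow_add (abs_pos.2 (sub_ne_zero.2 e)), neg_add_cancel, Real.rpow_zero]
  calc pairFactor A p y z ≤ |z - p.1| ^ (-A) * |z - p.2| ^ (-A) *
        (4 ^ A * (|z - p.1| ^ A * |z - p.1| ^ A)) :=
        mul_le_mul_of_nonneg_left h2 (by positivity)
    _ = 4 ^ A * (|z - p.1| ^ (-A) * |z - p.1| ^ A) * (|z - p.2| ^ (-A) * |z - p.1| ^ A) := by ring
    _ = 4 ^ A * (|z - p.2| ^ (-A) * |z - p.1| ^ A) := by rw [h4, mul_one]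
    _ ≤ 4 ^ A * (|z - p.2| ^ (-A) * (|z - p.2| ^ A + (p.2 - p.1) ^ A)) := by gcongr
    _ = 4 ^ A * (|z - p.2| ^ (-A) * |z - p.2| ^ A + (p.2 - p.1) ^ A * |z - p.2| ^ (-A)) := by ring
    _ ≤ 4 ^ A * (1 + (p.2 - p.1) ^ A * |z - p.2| ^ (-A)) := by gcongr

theorem tendsto_pairFactor {ξ z : ℝ} (hz : z ≠ ξ) {y : ℝ × ℝ → ℝ}
    (hy : Tendsto y (merge ξ) (𝓝 ξ)) :
    Tendsto (fun p => pairFactor A p (y p) z) (merge ξ) (𝓝 1) := by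
  have h0 : |z - ξ| ≠ 0 := abs_ne_zero.2 (sub_ne_zero.2 hz)
  have h0' : |ξ - z| ≠ 0 := abs_ne_zero.2 (sub_ne_zero.2 hz.symm)
  have h1 := ((tendsto_merge_fst (ξ := ξ)).const_sub z).abs.rpow_const (p := -A) (Or.inl h0)
  have h2 := ((tendsto_merge_snd (ξ := ξ)).const_sub z).abs.rpow_const (p := -A) (Or.inl h0)
  have h3 := (hy.sub_const z).abs.rpow_const (p := A) (Or.inl h0')
  have h4 := (h1.mul h2).mul (h3.mul h3)
  refine h4.trans (le_of_eq ?_)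
  have hd : 0 < |z - ξ| := abs_pos.2 (sub_ne_zero.2 hz)
  rw [abs_sub_comm ξ z, ← Real.rpow_add hd, ← Real.rpow_add hd, ← Real.rpow_add hd,
    show -A + -A + (A + A) = 0 by ring, Real.rpow_zero]

variable {P : Type*} [Fintype P] [DecidableEq P] {x : P → ℝ} {R ξ : ℝ}

theorem continuousAt_charge (hξ : ∀ i, x i ≠ ξ) (hR : |ξ| < R) : ContinuousAt (charge A R x) ξ := by
  have h1 : ContinuousAt (fun y => ∏ i, |y - x i| ^ (-A)) ξ := by
    refine tendsto_finsetProd _ fun i _ => ?_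
    refine ContinuousAt.rpow_const (by fun_prop) (Or.inl ?_)
    exact abs_ne_zero.2 (sub_ne_zero.2 (hξ i).symm)
  refine h1.congr ?_
  filter_upwards [isOpen_Ioo.mem_nhds (abs_lt.1 hR : ξ ∈ Ioo (-R) R)] with y hy
  rw [charge, indicator_of_mem hy]

theorem exists_charge_le (hξ : ∀ i, x i ≠ ξ) (hR : |ξ| < R) :
    ∃ ρ > 0, ∀ y, |y - ξ| < ρ → charge A R x y ≤ charge A R x ξ + 1 := by
  have h := (continuousAt_charge (A := A) hξ hR).eventually (gt_mem_nhds (lt_add_one _))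
  obtain ⟨ρ, hρ, h2⟩ := Metric.eventually_nhds_iff.1 h
  exact ⟨ρ, hρ, fun y hy => (h2 (by rwa [Real.dist_eq])).le⟩

/-- The error term in the domination of the fusion integrals. -/
def fuseError (A R : ℝ) (x : P → ℝ) (p : ℝ × ℝ) (y : ℝ) : ℝ :=
  (p.2 - p.1) ^ A * (charge A R x y * |y - p.2| ^ (-A))

theorem fuseError_nonneg (hp : p.1 < p.2) (y : ℝ) : 0 ≤ fuseError A R x p y := by
  have := sub_pos.2 hp
  have := charge_nonneg (A := A) (R := R) (x := x) y
  unfold fuseError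
  positivity

theorem tendsto_fuseError (hA : 0 < A) {y : ℝ} (hy : y ≠ ξ) :
    Tendsto (fun p => fuseError A R x p y) (merge ξ) (𝓝 0) := by
  have h0 : |y - ξ| ≠ 0 := abs_ne_zero.2 (sub_ne_zero.2 hy)
  have h2 := ((tendsto_merge_snd (ξ := ξ)).const_sub y).abs.rpow_const (p := -A) (Or.inl h0)
  have h3 := (tendsto_merge_rpow (ξ := ξ) hA).mul (h2.const_mul (charge A R x y))
  rw [zero_mul] at h3
  exact h3

/-- Near ξ the charge is bounded and |y - p.2|^(-A) has an integral independent of p.2 over a fixed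
window; away from ξ that power is bounded. The prefactor (p.2 - p.1)^A then sends the integral to 0.
-/
theorem integral_fuseError (hA : 0 < A) (hA1 : A < 1) (hx : Injective x)
    (hξ : ∀ i, x i ≠ ξ) (hR : |ξ| < R) :
    (∀ᶠ p in merge ξ, Integrable (fuseError A R x p)) ∧
      Tendsto (fun p => ∫ y, fuseError A R x p y) (merge ξ) (𝓝 0) := by
  obtain ⟨ρ, hρ, hM⟩ := exists_charge_le (A := A) hξ hR
  set M := charge A R x ξ + 1 with hMd
  have hM0 : 0 ≤ M := by have := charge_nonneg (A := A) (R := R) (x := x) ξ; linarith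
  set q : ℝ → ℝ := (Ioo (-(2 * ρ)) (2 * ρ)).indicator fun z => |z - 0| ^ (-A) with hq
  have hq0 : ∀ z, 0 ≤ q z := fun z => indicator_nonneg (fun z _ => by positivity) z
  have hqi : Integrable q := (integrable_indicator_iff measurableSet_Ioo).2
    (integrableOn_abs_sub_rpow (by linarith) 0 _ _)
  have hg := integrable_charge (R := R) hx hA.le hA1
  have hb : ∀ᶠ p in merge ξ, ∀ y, ‖fuseError A R x p y‖ ≤
      (p.2 - p.1) ^ A * (M * q (y - p.2) + (ρ / 2) ^ (-A) * charge A R x y) := by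
    have e2 := tendsto_merge_snd.eventually (ball_mem_nhds ξ (half_pos hρ))
    filter_upwards [eventually_merge_lt, e2] with p hp h2 y
    rw [Real.dist_eq] at h2
    have hε := sub_pos.2 hp
    have hgy := charge_nonneg (A := A) (R := R) (x := x) y
    rw [Real.norm_of_nonneg (fuseError_nonneg hp y), fuseError]
    refine mul_le_mul_of_nonneg_left ?_ (by positivity)
    by_cases h : |y - ξ| < ρ
    · have h3 : y - p.2 ∈ Ioo (-(2 * ρ)) (2 * ρ) := by
        rw [abs_lt] at h h2
        constructor <;> linarith
      have h4 : q (y - p.2) = |y - p.2| ^ (-A) := by rw [hq, indicator_of_mem h3, sub_zero]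
      rw [h4]
      have h5 := mul_le_mul_of_nonneg_right (hM y h) (Real.rpow_nonneg (abs_nonneg (y - p.2)) (-A))
      have h6 : 0 ≤ (ρ / 2) ^ (-A) * charge A R x y := by positivity
      linarith
    · have h3 : ρ / 2 ≤ |y - p.2| := by
        have := abs_sub_abs_le_abs_sub (y - ξ) (p.2 - ξ)
        rw [sub_sub_sub_cancel_right] at this
        linarith [not_lt.1 h]
      have h4 := mul_le_mul_of_nonneg_left
        (Real.rpow_le_rpow_of_nonpos (half_pos hρ) h3 (by linarith : -A ≤ 0)) hgy
      have h5 := mul_nonneg hM0 (hq0 (y - p.2))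
      linarith
  have hbi : ∀ p : ℝ × ℝ, Integrable fun y =>
      (p.2 - p.1) ^ A * (M * q (y - p.2) + (ρ / 2) ^ (-A) * charge A R x y) := fun p =>
    (((hqi.comp_sub_right p.2).const_mul M).add (hg.const_mul _)).const_mul _
  constructor
  · filter_upwards [hb] with p hp
    refine (hbi p).mono' ?_ (.of_forall hp)
    exact ((measurable_charge.mul
      ((measurable_id.sub_const _).abs.pow_const _)).const_mul _).aestronglyMeasurable
  · refine squeeze_zero_norm' (a := fun p : ℝ × ℝ => (p.2 - p.1) ^ A *
      (M * ∫ z, q z) + (p.2 - p.1) ^ A * ((ρ / 2) ^ (-A) * ∫ y, charge A R x y)) ?_ ?_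
    · filter_upwards [hb] with p hp
      refine (norm_integral_le_of_norm_le (hbi p) (.of_forall hp)).trans_eq ?_
      rw [integral_const_mul, integral_add ((hqi.comp_sub_right p.2).const_mul M) (hg.const_mul _),
        integral_const_mul, integral_const_mul, integral_sub_right_eq_self q]
      ring
    · have h := tendsto_merge_rpow (ξ := ξ) hA
      simpa using (h.mul_const (M * ∫ z, q z)).add
        (h.mul_const ((ρ / 2) ^ (-A) * ∫ y, charge A R x y))

end Bounds

instance merge_neBot (ξ : ℝ) : (merge ξ).NeBot := by
  rw [← mem_closure_iff_nhdsWithin_neBot]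
  have h : Tendsto (fun t : ℝ => (ξ, ξ + t)) (𝓝[>] 0) (𝓝 (ξ, ξ)) := by
    have := (by fun_prop : Continuous fun t : ℝ => (ξ, ξ + t)).tendsto 0
    rw [add_zero] at this
    exact this.mono_left nhdsWithin_le_nhds
  refine mem_closure_of_tendsto h ?_
  filter_upwards [self_mem_nhdsWithin] with t ht
  exact lt_add_of_pos_right ξ ht

/-! ### Limit of symmetric gas integrals as two points merge -/

section Fusion

variable {P : Type*} [Fintype P] [DecidableEq P] {x : P → ℝ} {A R ξ M : ℝ} {n : ℕ}

/-- The absolute value of the integrand in the presence of two additional points. -/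
def fuseGas (A R : ℝ) (x : P → ℝ) (p : ℝ × ℝ) (X : Fin n → ℝ) : ℝ :=
  (∏ r, (charge A R x (X r) * (|X r - p.1| ^ (-A) * |X r - p.2| ^ (-A)))) * repulsion A X

theorem fuseGas_comp (p : ℝ × ℝ) (σ : Equiv.Perm (Fin n)) (X : Fin n → ℝ) :
    fuseGas A R x p (fun r => X (σ r)) = fuseGas A R x p X := by
  have h : repulsion A (fun r => X (σ r)) = repulsion A X := by
    rw [repulsion, repulsion, ← Equiv.prod_comp σ fun r => ∏ s, if r = s then 1 else |X r - X s| ^ A]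
    refine prod_congr rfl fun r _ => ?_
    rw [← Equiv.prod_comp σ fun s => if σ r = s then 1 else |X (σ r) - X s| ^ A]
    simp only [σ.apply_eq_iff_eq]
  rw [fuseGas, fuseGas, h, Equiv.prod_comp σ fun r => charge A R x (X r) *
    (|X r - p.1| ^ (-A) * |X r - p.2| ^ (-A))]

/-- The integrand of the inner integral of the fusion, without the kernel. -/
def fuseInner (A R : ℝ) (x : P → ℝ) (W : (Fin (n + 1) → ℝ) → ℝ) (p : ℝ × ℝ) (X : Fin n → ℝ)
    (y : ℝ) : ℝ :=
  charge A R x y * (argminWeight (fun r => |(Fin.cons y X : Fin (n + 1) → ℝ) r - p.1|) 0 *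
    W (Fin.cons y X)) * ((∏ s, charge A R x (X s) * pairFactor A p y (X s)) * repulsion A X)

theorem mergeKernel_mul_fuseInner (W : (Fin (n + 1) → ℝ) → ℝ) (p : ℝ × ℝ) (X : Fin n → ℝ) (y : ℝ) :
    mergeKernel A p y * fuseInner A R x W p X y = (p.2 - p.1) ^ (2 * A - 1) *
      (argminWeight (fun r => |(Fin.cons y X : Fin (n + 1) → ℝ) r - p.1|) 0 *
        (W (Fin.cons y X) * fuseGas A R x p (Fin.cons y X))) := by
  rw [fuseGas, repulsion_cons, Fin.prod_univ_succ, mergeKernel, fuseInner]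
  simp only [Fin.cons_zero, Fin.cons_succ, pairFactor, prod_mul_distrib]
  ring

theorem measurable_fuseInner {W : (Fin (n + 1) → ℝ) → ℝ} (hW : Measurable W) (p : ℝ × ℝ)
    (X : Fin n → ℝ) : Measurable (fuseInner A R x W p X) := by
  have h1 := measurable_cons X
  refine (measurable_charge.mul (Measurable.mul ?_ (hW.comp h1))).mul (Measurable.mul_const ?_ _)
  · refine (measurable_argminWeight 0).comp ?_
    exact (Continuous.measurable (by fun_prop :
      Continuous fun (X : Fin (n + 1) → ℝ) s => |X s - p.1|)).comp h1
  · exact measurable_prod _ fun s _ => (measurable_pairFactor (X s)).const_mul _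

/-- Where the argmin weight is nonzero, `pairFactor_le` applies to every other variable; elsewhere
the expression is zero. The bound is a product over the variables, so it can be integrated in closed
form. -/
theorem abs_fuseInner_le (hA : 0 < A) (hA1 : A < 1) {W : (Fin (n + 1) → ℝ) → ℝ}
    (hW : ∀ X, |W X| ≤ M) {p : ℝ × ℝ} (hp : p.1 < p.2) (X : Fin n → ℝ) (y : ℝ) :
    |fuseInner A R x W p X y| ≤ charge A R x y * (M * (∏ _s : Fin n, 4 ^ A) *
      (∏ _r : Fin n, ∏ _s : Fin n, (1 + 2 * |R|) ^ A) *
        ∏ s, (charge A R x (X s) + fuseError A R x p (X s))) := by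
  have hM : 0 ≤ M := (abs_nonneg _).trans (hW (Fin.cons y X))
  have hε := sub_pos.2 hp
  have hc := charge_nonneg (A := A) (R := R) (x := x)
  have hrhs : 0 ≤ charge A R x y * (M * (∏ _s : Fin n, 4 ^ A) *
      (∏ _r : Fin n, ∏ _s : Fin n, (1 + 2 * |R|) ^ A) *
        ∏ s, (charge A R x (X s) + fuseError A R x p (X s))) := by
    refine mul_nonneg (hc y) (mul_nonneg (by positivity) (prod_nonneg fun s _ => ?_))
    exact add_nonneg (hc _) (fuseError_nonneg hp _)
  by_cases h : ∀ s : Fin (n + 1), |(Fin.cons y X : Fin (n + 1) → ℝ) 0 - p.1| ≤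
      |(Fin.cons y X : Fin (n + 1) → ℝ) s - p.1|
  · have h1 : ∏ s, pairFactor A p y (X s) ≤
        ∏ s, (4 ^ A * (1 + (p.2 - p.1) ^ A * |X s - p.2| ^ (-A))) := by
      refine prod_le_prod (fun s _ => pairFactor_nonneg _ _) fun s _ => ?_
      exact pairFactor_le hA hA1 hp (by simpa using h s.succ)
    have h2 := gas_le (A := A) (R := R) (x := x) hA.le X
    rw [gas] at h2
    have h3 : 0 ≤ ∏ s, pairFactor A p y (X s) := prod_nonneg fun s _ => pairFactor_nonneg _ _
    have h4 : 0 ≤ (∏ s, charge A R x (X s)) * repulsion A X :=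
      mul_nonneg (prod_nonneg fun s _ => hc _) (repulsion_nonneg X)
    have h5 : |argminWeight (fun r => |(Fin.cons y X : Fin (n + 1) → ℝ) r - p.1|) 0 *
        W (Fin.cons y X)| ≤ M := by
      rw [abs_mul, abs_of_nonneg (argminWeight_nonneg _ _)]
      exact (mul_le_mul (argminWeight_le_one _ _) (hW _) (abs_nonneg _) zero_le_one).trans_eq
        (one_mul M)
    rw [fuseInner, abs_mul, abs_mul, abs_of_nonneg (hc y), prod_mul_distrib, mul_assoc]
    refine mul_le_mul_of_nonneg_left ?_ (hc y)
    have h6 : 0 ≤ ((∏ s, charge A R x (X s)) * ∏ s, pairFactor A p y (X s)) * repulsion A X := by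
      rw [mul_right_comm]; exact mul_nonneg h4 h3
    rw [abs_of_nonneg h6]
    calc _ ≤ M * ((∏ s, pairFactor A p y (X s)) * ((∏ s, charge A R x (X s)) * repulsion A X)) := by
          rw [mul_right_comm (∏ s, charge A R x (X s)), mul_comm ((∏ s, charge A R x (X s)) * _)]
          exact mul_le_mul_of_nonneg_right h5 (mul_nonneg h3 h4)
      _ ≤ M * ((∏ s, (4 ^ A * (1 + (p.2 - p.1) ^ A * |X s - p.2| ^ (-A)))) *
          ((∏ s, charge A R x (X s)) * ∏ _r : Fin n, ∏ _s : Fin n, (1 + 2 * |R|) ^ A)) := by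
          refine mul_le_mul_of_nonneg_left (mul_le_mul h1 h2 h4 ?_) hM
          exact prod_nonneg fun s _ => by positivity
      _ = _ := by
          have e : ∏ s, (charge A R x (X s) + fuseError A R x p (X s)) =
              (∏ s, charge A R x (X s)) *
                ∏ s, (1 + (p.2 - p.1) ^ A * |X s - p.2| ^ (-A)) := by
            rw [← prod_mul_distrib]
            refine prod_congr rfl fun s _ => ?_
            rw [fuseError]; ring
          rw [e, prod_mul_distrib]
          ring
  · rw [fuseInner, argminWeight_eq_zero h]
    simpa using hrhs

/-- The limit of the inner integral. -/
theorem tendsto_fuseInner (hA : 1 / 2 < A) (hA1 : A < 1) (hx : Injective x)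
    (hξ : ∀ i, x i ≠ ξ) (hR : |ξ| < R) {W : ℝ × ℝ → (Fin (n + 1) → ℝ) → ℝ}
    (hWm : ∀ p, Measurable (W p)) (hWb : ∀ p X, |W p X| ≤ M) {X : Fin n → ℝ}
    (hX : ∀ s, X s ≠ ξ) {w₁ w₂ w₃ : ℝ}
    (h1 : ∀ y < 0, Tendsto (fun p => W p (Fin.cons (p.1 + (p.2 - p.1) * y) X)) (merge ξ) (𝓝 w₁))
    (h2 : ∀ y, 0 < y → y < 1 →
      Tendsto (fun p => W p (Fin.cons (p.1 + (p.2 - p.1) * y) X)) (merge ξ) (𝓝 w₂))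
    (h3 : ∀ y, 1 < y →
      Tendsto (fun p => W p (Fin.cons (p.1 + (p.2 - p.1) * y) X)) (merge ξ) (𝓝 w₃)) :
    Tendsto (fun p => ∫ y, mergeKernel A p y * fuseInner A R x (W p) p X y) (merge ξ)
      (𝓝 (charge A R x ξ * ((Gamma (1 - A) * Gamma (2 * A - 1) / Gamma A * (w₁ + w₃) +
        Gamma (1 - A) ^ 2 / Gamma (2 - 2 * A) * w₂) * gas A R x X))) := by
  have hA0 : 0 < A := by linarith
  have hc := charge_nonneg (A := A) (R := R) (x := x)
  have hM : 0 ≤ M := (abs_nonneg _).trans (hWb (0, 0) 0)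
  obtain ⟨ρ, hρ, hb⟩ := exists_charge_le (A := A) hξ hR
  set C := M * (∏ _s : Fin n, (4 : ℝ) ^ A) *
      (∏ _r : Fin n, ∏ _s : Fin n, (1 + 2 * |R|) ^ A) * ∏ s, (charge A R x (X s) + 1) with hC
  have hC0 : 0 ≤ C := mul_nonneg (by positivity)
    (prod_nonneg fun s _ => add_nonneg (hc _) zero_le_one)
  have hlim : ∀ {y w : ℝ}, Tendsto (fun p => W p (Fin.cons (p.1 + (p.2 - p.1) * y) X)) (merge ξ)
      (𝓝 w) → Tendsto (fun p => fuseInner A R x (W p) p X (p.1 + (p.2 - p.1) * y)) (merge ξ)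
      (𝓝 (charge A R x ξ * (1 * w) * ((∏ s, charge A R x (X s) * 1) * repulsion A X))) := by
    intro y w hw
    have ht := tendsto_merge_point (ξ := ξ) y
    refine Tendsto.mul (Tendsto.mul ((continuousAt_charge hξ hR).tendsto.comp ht)
      (Tendsto.mul ?_ hw)) (Tendsto.mul_const _ (tendsto_finsetProd _ fun s _ =>
        (tendsto_pairFactor (hX s) ht).const_mul _))
    refine tendsto_const_nhds.congr' ?_
    -- The rescaled variable tends to p.1 while the others stay away from ξ, so it is eventually the
    -- unique nearest one and its argmin weight is 1.
    have hev : ∀ s : Fin n, ∀ᶠ p in merge ξ, |p.1 + (p.2 - p.1) * y - p.1| < |X s - p.1| := by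
      intro s
      have e1 : Tendsto (fun p : ℝ × ℝ => |p.1 + (p.2 - p.1) * y - p.1|) (merge ξ) (𝓝 0) := by
        simpa using (ht.sub tendsto_merge_fst).abs
      have e2 := ((tendsto_merge_fst (ξ := ξ)).const_sub (X s)).abs
      exact e1.eventually_lt e2 (abs_pos.2 (sub_ne_zero.2 (hX s)))
    filter_upwards [eventually_all.2 hev] with p hp
    refine (argminWeight_eq_one fun s => ?_).symm
    refine Fin.cases (fun h => absurd rfl h) (fun s _ => ?_) s
    simpa using hp s
  have key := (tendsto_integral_mergeKernel (ξ := ξ) hA hA1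
    (Φ := fun p => fuseInner A R x (W p) p X) (g := fun y => charge A R x y * C)
    ((integrable_charge hx hA0.le hA1).mul_const C) (M := (charge A R x ξ + 1) * C) hρ
    (fun y hy => mul_le_mul_of_nonneg_right (hb y hy) hC0)
    (.of_forall fun p => measurable_fuseInner (hWm p) p X) ?_
    (fun y hy => hlim (h1 y hy)) (fun y hy hy' => hlim (h2 y hy hy'))
    (fun y hy => hlim (h3 y hy))).2
  · refine key.trans (le_of_eq ?_)
    rw [gas]
    simp only [mul_one, one_mul]
    congr 1
    ring
  · have hev : ∀ s : Fin n, ∀ᶠ p in merge ξ, fuseError A R x p (X s) < 1 := fun s =>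
      (tendsto_fuseError hA0 (hX s)).eventually (gt_mem_nhds one_pos)
    filter_upwards [eventually_all.2 hev, eventually_merge_lt] with p hp hlt y
    refine (abs_fuseInner_le hA0 hA1 (hWb p) hlt X y).trans ?_
    refine mul_le_mul_of_nonneg_left (mul_le_mul_of_nonneg_left ?_ (by positivity)) (hc y)
    refine prod_le_prod (fun s _ => add_nonneg (hc _) (fuseError_nonneg hlt _)) fun s _ => ?_
    linarith [hp s]

/-- The limit of a symmetric integral as two of the points merge. -/
theorem tendsto_fuseGas (hA : 1 / 2 < A) (hA1 : A < 1) (hx : Injective x)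
    (hξ : ∀ i, x i ≠ ξ) (hR : |ξ| < R) {W : ℝ × ℝ → (Fin (n + 1) → ℝ) → ℝ}
    (hWm : ∀ p, Measurable (W p)) (hWb : ∀ p X, |W p X| ≤ M)
    (hWs : ∀ p (σ : Equiv.Perm (Fin (n + 1))) X, W p (fun r => X (σ r)) = W p X)
    (hi : ∀ᶠ p in merge ξ, Integrable (fuseGas A R x p : (Fin (n + 1) → ℝ) → ℝ))
    {w₁ w₂ w₃ : (Fin n → ℝ) → ℝ} (hlim : ∀ᵐ X : Fin n → ℝ,
      (∀ y < 0, Tendsto (fun p => W p (Fin.cons (p.1 + (p.2 - p.1) * y) X)) (merge ξ) (𝓝 (w₁ X))) ∧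
      (∀ y, 0 < y → y < 1 →
        Tendsto (fun p => W p (Fin.cons (p.1 + (p.2 - p.1) * y) X)) (merge ξ) (𝓝 (w₂ X))) ∧
      (∀ y, 1 < y →
        Tendsto (fun p => W p (Fin.cons (p.1 + (p.2 - p.1) * y) X)) (merge ξ) (𝓝 (w₃ X)))) :
    Tendsto (fun p : ℝ × ℝ => (p.2 - p.1) ^ (2 * A - 1) * ∫ X, W p X * fuseGas A R x p X) (merge ξ)
      (𝓝 ((n + 1) * ∫ X : Fin n → ℝ, charge A R x ξ *
        ((Gamma (1 - A) * Gamma (2 * A - 1) / Gamma A * (w₁ X + w₃ X) +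
          Gamma (1 - A) ^ 2 / Gamma (2 - 2 * A) * w₂ X) * gas A R x X))) := by
  have hA0 : 0 < A := by linarith
  have hc := charge_nonneg (A := A) (R := R) (x := x)
  have hM : 0 ≤ M := (abs_nonneg _).trans (hWb (0, 0) 0)
  have hg := integrable_charge (R := R) hx hA0.le hA1
  have hFi : ∀ᶠ p in merge ξ, Integrable fun X => W p X * fuseGas A R x p X := by
    filter_upwards [hi] with p hp
    exact hp.bdd_mul (c := M) (hWm p).aestronglyMeasurable (.of_forall (hWb p))
  have hχi : ∀ᶠ p in merge ξ, Integrable fun X : Fin (n + 1) → ℝ => (p.2 - p.1) ^ (2 * A - 1) *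
      (argminWeight (fun r => |X r - p.1|) 0 * (W p X * fuseGas A R x p X)) := by
    filter_upwards [hFi] with p hp
    refine (hp.bdd_mul (c := 1) ?_ (.of_forall fun X => ?_)).const_mul _
    · exact ((measurable_argminWeight 0).comp (Continuous.measurable (by fun_prop :
        Continuous fun (X : Fin (n + 1) → ℝ) s => |X s - p.1|))).aestronglyMeasurable
    · rw [Real.norm_of_nonneg (argminWeight_nonneg _ _)]
      exact argminWeight_le_one _ _
  -- By symmetry the integral is n + 1 times the part in which variable 0 is nearest to p.1; Fubini
  -- then isolates the integral over that variable.
  have heq : ∀ᶠ p in merge ξ, ((n : ℝ) + 1) * ∫ X : Fin n → ℝ, ∫ y,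
      mergeKernel A p y * fuseInner A R x (W p) p X y =
      (p.2 - p.1) ^ (2 * A - 1) * ∫ X, W p X * fuseGas A R x p X := by
    filter_upwards [hFi, hχi] with p hp hχ
    rw [integral_eq_mul_argmin p.1 hp fun σ X => by rw [hWs, fuseGas_comp], mul_left_comm,
      ← integral_const_mul ((p.2 - p.1) ^ (2 * A - 1)), (integral_cons hχ).2]
    simp only [mergeKernel_mul_fuseInner]
  refine Tendsto.congr' heq (Tendsto.const_mul _ ?_)
  obtain ⟨ρ, hρ, hb⟩ := exists_charge_le (A := A) hξ hR
  set B := Gamma (1 - A) * Gamma (2 * A - 1) / Gamma A *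
    (charge A R x ξ + charge A R x ξ) +
      Gamma (1 - A) ^ 2 / Gamma (2 - 2 * A) * charge A R x ξ with hB
  have hcont : ∀ y : ℝ, Tendsto (fun p : ℝ × ℝ => charge A R x (p.1 + (p.2 - p.1) * y)) (merge ξ)
      (𝓝 (charge A R x ξ)) := fun y =>
    (continuousAt_charge hξ hR).tendsto.comp (tendsto_merge_point y)
  have hK := tendsto_integral_mergeKernel (ξ := ξ) hA hA1 (Φ := fun _ => charge A R x)
    (g := charge A R x) hg hρ hb (.of_forall fun _ => measurable_charge)
    (.of_forall fun _ y => (abs_of_nonneg (hc y)).le) (fun y _ => hcont y)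
    (fun y _ _ => hcont y) (fun y _ => hcont y)
  rw [← hB] at hK
  have hB0 : 0 ≤ B := by
    refine ge_of_tendsto hK.2 ?_
    filter_upwards [eventually_merge_lt] with p hp
    exact integral_nonneg fun y => mul_nonneg (mergeKernel_nonneg hp y) (hc y)
  set C := M * (∏ _s : Fin n, (4 : ℝ) ^ A) *
      (∏ _r : Fin n, ∏ _s : Fin n, (1 + 2 * |R|) ^ A) with hC
  have hC0 : 0 ≤ C := by positivity
  have hbound : ∀ᶠ p in merge ξ, ∀ X : Fin n → ℝ,
      |∫ y, mergeKernel A p y * fuseInner A R x (W p) p X y| ≤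
        (B + 1) * C * ∏ s, (charge A R x (X s) + fuseError A R x p (X s)) := by
    filter_upwards [hK.1, hK.2.eventually (gt_mem_nhds (lt_add_one B)), eventually_merge_lt]
      with p h1 h2 hlt X
    have h3 : 0 ≤ C * ∏ s, (charge A R x (X s) + fuseError A R x p (X s)) :=
      mul_nonneg hC0 (prod_nonneg fun s _ => add_nonneg (hc _) (fuseError_nonneg hlt _))
    rw [← Real.norm_eq_abs]
    refine (norm_integral_le_of_norm_le (h1.mul_const (C *
      ∏ s, (charge A R x (X s) + fuseError A R x p (X s)))) (.of_forall fun y => ?_)).trans ?_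
    · rw [norm_mul, Real.norm_of_nonneg (mergeKernel_nonneg hlt y), mul_assoc]
      exact mul_le_mul_of_nonneg_left (abs_fuseInner_le hA0 hA1 (hWb p) hlt X y)
        (mergeKernel_nonneg hlt y)
    · rw [integral_mul_const]
      exact (mul_le_mul_of_nonneg_right h2.le h3).trans_eq (by ring)
  have hgood : ∀ᵐ X : Fin n → ℝ, ∀ s, X s ≠ ξ := ae_all_iff.2 fun s =>
    Measure.ae_eval_ne (μ := fun _ : Fin n => (volume : Measure ℝ)) s ξ
  have hpt : ∀ᵐ X : Fin n → ℝ, Tendsto (fun p => ∫ y, mergeKernel A p y *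
      fuseInner A R x (W p) p X y) (merge ξ) (𝓝 (charge A R x ξ *
        ((Gamma (1 - A) * Gamma (2 * A - 1) / Gamma A * (w₁ X + w₃ X) +
          Gamma (1 - A) ^ 2 / Gamma (2 - 2 * A) * w₂ X) * gas A R x X))) := by
    filter_upwards [hgood, hlim] with X hX h
    exact tendsto_fuseInner hA hA1 hx hξ hR hWm hWb hX h.1 h.2.1 h.2.2
  obtain ⟨hei, het⟩ := integral_fuseError hA0 hA1 hx hξ hR
  have hprodi : ∀ᶠ p in merge ξ, Integrable fun X : Fin n → ℝ =>
      ∏ s, (charge A R x (X s) + fuseError A R x p (X s)) := by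
    filter_upwards [hei] with p hp
    exact Integrable.fintype_prod fun _ => hg.add hp
  have hprod : Integrable fun X : Fin n → ℝ => ∏ s, charge A R x (X s) :=
    Integrable.fintype_prod fun _ => hg
  -- The dominating product of charge plus error splits into the fixed product of charges and a
  -- remainder that vanishes in L¹.
  refine tendsto_integral_of_dominated_add
    (G := fun X => (B + 1) * C * ∏ s, charge A R x (X s))
    (E := fun p X => (B + 1) * C * ((∏ s, (charge A R x (X s) + fuseError A R x p (X s))) -
      ∏ s, charge A R x (X s))) ?_ (hprod.const_mul _) ?_ ?_ ?_ ?_ ?_ hpt ?_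
  · filter_upwards [hχi] with p hp
    have := (integral_cons hp).1.aestronglyMeasurable
    simpa only [mergeKernel_mul_fuseInner] using this
  · filter_upwards [hprodi] with p hp
    exact (hp.sub hprod).const_mul _
  · exact fun X => mul_nonneg (by positivity) (prod_nonneg fun s _ => hc _)
  · filter_upwards [eventually_merge_lt] with p hp X
    refine mul_nonneg (by positivity) (sub_nonneg.2 (prod_le_prod (fun s _ => hc _)
      fun s _ => ?_))
    linarith [fuseError_nonneg (A := A) (R := R) (x := x) hp (X s)]
  · filter_upwards [hbound] with p hp X
    refine (hp X).trans_eq ?_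
    ring
  -- The integral of the remainder is a difference of n-th powers of one-dimensional integrals,
  -- which tends to 0 with the integral of `fuseError`.
  · have e : ∀ᶠ p in merge ξ, (B + 1) * C * (((∫ y, charge A R x y) + ∫ y, fuseError A R x p y) ^ n -
        (∫ y, charge A R x y) ^ n) = ∫ X : Fin n → ℝ, (B + 1) * C *
          ((∏ s, (charge A R x (X s) + fuseError A R x p (X s))) - ∏ s, charge A R x (X s)) := by
      filter_upwards [hei, hprodi] with p hp hpi
      rw [integral_const_mul, integral_sub hpi hprod,
        integral_fintype_prod_volume_eq_pow (ι := Fin n)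
          (fun y => charge A R x y + fuseError A R x p y),
        integral_fintype_prod_volume_eq_pow (ι := Fin n) (fun y => charge A R x y),
        Fintype.card_fin, integral_add hg hp]
    refine Tendsto.congr' e ?_
    have h := (((het.const_add (∫ y, charge A R x y)).pow n).sub_const
      ((∫ y, charge A R x y) ^ n)).const_mul ((B + 1) * C)
    -- The limit inherits the bound by passing to the limit in `hbound`, where the error terms
    -- disappear.
    simpa using h
  · filter_upwards [hpt, hgood] with X h hX
    refine le_of_tendsto_of_tendsto h.abs ?_ (hbound.mono fun p hp => hp X)
    have h2 : Tendsto (fun p => ∏ s, (charge A R x (X s) + fuseError A R x p (X s))) (merge ξ)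
        (𝓝 (∏ s, (charge A R x (X s) + 0))) :=
      tendsto_finsetProd _ fun s _ => (tendsto_fuseError hA0 (hX s)).const_add _
    simpa using h2.const_mul ((B + 1) * C)

end Fusion

theorem abs_qnum_le (A m : ℝ) : |qnum A m| ≤ |sin (π * A)|⁻¹ := by
  rw [qnum, abs_div, div_eq_mul_inv]
  exact mul_le_of_le_one_left (by positivity) (Real.abs_sin_le_one _)

/-! ### Weights in terms of a potential and their fusion rules -/

namespace LinkPattern

variable {N : ℕ}

theorem skip_ne (j : Fin (2 * N + 1)) (i : Fin (2 * N)) :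
    (skip j i : ℕ) ≠ j ∧ (skip j i : ℕ) ≠ j + 1 := by
  simp only [skip]
  split_ifs <;> omega

theorem skip_ne_left (j : Fin (2 * N + 1)) (i : Fin (2 * N)) : skip j i ≠ left j := fun h =>
  (skip_ne j i).1 (congrArg Fin.val h)

theorem skip_ne_right (j : Fin (2 * N + 1)) (i : Fin (2 * N)) : skip j i ≠ right j := fun h =>
  (skip_ne j i).2 (congrArg Fin.val h)

theorem left_ne_right (j : Fin (2 * N + 1)) : left j ≠ right j := by simp [Fin.ext_iff]

theorem skip_injective (j : Fin (2 * N + 1)) : Injective (skip j) :=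
  StrictMono.injective fun _ _ h => (skip_lt_skip j).2 h

theorem eq_skip {j : Fin (2 * N + 1)} {k : Fin (2 * (N + 1))} (h1 : k ≠ left j) (h2 : k ≠ right j) :
    ∃ i, skip j i = k :=
  ⟨_, skip_unskip j k ⟨fun h => h1 (Fin.ext h), fun h => h2 (Fin.ext h)⟩⟩

theorem prod_skip {M : Type*} [CommMonoid M] (j : Fin (2 * N + 1)) (f : Fin (2 * (N + 1)) → M) :
    ∏ k, f k = f (left j) * (f (right j) * ∏ i, f (skip j i)) := by
  have e : (Finset.univ : Finset (Fin (2 * (N + 1)))) =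
      insert (left j) (insert (right j) (Finset.univ.image (skip j))) := by
    ext k
    simp only [Finset.mem_univ, Finset.mem_insert, Finset.mem_image, true_and, true_iff]
    by_cases h1 : k = left j
    · exact Or.inl h1
    by_cases h2 : k = right j
    · exact Or.inr (Or.inl h2)
    exact Or.inr (Or.inr (eq_skip h1 h2))
  rw [e, Finset.prod_insert, Finset.prod_insert, Finset.prod_image fun a _ b _ h => skip_injective j h]
  · simpa using skip_ne_right j
  · simp only [Finset.mem_insert, Finset.mem_image, Finset.mem_univ, true_and, not_or, not_exists]
    exact ⟨left_ne_right j, skip_ne_left j⟩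

/-- The number of screening variables to the left of the point `i`, minus half the number of points
to the left of it. -/
def pot {ι : Type*} [Fintype ι] (x : Fin (2 * N) → ℝ) (Y : ι → ℝ) (i : Fin (2 * N)) : ℝ :=
  (∑ l, if Y l < x i then 1 else 0) - (i : ℕ) / 2

variable (β : LinkPattern N)

/-- The weight of a configuration in terms of the function `pot`. -/
def potWeight (A : ℝ) (φ : Fin (2 * N) → ℝ) : ℝ :=
  ∏ k, if k < β.pair k then qnum A (φ (β.pair k) - φ k + 1 / 2) else 1

/-- The number of variables under a link is a difference of counting functions at its endpoints. The
number of points strictly below it is the difference of the endpoint indices minus 1, which produces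
the 1/2. -/
theorem cfgWeight_eq_potWeight {ι : Type*} [Fintype ι] (A : ℝ) {x : Fin (2 * N) → ℝ}
    (hx : StrictMono x) {Y : ι → ℝ} (hY : ∀ l i, Y l ≠ x i) :
    β.cfgWeight A x Y = β.potWeight A (pot x Y) := by
  rw [cfgWeight, potWeight, ← Finset.prod_filter, Finset.prod_subtype (p := fun k => k < β.pair k) _
    (by simp)]
  refine prod_congr rfl fun s _ => ?_
  have h1 : ∀ l, ind (β.ival x s) (Y l) =
      (if Y l < x (β.pair s.1) then 1 else 0) - if Y l < x s.1 then 1 else 0 := by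
    intro l
    have h := hx s.2
    rcases lt_or_gt_of_ne (hY l s.1) with h2 | h2
    · rw [ind_of_notMem fun h3 => absurd h3.1 h2.not_gt, if_pos h2, if_pos (h2.trans h), sub_self]
    · rw [if_neg h2.not_gt, sub_zero]
      split_ifs with h3
      · exact ind_of_mem ⟨h2, h3⟩
      · exact ind_of_notMem fun h4 => h3 h4.2
  have h2 : (∑ i, if β.lo s < i ∧ i < β.hi s then (1 : ℝ) else 0) =
      ((β.pair s.1 : ℕ) : ℝ) - ((s.1 : ℕ) : ℝ) - 1 := by
    have e : (Finset.univ.filter fun i => β.lo s < i ∧ i < β.hi s) = Finset.Ioo (β.lo s) (β.hi s) := by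
      ext; simp
    have h3 : (s.1 : ℕ) < (β.pair s.1 : ℕ) := s.2
    rw [Finset.sum_boole, e, Fin.card_Ioo]
    simp only [lo, hi]
    rw [Nat.cast_sub (by omega), Nat.cast_sub (by omega), Nat.cast_one]
  simp only [h1, h2, sum_sub_distrib, pot]
  congr 1
  ring

theorem abs_cfgWeight_le {ι : Type*} [Fintype ι] (A : ℝ) (x : Fin (2 * N) → ℝ) (Y : ι → ℝ) :
    |β.cfgWeight A x Y| ≤ ∏ _s : β.Link, |sin (π * A)|⁻¹ := by
  rw [cfgWeight, Finset.abs_prod]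
  exact prod_le_prod (fun _ _ => abs_nonneg _) fun _ _ => abs_qnum_le _ _

theorem measurable_cfgWeight {ι : Type*} [Fintype ι] (A : ℝ) (x : Fin (2 * N) → ℝ) :
    Measurable (β.cfgWeight A x : (ι → ℝ) → ℝ) := by
  refine measurable_prod _ fun s _ => Measurable.div_const (Real.measurable_sin.comp
    (Measurable.const_mul (Measurable.sub_const (measurable_sum _ fun l _ => ?_) _) _)) _
  exact (measurable_ind measurableSet_Ioo).comp (measurable_pi_apply l)

theorem cfgWeight_comp {ι : Type*} [Fintype ι] (A : ℝ) (x : Fin (2 * N) → ℝ) (σ : Equiv.Perm ι)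
    (Y : ι → ℝ) : β.cfgWeight A x (fun l => Y (σ l)) = β.cfgWeight A x Y := by
  refine prod_congr rfl fun s _ => ?_
  rw [Equiv.sum_comp σ fun l => ind (β.ival x s) (Y l)]

section Fuse

variable (β : LinkPattern (N + 1)) (j : Fin (2 * N + 1))

theorem potWeight_remove (h : β.pair (left j) = right j) (A : ℝ) (φ : Fin (2 * (N + 1)) → ℝ) :
    β.potWeight A φ = qnum A (φ (right j) - φ (left j) + 1 / 2) *
      (β.remove j h).potWeight A fun i => φ (skip j i) := by
  have h' : β.pair (right j) = left j := by rw [← h, β.pair_pair]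
  have hlr : left j < right j := by simp [Fin.lt_def]
  have e : ∀ i, skip j ((β.remove j h).pair i) = β.pair (skip j i) := fun i =>
    skip_unskip _ _ (β.pair_skip_ne j h i)
  rw [potWeight, prod_skip j, h, h', if_pos hlr, if_neg hlr.not_gt, one_mul, potWeight]
  congr 1
  refine prod_congr rfl fun i _ => ?_
  simp only [← e, skip_lt_skip]

/-- The potential on all points, from its values at `j`, `j + 1` and at the other points. -/
def extend (φ : Fin (2 * N) → ℝ) (l r : ℝ) (k : Fin (2 * (N + 1))) : ℝ :=
  if h : (k : ℕ) ≠ j ∧ (k : ℕ) ≠ j + 1 then φ (unskip j k h) else if (k : ℕ) = j then l else r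

theorem extend_left (φ : Fin (2 * N) → ℝ) (l r : ℝ) : extend j φ l r (left j) = l := by
  simp [extend]

theorem extend_right (φ : Fin (2 * N) → ℝ) (l r : ℝ) : extend j φ l r (right j) = r := by
  simp [extend]

theorem extend_skip (φ : Fin (2 * N) → ℝ) (l r : ℝ) (i : Fin (2 * N)) :
    extend j φ l r (skip j i) = φ i := by
  rw [extend, dif_pos (skip_ne j i), unskip_skip]

variable {β j}

/-- `c₁` and `c₂` are the potentials at the partners of j and j+1, and `E` collects the links not
affected by tying. The three cases are partners on opposite sides, both to the right, and both to
the left. -/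
theorem exists_potWeight_tie (h : β.pair (left j) ≠ right j) (A : ℝ) (φ : Fin (2 * N) → ℝ) :
    ∃ E c₁ c₂ : ℝ,
      ((∀ l r, β.potWeight A (extend j φ l r) =
          E * (qnum A (l - c₁ + 1 / 2) * qnum A (c₂ - r + 1 / 2))) ∧
        ((β.tie j).remove j (β.tie_pair j)).potWeight A φ = E * qnum A (c₂ - c₁ + 1 / 2)) ∨
      ((∀ l r, β.potWeight A (extend j φ l r) =
          E * (qnum A (c₁ - l + 1 / 2) * qnum A (c₂ - r + 1 / 2))) ∧
        ((β.tie j).remove j (β.tie_pair j)).potWeight A φ = E * qnum A (c₁ - c₂ + 1 / 2)) ∨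
      ((∀ l r, β.potWeight A (extend j φ l r) =
          E * (qnum A (l - c₁ + 1 / 2) * qnum A (r - c₂ + 1 / 2))) ∧
        ((β.tie j).remove j (β.tie_pair j)).potWeight A φ = E * qnum A (c₁ - c₂ + 1 / 2)) := by
  have hlr : left j < right j := by simp [Fin.lt_def]
  have key : ∀ m : Fin (2 * (N + 1)), m ≠ left j → m ≠ right j → m < left j ∨ right j < m := by
    intro m h1 h2
    simp only [Fin.lt_def, ne_eq, Fin.ext_iff] at *
    omega
  have h1 := β.pair_ne (left j)
  have h2 := β.pair_ne (right j)
  have h3 : β.pair (right j) ≠ left j := fun e => h (by rw [← e, β.pair_pair])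
  obtain ⟨i₁, hi₁⟩ := eq_skip h1 h
  obtain ⟨i₂, hi₂⟩ := eq_skip h3 h2
  have g1 : β.pair (skip j i₁) = left j := by rw [hi₁, β.pair_pair]
  have g2 : β.pair (skip j i₂) = right j := by rw [hi₂, β.pair_pair]
  have hne : i₁ ≠ i₂ := fun e => left_ne_right j (by rw [← g1, ← g2, e])
  set γ := (β.tie j).remove j (β.tie_pair j) with hγ
  have e : ∀ i, skip j (γ.pair i) = β.tiePair j (skip j i) := fun i =>
    skip_unskip _ _ ((β.tie j).pair_skip_ne j (β.tie_pair j) i)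
  have p1 : γ.pair i₁ = i₂ := by
    refine skip_injective j ?_
    rw [e, tiePair, if_neg (skip_ne_left j _), if_neg (skip_ne_right j _), if_pos hi₁, hi₂]
  have p2 : γ.pair i₂ = i₁ := by rw [← p1, γ.pair_pair]
  have p3 : ∀ i, i ≠ i₁ → i ≠ i₂ → skip j (γ.pair i) = β.pair (skip j i) := by
    intro i n1 n2
    rw [e, tiePair, if_neg (skip_ne_left j _), if_neg (skip_ne_right j _),
      if_neg fun h => n1 (skip_injective j (h.trans hi₁.symm)),
      if_neg fun h => n2 (skip_injective j (h.trans hi₂.symm))]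
  set E := ∏ i ∈ (Finset.univ.erase i₁).erase i₂,
    if i < γ.pair i then qnum A (φ (γ.pair i) - φ i + 1 / 2) else 1 with hE
  have split : ∀ f : Fin (2 * N) → ℝ,
      ∏ i, f i = (∏ i ∈ (Finset.univ.erase i₁).erase i₂, f i) * (f i₁ * f i₂) := by
    intro f
    rw [← Finset.mul_prod_erase _ f (Finset.mem_univ i₁),
      ← Finset.mul_prod_erase (Finset.univ.erase i₁) f (a := i₂) (by simp [hne.symm])]
    ring
  have hγw : γ.potWeight A φ = E * ((if i₁ < i₂ then qnum A (φ i₂ - φ i₁ + 1 / 2) else 1) *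
      if i₂ < i₁ then qnum A (φ i₁ - φ i₂ + 1 / 2) else 1) := by
    rw [potWeight, split, p1, p2]
  have hβw : ∀ l r, β.potWeight A (extend j φ l r) =
      E * (((if left j < skip j i₁ then qnum A (φ i₁ - l + 1 / 2) else 1) *
        (if skip j i₁ < left j then qnum A (l - φ i₁ + 1 / 2) else 1)) *
        ((if right j < skip j i₂ then qnum A (φ i₂ - r + 1 / 2) else 1) *
        (if skip j i₂ < right j then qnum A (r - φ i₂ + 1 / 2) else 1))) := by
    intro l r
    rw [potWeight, prod_skip j, split, g1, g2, ← hi₁, ← hi₂, extend_left, extend_right, extend_skip,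
      extend_skip]
    have : ∏ i ∈ (Finset.univ.erase i₁).erase i₂, (if skip j i < β.pair (skip j i) then
        qnum A (extend j φ l r (β.pair (skip j i)) - extend j φ l r (skip j i) + 1 / 2) else 1) =
        E := by
      refine prod_congr rfl fun i hi => ?_
      have hi' : i ≠ i₂ ∧ i ≠ i₁ := by simpa using hi
      simp only [← p3 i hi'.2 hi'.1, skip_lt_skip, extend_skip]
    rw [this]
    ring
  have k1 := key (skip j i₁) (skip_ne_left j _) (skip_ne_right j _)
  have k2 := key (skip j i₂) (skip_ne_left j _) (skip_ne_right j _)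
  have q1 := β.planar (left j) (right j)
  have q2 := β.planar (skip j i₂) (left j)
  have q3 := β.planar (skip j i₁) (skip j i₂)
  rw [← hi₁, ← hi₂] at q1
  rw [g2, ← hi₁] at q2
  rw [g1, g2] at q3
  have q4 := skip_lt_skip j (i := i₁) (k := i₂)
  have q5 := skip_lt_skip j (i := i₂) (k := i₁)
  have q6 : skip j i₁ ≠ skip j i₂ := fun h => hne (skip_injective j h)
  refine ⟨E, φ i₁, φ i₂, ?_⟩
  rw [hγw]
  simp only [hβw, ← q4, ← q5]
  rcases k1 with k1 | k1 <;> rcases k2 with k2 | k2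
  · have o : skip j i₂ < skip j i₁ := by omega
    refine Or.inr (Or.inr ⟨fun l r => ?_, ?_⟩)
    · rw [if_neg k1.not_gt, if_pos k1, if_neg (k2.trans hlr).not_gt, if_pos (k2.trans hlr)]
      ring
    · rw [if_pos o, if_neg o.not_gt, one_mul]
  · refine Or.inl ⟨fun l r => ?_, ?_⟩
    · rw [if_neg k1.not_gt, if_pos k1, if_pos k2, if_neg k2.not_gt]
      ring
    · have o : skip j i₁ < skip j i₂ := k1.trans (hlr.trans k2)
      rw [if_pos o, if_neg o.not_gt, mul_one]
  -- The partner of j to the right and that of j+1 to the left would be a crossing.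
  · exact absurd ⟨k2, hlr, k1⟩ q2
  · have o : skip j i₂ < skip j i₁ := by omega
    refine Or.inr (Or.inl ⟨fun l r => ?_, ?_⟩)
    · rw [if_pos (hlr.trans k1), if_neg (hlr.trans k1).not_gt, if_pos k2, if_neg k2.not_gt]
      ring
    · rw [if_pos o, if_neg o.not_gt, one_mul]

/-- With α = πA, expanding sin(αa + α) and sin(αb + α) makes the cosine terms cancel against the
third summand and leaves sin α · sin(α(a + b)). -/
theorem qnum_fuse {A : ℝ} (hA : sin (π * A) ≠ 0) (a b : ℝ) :
    qnum A (a + 1) * qnum A b + qnum A a * qnum A (b + 1) -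
      2 * cos (π * A) * (qnum A a * qnum A b) = qnum A (a + b) := by
  simp only [qnum, mul_add, mul_one, Real.sin_add]
  field_simp
  ring

theorem qnum_neg (A m : ℝ) : qnum A (-m) = -qnum A m := by
  rw [qnum, qnum, mul_neg, Real.sin_neg, neg_div]

/-- The three summands correspond to the close variable lying left of, right of and between the
merging points, with `c` the potential at j apart from that variable. In each case of
`exists_potWeight_tie` the relation is `qnum_fuse`, up to signs from `qnum_neg`. -/
theorem potWeight_tie (h : β.pair (left j) ≠ right j) {A : ℝ} (hA : sin (π * A) ≠ 0)
    (φ : Fin (2 * N) → ℝ) (c : ℝ) :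
    β.potWeight A (extend j φ (c + 1) (c + 1 / 2)) + β.potWeight A (extend j φ c (c - 1 / 2)) -
      2 * cos (π * A) * β.potWeight A (extend j φ c (c + 1 / 2)) =
      ((β.tie j).remove j (β.tie_pair j)).potWeight A φ := by
  obtain ⟨E, c₁, c₂, h | h | h⟩ := exists_potWeight_tie h A φ
  · have e := qnum_fuse hA (c - c₁ + 1 / 2) (c₂ - c)
    rw [h.2, h.1, h.1, h.1, show c₂ - c₁ + 1 / 2 = c - c₁ + 1 / 2 + (c₂ - c) by ring, ← e]
    ring_nf
  · have e := qnum_fuse hA (-(c₁ - c + 1 / 2)) (c₂ - c)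
    rw [show -(c₁ - c + 1 / 2) + 1 = -(c₁ - c - 1 / 2) by ring,
      show -(c₁ - c + 1 / 2) + (c₂ - c) = -(c₁ - c₂ + 1 / 2) by ring, qnum_neg, qnum_neg, qnum_neg] at e
    rw [h.2, h.1, h.1, h.1, ← neg_eq_iff_eq_neg.2 e]
    ring_nf
  · have e := qnum_fuse hA (-(c - c₂ + 1)) (c - c₁ + 1 / 2)
    rw [show -(c - c₂ + 1) + 1 = -(c - c₂) by ring,
      show -(c - c₂ + 1) + (c - c₁ + 1 / 2) = -(c₁ - c₂ + 1 / 2) by ring, qnum_neg, qnum_neg,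
      qnum_neg] at e
    rw [h.2, h.1, h.1, h.1, ← neg_eq_iff_eq_neg.2 e]
    ring_nf

end Fuse

end LinkPattern

/-! ### Merging two points: the asymptotics of the Coulomb gas integral -/

namespace LinkPattern

variable {N : ℕ} {j : Fin (2 * N + 1)} {x : Fin (2 * (N + 1)) → ℝ} {ξ : ℝ} {p : ℝ × ℝ}

/-- The points `x` with `x j`, `x (j + 1)` moved to `p.1`, `p.2`. -/
abbrev move (j : Fin (2 * N + 1)) (x : Fin (2 * (N + 1)) → ℝ) (p : ℝ × ℝ) : Fin (2 * (N + 1)) → ℝ :=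
  update (update x (left j) p.1) (right j) p.2

theorem move_left : move j x p (left j) = p.1 := by
  rw [move, Function.update_of_ne (left_ne_right j), Function.update_self]

theorem move_right : move j x p (right j) = p.2 := Function.update_self ..

theorem move_skip (i : Fin (2 * N)) : move j x p (skip j i) = x (skip j i) := by
  rw [move, Function.update_of_ne (skip_ne_right j i), Function.update_of_ne (skip_ne_left j i)]

theorem move_mem_chamber (hx : x ∈ chamber (N + 1)) (hp : p.1 < p.2)
    (h1 : ∀ i, i < left j → x i < p.1) (h2 : ∀ i, right j < i → p.2 < x i) :
    move j x p ∈ chamber (N + 1) := by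
  have key : ∀ m : Fin (2 * (N + 1)), m ≠ left j → m ≠ right j → m < left j ∨ right j < m := by
    intro m h1 h2
    simp only [Fin.lt_def, ne_eq, Fin.ext_iff] at *
    omega
  have hlr : left j < right j := by simp [Fin.lt_def]
  have e : ∀ m, m ≠ left j → m ≠ right j → move j x p m = x m := fun m n1 n2 => by
    rw [move, Function.update_of_ne n2, Function.update_of_ne n1]
  intro a b hab
  by_cases a1 : a = left j
  · subst a1
    rw [move_left]
    by_cases b2 : b = right j
    · rw [b2, move_right]; exact hp
    · rw [e b hab.ne' b2]
      exact hp.trans (h2 b ((key b hab.ne' b2).resolve_left hab.not_gt))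
  by_cases a2 : a = right j
  · subst a2
    rw [move_right, e b (hlr.trans hab).ne' hab.ne']
    exact h2 b hab
  rw [e a a1 a2]
  by_cases b1 : b = left j
  · subst b1
    rw [move_left]
    exact h1 a hab
  by_cases b2 : b = right j
  · subst b2
    rw [move_right]
    exact (h1 a ((key a a1 a2).resolve_right hab.not_gt)).trans hp
  rw [e b b1 b2]
  exact hx hab

theorem eventually_move_mem_chamber (hx : x ∈ chamber (N + 1)) (h1 : ∀ i, i < left j → x i < ξ)
    (h2 : ∀ i, right j < i → ξ < x i) : ∀ᶠ p in merge ξ, move j x p ∈ chamber (N + 1) := by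
  have e1 : ∀ᶠ p : ℝ × ℝ in merge ξ, ∀ i, i < left j → x i < p.1 := by
    refine eventually_all.2 fun i => ?_
    by_cases h : i < left j
    · filter_upwards [tendsto_merge_fst.eventually (lt_mem_nhds (h1 i h))] with p hp _ using hp
    · exact .of_forall fun p h' => absurd h' h
  have e2 : ∀ᶠ p : ℝ × ℝ in merge ξ, ∀ i, right j < i → p.2 < x i := by
    refine eventually_all.2 fun i => ?_
    by_cases h : right j < i
    · filter_upwards [tendsto_merge_snd.eventually (gt_mem_nhds (h2 i h))] with p hp _ using hp
    · exact .of_forall fun p h' => absurd h' h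
  filter_upwards [e1, e2, eventually_merge_lt] with p g1 g2 hp
  exact move_mem_chamber hx hp g1 g2

theorem skip_mem_chamber (hx : x ∈ chamber (N + 1)) : (fun i => x (skip j i)) ∈ chamber N :=
  fun _ _ h => hx ((skip_lt_skip j).2 h)

theorem charge_move (A R : ℝ) (y : ℝ) : charge A R (move j x p) y =
    charge A R (fun i => x (skip j i)) y * (|y - p.1| ^ (-A) * |y - p.2| ^ (-A)) := by
  rw [charge, charge]
  by_cases h : y ∈ Ioo (-R) R
  · rw [indicator_of_mem h, indicator_of_mem h, prod_skip j, move_left, move_right]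
    simp only [move_skip]
    ring
  · rw [indicator_of_notMem h, indicator_of_notMem h, zero_mul]

theorem gas_move (A R : ℝ) {n : ℕ} (X : Fin n → ℝ) :
    gas A R (move j x p) X = fuseGas A R (fun i => x (skip j i)) p X := by
  simp only [gas, fuseGas, charge_move]

theorem vand_eq_repulsion (t : ℝ) {x : Fin (2 * N) → ℝ} (hx : x ∈ chamber N) :
    vand N t x = repulsion t x := by
  rw [repulsion, prod_prod_ite_eq (fun i k => |x i - x k| ^ t) fun i k => by rw [abs_sub_comm], vand]
  refine prod_congr rfl fun i _ => prod_congr rfl fun k hk => ?_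
  have h : 0 < x k - x i := sub_pos.2 (hx (Finset.mem_filter.1 hk).2)
  rw [abs_sub_comm, abs_of_pos h, two_mul, Real.rpow_add h]

theorem vand_move (t : ℝ) (hx : x ∈ chamber (N + 1)) (hm : move j x p ∈ chamber (N + 1)) :
    vand (N + 1) t (move j x p) = (p.2 - p.1) ^ (2 * t) *
      (∏ i, (|p.1 - x (skip j i)| ^ t * |p.2 - x (skip j i)| ^ t) *
        (|p.1 - x (skip j i)| ^ t * |p.2 - x (skip j i)| ^ t)) *
          vand N t fun i => x (skip j i) := by
  have hp : p.1 < p.2 := by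
    have := hm (show left j < right j by simp [Fin.lt_def])
    rwa [move_left, move_right] at this
  have hε := sub_pos.2 hp
  rw [vand_eq_repulsion t hm, vand_eq_repulsion t (skip_mem_chamber hx), repulsion, prod_skip j]
  simp only [prod_skip j, if_true, if_neg (left_ne_right j), if_neg (left_ne_right j).symm,
    if_neg (skip_ne_left j _), if_neg (skip_ne_right j _), if_neg (skip_ne_left j _).symm,
    if_neg (skip_ne_right j _).symm, (skip_injective j).eq_iff, move_left, move_right, move_skip]
  rw [prod_mul_distrib, prod_mul_distrib, prod_mul_distrib, abs_sub_comm p.1,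
    abs_of_pos hε, show (p.2 - p.1) ^ (2 * t) = (p.2 - p.1) ^ t * (p.2 - p.1) ^ t by
      rw [two_mul, Real.rpow_add hε]]
  simp only [repulsion]
  simp only [abs_sub_comm (x (skip j _)) p.1, abs_sub_comm (x (skip j _)) p.2,
    prod_mul_distrib]
  ring

theorem eventually_compare {f : ℝ × ℝ → ℝ} (hf : Tendsto f (merge ξ) (𝓝 ξ)) {c : ℝ} (hc : c ≠ ξ) :
    ∀ᶠ p in merge ξ, (f p < c ↔ ξ < c) ∧ (c < f p ↔ c < ξ) ∧ c ≠ f p := by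
  rcases lt_or_gt_of_ne hc with h | h
  · filter_upwards [hf.eventually (lt_mem_nhds h)] with p hp
    exact ⟨iff_of_false hp.not_gt h.not_gt, iff_of_true hp h, hp.ne⟩
  · filter_upwards [hf.eventually (gt_mem_nhds h)] with p hp
    exact ⟨iff_of_true hp h, iff_of_false hp.not_gt h.not_gt, hp.ne'⟩

/-- The potential at the point where two points merge. -/
def mergePot (j : Fin (2 * N + 1)) (ξ : ℝ) (X : Fin N → ℝ) : ℝ :=
  (∑ l, if X l < ξ then 1 else 0) - (j : ℕ) / 2

/-- The weight depends only on the order of points and variables, which is eventually constant.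
Points to the right of j+1 see two more points and one more variable on their left, so their
potential is unchanged; those to the left of j see neither. -/
theorem tendsto_cfgWeight_move (β : LinkPattern (N + 1)) (A : ℝ) (hx : x ∈ chamber (N + 1))
    (h1 : ∀ i, i < left j → x i < ξ) (h2 : ∀ i, right j < i → ξ < x i) {X : Fin N → ℝ}
    (hX : ∀ l, X l ≠ ξ) (hXx : ∀ l i, X l ≠ x (skip j i)) {y : ℝ} (hy0 : y ≠ 0) (hy1 : y ≠ 1) :
    Tendsto (fun p : ℝ × ℝ => β.cfgWeight A (move j x p)
      (Fin.cons (p.1 + (p.2 - p.1) * y) X : Fin (N + 1) → ℝ)) (merge ξ)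
      (𝓝 (β.potWeight A (extend j (pot (fun i => x (skip j i)) X)
        (mergePot j ξ X + if y < 0 then 1 else 0)
        (mergePot j ξ X - 1 / 2 + if y < 1 then 1 else 0)))) := by
  refine tendsto_const_nhds.congr' ?_
  have hs : ∀ i : Fin (2 * N), ((i : ℕ) < j ∧ skip j i < left j) ∨ (¬ (i : ℕ) < j ∧ right j < skip j i) := by
    intro i
    simp only [skip, Fin.lt_def]
    split_ifs <;> omega
  have hxξ : ∀ i, x (skip j i) ≠ ξ := fun i => (hs i).elim (fun h => (h1 _ h.2).ne)
    fun h => (h2 _ h.2).ne'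
  have ev1 := eventually_all.2 fun i => eventually_compare (tendsto_merge_point (ξ := ξ) y) (hxξ i)
  have ev2 := eventually_all.2 fun l => eventually_compare (tendsto_merge_fst (ξ := ξ)) (hX l)
  have ev3 := eventually_all.2 fun l => eventually_compare (tendsto_merge_snd (ξ := ξ)) (hX l)
  filter_upwards [ev1, ev2, ev3, eventually_merge_lt, eventually_move_mem_chamber hx h1 h2]
    with p g1 g2 g3 hp hm
  have hε := sub_pos.2 hp
  have hcases : ∀ {P : Fin (2 * (N + 1)) → Prop}, P (left j) → P (right j) → (∀ i, P (skip j i)) →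
      ∀ k, P k := by
    intro P a b c k
    by_cases k1 : k = left j
    · rw [k1]; exact a
    by_cases k2 : k = right j
    · rw [k2]; exact b
    obtain ⟨i, rfl⟩ := eq_skip k1 k2
    exact c i
  have b0 : p.1 + (p.2 - p.1) * y < p.1 ↔ y < 0 := by
    constructor
    · intro h; by_contra h'; nlinarith
    · intro h; nlinarith
  have b1 : p.1 + (p.2 - p.1) * y < p.2 ↔ y < 1 := by
    constructor
    · intro h; by_contra h'; nlinarith
    · intro h; nlinarith
  rw [β.cfgWeight_eq_potWeight A hm]
  · congr 1
    funext k
    revert k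
    refine hcases ?_ ?_ fun i => ?_
    · simp only [extend_left, pot, move_left, Fin.sum_univ_succ, Fin.cons_zero, Fin.cons_succ, b0,
        (g2 _).2.1, mergePot]
      ring
    · simp only [extend_right, pot, move_right, Fin.sum_univ_succ, Fin.cons_zero, Fin.cons_succ, b1,
        (g3 _).2.1, mergePot]
      push_cast
      ring
    · simp only [extend_skip, pot, move_skip, Fin.sum_univ_succ, Fin.cons_zero, Fin.cons_succ,
        (g1 _).1]
      rcases hs i with ⟨h, h'⟩ | ⟨h, h'⟩
      · have e : ((skip j i : ℕ) : ℝ) = (i : ℕ) := by simp [skip, h]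
        rw [if_neg (h1 _ h').not_gt, zero_add, e]
      · have e : ((skip j i : ℕ) : ℝ) = (i : ℕ) + 2 := by simp [skip, h]
        rw [if_pos (h2 _ h'), e]
        ring
  · refine Fin.cases (hcases ?_ ?_ fun i => ?_) fun l => hcases ?_ ?_ fun i => ?_
    · rw [Fin.cons_zero, move_left]
      simpa [hε.ne'] using hy0
    · rw [Fin.cons_zero, move_right]
      intro h
      refine hy1 (mul_left_cancel₀ hε.ne' ?_)
      linarith
    · rw [Fin.cons_zero, move_skip]
      exact (g1 i).2.2.symm
    · rw [Fin.cons_succ, move_left]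
      exact (g2 l).2.2
    · rw [Fin.cons_succ, move_right]
      exact (g3 l).2.2
    · rw [Fin.cons_succ, move_skip]
      exact hXx l i

/-- In the limit four powers A/4 = 1/κ combine to |ξ - x_i|^A, the inverse of the interaction of the
close variable with x_i. The two cancel in the fusion limit. -/
theorem tendsto_vand_move (A R : ℝ) (hξ : ∀ i, x (skip j i) ≠ ξ) (hR : |ξ| < R) :
    Tendsto (fun p : ℝ × ℝ => ∏ i, (|p.1 - x (skip j i)| ^ (A / 4) * |p.2 - x (skip j i)| ^ (A / 4)) *
        (|p.1 - x (skip j i)| ^ (A / 4) * |p.2 - x (skip j i)| ^ (A / 4))) (merge ξ)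
      (𝓝 (charge A R (fun i => x (skip j i)) ξ)⁻¹) := by
  have hc : (charge A R (fun i => x (skip j i)) ξ)⁻¹ =
      ∏ i, (|ξ - x (skip j i)| ^ (A / 4) * |ξ - x (skip j i)| ^ (A / 4)) *
        (|ξ - x (skip j i)| ^ (A / 4) * |ξ - x (skip j i)| ^ (A / 4)) := by
    rw [charge, indicator_of_mem (show ξ ∈ Ioo (-R) R from abs_lt.1 hR), ← Finset.prod_inv_distrib]
    refine prod_congr rfl fun i _ => ?_
    have h : 0 < |ξ - x (skip j i)| := abs_pos.2 (sub_ne_zero.2 (hξ i).symm)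
    rw [← Real.rpow_neg h.le, ← Real.rpow_add h, ← Real.rpow_add h]
    congr 1
    ring
  rw [hc]
  refine tendsto_finsetProd _ fun i _ => ?_
  have h : |ξ - x (skip j i)| ≠ 0 := abs_ne_zero.2 (sub_ne_zero.2 (hξ i).symm)
  have e1 := ((tendsto_merge_fst (ξ := ξ)).sub_const (x (skip j i))).abs.rpow_const
    (p := A / 4) (Or.inl h)
  have e2 := ((tendsto_merge_snd (ξ := ξ)).sub_const (x (skip j i))).abs.rpow_const
    (p := A / 4) (Or.inl h)
  exact (e1.mul e2).mul (e1.mul e2)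

/-- Reduction of (ASY) to an algebraic relation between weights: `tendsto_fuseGas` yields the left
and right weights with the outer beta integral and the middle weight with the inner one, which are
normC⁻¹ and normC⁻¹·(-2cos πA). -/
theorem fusionLimit_of_weight {κ : ℝ} (hκ : κ ∈ Ioo (4 : ℝ) 8) (β : LinkPattern (N + 1))
    (hx : x ∈ chamber (N + 1)) (h1 : ∀ i, i < left j → x i < ξ) (h2 : ∀ i, right j < i → ξ < x i)
    (γ : LinkPattern N) (q : ℝ) (hw : ∀ (φ : Fin (2 * N) → ℝ) (c : ℝ),
      β.potWeight (4 / κ) (extend j φ (c + 1) (c + 1 / 2)) +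
        β.potWeight (4 / κ) (extend j φ c (c - 1 / 2)) - 2 * cos (π * (4 / κ)) *
          β.potWeight (4 / κ) (extend j φ c (c + 1 / 2)) = q * γ.potWeight (4 / κ) φ) :
    FusionLimit κ (G κ β) j x ξ (q * G κ γ fun i => x (skip j i)) := by
  have hκ0 : 0 < κ := by linarith [hκ.1]
  have hA : 1 / 2 < 4 / κ := by rw [div_lt_div_iff₀] <;> linarith [hκ.1, hκ.2]
  have hA1 : 4 / κ < 1 := (div_lt_one hκ0).2 hκ.1
  have hx' := skip_mem_chamber (j := j) hx
  obtain ⟨R, hRx, hRξ⟩ : ∃ R, (∀ i, |x i| < R) ∧ |ξ| < R := by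
    obtain ⟨R, hR⟩ := (Set.finite_range fun i => |x i|).bddAbove
    refine ⟨max R |ξ| + 1, fun i => ?_, ?_⟩
    · have := hR ⟨i, rfl⟩
      have := le_max_left R |ξ|
      simp only at *
      linarith
    · have := le_max_right R |ξ|
      linarith
  have hξ : ∀ i, x (skip j i) ≠ ξ := by
    intro i
    have h3 := skip_ne j i
    rcases lt_or_ge (skip j i : ℕ) (j : ℕ) with h | h
    · exact (h1 _ (Fin.lt_def.2 h)).ne
    · exact (h2 _ (Fin.lt_def.2 (by simp only; omega))).ne'
  have hm := eventually_move_mem_chamber hx h1 h2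
  have hbd : ∀ᶠ p in merge ξ, ∀ i, |move j x p i| < R := by
    filter_upwards [tendsto_merge_fst.abs.eventually (gt_mem_nhds hRξ),
      tendsto_merge_snd.abs.eventually (gt_mem_nhds hRξ)] with p g1 g2 i
    by_cases k1 : i = left j
    · rw [k1, move_left]; exact g1
    by_cases k2 : i = right j
    · rw [k2, move_right]; exact g2
    rw [move, Function.update_of_ne k2, Function.update_of_ne k1]
    exact hRx i
  have hgood : ∀ᵐ X : Fin N → ℝ, (∀ l, X l ≠ ξ) ∧ ∀ l i, X l ≠ x (skip j i) := by
    have e1 : ∀ᵐ X : Fin N → ℝ, ∀ l, X l ≠ ξ := ae_all_iff.2 fun l =>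
      Measure.ae_eval_ne (μ := fun _ : Fin N => (volume : Measure ℝ)) l ξ
    have e2 : ∀ᵐ X : Fin N → ℝ, ∀ l i, X l ≠ x (skip j i) := ae_all_iff.2 fun l =>
      ae_all_iff.2 fun i => Measure.ae_eval_ne (μ := fun _ : Fin N => (volume : Measure ℝ)) l _
    exact e1.and e2
  have hfuse := tendsto_fuseGas (n := N) hA hA1 hx'.injective hξ hRξ
    (W := fun p X => β.cfgWeight (4 / κ) (move j x p) X)
    (M := ∏ _s : β.Link, |sin (π * (4 / κ))|⁻¹)
    (fun p => β.measurable_cfgWeight _ _) (fun p X => β.abs_cfgWeight_le _ _ _)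
    (fun p σ X => β.cfgWeight_comp _ _ σ X)
    (by
      filter_upwards [hm] with p hp
      have := integrable_gas (ι := Fin (N + 1)) (R := R) hp.injective (by linarith) hA1
      exact this.congr (.of_forall fun X => gas_move _ _ X))
    (w₁ := fun X => β.potWeight (4 / κ) (extend j (pot (fun i => x (skip j i)) X)
        (mergePot j ξ X + 1) (mergePot j ξ X + 1 / 2)))
    (w₂ := fun X => β.potWeight (4 / κ) (extend j (pot (fun i => x (skip j i)) X)
        (mergePot j ξ X) (mergePot j ξ X + 1 / 2)))
    (w₃ := fun X => β.potWeight (4 / κ) (extend j (pot (fun i => x (skip j i)) X)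
        (mergePot j ξ X) (mergePot j ξ X - 1 / 2)))
    (by
      filter_upwards [hgood] with X hX
      have e : mergePot j ξ X - 1 / 2 + 1 = mergePot j ξ X + 1 / 2 := by ring
      refine ⟨fun y hy => ?_, fun y hy hy' => ?_, fun y hy => ?_⟩
      · have := tendsto_cfgWeight_move β (4 / κ) hx h1 h2 hX.1 hX.2 hy.ne (by linarith)
        rwa [if_pos hy, if_pos (by linarith), e] at this
      · have := tendsto_cfgWeight_move β (4 / κ) hx h1 h2 hX.1 hX.2 hy.ne' hy'.ne
        rwa [if_neg hy.not_gt, if_pos hy', e, add_zero] at this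
      · have := tendsto_cfgWeight_move β (4 / κ) hx h1 h2 hX.1 hX.2 (by linarith) hy.ne'
        rwa [if_neg (by linarith), if_neg hy.not_gt, add_zero, add_zero] at this)
  have hc : charge (4 / κ) R (fun i => x (skip j i)) ξ ≠ 0 := by
    rw [charge, indicator_of_mem (show ξ ∈ Ioo (-R) R from abs_lt.1 hRξ)]
    exact Finset.prod_ne_zero_iff.2 fun i _ =>
      (Real.rpow_pos_of_pos (abs_pos.2 (sub_ne_zero.2 (hξ i).symm)) _).ne'
  have hn := (normC_pos hκ).ne'
  have hintg : ∫ X : Fin N → ℝ, charge (4 / κ) R (fun i => x (skip j i)) ξ *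
      ((Gamma (1 - 4 / κ) * Gamma (2 * (4 / κ) - 1) / Gamma (4 / κ) *
        (β.potWeight (4 / κ) (extend j (pot (fun i => x (skip j i)) X)
          (mergePot j ξ X + 1) (mergePot j ξ X + 1 / 2)) +
        β.potWeight (4 / κ) (extend j (pot (fun i => x (skip j i)) X)
          (mergePot j ξ X) (mergePot j ξ X - 1 / 2))) +
        Gamma (1 - 4 / κ) ^ 2 / Gamma (2 - 2 * (4 / κ)) *
        β.potWeight (4 / κ) (extend j (pot (fun i => x (skip j i)) X)
          (mergePot j ξ X) (mergePot j ξ X + 1 / 2))) * gas (4 / κ) R (fun i => x (skip j i)) X) =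
      charge (4 / κ) R (fun i => x (skip j i)) ξ * ((normC κ)⁻¹ * (q *
        ∫ X : Fin N → ℝ, γ.cfgWeight (4 / κ) (fun i => x (skip j i)) X *
          gas (4 / κ) R (fun i => x (skip j i)) X)) := by
    rw [integral_const_mul, ← integral_const_mul q, ← integral_const_mul (normC κ)⁻¹]
    congr 1
    refine integral_congr_ae ?_
    filter_upwards [hgood] with X hX
    have := hw (pot (fun i => x (skip j i)) X) (mergePot j ξ X)
    rw [γ.cfgWeight_eq_potWeight (4 / κ) hx' hX.2, outer_beta_eq hκ, inner_beta_eq hκ, ← mul_assoc q,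
      ← this]
    ring
  rw [hintg] at hfuse
  have hreal := ((tendsto_vand_move (x := x) (4 / κ) R hξ hRξ).mul hfuse).const_mul
    (normC κ ^ (N + 1) * ((N + 1).factorial : ℝ)⁻¹ * vand N (1 / κ) fun i => x (skip j i))
  have hlim : (normC κ ^ (N + 1) * ((N + 1).factorial : ℝ)⁻¹ * vand N (1 / κ) fun i => x (skip j i)) *
      ((charge (4 / κ) R (fun i => x (skip j i)) ξ)⁻¹ * ((N + 1) *
        (charge (4 / κ) R (fun i => x (skip j i)) ξ * ((normC κ)⁻¹ * (q *
        ∫ X : Fin N → ℝ, γ.cfgWeight (4 / κ) (fun i => x (skip j i)) X *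
          gas (4 / κ) R (fun i => x (skip j i)) X))))) =
      q * (normC κ ^ N * (N.factorial : ℝ)⁻¹ * (vand N (1 / κ) (fun i => x (skip j i)) *
        ∫ X : Fin N → ℝ, γ.cfgWeight (4 / κ) (fun i => x (skip j i)) X *
          gas (4 / κ) R (fun i => x (skip j i)) X)) := by
    -- The choice of the close variable turns 1/(N+1)! into 1/N!, and the beta integral removes one
    -- factor of the normalization.
    have hN : (N : ℝ) + 1 ≠ 0 := by positivity
    have hN' : (N.factorial : ℝ) ≠ 0 := by exact_mod_cast N.factorial_ne_zero
    rw [Nat.factorial_succ, pow_succ]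
    push_cast
    field_simp
  rw [hlim] at hreal
  rw [FusionLimit, γ.G_eq_integral hκ.1 hx' fun i => hRx _, ← Complex.ofReal_mul]
  refine ((Complex.continuous_ofReal.tendsto _).comp hreal).congr' ?_
  filter_upwards [hm, hbd, eventually_merge_lt] with p hp hb hlt
  have hε := sub_pos.2 hlt
  rw [Function.comp_apply, β.G_eq_integral hκ.1 hp hb, ← Complex.ofReal_div, vand_move _ hx hp]
  congr 1
  simp only [gas_move]
  -- Exponents match: 2A - 1 = 2/κ + 2h, with 2/κ from the factor (x_{j+1} - x_j)^(2/κ) and 2h from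
  -- the division by (x_{j+1} - x_j)^(-2h).
  rw [show 4 / κ / 4 = 1 / κ by ring, show -2 * weight κ = -(2 * weight κ) by ring,
    Real.rpow_neg hε.le, div_inv_eq_mul, show 2 * (4 / κ) - 1 = 2 * (1 / κ) + 2 * weight κ by
      rw [weight]; field_simp; ring, Real.rpow_add hε]
  ring

theorem sin_pi_mul_ne_zero {κ : ℝ} (hκ : κ ∈ Ioo (4 : ℝ) 8) : sin (π * (4 / κ)) ≠ 0 := by
  have h0 : 0 < κ := by linarith [hκ.1]
  have h1 : 4 / κ < 1 := (div_lt_one h0).2 hκ.1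
  exact (Real.sin_pos_of_pos_of_lt_pi (by positivity) (by nlinarith [Real.pi_pos])).ne'

/-- The link {j, j+1} contributes [1] = 1 if the close variable lies between the points and [0] = 0
otherwise; only the middle term survives and -2cos πA = √q. -/
theorem fusionLimit_remove {κ : ℝ} (hκ : κ ∈ Ioo (4 : ℝ) 8) (β : LinkPattern (N + 1))
    (hx : x ∈ chamber (N + 1)) (h1 : ∀ i, i < left j → x i < ξ) (h2 : ∀ i, right j < i → ξ < x i)
    (h : β.pair (left j) = right j) :
    FusionLimit κ (G κ β) j x ξ (Real.sqrt (clusterWeight κ) *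
      G κ (β.remove j h) fun i => x (skip j i)) := by
  refine fusionLimit_of_weight hκ β hx h1 h2 _ _ fun φ c => ?_
  have hs := sin_pi_mul_ne_zero hκ
  have e : ∀ l r : ℝ, (fun i => extend j φ l r (skip j i)) = φ := fun l r => by
    funext i; exact extend_skip j φ l r i
  simp only [potWeight_remove β j h, extend_left, extend_right, e]
  rw [show c + 1 / 2 - (c + 1) + 1 / 2 = 0 by ring, show c - 1 / 2 - c + 1 / 2 = 0 by ring,
    show c + 1 / 2 - c + 1 / 2 = 1 by ring, (sqrt_clusterWeight hκ).1]
  simp only [qnum, mul_zero, Real.sin_zero, zero_div, mul_one, div_self hs]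
  ring

theorem fusionLimit_tie {κ : ℝ} (hκ : κ ∈ Ioo (4 : ℝ) 8) (β : LinkPattern (N + 1))
    (hx : x ∈ chamber (N + 1)) (h1 : ∀ i, i < left j → x i < ξ) (h2 : ∀ i, right j < i → ξ < x i)
    (h : β.pair (left j) ≠ right j) :
    FusionLimit κ (G κ β) j x ξ (G κ ((β.tie j).remove j (β.tie_pair j)) fun i => x (skip j i)) := by
  have := fusionLimit_of_weight hκ β hx h1 h2 ((β.tie j).remove j (β.tie_pair j)) 1 fun φ c => by
    rw [potWeight_tie h (sin_pi_mul_ne_zero hκ), one_mul]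
  simpa using this

theorem G_zero (κ : ℝ) (β : LinkPattern 0) (x : Fin (2 * 0) → ℝ) : G κ β x = 1 := by
  have : IsEmpty (Fin (2 * 0)) := by rw [mul_zero]; infer_instance
  have : IsEmpty β.Link := ⟨fun r => isEmptyElim r.1⟩
  have h : box β = Set.univ := by ext; simp [box]
  have e : ∀ θ, β.pullback κ x θ = 1 := fun θ => by
    simp [pullback, integrand]
  rw [G, h, setIntegral_univ]
  simp only [e]
  rw [integral_const, Measure.real, volume_pi, Measure.pi_of_empty]
  simp

end LinkPattern

end CoulombGas

end

/-! ### The theorem -/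

theorem mainTheorem3 (κ : ℝ) (hκ : κ ∈ Set.Ioo (4 : ℝ) 8) :
    -- the integrals converge absolutely and are real
    (∀ (N : ℕ) (β : CoulombGas.LinkPattern N), ∀ x ∈ CoulombGas.chamber N,
      MeasureTheory.IntegrableOn (β.pullback κ x) (CoulombGas.box β) ∧
      (CoulombGas.G κ β x).im = 0) ∧
    -- (PDE)
    (∀ (N : ℕ) (β : CoulombGas.LinkPattern N), CoulombGas.SatisfiesBPZ κ (CoulombGas.G κ β)) ∧
    -- (COV)
    (∀ (N : ℕ) (β : CoulombGas.LinkPattern N), CoulombGas.MobiusCovariant κ (CoulombGas.G κ β)) ∧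
    -- (ASY)
    (∀ (β : CoulombGas.LinkPattern 0) (x : Fin (2 * 0) → ℝ), CoulombGas.G κ β x = 1) ∧
    (∀ (N : ℕ) (β : CoulombGas.LinkPattern (N + 1)) (j : Fin (2 * N + 1)),
      ∀ x ∈ CoulombGas.chamber (N + 1), ∀ ξ : ℝ,
      (∀ i, i < CoulombGas.LinkPattern.left j → x i < ξ) →
      (∀ i, CoulombGas.LinkPattern.right j < i → ξ < x i) →
      (∀ h : β.pair (CoulombGas.LinkPattern.left j) = CoulombGas.LinkPattern.right j,
        CoulombGas.FusionLimit κ (CoulombGas.G κ β) j x ξ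
          (Real.sqrt (CoulombGas.clusterWeight κ) *
            CoulombGas.G κ (β.remove j h) (fun i => x (CoulombGas.skip j i)))) ∧
      (β.pair (CoulombGas.LinkPattern.left j) ≠ CoulombGas.LinkPattern.right j →
        CoulombGas.FusionLimit κ (CoulombGas.G κ β) j x ξ
          (CoulombGas.G κ ((β.tie j).remove j (β.tie_pair j))
            (fun i => x (CoulombGas.skip j i))))) := by
  have hκ4 := hκ.1
  refine ⟨fun N β x hx => ⟨β.integrableOn_pullback hκ4 hx, ?_⟩, fun N β => β.satisfiesBPZ hκ4,
    fun N β => β.mobiusCovariant hκ4, fun β x => CoulombGas.LinkPattern.G_zero κ β x,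
    fun N β j x hx ξ h1 h2 => ⟨fun h => β.fusionLimit_remove hκ hx h1 h2 h,
      fun h => β.fusionLimit_tie hκ hx h1 h2 h⟩⟩
  -- Reality follows from the representation as a real integral, valid for any cutoff beyond all the
  -- points.
  obtain ⟨R, hR⟩ := (Set.finite_range fun i => |x i|).bddAbove
  rw [β.G_eq_integral (R := R + 1) hκ4 hx fun i => by have := hR ⟨i, rfl⟩; simp only at this; linarith]
  exact Complex.ofReal_im _
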